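/- Let $\mathbb{F}_q$ be a finite field with $q$ elements, $C$ a smooth projective geometrically irreducible curve over $\mathbb{F}_q$ with function field $Q$, and $\infty\in C(\mathbb{F}_q)$ a fixed rational point. For a field $L\supseteq\mathbb{F}_q$ put $C_L=C\times_{\mathbb{F}_q}\operatorname{Spec}L$ and $\sigma=\mathrm{id}_C\times\operatorname{Spec}(\mathrm{Frob}_q)$ on $C_L$, and fix a morphism $c:\operatorname{Spec}L\to C$ over $\mathbb{F}_q$ with image point $\varepsilon$ (the characteristic point); let $\mathcal{I}$ be the ideal sheaf of the graph of $c$ in $C_L$. An abelian $\tau$-sheaf $\mathcal{F}=(\mathcal{F}_i,\Pi_i,\tau_i)_{i\in\mathbb{Z}}$ of rank $r\ge 0$, dimension $d\ge 0$ and characteristic $c$ over $L$ consists of locally free sheaves $\mathcal{F}_i$ of rank $r$ on $C_L$ and injective $\mathcal{O}_{C_L}$-linear maps $\Pi_i:\mathcal{F}_i\to\mathcal{F}_{i+1}$, $\tau_i:\sigma^*\mathcal{F}_i\to\mathcal{F}_{i+1}$ such that $\Pi_{i+1}\circ\tau_i=\tau_{i+1}\circ\sigma^*\Pi_i$; for some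 integers $k,l>0$ with $ld=kr$ the map $\Pi_{i+l-1}\circ\cdots\circ\Pi_i$ identifies $\mathcal{F}_i$ with $\mathcal{F}_{i+l}(-k\cdot\infty)$ for all $i$; $\dim_L\operatorname{coker}\Pi_i=d$ for all $i$; and $\operatorname{coker}\tau_i$ is annihilated by $\mathcal{I}^d$ and $\dim_L\operatorname{coker}\tau_i=d$ for all $i$. Morphisms are families of maps $\mathcal{F}_i\to\mathcal{F}'_i$ commuting with the $\Pi$'s and $\tau$'s; a morphism is injective (surjective) if all its components are, and an isomorphism if it is both. A quasi-morphism $\mathcal{F}\to\mathcal{F}'$ is a morphism $\mathcal{F}\to\mathcal{F}'(D)$ for some effective divisor $D$ on $C$, up to the identification of morphisms into $\mathcal{F}'(D_1)$ and $\mathcal{F}'(D_2)$ which agree in $\mathcal{F}'(D_1+D_2)$; it is a quasi-isogeny if it is injective and the supports of its cokernels lie in $Z\times\operatorname{Spec}L$ for one finite closed subscheme $Z$ of $C$. $\operatorname{QEnd}(\mathcal{F})$ is the $Q$-algebra of quasi-morphisms $\mathcal{F}\to\mathcal{F}$. $\mathcal{F}$ is simple if $\mathcal{F}\ne 0$ and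 every abelian $\tau$-sheaf of characteristic $c$ onto which $\mathcal{F}$ surjects is $0$ or isomorphic to $\mathcal{F}$; $\mathcal{F}$ is semisimple if there is a quasi-isogeny from $\mathcal{F}$ to a finite (possibly empty) direct sum of simple abelian $\tau$-sheaves. **Theorem.** Let $\mathcal{F}$ be an abelian $\tau$-sheaf of characteristic $c$ over a finite field $L\supseteq\mathbb{F}_q$. 1. If $\operatorname{QEnd}(\mathcal{F})$ is a division algebra over $Q$, then $\mathcal{F}$ is simple. If in addition $\varepsilon\ne\infty$, then $\mathcal{F}$ is simple if and only if $\operatorname{QEnd}(\mathcal{F})$ is a division algebra over $Q$. 2. If $\varepsilon\ne\infty$, then $\mathcal{F}$ is semisimple if and only if $\operatorname{QEnd}(\mathcal{F})$ is a semisimple $Q$-algebra. These statements fail over infinite fields: for every finite field $\mathbb{F}_q$ with $q>2$ there are, for $C=\mathbb{P}^1_{\mathbb{F}_q}$, the rational function field $L=\mathbb{F}_q(\alpha)$, a rational point $\infty$ and a morphism $c$ with $\varepsilon\neq\infty$, an abelian $\tau$-sheaf $\mathcal{F}$ over $L$ of rank $2$, dimension $2$ and characteristic $c$ with $\operatorname{QEnd}(\mathcal{F})=Q$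 (so that $\operatorname{QEnd}(\mathcal{F})$ is a division algebra and semisimple) which is neither simple nor semisimple. -/

import Mathlib

open scoped TensorProduct DirectSum IntermediateField

universe u

namespace TauSheaf

noncomputable section

/-! ### Curves and their points -/

section Curves

variable (k E : Type*) [Field k] [Field E] [Algebra k E]

/-- `E` is the function field of a smooth projective geometrically irreducible curve over the
(perfect) field `k`: it is finite and separable over a rational function field `k(t)`, and `k` is
algebraically closed in `E`. The curve itself is recovered from `E`, see `CurvePoint`. -/
class IsCurveFunctionField : Prop where
  exists_separating : ∃ t : E, Transcendental k t ∧ FiniteDimensional k⟮t⟯ E ∧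
    Algebra.IsSeparable k⟮t⟯ E
  algebraic_mem : ∀ x : E, IsAlgebraic k x → x ∈ (algebraMap k E).range

/-- A point of the complete regular curve over `k` with function field `E`, given by its local
ring, a valuation ring of `E` containing `k`. The generic point is the one whose ring is `⊤`, all
other points are closed. The nonempty open subsets are the complements of the finite sets of
closed points. -/
@[ext]
structure CurvePoint where
  ring : ValuationSubring E
  const_mem : ∀ a : k, algebraMap k E a ∈ ring

variable {k E}

/-- The local ring of a point is a `k`-algebra. -/
instance (P : CurvePoint k E) : Algebra k P.ring :=
  ((algebraMap k E).codRestrict P.ring P.const_mem).toAlgebra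

namespace CurvePoint

def IsClosedPoint (P : CurvePoint k E) : Prop := P.ring ≠ ⊤

/-- `P` is a `k`-rational point: its residue field is `k`. -/
def IsRational (P : CurvePoint k E) : Prop :=
  Function.Surjective (algebraMap k (IsLocalRing.ResidueField P.ring))

end CurvePoint

end Curves

section Poles

open IntermediateField.algebraAdjoinAdjoin

variable {k E : Type*} [Field k] [Field E] [Algebra k E]

theorem finite_poles_of_isDedekindDomain (B : Subring E) [IsDedekindDomain B]
    [IsFractionRing B E] (a : E) :
    {O : ValuationSubring E | B ≤ O.toSubring ∧ a ∉ O}.Finite := by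
  obtain ⟨b, c, hc, rfl⟩ := IsFractionRing.div_surjective (A := B) a
  have hc0 : c ≠ 0 := nonZeroDivisors.ne_zero hc
  let S := {O : ValuationSubring E | B ≤ O.toSubring ∧
    algebraMap B E b / algebraMap B E c ∉ O}
  let f : S → Ideal B := fun O =>
    (IsLocalRing.maximalIdeal O.1).comap (Subring.inclusion O.2.1)
  have hf : ∀ O : S, ∀ z : B, z ∈ f O ↔ (z : E) ∈ O.1.nonunits := by
    intro O z
    rw [ValuationSubring.mem_nonunits_iff_exists_mem_maximalIdeal]
    constructor
    · intro h
      exact ⟨O.2.1 z.2, h⟩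
    · rintro ⟨_, h⟩
      exact h
  have hcf : ∀ O : S, c ∈ f O := by
    intro O
    rw [hf]
    by_contra h
    apply O.2.2
    have hcO : (c : E) ∈ O.1 := O.2.1 c.2
    have : (c : E)⁻¹ ∈ O.1 := by
      rw [ValuationSubring.mem_nonunits_iff, not_lt] at h
      rw [← ValuationSubring.valuation_le_one_iff, map_inv₀]
      exact inv_le_one_of_one_le₀ h
    rw [div_eq_mul_inv]
    exact O.1.mul_mem _ _ (O.2.1 b.2) this
  have hprime : ∀ O : S, (f O).IsPrime := fun O => by
    change (Ideal.comap _ (IsLocalRing.maximalIdeal O.1)).IsPrime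
    infer_instance
  have hfin : {p : Ideal B | p.IsPrime ∧ c ∈ p}.Finite := by
    have h := Ideal.finite_factors (I := Ideal.span {c}) (by simpa using hc0)
    refine (h.image (fun v => v.asIdeal)).subset ?_
    rintro p ⟨hp, hcp⟩
    exact ⟨⟨p, hp, fun h0 => hc0 (by simpa [h0] using hcp)⟩,
      by simpa [Ideal.dvd_span_singleton] using hcp, rfl⟩
  have hinj : Function.Injective f := by
    have key : ∀ O O' : S, f O = f O' → ∀ z ∈ O.1, z ∈ O'.1 := by
      intro O O' h z hz
      have hp := hprime O
      have hp0 : f O ≠ ⊥ := fun h0 => hc0 (by simpa [h0] using hcf O)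
      have := IsLocalization.AtPrime.isDiscreteValuationRing_of_dedekind_domain B hp0
        (Localization.AtPrime (f O))
      obtain ⟨n, d, hd, rfl⟩ := IsFractionRing.div_surjective (A := B) z
      have hd0 : (d : E) ≠ 0 := by
        have := nonZeroDivisors.ne_zero hd
        exact_mod_cast this
      have hinjL : Function.Injective (algebraMap B (Localization.AtPrime (f O))) :=
        IsLocalization.injective _ (f O).primeCompl_le_nonZeroDivisors
      obtain ⟨e, he⟩ := ValuationRing.cond (algebraMap B (Localization.AtPrime (f O)) n)
        (algebraMap B (Localization.AtPrime (f O)) d)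
      obtain ⟨⟨u, s⟩, hus⟩ := IsLocalization.surj (f O).primeCompl e
      dsimp only at hus
      have hs : (s : B) ∉ f O := s.2
      have hs0 : ((s : B) : E) ≠ 0 := by
        intro h0
        exact hs (by rw [show (s : B) = 0 from Subtype.ext h0]; exact zero_mem _)
      have unit : ∀ {O : S} {w : B}, w ∉ f O → (w : E)⁻¹ ∈ O.1 := by
        intro O w hw
        rw [hf, ValuationSubring.mem_nonunits_iff_or] at hw
        by_contra h'
        exact hw (Or.inr h')
      rcases he with he | he
      · have h1 : n * u = d * s := hinjL (by rw [map_mul, map_mul, ← hus, ← he]; ring)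
        have h2 : (n : E) * u = d * s := by exact_mod_cast congrArg (Subtype.val) h1
        by_cases hu : u ∈ f O
        · exfalso
          have hu' := (hf O u).1 hu
          have hzu : (n : E) / d * u = s := by field_simp; linear_combination h2
          apply hs
          rw [hf, ValuationSubring.mem_nonunits_iff, ← hzu, map_mul]
          exact (mul_le_of_le_one_left zero_le ((ValuationSubring.valuation_le_one_iff _ _).2
            hz)).trans_lt ((ValuationSubring.mem_nonunits_iff _).1 hu')
        · have hu0 : (u : E) ≠ 0 := by
            intro h0
            exact hu (by rw [show u = 0 from Subtype.ext h0]; exact zero_mem _)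
          have : (n : E) / d = s * (u : E)⁻¹ := by field_simp; linear_combination h2
          change (n : E) / d ∈ O'.1
          rw [this]
          exact O'.1.mul_mem _ _ (O'.2.1 (s : B).2) (unit (h ▸ hu))
      · have h1 : d * u = n * s := hinjL (by rw [map_mul, map_mul, ← hus, ← he]; ring)
        have h2 : (d : E) * u = n * s := by exact_mod_cast congrArg (Subtype.val) h1
        have : (n : E) / d = u * ((s : B) : E)⁻¹ := by field_simp; linear_combination -h2
        change (n : E) / d ∈ O'.1
        rw [this]
        exact O'.1.mul_mem _ _ (O'.2.1 u.2) (unit (h ▸ hs))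
    intro O O' h
    exact Subtype.ext (le_antisymm (key O O' h) (key O' O h.symm))
  have := hfin.to_subtype
  exact @Set.toFinite _ S (Finite.of_injective (fun O : S => (⟨f O, hprime O, hcf O⟩ :
    {p : Ideal B | p.IsPrime ∧ c ∈ p})) (fun O O' h => hinj (by simpa using h)))

/-- A rational function on a curve has only finitely many poles. -/
theorem finite_poles [IsCurveFunctionField k E] (a : E) :
    {x : CurvePoint k E | a ∉ x.ring}.Finite := by
  obtain ⟨t, ht, hfd, hsep⟩ := IsCurveFunctionField.exists_separating (k := k) (E := E)
  have main : ∀ s : E, Transcendental k s → FiniteDimensional k⟮s⟯ E →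
      Algebra.IsSeparable k⟮s⟯ E →
      {x : CurvePoint k E | s ∈ x.ring ∧ a ∉ x.ring}.Finite := by
    intro s hs hfd hsep
    let A := Algebra.adjoin k {s}
    have e : Polynomial k ≃ₐ[k] A := Polynomial.algEquivOfTranscendental k s hs
    have : IsPrincipalIdealRing A := IsPrincipalIdealRing.of_surjective e.toRingHom e.surjective
    have : IsDedekindDomain A := inferInstance
    have : IsDedekindDomain (integralClosure A E) :=
      integralClosure.isDedekindDomain A k⟮s⟯ E
    have : IsFractionRing (integralClosure A E) E :=
      integralClosure.isFractionRing_of_finite_extension k⟮s⟯ E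
    have h1 : IsDedekindDomain (integralClosure A E).toSubring := ‹IsDedekindDomain _›
    have h2 : IsFractionRing (integralClosure A E).toSubring E :=
      ‹IsFractionRing (integralClosure A E) E›
    have h := finite_poles_of_isDedekindDomain (integralClosure A E).toSubring a
    refine (h.preimage (f := CurvePoint.ring) (fun x _ y _ hxy => CurvePoint.ext hxy)).subset ?_
    rintro x ⟨hsx, hax⟩
    refine ⟨fun z hz => ?_, hax⟩
    have hA : ∀ w ∈ Algebra.adjoin k {s}, w ∈ x.ring := by
      intro w hw
      induction hw using Algebra.adjoin_induction with
      | mem w hw => rw [Set.mem_singleton_iff.1 hw]; exact hsx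
      | algebraMap r => exact x.const_mem r
      | add w w' _ _ h h' => exact x.ring.add_mem _ _ h h'
      | mul w w' _ _ h h' => exact x.ring.mul_mem _ _ h h'
    obtain ⟨p, hp, hpz⟩ : IsIntegral A z := hz
    have hz' : IsIntegral x.ring z := by
      refine ⟨p.map (Subring.inclusion (S := A.toSubring) (T := x.ring.toSubring) hA),
        hp.map _, ?_⟩
      rw [Polynomial.eval₂_map]
      exact hpz
    obtain ⟨y, hy⟩ := IsIntegrallyClosed.isIntegral_iff.1 hz'
    rw [← hy]
    exact y.2
  have htop : k⟮t⁻¹⟯ = k⟮t⟯ := by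
    apply le_antisymm
    · rw [IntermediateField.adjoin_simple_le_iff]
      exact inv_mem (IntermediateField.mem_adjoin_simple_self k t)
    · rw [IntermediateField.adjoin_simple_le_iff]
      simpa using inv_mem (IntermediateField.mem_adjoin_simple_self k t⁻¹)
  refine ((main t ht hfd hsep).union (main t⁻¹ ?_ ?_ ?_)).subset ?_
  · exact fun h => ht (by simpa using h.inv)
  · rw [htop]; exact hfd
  · rw [htop]; exact hsep
  · intro x hx
    rcases x.ring.mem_or_inv_mem t with h | h
    · exact Or.inl ⟨h, hx⟩
    · exact Or.inr ⟨h, hx⟩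

end Poles

/-! ### Vector bundles -/

section Bundles

variable (L K : Type u) [Field L] [Field K] [Algebra L K]

/-- A locally free sheaf of finite rank on the complete regular curve over `L` with function field
`K`, given by its generic fibre `V` and by its stalks inside `V`. Local freeness: around every
point `P` there is an open set (the complement of finitely many closed points) on which the sheaf
is freely generated over the structure sheaf by a basis of `V`. The sections over an open set `U`
are the `v` in `V` which lie in the stalks at all points of `U`. -/
structure VectorBundle where
  fiber : Type u
  [addCommGroup : AddCommGroup fiber]
  [module : Module K fiber]
  [finiteDimensional : FiniteDimensional K fiber]
  stalk : ∀ P : CurvePoint L K, Submodule P.ring fiber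
  locallyFree : ∀ P : CurvePoint L K,
    ∃ b : Module.Basis (Fin (Module.finrank K fiber)) K fiber,
      stalk P = Submodule.span P.ring (Set.range b) ∧
      {P' : CurvePoint L K | stalk P' ≠ Submodule.span P'.ring (Set.range b)}.Finite

attribute [instance] VectorBundle.addCommGroup VectorBundle.module
  VectorBundle.finiteDimensional

variable {L K}

def VectorBundle.rank (E : VectorBundle L K) : ℕ := Module.finrank K E.fiber

/-- For families of submodules `N P ≤ N' P` of `V` (the stalks of two subsheaves of the constant
sheaf `V`), the dimension over `L` of the global sections of the quotient sheaf, when this quotient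
is a torsion sheaf, that is, of the direct sum of its stalks. -/
def cokerDim {V : Type u} [AddCommGroup V] [Module K V]
    (N N' : ∀ P : CurvePoint L K, Submodule P.ring V) : Cardinal :=
  letI : ∀ P : CurvePoint L K, Module L (N' P ⧸ (N P).submoduleOf (N' P)) :=
    fun P => Module.compHom _ (algebraMap L P.ring)
  Module.rank L (⨁ P : CurvePoint L K, N' P ⧸ (N P).submoduleOf (N' P))

end Bundles

/-! ### Base change of a curve, Frobenius, characteristic -/

section BaseChange

variable (Fq Q L K : Type u) [Field Fq] [Field Q] [Field L] [Field K]
  [Algebra Fq Q] [Algebra Fq L] [Algebra Fq K] [Algebra Q K] [Algebra L K]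
  [IsScalarTower Fq Q K] [IsScalarTower Fq L K]

/-- The multiplication map `Q ⊗ L → K`. -/
def mulMap : Q ⊗[Fq] L →ₐ[Fq] K :=
  Algebra.TensorProduct.productMap (IsScalarTower.toAlgHom Fq Q K) (IsScalarTower.toAlgHom Fq L K)

/-- `K` is the field of fractions of `Q ⊗ L`, where the tensor product is over `Fq`. If `Q` is the
function field of the curve `C` over `Fq`, then `K` is the function field of the base change `C_L`
of `C` to `L`, and the points of `C_L` are given by `CurvePoint L K`. -/
class IsBaseChangeFunctionField : Prop where
  injective : Function.Injective (mulMap Fq Q L K)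
  exists_div : ∀ z : K, ∃ a b : Q ⊗[Fq] L, mulMap Fq Q L K b ≠ 0 ∧
    z = mulMap Fq Q L K a / mulMap Fq Q L K b

variable {L K} in
/-- The image of a point `P` of `C_L` under the projection `C_L → C`. -/
def CurvePoint.proj (P : CurvePoint L K) : CurvePoint Fq Q where
  ring := P.ring.comap (algebraMap Q K)
  const_mem a := by
    rw [ValuationSubring.mem_comap, ← IsScalarTower.algebraMap_apply,
      IsScalarTower.algebraMap_apply Fq L K]
    exact P.const_mem _

variable [IsBaseChangeFunctionField Fq Q L K]

theorem mulMap_isFractionRing :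
    letI := (mulMap Fq Q L K).toRingHom.toAlgebra
    IsFractionRing (Q ⊗[Fq] L) K := by
  let := (mulMap Fq Q L K).toRingHom.toAlgebra
  have inj : Function.Injective (algebraMap (Q ⊗[Fq] L) K) :=
    IsBaseChangeFunctionField.injective
  have : IsDomain (Q ⊗[Fq] L) := inj.isDomain _
  have : FaithfulSMul (Q ⊗[Fq] L) K := (faithfulSMul_iff_algebraMap_injective _ _).2 inj
  refine IsFractionRing.of_field _ _ fun z => ?_
  obtain ⟨a, b, -, h⟩ := IsBaseChangeFunctionField.exists_div (Fq := Fq) (Q := Q) (L := L) z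
  exact ⟨a, b, h⟩

variable [Fintype Fq]

/-- The endomorphism `a ⊗ b ↦ a ⊗ b ^ q` of `Q ⊗ L`, followed by the inclusion into `K`. -/
def tensorSigma : Q ⊗[Fq] L →+* K :=
  (mulMap Fq Q L K).toRingHom.comp (Algebra.TensorProduct.map (AlgHom.id Fq Q)
    (FiniteField.frobeniusAlgHom Fq L)).toRingHom

theorem tensorSigma_injective : Function.Injective (tensorSigma Fq Q L K) := by
  refine (IsBaseChangeFunctionField.injective (Fq := Fq) (Q := Q) (L := L) (K := K)).comp ?_
  exact Module.Flat.lTensor_preserves_injective_linearMap (M := Q)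
    (FiniteField.frobeniusAlgHom Fq L).toLinearMap (FiniteField.frobeniusAlgHom Fq L).injective

/-- The endomorphism of `K` induced by `σ = id_C × Spec(Frob_q) : C_L → C_L`. It is characterised
by `sigma_algebraMap_left` and `sigma_algebraMap_right`. -/
def sigma : K →+* K :=
  letI := (mulMap Fq Q L K).toRingHom.toAlgebra
  haveI := mulMap_isFractionRing Fq Q L K
  haveI : IsDomain (Q ⊗[Fq] L) := (tensorSigma_injective Fq Q L K).isDomain _
  IsFractionRing.lift (K := K) (tensorSigma_injective Fq Q L K)

theorem sigma_mulMap (x : Q ⊗[Fq] L) :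
    sigma Fq Q L K (mulMap Fq Q L K x) = tensorSigma Fq Q L K x := by
  let := (mulMap Fq Q L K).toRingHom.toAlgebra
  have := mulMap_isFractionRing Fq Q L K
  have : IsDomain (Q ⊗[Fq] L) := (tensorSigma_injective Fq Q L K).isDomain _
  exact IsFractionRing.lift_algebraMap (K := K) (tensorSigma_injective Fq Q L K) x

theorem sigma_algebraMap_left (a : Q) :
    sigma Fq Q L K (algebraMap Q K a) = algebraMap Q K a := by
  have h := sigma_mulMap Fq Q L K (a ⊗ₜ 1)
  simpa [mulMap, tensorSigma] using h

theorem sigma_algebraMap_right (b : L) :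
    sigma Fq Q L K (algebraMap L K b) = algebraMap L K b ^ Fintype.card Fq := by
  have h := sigma_mulMap Fq Q L K (1 ⊗ₜ b)
  simpa [mulMap, tensorSigma] using h

variable {K} in
/-- The image `σ(P)` of a point `P` of `C_L` under `σ : C_L → C_L`. -/
def sigmaPoint (P : CurvePoint L K) : CurvePoint L K where
  ring := P.ring.comap (sigma Fq Q L K)
  const_mem b := by
    rw [ValuationSubring.mem_comap, sigma_algebraMap_right]
    exact pow_mem (P.const_mem b) _

end BaseChange

section TauSheaves

variable {Fq Q L : Type u} [Field Fq] [Field Q] [Field L] [Algebra Fq Q] [Algebra Fq L]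

variable (Fq Q L) in
/-- A morphism `c : Spec L → C` over `Fq`, given by its image point `c(Spec L)`, the characteristic
point, and by the local homomorphism from the local ring of this point to `L`. -/
structure Characteristic where
  point : CurvePoint Fq Q
  hom : point.ring →ₐ[Fq] L
  isLocalHom : IsLocalHom hom

variable {K : Type u} [Field K] [Algebra Fq K] [Algebra Q K] [Algebra L K]
  [IsScalarTower Fq Q K] [IsScalarTower Fq L K]

open Classical in
/-- The stalk at a point `P` of `C_L` of the ideal sheaf of the graph of `c`: it is generated by the
`a ⊗ 1 - 1 ⊗ c^*(a)` for `a` in the local ring of `C` at the characteristic point if this local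
ring is contained in the one of `P`, and `P` does not lie on the graph otherwise. -/
def graphIdeal (c : Characteristic Fq Q L) (P : CurvePoint L K) : Ideal P.ring :=
  if c.point.ring ≤ (P.proj Fq Q).ring then
    Ideal.span {z : P.ring | ∃ a : c.point.ring,
      (z : K) = algebraMap Q K a - algebraMap L K (c.hom a)}
  else ⊤

open Classical in
/-- The stalk at `P` of `E(-n·x)`, for a closed point `x` of `C` and a natural number `n`:
it is `𝔪^n E_P` if `P` lies above `x`, where `𝔪` is the maximal ideal of the local ring at `x`,
and `E_P` otherwise. -/
def stalkTwistNeg (n : ℕ) (x : CurvePoint Fq Q) (E : VectorBundle L K) (P : CurvePoint L K) :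
    Submodule P.ring E.fiber :=
  if P.proj Fq Q = x then
    Submodule.span P.ring {w | ∃ a ∈ IsLocalRing.maximalIdeal x.ring ^ n, ∃ v ∈ E.stalk P,
      w = algebraMap Q K a • v}
  else E.stalk P

/-- The identification of two members of a family of vector bundles with equal indices. -/
def fiberCast (E : ℤ → VectorBundle L K) {i j : ℤ} (h : i = j) :
    (E i).fiber ≃ₗ[K] (E j).fiber :=
  h ▸ LinearEquiv.refl K (E i).fiber

/-- The composite `Π_{i+n-1} ∘ … ∘ Π_i`. -/
def iterateMap (E : ℤ → VectorBundle L K) (Pi : ∀ i, (E i).fiber →ₗ[K] (E (i + 1)).fiber) (i : ℤ) :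
    ∀ n : ℕ, (E i).fiber →ₗ[K] (E (i + n)).fiber
  | 0 => (fiberCast E (by simp)).toLinearMap
  | n + 1 => (fiberCast E (by push_cast; ring)).toLinearMap ∘ₗ Pi (i + n) ∘ₗ iterateMap E Pi i n

variable [Fintype Fq] [IsBaseChangeFunctionField Fq Q L K]

variable (K) in
/-- An abelian `τ`-sheaf over `L` of characteristic `c`, on the curve `C` with function field `Q`
and with the fixed point `infty` of `C`.

Morphisms of sheaves are given by `K`-linear maps of the generic fibres which map stalks into
stalks. A morphism `σ^* F → F'` is given by a `σ`-semilinear map `τ` of the generic fibres which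
maps the stalk of `F` at `σ(P)` into the stalk of `F'` at `P` (the stalk of `σ^* F` at `P` is the
base change of the stalk of `F` at `σ(P)`); the stalk of its image is then generated by the
`τ v` for `v` in the stalk of `F` at `σ(P)`, and it is injective if and only if `τ` preserves linear
independence. -/
structure AbelianTauSheaf (infty : CurvePoint Fq Q) (c : Characteristic Fq Q L) where
  rank : ℕ
  dim : ℕ
  sheaf : ℤ → VectorBundle L K
  Pi : ∀ i, (sheaf i).fiber →ₗ[K] (sheaf (i + 1)).fiber
  tau : ∀ i, (sheaf i).fiber →ₛₗ[sigma Fq Q L K] (sheaf (i + 1)).fiber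
  rank_sheaf : ∀ i, (sheaf i).rank = rank
  Pi_mem : ∀ i P, ∀ v ∈ (sheaf i).stalk P, Pi i v ∈ (sheaf (i + 1)).stalk P
  tau_mem : ∀ i P, ∀ v ∈ (sheaf i).stalk (sigmaPoint Fq Q L P),
    tau i v ∈ (sheaf (i + 1)).stalk P
  Pi_injective : ∀ i, Function.Injective (Pi i)
  tau_injective : ∀ i (n : ℕ) (v : Fin n → (sheaf i).fiber), LinearIndependent K v →
    LinearIndependent K (fun j => tau i (v j))
  comm : ∀ i v, Pi (i + 1) (tau i v) = tau (i + 1) (Pi i v)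
  /-- There are positive integers `k, l` with `l d = k r` such that the composite
  `F_i → F_{i+l}` of the `Π`'s identifies `F_i` with the subsheaf `F_{i+l}(-k·∞)`. -/
  periodic : ∃ k l : ℕ, 0 < k ∧ 0 < l ∧ l * dim = k * rank ∧
    ∀ (i : ℤ) (P : CurvePoint L K),
      iterateMap sheaf Pi i l '' ((sheaf i).stalk P : Set (sheaf i).fiber) =
        (stalkTwistNeg k infty (sheaf (i + l)) P : Set (sheaf (i + l)).fiber)
  dim_coker_Pi : ∀ i,
    cokerDim (fun P => Submodule.span P.ring (Pi i '' (sheaf i).stalk P))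
      (sheaf (i + 1)).stalk = dim
  dim_coker_tau : ∀ i,
    cokerDim (fun P => Submodule.span P.ring (tau i '' (sheaf i).stalk (sigmaPoint Fq Q L P)))
      (sheaf (i + 1)).stalk = dim
  /-- The cokernel of `τ_i` is annihilated by the `d`-th power of the ideal sheaf of the graph. -/
  annihilated : ∀ i P, ∀ a ∈ graphIdeal c P ^ dim, ∀ v ∈ (sheaf (i + 1)).stalk P,
    a • v ∈ Submodule.span P.ring (tau i '' (sheaf i).stalk (sigmaPoint Fq Q L P))

/-- An effective divisor `D` on the curve with function field `E`, given by a local equation at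
every point: the stalk of `O(D)` at `x` is generated by the inverse of `eqn x`. -/
structure EffectiveDivisor (k E : Type*) [Field k] [Field E] [Algebra k E] where
  eqn : CurvePoint k E → E
  eqn_mem : ∀ x, eqn x ∈ x.ring
  eqn_ne_zero : ∀ x, eqn x ≠ 0
  finite : {x | (eqn x)⁻¹ ∉ x.ring}.Finite

/-- The sum of two effective divisors. -/
def EffectiveDivisor.add {k E : Type*} [Field k] [Field E] [Algebra k E]
    (D D' : EffectiveDivisor k E) : EffectiveDivisor k E where
  eqn x := D.eqn x * D'.eqn x
  eqn_mem x := mul_mem (D.eqn_mem x) (D'.eqn_mem x)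
  eqn_ne_zero x := mul_ne_zero (D.eqn_ne_zero x) (D'.eqn_ne_zero x)
  finite := by
    refine (D.finite.union D'.finite).subset fun x hx => ?_
    by_contra h
    rw [Set.mem_union, not_or] at h
    simp only [Set.mem_ofPred_eq, not_not] at h
    apply hx
    rw [mul_inv]
    exact mul_mem h.1 h.2

open Classical in
/-- The divisor of poles of a rational function. -/
def EffectiveDivisor.poles {k E : Type*} [Field k] [Field E] [Algebra k E]
    [IsCurveFunctionField k E] (a : E) : EffectiveDivisor k E where
  eqn x := if a ∈ x.ring then 1 else a⁻¹
  eqn_mem x := by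
    split_ifs with h
    · exact one_mem _
    · exact (x.ring.mem_or_inv_mem a).resolve_left h
  eqn_ne_zero x := by
    split_ifs with h
    · exact one_ne_zero
    · exact inv_ne_zero fun h0 => h (h0 ▸ zero_mem _)
  finite := by
    refine (finite_poles (k := k) a).subset fun x hx => ?_
    by_contra h
    simp only [Set.mem_ofPred_eq, not_not] at h
    simp [h] at hx

/-- The stalk at `P` of `E(D)`, for an effective divisor `D` on `C`. -/
def stalkTwist (D : EffectiveDivisor Fq Q) (E : VectorBundle L K) (P : CurvePoint L K) :
    Submodule P.ring E.fiber where
  carrier := {v | algebraMap Q K (D.eqn (P.proj Fq Q)) • v ∈ E.stalk P}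
  zero_mem' := by simp
  add_mem' {v w} hv hw := by
    simp only [Set.mem_ofPred_eq, smul_add] at *
    exact add_mem hv hw
  smul_mem' a v hv := by
    simp only [Set.mem_ofPred_eq] at *
    rw [smul_comm]
    exact Submodule.smul_mem _ a hv

namespace AbelianTauSheaf

variable {infty : CurvePoint Fq Q} {c : Characteristic Fq Q L}

/-- Families of linear maps between the generic fibres. -/
abbrev GenericHom (F F' : AbelianTauSheaf K infty c) : Type u :=
  ∀ i : ℤ, (F.sheaf i).fiber →ₗ[K] (F'.sheaf i).fiber

/-- The maps commute with the `Π`'s and the `τ`'s. -/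
structure Commutes {F F' : AbelianTauSheaf K infty c} (f : GenericHom F F') : Prop where
  Pi : ∀ i v, f (i + 1) (F.Pi i v) = F'.Pi i (f i v)
  tau : ∀ i v, f (i + 1) (F.tau i v) = F'.tau i (f i v)

/-- `f` is a morphism from `F` to `F'`. -/
structure IsMorphism {F F' : AbelianTauSheaf K infty c} (f : GenericHom F F') : Prop where
  commutes : Commutes f
  map_mem : ∀ i P, ∀ v ∈ (F.sheaf i).stalk P, f i v ∈ (F'.sheaf i).stalk P

/-- `f` is a morphism from `F` to `F'(D)`. -/
structure IsMorphismTwist {F F' : AbelianTauSheaf K infty c} (D : EffectiveDivisor Fq Q)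
    (f : GenericHom F F') : Prop where
  commutes : Commutes f
  map_mem : ∀ i P, ∀ v ∈ (F.sheaf i).stalk P, f i v ∈ stalkTwist D (F'.sheaf i) P

def IsInjective {F F' : AbelianTauSheaf K infty c} (f : GenericHom F F') : Prop :=
  ∀ i, Function.Injective (f i)

/-- The morphism `f` from `F` to `F'` is surjective. -/
def IsSurjective {F F' : AbelianTauSheaf K infty c} (f : GenericHom F F') : Prop :=
  ∀ i P, f i '' (F.sheaf i).stalk P = ((F'.sheaf i).stalk P : Set (F'.sheaf i).fiber)

def IsZero (F : AbelianTauSheaf K infty c) : Prop := ∀ i, Subsingleton (F.sheaf i).fiber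

def Isomorphic (F F' : AbelianTauSheaf K infty c) : Prop :=
  ∃ f : GenericHom F F', IsMorphism f ∧ IsInjective f ∧ IsSurjective f

/-- `F'` is an abelian quotient `τ`-sheaf of `F`. -/
def IsQuotient (F' F : AbelianTauSheaf K infty c) : Prop :=
  ∃ f : GenericHom F F', IsMorphism f ∧ IsSurjective f

def IsSimple (F : AbelianTauSheaf K infty c) : Prop :=
  ¬ F.IsZero ∧ ∀ F' : AbelianTauSheaf K infty c, F'.IsQuotient F → F'.IsZero ∨ F'.Isomorphic F

/-- `f` represents a quasi-morphism from `F` to `F'`. Quasi-morphisms into `F'(D₁)` and `F'(D₂)` are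
equivalent if and only if they agree on the generic fibres. -/
def IsQuasiMorphism {F F' : AbelianTauSheaf K infty c} (f : GenericHom F F') : Prop :=
  ∃ D : EffectiveDivisor Fq Q, IsMorphismTwist D f

/-- `f` represents a quasi-isogeny from `F` to `F'`: for some effective divisor `D` on `C` it is a
morphism from `F` to `F'(D)` which is injective and has its cokernels supported on `Z × Spec L` for
a finite set `Z` of closed points of `C`. -/
def IsQuasiIsogeny {F F' : AbelianTauSheaf K infty c} (f : GenericHom F F') : Prop :=
  ∃ D : EffectiveDivisor Fq Q, IsMorphismTwist D f ∧ IsInjective f ∧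
    ∃ Z : Set (CurvePoint Fq Q), Z.Finite ∧ (∀ x ∈ Z, x.IsClosedPoint) ∧
      ∀ i (P : CurvePoint L K), P.proj Fq Q ∉ Z →
        f i '' (F.sheaf i).stalk P = (stalkTwist D (F'.sheaf i) P : Set (F'.sheaf i).fiber)

def QuasiIsogenous (F F' : AbelianTauSheaf K infty c) : Prop :=
  ∃ f : GenericHom F F', IsQuasiIsogeny f

/-- `S` is the direct sum of the abelian `τ`-sheaves `G j`, with injections `inj j` and projections
`proj j`. -/
def IsDirectSum (S : AbelianTauSheaf K infty c) {n : ℕ} (G : Fin n → AbelianTauSheaf K infty c) :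
    Prop :=
  ∃ (inj : ∀ j, GenericHom (G j) S) (proj : ∀ j, GenericHom S (G j)),
    (∀ j, IsMorphism (inj j)) ∧ (∀ j, IsMorphism (proj j)) ∧
    (∀ j i v, proj j i (inj j i v) = v) ∧
    (∀ j j', j ≠ j' → ∀ i v, proj j' i (inj j i v) = 0) ∧
    ∀ i v, ∑ j, inj j i (proj j i v) = v

/-- `F` is quasi-isogenous to a (possibly empty) direct sum of simple abelian `τ`-sheaves. -/
def IsSemisimple (F : AbelianTauSheaf K infty c) : Prop :=
  ∃ (n : ℕ) (G : Fin n → AbelianTauSheaf K infty c) (S : AbelianTauSheaf K infty c),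
    (∀ j, (G j).IsSimple) ∧ S.IsDirectSum G ∧ F.QuasiIsogenous S

/-- The ring of all families of endomorphisms of the generic fibres. -/
def GenericEnd (F : AbelianTauSheaf K infty c) : Type u :=
  ∀ i : ℤ, Module.End K (F.sheaf i).fiber

instance (F : AbelianTauSheaf K infty c) : Ring F.GenericEnd :=
  inferInstanceAs (Ring (∀ i : ℤ, Module.End K (F.sheaf i).fiber))

instance (F : AbelianTauSheaf K infty c) : Algebra Q F.GenericEnd :=
  letI : Algebra K F.GenericEnd :=
    inferInstanceAs (Algebra K (∀ i : ℤ, Module.End K (F.sheaf i).fiber))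
  Algebra.compHom F.GenericEnd (algebraMap Q K)

/-- The `Q`-algebra `QEnd(F)` of quasi-morphisms from `F` to `F`. -/
def QEnd [IsCurveFunctionField Fq Q] (F : AbelianTauSheaf K infty c) :
    Subalgebra Q F.GenericEnd where
  carrier := {f | IsQuasiMorphism (F := F) (F' := F) f}
  add_mem' := by
    rintro f g ⟨D, hf⟩ ⟨D', hg⟩
    refine ⟨D.add D', ⟨fun i v => ?_, fun i v => ?_⟩, fun i P v hv => ?_⟩
    · change f (i + 1) _ + g (i + 1) _ = F.Pi i (f i v + g i v)
      rw [hf.commutes.Pi, hg.commutes.Pi, map_add]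
    · change f (i + 1) _ + g (i + 1) _ = F.tau i (f i v + g i v)
      rw [hf.commutes.tau, hg.commutes.tau, map_add]
    · change algebraMap Q K (D.eqn (P.proj Fq Q) * D'.eqn (P.proj Fq Q)) • (f i v + g i v) ∈
        (F.sheaf i).stalk P
      rw [smul_add, map_mul]
      refine add_mem ?_ ?_
      · rw [mul_comm, mul_smul]
        exact Submodule.smul_mem _ (⟨_, D'.eqn_mem (P.proj Fq Q)⟩ : P.ring) (hf.map_mem i P v hv)
      · rw [mul_smul]
        exact Submodule.smul_mem _ (⟨_, D.eqn_mem (P.proj Fq Q)⟩ : P.ring) (hg.map_mem i P v hv)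
  mul_mem' := by
    rintro f g ⟨D, hf⟩ ⟨D', hg⟩
    refine ⟨D.add D', ⟨fun i v => ?_, fun i v => ?_⟩, fun i P v hv => ?_⟩
    · change f (i + 1) (g (i + 1) _) = F.Pi i (f i (g i v))
      rw [hg.commutes.Pi, hf.commutes.Pi]
    · change f (i + 1) (g (i + 1) _) = F.tau i (f i (g i v))
      rw [hg.commutes.tau, hf.commutes.tau]
    · change algebraMap Q K (D.eqn (P.proj Fq Q) * D'.eqn (P.proj Fq Q)) • (f i (g i v)) ∈
        (F.sheaf i).stalk P
      rw [map_mul, mul_smul, ← map_smul (f i)]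
      exact hf.map_mem i P _ (hg.map_mem i P v hv)
  algebraMap_mem' a := by
    have h : ∀ i v, (algebraMap Q F.GenericEnd a) i v = algebraMap Q K a • v := fun _ _ => rfl
    refine ⟨EffectiveDivisor.poles a, ⟨fun i v => ?_, fun i v => ?_⟩, fun i P v hv => ?_⟩
    · rw [h, h, map_smul]
    · rw [h, h, LinearMap.map_smulₛₗ, sigma_algebraMap_left]
    · rw [h]
      change algebraMap Q K ((EffectiveDivisor.poles (k := Fq) a).eqn (P.proj Fq Q)) •
        algebraMap Q K a • v ∈ (F.sheaf i).stalk P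
      dsimp only [EffectiveDivisor.poles]
      rw [smul_smul, ← map_mul]
      split_ifs with ha
      · rw [one_mul]
        exact Submodule.smul_mem _ (⟨_, ha⟩ : P.ring) hv
      · have ha0 : a ≠ 0 := fun h0 => ha (h0 ▸ zero_mem _)
        rw [inv_mul_cancel₀ ha0, map_one, one_smul]
        exact hv

end AbelianTauSheaf

end TauSheaves

/-- A division algebra: a nonzero ring in which every nonzero element is invertible. -/
def IsDivisionAlgebra (R : Type*) [Ring R] : Prop :=
  Nontrivial R ∧ ∀ x : R, x ≠ 0 → IsUnit x

end

end TauSheaf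

namespace TauSheaf

noncomputable section

/-! ### Local rings of points of a curve -/

section Points

open IntermediateField.algebraAdjoinAdjoin

variable {k E : Type*} [Field k] [Field E] [Algebra k E]

/-! The `Π`'s identify the generic fibres of all `F_i` with one finite-dimensional `K`-space `V`,
and `Π⁻¹ ∘ τ` becomes a single `σ`-semilinear map `φ` on `V` (`psi`, `phi`, `psi_tau`). The sheaves
themselves are a chain of lattices in `V`, and a commuting family of maps is determined by its
effect on `V`. Up to quasi-isogeny everything is governed by the pair `(V, φ)`.

Let `L` be finite. Then `K = Q ⊗ L` is finite over `Q`, and `σ` has finite order `e` and fixed field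
`Q`. An endomorphism of `(V, φ)` has finitely many poles, bounded by a divisor coming from `C`;
hence `QEnd(F)` is the ring of endomorphisms of `V` commuting with `φ` (`qEndEquiv`). Two tools
control this ring. The power `π = φ^e` is `K`-linear, so ordinary linear algebra applies to it. A
map commuting with `π` can be multiplied by a scalar and averaged over its `σ`-orbit to commute with
`φ`; by independence of the powers of `σ`, a nonzero map has a nonzero average for some scalar
(`map_orbitSum`, `exists_orbitSum_ne_zero`).

If `QEnd(F)` is a division algebra and `F → F'` is surjective with `F'` nonzero, there is a nonzero
map back `V' → V` (`exists_ne_zero_of_surjective`). The composite endomorphism of `V` is nonzero,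
hence invertible, so `F → F'` is injective. This needs no condition on `ε`.

For the converse, quotients of `(V, φ)` must come from quotient `τ`-sheaves. The images of the
stalks are an obvious candidate, and only the dimensions of the cokernels are in question. If `ε ≠
∞`, then `τ` is an isomorphism at `∞` and `Π` is one at `ε`, so both dimensions are read off from
the divisor of `det φ` above `∞` and above `ε`. The norm of `det φ` lies in `Q` and has zeros and
poles only at these two points; comparison with the same data for `F` shows that the two dimensions
agree and have the right value (`degAbove_mul_degAbove`, `exists_dim`). Thus a simple `F` has no
proper nonzero `φ`-stable subspace, and Schur's lemma applies.

For semisimplicity, `V` is viewed as a module over the ring generated by `K` and `φ`. A semisimple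
module of finite length has a semisimple endomorphism ring. Conversely, if the endomorphism ring is
semisimple, a repeated factor of the minimal polynomial of `π` would give, after averaging, a
nonzero central nilpotent endomorphism; so `π` is semisimple (`isSemisimple_frobPow`). A
`π`-equivariant projection onto a stable subspace is then averaged to a `φ`-equivariant one, and `V`
splits into simple pieces, which are realised by images of `F`.

For the counterexample take `F_i = O(i·∞)²` on the projective line and `τ = t·U·σ` with `U` upper
triangular with rows `(1, α²)` and `(0, α)`. On `K = Q(α)` the map `σ` fixes `Q` and multiplies
orders at the pole of `α` by `q`. For `q > 2` this leaves only scalar endomorphisms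
(`exists_eq_smul_of_commutes`), while the second coordinate is a quotient of rank one. A direct sum
decomposition up to quasi-isogeny would have a summand with the same generic fibre, and that summand
still has a quotient of rank one (`exists_isQuotient_rank_one`). -/

/-- A nontrivial valuation ring containing a Dedekind domain with the same field of fractions is
discrete, and the Dedekind domain surjects onto its residue field. -/
theorem isDiscreteValuationRing_of_le (B : Subring E) [IsDedekindDomain B] [IsFractionRing B E]
    (O : ValuationSubring E) (hB : B ≤ O.toSubring) (hO : O ≠ ⊤) :
    IsDiscreteValuationRing O ∧ Function.Surjective
      ((IsLocalRing.residue O).comp (Subring.inclusion hB : B →+* O)) := by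
  let p : Ideal B := (IsLocalRing.maximalIdeal O).comap (Subring.inclusion hB)
  have hf : ∀ z : B, z ∈ p ↔ (z : E) ∈ O.nonunits := by
    intro z
    rw [ValuationSubring.mem_nonunits_iff_exists_mem_maximalIdeal]
    exact ⟨fun h => ⟨hB z.2, h⟩, fun ⟨_, h⟩ => h⟩
  have hp : p.IsPrime := by
    change (Ideal.comap _ (IsLocalRing.maximalIdeal O)).IsPrime
    infer_instance
  have unit : ∀ {w : B}, w ∉ p → (w : E)⁻¹ ∈ O := by
    intro w hw
    rw [hf, ValuationSubring.mem_nonunits_iff_or] at hw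
    by_contra h'
    exact hw (Or.inr h')
  -- If the centre `p` were zero, all nonzero elements of `B` would be units of `O`, which would
  -- then be all of `E`.
  have hp0 : p ≠ ⊥ := by
    intro h0
    apply hO
    rw [eq_top_iff]
    intro z _
    obtain ⟨n, d, hd, rfl⟩ := IsFractionRing.div_surjective (A := B) z
    rw [div_eq_mul_inv]
    refine O.mul_mem _ _ (hB n.2) (unit ?_)
    rw [h0]
    exact nonZeroDivisors.ne_zero hd
  have := IsLocalization.AtPrime.isDiscreteValuationRing_of_dedekind_domain B hp0
    (Localization.AtPrime p)
  let : Algebra B O := (Subring.inclusion hB).toAlgebra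
  -- Both claims follow once `O` is the localization of `B` at `p`. A fraction `n/d` in `O` is
  -- rewritten with denominator outside `p` by using that the localization is a valuation ring, so
  -- one of `n`, `d` divides the other there.
  have hloc : IsLocalization.AtPrime O p := by
    refine ⟨⟨?_, ?_, ?_⟩⟩
    · rintro ⟨w, hw⟩
      refine .of_mul_eq_one ⟨(w : E)⁻¹, unit hw⟩ (Subtype.ext (mul_inv_cancel₀ (a := (w : E)) ?_))
      intro h0
      exact hw (by rw [show w = 0 from Subtype.ext h0]; exact zero_mem _)
    · intro z
      obtain ⟨n, d, hd, hz⟩ := IsFractionRing.div_surjective (A := B) (z : E)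
      have hzO := z.2
      have hd0 : (d : E) ≠ 0 := by
        have := nonZeroDivisors.ne_zero hd
        exact_mod_cast this
      have hinjL : Function.Injective (algebraMap B (Localization.AtPrime p)) :=
        IsLocalization.injective _ p.primeCompl_le_nonZeroDivisors
      obtain ⟨e, he⟩ := ValuationRing.cond (algebraMap B (Localization.AtPrime p) n)
        (algebraMap B (Localization.AtPrime p) d)
      obtain ⟨⟨u, s⟩, hus⟩ := IsLocalization.surj p.primeCompl e
      dsimp only at hus
      have hs : (s : B) ∉ p := s.2
      have hs0 : ((s : B) : E) ≠ 0 := by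
        intro h0
        exact hs (by rw [show (s : B) = 0 from Subtype.ext h0]; exact zero_mem _)
      rcases he with he | he
      · have h1 : n * u = d * s := hinjL (by rw [map_mul, map_mul, ← hus, ← he]; ring)
        have h2 : (n : E) * u = d * s := by exact_mod_cast congrArg (Subtype.val) h1
        have hzu : (z : E) * u = s := by
          rw [← hz]
          change (n : E) / d * u = s
          field_simp; linear_combination h2
        have hu : u ∉ p := by
          intro hu
          have hu' := (hf u).1 hu
          apply hs
          rw [hf, ValuationSubring.mem_nonunits_iff, ← hzu, map_mul]
          exact (mul_le_of_le_one_left zero_le ((ValuationSubring.valuation_le_one_iff _ _).2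
            hzO)).trans_lt ((ValuationSubring.mem_nonunits_iff _).1 hu')
        exact ⟨⟨s, ⟨u, hu⟩⟩, Subtype.ext hzu⟩
      · have h1 : d * u = n * s := hinjL (by rw [map_mul, map_mul, ← hus, ← he]; ring)
        have h2 : (d : E) * u = n * s := by exact_mod_cast congrArg (Subtype.val) h1
        refine ⟨⟨u, s⟩, Subtype.ext ?_⟩
        change (z : E) * s = u
        rw [← hz]
        change (n : E) / d * s = u
        field_simp; linear_combination -h2
    · intro a b hab
      exact ⟨1, by simpa using (Subring.inclusion_injective hB hab)⟩
  refine ⟨IsLocalization.AtPrime.isDiscreteValuationRing_of_dedekind_domain B hp0 O, fun y => ?_⟩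
  -- As `p` is maximal, the denominator `s` has an inverse `v` modulo `p`, and `n * v` lifts the
  -- given residue class.
  have hmax : p.IsMaximal := Ring.DimensionLEOne.maximalOfPrime hp0 hp
  obtain ⟨z, rfl⟩ := IsLocalRing.residue_surjective y
  obtain ⟨⟨n, s⟩, hns⟩ := IsLocalization.surj p.primeCompl z
  obtain ⟨v, hv⟩ := hmax.exists_inv s.2
  have hres : ∀ w : B, w ∈ p → IsLocalRing.residue O (algebraMap B O w) = 0 := fun w hw => by
    rw [IsLocalRing.residue_eq_zero_iff]
    exact hw
  obtain ⟨i, hi, hvi⟩ := hv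
  refine ⟨n * v, ?_⟩
  change IsLocalRing.residue O (algebraMap B O (n * v)) = _
  have h1 := congrArg (fun w => IsLocalRing.residue O (algebraMap B O w)) hvi
  simp only [map_add, map_mul, map_one, hres i hi, add_zero] at h1
  have h2 := congrArg (IsLocalRing.residue O) hns
  dsimp only at h2
  rw [map_mul] at h2
  rw [map_mul, map_mul, ← h2]
  linear_combination (IsLocalRing.residue O z) * h1

/-- Around every point there is a separating element of the function field which is regular. -/
theorem exists_separating_mem [IsCurveFunctionField k E] (x : CurvePoint k E) :
    ∃ s : E, s ∈ x.ring ∧ Transcendental k s ∧ FiniteDimensional k⟮s⟯ E ∧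
      Algebra.IsSeparable k⟮s⟯ E := by
  obtain ⟨t, ht, hfd, hsep⟩ := IsCurveFunctionField.exists_separating (k := k) (E := E)
  rcases x.ring.mem_or_inv_mem t with h | h
  · exact ⟨t, h, ht, hfd, hsep⟩
  have htop : k⟮t⁻¹⟯ = k⟮t⟯ := by
    apply le_antisymm
    · rw [IntermediateField.adjoin_simple_le_iff]
      exact inv_mem (IntermediateField.mem_adjoin_simple_self k t)
    · rw [IntermediateField.adjoin_simple_le_iff]
      simpa using inv_mem (IntermediateField.mem_adjoin_simple_self k t⁻¹)
  refine ⟨t⁻¹, h, fun h => ht (by simpa using h.inv), ?_, ?_⟩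
  · rw [htop]; exact hfd
  · rw [htop]; exact hsep

theorem CurvePoint.adjoin_le (x : CurvePoint k E) {s : E} (hs : s ∈ x.ring) :
    ∀ w ∈ Algebra.adjoin k {s}, w ∈ x.ring := by
  intro w hw
  induction hw using Algebra.adjoin_induction with
  | mem w hw => rw [Set.mem_singleton_iff.1 hw]; exact hs
  | algebraMap r => exact x.const_mem r
  | add w w' _ _ h h' => exact x.ring.add_mem _ _ h h'
  | mul w w' _ _ h h' => exact x.ring.mul_mem _ _ h h'

/-- Around every point there is an affine open subset of the curve. -/
theorem CurvePoint.exists_isDedekindDomain [IsCurveFunctionField k E] (x : CurvePoint k E) :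
    ∃ B : Subalgebra k E, IsDedekindDomain B ∧ IsFractionRing B E ∧ Algebra.FiniteType k B ∧
      B.toSubring ≤ x.ring.toSubring := by
  obtain ⟨s, hsx, hs, hfd, hsep⟩ := exists_separating_mem x
  let A := Algebra.adjoin k {s}
  have e : Polynomial k ≃ₐ[k] A := Polynomial.algEquivOfTranscendental k s hs
  have : IsPrincipalIdealRing A := IsPrincipalIdealRing.of_surjective e.toRingHom e.surjective
  have : IsDedekindDomain A := inferInstance
  have : IsDedekindDomain (integralClosure A E) :=
    integralClosure.isDedekindDomain A k⟮s⟯ E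
  have : IsFractionRing (integralClosure A E) E :=
    integralClosure.isFractionRing_of_finite_extension k⟮s⟯ E
  have hfin : Module.Finite A (integralClosure A E) :=
    IsIntegralClosure.finite A k⟮s⟯ E (integralClosure A E)
  have hft : Algebra.FiniteType k A := .equiv inferInstance e
  have hft' : Algebra.FiniteType k (integralClosure A E) := .trans hft inferInstance
  refine ⟨(integralClosure A E).restrictScalars k, ‹IsDedekindDomain (integralClosure A E)›,
    ‹IsFractionRing (integralClosure A E) E›, hft', fun z hz => ?_⟩
  have hA := x.adjoin_le hsx
  obtain ⟨p, hp, hpz⟩ : IsIntegral A z := hz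
  have hz' : IsIntegral x.ring z := by
    refine ⟨p.map (Subring.inclusion (S := A.toSubring) (T := x.ring.toSubring) hA),
      hp.map _, ?_⟩
    rw [Polynomial.eval₂_map]
    exact hpz
  obtain ⟨y, hy⟩ := IsIntegrallyClosed.isIntegral_iff.1 hz'
  rw [← hy]
  exact y.2

theorem CurvePoint.IsClosedPoint.isDiscreteValuationRing [IsCurveFunctionField k E]
    {x : CurvePoint k E} (hx : x.IsClosedPoint) : IsDiscreteValuationRing x.ring := by
  obtain ⟨B, h1, h2, -, hB⟩ := x.exists_isDedekindDomain
  have h1' : IsDedekindDomain B.toSubring := h1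
  have h2' : IsFractionRing B.toSubring E := h2
  exact (isDiscreteValuationRing_of_le B.toSubring x.ring hB hx).1

/-- The residue field is a quotient of a finitely generated `k`-algebra, so Zariski's lemma applies.
-/
theorem CurvePoint.IsClosedPoint.finite_residueField [IsCurveFunctionField k E]
    {x : CurvePoint k E} (hx : x.IsClosedPoint) :
    Module.Finite k (IsLocalRing.ResidueField x.ring) := by
  obtain ⟨B, h1, h2, h3, hB⟩ := x.exists_isDedekindDomain
  have h1' : IsDedekindDomain B.toSubring := h1
  have h2' : IsFractionRing B.toSubring E := h2
  have hs := (isDiscreteValuationRing_of_le B.toSubring x.ring hB hx).2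
  have : Algebra.FiniteType k (IsLocalRing.ResidueField x.ring) :=
    Algebra.FiniteType.of_surjective (A := B)
      (AlgHom.mk ((IsLocalRing.residue x.ring).comp (Subring.inclusion hB)) fun a => rfl) hs
  exact finite_of_finite_type_of_isJacobsonRing k _

/-- At closed points the ring is discrete; at the generic point it is a field. Treating both
together makes lattices free at every point. -/
instance CurvePoint.isPrincipalIdealRing [IsCurveFunctionField k E] (x : CurvePoint k E) :
    IsPrincipalIdealRing x.ring := by
  by_cases hx : x.IsClosedPoint
  · have := hx.isDiscreteValuationRing
    infer_instance
  · have hx' : x.ring = ⊤ := not_not.1 hx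
    have hf : IsField x.ring := by
      refine ⟨⟨0, 1, zero_ne_one⟩, mul_comm, fun {a} ha => ?_⟩
      refine ⟨⟨(a : E)⁻¹, hx'.ge (show _ ∈ (⊤ : ValuationSubring E) from trivial)⟩, Subtype.ext (mul_inv_cancel₀ (a := (a : E)) ?_)⟩
      exact_mod_cast ha
    let := hf.toField
    exact (inferInstance : IsPrincipalIdealRing x.ring)

/-! ### Orders of vanishing -/

open Classical in
/-- The normalized valuation of a discrete valuation ring on its field of fractions, with value `0`
at `0`. It is zero if the valuation ring is trivial. -/
def _root_.ValuationSubring.ord (O : ValuationSubring E) (z : E) : ℤ :=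
  if h : ∃ (n : ℤ) (w : O) (u : Oˣ), Irreducible w ∧ z = (u : O) * (w : E) ^ n then h.choose else 0

/-- Two irreducible elements of a valuation ring are associated, since one divides the other, and a
unit times `w ^ j` is a unit only for `j = 0`. So the chosen exponent depends on no choices. -/
theorem _root_.ValuationSubring.ord_eq {O : ValuationSubring E} {z : E} {n : ℤ} {w : O}
    (hw : Irreducible w) (u : Oˣ) (hz : z = (u : O) * (w : E) ^ n) : O.ord z = n := by
  have h : ∃ (n : ℤ) (w : O) (u : Oˣ), Irreducible w ∧ z = (u : O) * (w : E) ^ n :=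
    ⟨n, w, u, hw, hz⟩
  have hc : O.ord z = h.choose := dif_pos h
  obtain ⟨w', u', hw', hz'⟩ := h.choose_spec
  rw [hc]
  generalize h.choose = m at hz'
  have hass : ∃ v : Oˣ, w * v = w' := by
    rcases ValuationRing.dvd_total w w' with h | h
    · exact (hw.associated_of_dvd hw' h)
    · exact (hw'.associated_of_dvd hw h).symm
  obtain ⟨v, rfl⟩ := hass
  have hw0 : (w : E) ≠ 0 := by exact_mod_cast hw.ne_zero
  have key : ∀ j : ℕ, ∀ a b : Oˣ, ((a : O) : E) * (w : E) ^ (j : ℤ) = ((b : O) : E) → j = 0 := by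
    intro j a b hab
    by_contra hj
    have h1 : (a : O) * w ^ j = b := by
      apply Subtype.ext
      push_cast
      simpa using hab
    apply hw.not_isUnit
    have h2 : IsUnit (w ^ j) := by
      have : IsUnit ((a : O) * w ^ j) := h1 ▸ b.isUnit
      exact isUnit_of_mul_isUnit_right this
    exact (isUnit_pow_iff hj).1 h2
  have hne : ∀ a : Oˣ, ((a : O) : E) ≠ 0 := fun a => by exact_mod_cast a.ne_zero
  have hvm : ∀ m : ℤ, (((v : O) : E)) ^ m = (((v ^ m : Oˣ) : O) : E) := by
    intro m
    let f : Oˣ →* Eˣ := Units.map (algebraMap O E : O →* E)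
    have : f (v ^ m) = f v ^ m := map_zpow f v m
    have := congrArg (Units.val) this
    rw [Units.val_zpow_eq_zpow_val] at this
    exact this.symm
  have heq : (((u' * v ^ m : Oˣ) : O) : E) * (w : E) ^ m = ((u : O) : E) * (w : E) ^ n := by
    rw [← hz, hz']
    push_cast
    rw [mul_zpow, hvm]
    ring
  rcases le_total m n with hmn | hmn
  · obtain ⟨j, rfl⟩ : ∃ j : ℕ, n = m + j := ⟨(n - m).toNat, by omega⟩
    have := key j u (u' * v ^ m) (by
      rw [zpow_add₀ hw0] at heq
      apply mul_right_cancel₀ (zpow_ne_zero m hw0)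
      rw [heq]; ring)
    omega
  · obtain ⟨j, rfl⟩ : ∃ j : ℕ, m = n + j := ⟨(m - n).toNat, by omega⟩
    have := key j (u' * v ^ (n + (j : ℤ))) u (by
      rw [zpow_add₀ hw0 n j] at heq
      apply mul_right_cancel₀ (zpow_ne_zero n hw0)
      rw [← heq]; ring)
    omega

end Points

end

end TauSheaf

namespace TauSheaf

noncomputable section

section Order

variable {k E : Type*} [Field k] [Field E] [Algebra k E]

theorem _root_.ValuationSubring.ord_top {O : ValuationSubring E} (hO : O = ⊤) (z : E) :
    O.ord z = 0 := by
  refine dif_neg ?_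
  rintro ⟨n, w, u, hw, -⟩
  apply hw.not_isUnit
  refine .of_mul_eq_one ⟨(w : E)⁻¹, hO.ge (show _ ∈ (⊤ : ValuationSubring E) from trivial)⟩
    (Subtype.ext (mul_inv_cancel₀ (a := (w : E)) ?_))
  exact_mod_cast hw.ne_zero

/-- The order of vanishing of a rational function at a point. -/
def CurvePoint.ord (x : CurvePoint k E) (z : E) : ℤ := x.ring.ord z

namespace CurvePoint

theorem ord_of_not_isClosedPoint {x : CurvePoint k E} (hx : ¬ x.IsClosedPoint) (z : E) :
    x.ord z = 0 :=
  ValuationSubring.ord_top (not_not.1 hx) z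

variable [IsCurveFunctionField k E]

theorem IsClosedPoint.exists_irreducible {x : CurvePoint k E} (hx : x.IsClosedPoint) :
    ∃ w : x.ring, Irreducible w := by
  have := hx.isDiscreteValuationRing
  exact IsDiscreteValuationRing.exists_irreducible _

theorem IsClosedPoint.eq_unit_mul_zpow_ord {x : CurvePoint k E} (hx : x.IsClosedPoint) {w : x.ring}
    (hw : Irreducible w) {z : E} (hz : z ≠ 0) :
    ∃ u : x.ringˣ, z = (u : x.ring) * (w : E) ^ x.ord z := by
  have := hx.isDiscreteValuationRing
  suffices h : ∃ (n : ℤ) (u : x.ringˣ), z = (u : x.ring) * (w : E) ^ n by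
    obtain ⟨n, u, h⟩ := h
    have : x.ord z = n := ValuationSubring.ord_eq hw u h
    exact ⟨u, this ▸ h⟩
  have key : ∀ z : E, z ≠ 0 → z ∈ x.ring →
      ∃ (n : ℕ) (u : x.ringˣ), z = (u : x.ring) * (w : E) ^ n := by
    intro z hz hzx
    obtain ⟨n, u, h⟩ := IsDiscreteValuationRing.eq_unit_mul_pow_irreducible (x := (⟨z, hzx⟩ : x.ring))
      (fun h => hz (congrArg Subtype.val h)) hw
    refine ⟨n, u, ?_⟩
    have := congrArg Subtype.val h
    push_cast at this
    exact this
  rcases x.ring.mem_or_inv_mem z with h | h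
  · obtain ⟨n, u, h⟩ := key z hz h
    exact ⟨n, u, by simpa using h⟩
  · obtain ⟨n, u, h⟩ := key z⁻¹ (inv_ne_zero hz) h
    refine ⟨-n, u⁻¹, ?_⟩
    have hu : (((u⁻¹ : x.ringˣ) : x.ring) : E) * ((u : x.ring) : E) = 1 := by
      exact_mod_cast congrArg Subtype.val u.inv_mul
    have hu0 : ((u : x.ring) : E) ≠ 0 := by exact_mod_cast u.ne_zero
    rw [zpow_neg, zpow_natCast, eq_comm, ← inv_inv z, h, mul_inv]
    congr 1
    exact eq_inv_of_mul_eq_one_left hu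

omit [IsCurveFunctionField k E] in
theorem ord_irreducible {x : CurvePoint k E} {w : x.ring} (hw : Irreducible w) :
    x.ord (w : E) = 1 :=
  ValuationSubring.ord_eq hw 1 (by simp)

theorem ord_mul (x : CurvePoint k E) {z z' : E} (hz : z ≠ 0) (hz' : z' ≠ 0) :
    x.ord (z * z') = x.ord z + x.ord z' := by
  by_cases hx : x.IsClosedPoint
  · obtain ⟨w, hw⟩ := hx.exists_irreducible
    obtain ⟨u, hu⟩ := hx.eq_unit_mul_zpow_ord hw hz
    obtain ⟨u', hu'⟩ := hx.eq_unit_mul_zpow_ord hw hz'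
    refine ValuationSubring.ord_eq hw (u * u') ?_
    have hw0 : (w : E) ≠ 0 := by exact_mod_cast hw.ne_zero
    conv_lhs => rw [hu, hu']
    rw [zpow_add₀ hw0]
    push_cast
    ring
  · simp [ord_of_not_isClosedPoint hx]

theorem ord_eq_zero (x : CurvePoint k E) {z : E} (hz : z ∈ x.ring) (hz' : z⁻¹ ∈ x.ring) :
    x.ord z = 0 := by
  by_cases hx : x.IsClosedPoint
  · obtain ⟨w, hw⟩ := hx.exists_irreducible
    -- Since `0⁻¹ = 0`, the element `0` satisfies both hypotheses; its order is the default value.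
    by_cases h0 : z = 0
    · subst h0
      refine dif_neg ?_
      rintro ⟨n, w, u, hw, h⟩
      have h1 : ((u : x.ring) : E) ≠ 0 := by exact_mod_cast u.ne_zero
      have h2 : (w : E) ≠ 0 := by exact_mod_cast hw.ne_zero
      exact mul_ne_zero h1 (zpow_ne_zero n h2) h.symm
    · refine ValuationSubring.ord_eq hw ⟨⟨z, hz⟩, ⟨z⁻¹, hz'⟩, Subtype.ext ?_, Subtype.ext ?_⟩ ?_
      · exact mul_inv_cancel₀ h0
      · exact inv_mul_cancel₀ h0
      · simp
  · exact ord_of_not_isClosedPoint hx z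

@[simp] theorem ord_one (x : CurvePoint k E) : x.ord (1 : E) = 0 :=
  x.ord_eq_zero (one_mem _) (by simp [one_mem])

@[simp] theorem ord_zero (x : CurvePoint k E) : x.ord (0 : E) = 0 :=
  x.ord_eq_zero (zero_mem _) (by simp [zero_mem])

theorem ord_inv (x : CurvePoint k E) (z : E) : x.ord z⁻¹ = - x.ord z := by
  by_cases hz : z = 0
  · simp [hz]
  have := x.ord_mul hz (inv_ne_zero hz)
  rw [mul_inv_cancel₀ hz, ord_one] at this
  omega

theorem ord_prod (x : CurvePoint k E) {ι : Type*} (s : Finset ι) (f : ι → E)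
    (hf : ∀ i ∈ s, f i ≠ 0) : x.ord (∏ i ∈ s, f i) = ∑ i ∈ s, x.ord (f i) := by
  classical
  induction s using Finset.induction_on with
  | empty => simp
  | insert i s hi ih =>
    rw [Finset.prod_insert hi, Finset.sum_insert hi, ord_mul, ih]
    · exact fun j hj => hf j (Finset.mem_insert_of_mem hj)
    · exact hf i (Finset.mem_insert_self _ _)
    · exact Finset.prod_ne_zero_iff.2 fun j hj => hf j (Finset.mem_insert_of_mem hj)

theorem ord_pow (x : CurvePoint k E) {z : E} (hz : z ≠ 0) (n : ℕ) :
    x.ord (z ^ n) = n * x.ord z := by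
  have := x.ord_prod (Finset.range n) (fun _ => z) (fun _ _ => hz)
  simpa using this

theorem mem_ring_of_ord_nonneg {x : CurvePoint k E} (hx : x.IsClosedPoint) {z : E}
    (h : 0 ≤ x.ord z) : z ∈ x.ring := by
  by_cases hz : z = 0
  · exact hz ▸ zero_mem _
  obtain ⟨w, hw⟩ := hx.exists_irreducible
  obtain ⟨u, hu⟩ := hx.eq_unit_mul_zpow_ord hw hz
  rw [hu]
  obtain ⟨n, hn⟩ := Int.eq_ofNat_of_zero_le h
  rw [hn, zpow_natCast]
  exact mul_mem (u : x.ring).2 (pow_mem w.2 n)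

theorem ord_nonneg {x : CurvePoint k E} {z : E} (h : z ∈ x.ring) :
    0 ≤ x.ord z := by
  by_cases hx : x.IsClosedPoint
  swap
  · exact (ord_of_not_isClosedPoint hx z).ge
  by_cases hz : z = 0
  · simp [hz]
  have := hx.isDiscreteValuationRing
  obtain ⟨w, hw⟩ := hx.exists_irreducible
  obtain ⟨n, u, hu⟩ := IsDiscreteValuationRing.eq_unit_mul_pow_irreducible
    (x := (⟨z, h⟩ : x.ring)) (fun h => hz (congrArg Subtype.val h)) hw
  have h1 := congrArg Subtype.val hu
  push_cast at h1
  have : x.ord z = n := ValuationSubring.ord_eq hw u (by simpa using h1)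
  omega

theorem mem_ring_iff {x : CurvePoint k E} (hx : x.IsClosedPoint) {z : E} :
    z ∈ x.ring ↔ 0 ≤ x.ord z :=
  ⟨ord_nonneg, mem_ring_of_ord_nonneg hx⟩

/-- A point whose local ring is contained in the one of a closed point is equal to it. -/
theorem eq_of_le {x y : CurvePoint k E} (h : x.ring ≤ y.ring) (hy : y.IsClosedPoint) : x = y := by
  have hx : x.IsClosedPoint := fun h0 => hy (top_le_iff.1 (h0 ▸ h))
  refine CurvePoint.ext (le_antisymm h fun z hz => ?_)
  by_contra hzx
  have hz0 : z ≠ 0 := fun h0 => hzx (h0 ▸ zero_mem _)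
  rw [mem_ring_iff hx, not_le] at hzx
  apply hy
  rw [eq_top_iff]
  intro v _
  by_cases hv : v = 0
  · exact hv ▸ zero_mem _
  -- As `z` has a pole at `x`, the quotient `v / z ^ n` is regular at `x` for large `n`; the
  -- exponent `|ord v|` is enough. Then `v` lies in the ring of `y`, which would be all of `E`.
  obtain ⟨n, hn⟩ : ∃ n : ℕ, 0 ≤ x.ord v - n * x.ord z := by
    refine ⟨(x.ord v).natAbs, ?_⟩
    have : (|x.ord v|) * x.ord z ≤ -|x.ord v| := by nlinarith [abs_nonneg (x.ord v)]
    have h3 := neg_abs_le (x.ord v)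
    rw [Int.natCast_natAbs]
    linarith
  have h1 : v * (z ^ n)⁻¹ ∈ x.ring := by
    rw [mem_ring_iff hx, ord_mul _ hv (inv_ne_zero (pow_ne_zero n hz0)), ord_inv,
      ord_pow _ hz0]
    linarith
  have h2 := mul_mem (h h1) (pow_mem hz n)
  rwa [inv_mul_cancel_right₀ (pow_ne_zero n hz0)] at h2

/-- The group homomorphisms `E^* → ℤ` which vanish on units of the local ring are the multiples of
the order of vanishing. -/
theorem IsClosedPoint.eq_mul_ord {x : CurvePoint k E} (hx : x.IsClosedPoint) (f : E → ℤ)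
    (hmul : ∀ z z', z ≠ 0 → z' ≠ 0 → f (z * z') = f z + f z')
    (hunit : ∀ z, z ≠ 0 → z ∈ x.ring → z⁻¹ ∈ x.ring → f z = 0) {w : x.ring} (hw : Irreducible w)
    {z : E} (hz : z ≠ 0) : f z = f w * x.ord z := by
  have hw0 : (w : E) ≠ 0 := by exact_mod_cast hw.ne_zero
  have hpow : ∀ n : ℕ, f ((w : E) ^ n) = f w * n := by
    intro n
    induction n with
    | zero => simpa using hunit 1 one_ne_zero (one_mem _) (by simp [one_mem])
    | succ n ih =>
      rw [pow_succ, hmul _ _ (pow_ne_zero n hw0) hw0, ih]; push_cast; ring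
  have hzpow : ∀ n : ℤ, f ((w : E) ^ n) = f w * n := by
    intro n
    obtain ⟨m, rfl | rfl⟩ := n.eq_nat_or_neg
    · simpa using hpow m
    · have h1 := hmul ((w : E) ^ m) (((w : E) ^ m)⁻¹) (pow_ne_zero m hw0)
        (inv_ne_zero (pow_ne_zero m hw0))
      rw [mul_inv_cancel₀ (pow_ne_zero m hw0), hpow,
        hunit 1 one_ne_zero (one_mem _) (by simp [one_mem])] at h1
      rw [zpow_neg, zpow_natCast]
      linarith
  obtain ⟨u, hu⟩ := hx.eq_unit_mul_zpow_ord hw hz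
  conv_lhs => rw [hu]
  have hu0 : ((u : x.ring) : E) ≠ 0 := by exact_mod_cast u.ne_zero
  have hinv : ((u : x.ring) : E)⁻¹ ∈ x.ring := by
    have : (((u⁻¹ : x.ringˣ) : x.ring) : E) * ((u : x.ring) : E) = 1 := by
      exact_mod_cast congrArg Subtype.val u.inv_mul
    rw [← eq_inv_of_mul_eq_one_left this]
    exact Subtype.prop _
  rw [hmul _ _ hu0 (zpow_ne_zero _ hw0), hzpow, hunit _ hu0 (u : x.ring).2 hinv, zero_add]

end CurvePoint

/-- A rational function without poles on the curve is constant. -/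
theorem mem_range_algebraMap_of_forall_mem [IsCurveFunctionField k E] {z : E}
    (h : ∀ x : CurvePoint k E, z ∈ x.ring) : z ∈ (algebraMap k E).range := by
  apply IsCurveFunctionField.algebraic_mem
  apply IsIntegral.isAlgebraic
  -- The intersection of all valuation rings containing the constants is their integral closure in
  -- `E`, and the constants are algebraically closed in `E`.
  have h1 := iInf_valuationSubring_superset (K := E) (s := Set.range (algebraMap k E))
  have hz : z ∈ (integralClosure (Subring.closure (Set.range (algebraMap k E))) E).toSubring := by
    rw [← h1, Subring.mem_iInf]
    exact fun V => h ⟨V.1, fun a => V.2 ⟨a, rfl⟩⟩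
  obtain ⟨p, hp, hpz⟩ := hz
  have hle : Subring.closure (Set.range (algebraMap k E)) ≤ (algebraMap k E).range :=
    (Subring.closure_le).2 (by simp)
  let e : k ≃+* (algebraMap k E).range := RingEquiv.ofBijective (algebraMap k E).rangeRestrict
    ⟨(algebraMap k E).injective.codRestrict _, (algebraMap k E).rangeRestrict_surjective⟩
  have he : ∀ y, algebraMap k E (e.symm y) = y := fun y =>
    congrArg Subtype.val (e.apply_symm_apply y)
  refine ⟨p.map ((e.symm : (algebraMap k E).range →+* k).comp (Subring.inclusion hle)),
    hp.map _, ?_⟩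
  rw [Polynomial.eval₂_map, ← hpz]
  congr 1
  ext y
  exact he _

end Order

/-! ### Dimensions over the field of constants -/

universe v w

theorem _root_.Cardinal.sum_eq_of_forall_ne {ι : Type v} (f : ι → Cardinal.{max u v}) (a : ι)
    (h : ∀ i, i ≠ a → f i = 0) : Cardinal.sum f = f a := by
  have e : (f a).out ≃ Σ i, (f i).out := by
    refine Equiv.ofBijective (fun x => ⟨a, x⟩) ⟨fun x y h => by simpa using h, ?_⟩
    rintro ⟨i, x⟩
    by_cases hi : i = a
    · subst hi
      exact ⟨x, rfl⟩
    · have hx := Cardinal.mk_eq_zero_iff.1 ((f i).mk_out.trans (h i hi))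
      exact hx.elim x
  exact (Cardinal.mk_congr e).symm.trans (f a).mk_out

theorem _root_.Cardinal.sum_eq_finset_sum {ι : Type v} (f : ι → Cardinal.{max u v}) (s : Finset ι)
    (h : ∀ i ∉ s, f i = 0) : Cardinal.sum f = ∑ i ∈ s, f i := by
  classical
  induction s using Finset.induction_on generalizing f with
  | empty =>
    have : f = fun _ => 0 := funext fun i => h i (Finset.notMem_empty i)
    rw [this, Finset.sum_empty, Cardinal.sum_const]
    simp
  | insert a s ha ih =>
    have h1 : f = Pi.single a (f a) + Function.update f a 0 := by
      funext i
      by_cases hi : i = a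
      · subst hi; simp
      · rw [Pi.add_apply, Pi.single_eq_of_ne hi, Function.update_of_ne hi, zero_add]
    conv_lhs => rw [h1]
    rw [Cardinal.sum_add_distrib, Cardinal.sum_eq_of_forall_ne _ a (fun i hi => Pi.single_eq_of_ne hi _),
      ih (Function.update f a 0), Finset.sum_insert ha, Pi.single_eq_same]
    · congr 1
      refine Finset.sum_congr rfl fun i hi => ?_
      rw [Function.update_of_ne]
      rintro rfl
      exact ha hi
    · intro i hi
      by_cases hia : i = a
      · subst hia; simp
      · rw [Function.update_of_ne hia]
        exact h i (by simp [hia, hi])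

section RelRank

variable (k : Type v) [Field k] (O : Type w) [CommRing O] [Algebra k O]

/-- The dimension over `k` of a module over a `k`-algebra. -/
def relRank (M : Type*) [AddCommGroup M] [Module O M] : Cardinal :=
  letI := Module.compHom M (algebraMap k O)
  Module.rank k M

variable {k O}

theorem relRank_congr {M N : Type u} [AddCommGroup M] [Module O M] [AddCommGroup N] [Module O N]
    (e : M ≃ₗ[O] N) : relRank k O M = relRank k O N := by
  let := Module.compHom M (algebraMap k O)
  let := Module.compHom N (algebraMap k O)
  exact LinearEquiv.rank_eq (R := k)
    { e with map_smul' := fun a m => e.map_smul (algebraMap k O a) m }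

theorem relRank_eq_zero_of_subsingleton {M : Type*} [AddCommGroup M] [Module O M]
    [Subsingleton M] : relRank k O M = 0 := by
  let := Module.compHom M (algebraMap k O)
  exact rank_subsingleton' k M

theorem relRank_eq_zero_iff {M : Type*} [AddCommGroup M] [Module O M] :
    relRank k O M = 0 ↔ Subsingleton M := by
  let := Module.compHom M (algebraMap k O)
  exact rank_zero_iff

theorem relRank_add {M N P : Type u} [AddCommGroup M] [Module O M] [AddCommGroup N] [Module O N]
    [AddCommGroup P] [Module O P] (f : M →ₗ[O] N) (g : N →ₗ[O] P) (hf : Function.Injective f)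
    (hg : Function.Surjective g) (hfg : Function.Exact f g) :
    relRank k O N = relRank k O M + relRank k O P := by
  let := Module.compHom M (algebraMap k O)
  let := Module.compHom N (algebraMap k O)
  let := Module.compHom P (algebraMap k O)
  let f' : M →ₗ[k] N := { f with map_smul' := fun a m => f.map_smul (algebraMap k O a) m }
  let g' : N →ₗ[k] P := { g with map_smul' := fun a m => g.map_smul (algebraMap k O a) m }
  have h1 := LinearMap.rank_range_add_rank_ker g'
  have h2 : LinearMap.range f' = LinearMap.ker g' := by
    ext n
    exact ((hfg n).symm)
  rw [← h2, rank_range_of_injective f' hf, rank_range_of_surjective g' hg] at h1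
  change Module.rank k N = Module.rank k M + Module.rank k P
  rw [← h1, add_comm]

theorem relRank_pi {ι : Type} [Fintype ι] (M : ι → Type u) [∀ i, AddCommGroup (M i)]
    [∀ i, Module O (M i)] : relRank k O (∀ i, M i) = ∑ i, relRank k O (M i) := by
  let : ∀ i, Module k (M i) := fun i => Module.compHom (M i) (algebraMap k O)
  exact (rank_pi (R := k) (η := ι) (φ := M)).trans 
    (Cardinal.sum_eq_finset_sum.{u, 0} _ Finset.univ fun i hi => (hi (Finset.mem_univ i)).elim)

/-- This is additivity along `0 → O/b → O/ab → O/a → 0`, where the first map is multiplication by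
`a`. -/
theorem relRank_quotient_span_mul {O : Type u} [CommRing O] [IsDomain O] [Algebra k O] {a b : O}
    (ha : a ≠ 0) :
    relRank k O (O ⧸ Ideal.span {a * b}) =
      relRank k O (O ⧸ Ideal.span {b}) + relRank k O (O ⧸ Ideal.span {a}) := by
  have h1 : Ideal.span {b} ≤ Submodule.comap (LinearMap.mulLeft O a) (Ideal.span {a * b}) := by
    rw [Ideal.span_le, Set.singleton_subset_iff]
    exact Ideal.mem_span_singleton_self _
  have h2 : Ideal.span {a * b} ≤ Submodule.comap LinearMap.id (Ideal.span {a}) := by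
    rw [Ideal.span_le, Set.singleton_subset_iff]
    exact Ideal.mul_mem_right _ _ (Ideal.mem_span_singleton_self _)
  refine relRank_add (Submodule.mapQ _ _ (LinearMap.mulLeft O a) h1)
    (Submodule.mapQ _ _ LinearMap.id h2) ?_ ?_ ?_
  · rw [← LinearMap.ker_eq_bot, LinearMap.ker_eq_bot']
    intro m
    obtain ⟨m, rfl⟩ := Submodule.Quotient.mk_surjective _ m
    rw [Submodule.mapQ_apply, Submodule.Quotient.mk_eq_zero, Submodule.Quotient.mk_eq_zero,
      LinearMap.mulLeft_apply, Ideal.mem_span_singleton, Ideal.mem_span_singleton]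
    exact (mul_dvd_mul_iff_left ha).1
  · intro m
    obtain ⟨m, rfl⟩ := Submodule.Quotient.mk_surjective _ m
    exact ⟨Submodule.Quotient.mk m, rfl⟩
  · intro m
    obtain ⟨m, rfl⟩ := Submodule.Quotient.mk_surjective _ m
    rw [Submodule.mapQ_apply, Submodule.Quotient.mk_eq_zero, LinearMap.id_apply,
      Ideal.mem_span_singleton]
    constructor
    · rintro ⟨c, rfl⟩
      exact ⟨Submodule.Quotient.mk c, rfl⟩
    · rintro ⟨c, hc⟩
      obtain ⟨c, rfl⟩ := Submodule.Quotient.mk_surjective _ c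
      rw [Submodule.mapQ_apply, LinearMap.mulLeft_apply, Submodule.Quotient.eq,
        Ideal.mem_span_singleton] at hc
      obtain ⟨d, hd⟩ := hc
      exact ⟨c - b * d, by linear_combination -hd⟩

end RelRank

/-! ### Degrees of closed points -/

section Degree

variable {k : Type u} {E : Type u} [Field k] [Field E] [Algebra k E]

/-- The degree of a point over the field of constants. -/
def CurvePoint.deg (x : CurvePoint k E) : ℕ :=
  Module.finrank k (IsLocalRing.ResidueField x.ring)

variable [IsCurveFunctionField k E]

theorem CurvePoint.IsClosedPoint.deg_pos {x : CurvePoint k E} (hx : x.IsClosedPoint) :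
    0 < x.deg := by
  have := hx.finite_residueField
  exact Module.finrank_pos

/-- Up to a unit `a` is a power of a uniformizer, and each factor of the filtration by powers
contributes one copy of the residue field. -/
theorem CurvePoint.relRank_quotient_span {x : CurvePoint k E} (hx : x.IsClosedPoint) {a : x.ring}
    (ha : a ≠ 0) : relRank k x.ring (x.ring ⧸ Ideal.span {a}) =
      ((x.deg * (x.ord a).toNat : ℕ) : Cardinal) := by
  have := hx.isDiscreteValuationRing
  have := hx.finite_residueField
  obtain ⟨w, hw⟩ := hx.exists_irreducible
  obtain ⟨n, u, hu⟩ := IsDiscreteValuationRing.eq_unit_mul_pow_irreducible ha hw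
  have h1 := congrArg Subtype.val hu
  push_cast at h1
  have h2 : x.ord a = n := ValuationSubring.ord_eq hw u (by simpa using h1)
  rw [h2, Int.toNat_natCast, hu, Ideal.span_singleton_mul_left_unit u.isUnit]
  clear h2 h1 hu
  induction n with
  | zero =>
    rw [pow_zero, Ideal.span_singleton_one, mul_zero, Nat.cast_zero]
    exact relRank_eq_zero_of_subsingleton
  | succ n ih =>
    have h3 : relRank k x.ring (x.ring ⧸ Ideal.span {w}) = (x.deg : Cardinal) := by
      rw [← hw.maximalIdeal_eq]
      exact (Module.finrank_eq_rank k (IsLocalRing.ResidueField x.ring)).symm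
    rw [pow_succ, relRank_quotient_span_mul (pow_ne_zero n hw.ne_zero), ih, h3]
    push_cast
    ring

end Degree

end

end TauSheaf

namespace TauSheaf

noncomputable section

/-! ### Lattices -/

section Lattices

open Module

variable {E : Type u} [Field E] (O : ValuationSubring E) {V : Type u} [AddCommGroup V] [Module E V]

theorem mem_span_basis_iff {ι : Type*} [Finite ι] (b : Basis ι E V) (v : V) :
    v ∈ Submodule.span O (Set.range b) ↔ ∀ i, b.repr v i ∈ O := by
  have := Fintype.ofFinite ι
  rw [Submodule.mem_span_range_iff_exists_fun]
  constructor
  · rintro ⟨c, rfl⟩ i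
    have : ∀ j, c j • b j = (c j : E) • b j := fun j => rfl
    simp only [this, b.repr_sum_self]
    exact (c i).2
  · intro h
    exact ⟨fun i => ⟨b.repr v i, h i⟩, b.sum_repr v⟩

/-- The basis over the valuation ring of the lattice generated by a basis. -/
def latticeBasis {ι : Type*} (b : Basis ι E V) :
    Basis ι O (Submodule.span O (Set.range b)) :=
  Basis.span (b.linearIndependent.restrict_scalars (R := O) (fun _ _ h => by
    simpa [Algebra.smul_def] using h))

theorem latticeBasis_apply {ι : Type*} (b : Basis ι E V) (i : ι) :
    (latticeBasis O b i : V) = b i := by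
  simp [latticeBasis, Basis.span_apply]

variable {O}

theorem exists_basis_of_lattice {N : Submodule O V} (hN : Submodule.span E (N : Set V) = ⊤)
    {ι : Type*} (c : Basis ι O N) :
    ∃ b : Basis ι E V, (∀ i, b i = c i) ∧ Submodule.span O (Set.range b) = N := by
  have hli : LinearIndependent O (fun i => (c i : V)) :=
    c.linearIndependent.map' N.subtype N.ker_subtype
  have hspan : Submodule.span O (Set.range fun i => (c i : V)) = N := by
    have := congrArg (Submodule.map N.subtype) c.span_eq
    rw [Submodule.map_span, Submodule.map_top, Submodule.range_subtype, ← Set.range_comp] at this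
    exact this
  let b : Basis _ E V := Basis.mk ((LinearIndependent.iff_fractionRing O E).1 hli) (by
    rw [← hN, Submodule.span_le]
    intro v hv
    have h1 : v ∈ Submodule.span O (Set.range fun i => (c i : V)) := by
      rw [hspan]
      exact hv
    exact Submodule.span_le_restrictScalars O E _ h1)
  refine ⟨b, fun i => Basis.mk_apply _ _ i, ?_⟩
  rw [Basis.coe_mk, hspan]

/-- A finitely generated torsion-free module over a principal ideal domain is free, and a basis of a
lattice that spans `V` is a basis of `V`. -/
theorem exists_basis_span_eq [IsPrincipalIdealRing O] {ι : Type*} [Finite ι] (w : ι → V)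
    (hw : Submodule.span E (Set.range w) = ⊤) :
    ∃ b : Basis (Fin (finrank E V)) E V,
      Submodule.span O (Set.range w) = Submodule.span O (Set.range b) := by
  have : Module.Finite E V := ⟨(Submodule.fg_def).2 ⟨_, Set.finite_range w, hw⟩⟩
  let N := Submodule.span O (Set.range w)
  have : Module.Finite O N := Module.Finite.iff_fg.2 ((Submodule.fg_def).2
    ⟨_, Set.finite_range w, rfl⟩)
  have : IsTorsionFree O V := .trans_faithfulSMul O E V
  have : Module.Free O N := Module.free_iff_isTorsionFree.2 inferInstance
  have hN : Submodule.span E (N : Set V) = ⊤ :=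
    top_le_iff.1 (hw ▸ Submodule.span_mono Submodule.subset_span)
  obtain ⟨b, -, hb⟩ := exists_basis_of_lattice hN (Module.Free.chooseBasis O N)
  refine ⟨b.reindex (Fintype.equivFinOfCardEq (finrank_eq_card_basis b).symm), ?_⟩
  rw [Basis.range_reindex, hb]

theorem det_mem {ι : Type*} [Fintype ι] [DecidableEq ι] (b : Basis ι E V) (v : ι → V)
    (h : ∀ i, v i ∈ Submodule.span O (Set.range b)) : b.det v ∈ O := by
  rw [Basis.det_apply, Matrix.det_apply]
  refine sum_mem fun p _ => ?_
  have : ∏ i, b.toMatrix v (p i) i ∈ O :=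
    prod_mem fun i _ => (mem_span_basis_iff O b (v i)).1 (h i) _
  rcases Int.units_eq_one_or (Equiv.Perm.sign p) with hp | hp
  · simpa [hp] using this
  · simpa [hp] using neg_mem this

theorem det_basis_mul_det {ι : Type*} [Fintype ι] [DecidableEq ι] (b b' : Basis ι E V)
    (v : ι → V) : b.det b' * b'.det v = b.det v := by
  rw [Basis.det_apply, Basis.det_apply, Basis.det_apply, ← Matrix.det_mul,
    Basis.toMatrix_mul_toMatrix]

theorem det_basis_ne_zero {ι : Type*} [Fintype ι] [DecidableEq ι] (b b' : Basis ι E V) :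
    b.det b' ≠ 0 := (b.isUnit_det b').ne_zero

theorem det_basis_inv {ι : Type*} [Fintype ι] [DecidableEq ι] (b b' : Basis ι E V) :
    (b.det b')⁻¹ = b'.det b := by
  rw [inv_eq_iff_eq_inv]
  exact eq_inv_of_mul_eq_one_left (by rw [det_basis_mul_det, Basis.det_self])

end Lattices

/-! ### Indices of lattices and determinants -/

section Index

open Module

variable {k E : Type u} [Field k] [Field E] [Algebra k E] [IsCurveFunctionField k E]
  {V : Type u} [AddCommGroup V] [Module E V]

/-- The two change of basis determinants are inverse to each other and both lie in the local ring.
-/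
theorem CurvePoint.ord_det_eq_zero (x : CurvePoint k E) {ι : Type*} [Fintype ι] [DecidableEq ι]
    {b b' : Basis ι E V}
    (h : Submodule.span x.ring (Set.range b) = Submodule.span x.ring (Set.range b')) :
    x.ord (b.det b') = 0 := by
  refine x.ord_eq_zero (det_mem b b' fun i => ?_) ?_
  · rw [h]; exact Submodule.subset_span ⟨i, rfl⟩
  · rw [det_basis_inv]
    refine det_mem b' b fun i => ?_
    rw [← h]; exact Submodule.subset_span ⟨i, rfl⟩

theorem CurvePoint.ord_det_trans (x : CurvePoint k E) {ι : Type*} [Fintype ι] [DecidableEq ι]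
    (b b' b'' : Basis ι E V) :
    x.ord (b.det b'') = x.ord (b.det b') + x.ord (b'.det b'') := by
  rw [← x.ord_mul (det_basis_ne_zero b b') (det_basis_ne_zero b' b''), det_basis_mul_det]

/-- The index of two lattices is given by the valuation of the determinant. -/
theorem CurvePoint.relRank_span_quotient (x : CurvePoint k E) {n : ℕ}
    (b b' : Basis (Fin n) E V)
    (h : Submodule.span x.ring (Set.range b') ≤ Submodule.span x.ring (Set.range b)) :
    relRank k x.ring (Submodule.span x.ring (Set.range b) ⧸
      (Submodule.span x.ring (Set.range b')).submoduleOf (Submodule.span x.ring (Set.range b))) =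
      ((x.deg * (x.ord (b.det b')).toNat : ℕ) : Cardinal) := by
  -- At the generic point both lattices are all of `V`, and the order is zero by convention.
  by_cases hx : x.IsClosedPoint
  swap
  · have hx' : x.ring = ⊤ := not_not.1 hx
    have h1 : Submodule.span x.ring (Set.range b') = ⊤ := by
      rw [eq_top_iff]
      intro v _
      rw [mem_span_basis_iff]
      exact fun i => hx'.ge (show _ ∈ (⊤ : ValuationSubring E) from trivial)
    have h2 : (Submodule.span x.ring (Set.range b')).submoduleOf
        (Submodule.span x.ring (Set.range b)) = ⊤ := by
      rw [Submodule.submoduleOf_eq_top, h1]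
      exact le_top
    rw [ord_of_not_isClosedPoint hx, h2]
    have : Subsingleton (Submodule.span x.ring (Set.range b) ⧸
      (⊤ : Submodule x.ring (Submodule.span x.ring (Set.range b)))) :=
        Submodule.Quotient.subsingleton_iff.2 rfl
    simpa using relRank_eq_zero_of_subsingleton
  set N := Submodule.span x.ring (Set.range b) with hN
  set N' := Submodule.span x.ring (Set.range b') with hN'
  let c := latticeBasis x.ring b
  let c' : Basis (Fin n) x.ring (N'.submoduleOf N) :=
    (latticeBasis x.ring b').map (Submodule.submoduleOfEquivOfLe h).symm
  have hc' : ∀ i, ((c' i : N) : V) = b' i := fun i => latticeBasis_apply x.ring b' i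
  have hrank : finrank x.ring (N'.submoduleOf N) = finrank x.ring N := by
    rw [finrank_eq_card_basis c, finrank_eq_card_basis c']
  -- By Smith normal form there is a basis `T` of the larger lattice such that the `a i • T i` are a
  -- basis of the smaller one. The quotient is then the sum of the `O/a i`, and the determinant is
  -- `∏ a i` up to units.
  let a := Submodule.smithNormalFormCoeffs c hrank
  let t := Submodule.smithNormalFormTopBasis c hrank
  let s := Submodule.smithNormalFormBotBasis c hrank
  have hst : ∀ i, ((s i : N) : V) = (a i : E) • ((t i : N) : V) := fun i =>
    congrArg Subtype.val (Submodule.smithNormalFormBotBasis_def c hrank i)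
  have ha : ∀ i, a i ≠ 0 := Submodule.smithNormalFormCoeffs_ne_zero c hrank
  have ha' : ∀ i, (a i : E) ≠ 0 := fun i => by exact_mod_cast ha i
  have hNtop : Submodule.span E (N : Set V) = ⊤ :=
    top_le_iff.1 (b.span_eq ▸ Submodule.span_mono Submodule.subset_span)
  have hN'top : Submodule.span E (N' : Set V) = ⊤ :=
    top_le_iff.1 (b'.span_eq ▸ Submodule.span_mono Submodule.subset_span)
  obtain ⟨T, hT, hTN⟩ := exists_basis_of_lattice hNtop t
  obtain ⟨S, hS, hSN⟩ := exists_basis_of_lattice hN'top (s.map (Submodule.submoduleOfEquivOfLe h))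
  have hS' : (S : Fin n → V) = fun i => (a i : E) • T i := by
    funext i
    rw [hS, hT]
    exact hst i
  have hdet : T.det S = ∏ i, (a i : E) := by
    rw [hS', T.det.map_smul_univ, Basis.det_self, smul_eq_mul, mul_one]
  have hord : x.ord (b.det b') = ∑ i, x.ord (a i : E) := by
    rw [x.ord_det_trans b T b', x.ord_det_trans T S b', x.ord_det_eq_zero hTN.symm,
      x.ord_det_eq_zero hSN, hdet, x.ord_prod _ _ (fun i _ => ha' i)]
    ring
  rw [relRank_congr (Submodule.quotientEquivPiSpan _ c hrank), relRank_pi,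
    Finset.sum_congr rfl fun i _ => relRank_quotient_span hx (ha i), hord, ← Nat.cast_sum,
    ← Finset.mul_sum]
  congr 2
  zify
  rw [Int.toNat_of_nonneg (Finset.sum_nonneg fun i _ => ord_nonneg (a i).2)]
  exact Finset.sum_congr rfl fun i _ => Int.toNat_of_nonneg (ord_nonneg (a i).2)

end Index

end

end TauSheaf

namespace TauSheaf

noncomputable section

/-! ### Images of vector bundles -/

section ImageBundle

open Module

theorem cokerDim_eq_sum {L K : Type u} [Field L] [Field K] [Algebra L K] {V : Type u}
    [AddCommGroup V] [Module K V] (N N' : ∀ P : CurvePoint L K, Submodule P.ring V) :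
    cokerDim N N' =
      Cardinal.sum fun P => relRank L P.ring (N' P ⧸ (N P).submoduleOf (N' P)) := by
  let : ∀ P : CurvePoint L K, Module L (N' P ⧸ (N P).submoduleOf (N' P)) :=
    fun P => Module.compHom _ (algebraMap L P.ring)
  have : ∀ P : CurvePoint L K, Module.Free L (N' P ⧸ (N P).submoduleOf (N' P)) :=
    fun P => Module.Free.of_divisionRing L _
  exact rank_directSum (R := L) (fun P : CurvePoint L K => N' P ⧸ (N P).submoduleOf (N' P))

theorem relRank_quotient_eq_zero_of_le {k O V : Type*} [Field k] [CommRing O] [Algebra k O]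
    [AddCommGroup V] [Module O V] {N N' : Submodule O V} (h : N' ≤ N) :
    relRank k O (N' ⧸ N.submoduleOf N') = 0 := by
  rw [relRank_eq_zero_iff, Submodule.Quotient.subsingleton_iff, Submodule.submoduleOf_eq_top]
  exact h

/-- A finitely generated module of dimension at most `d` over a local ring is annihilated by the
`d`-th power of the maximal ideal. -/
theorem maximalIdeal_pow_smul_eq_bot {k O : Type u} [Field k] [CommRing O] [IsLocalRing O]
    [IsNoetherianRing O] [Algebra k O] (d : ℕ) (M : Type u) [AddCommGroup M] [Module O M]
    [Module.Finite O M] (h : relRank k O M ≤ d) :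
    IsLocalRing.maximalIdeal O ^ d • (⊤ : Submodule O M) = ⊥ := by
  induction d generalizing M with
  | zero =>
    have : Subsingleton M := relRank_eq_zero_iff.1 (by simpa using h)
    exact Subsingleton.elim _ _
  | succ d ih =>
    let N : Submodule O M := IsLocalRing.maximalIdeal O • ⊤
    -- If `𝔪M = M`, then `M = 0` by Nakayama. Otherwise `M/𝔪M` uses up at least one dimension and
    -- induction applies to `𝔪M`.
    by_cases hN : N = ⊤
    · have : (⊤ : Submodule O M) = ⊥ :=
        Submodule.eq_bot_of_le_smul_of_le_jacobson_bot (IsLocalRing.maximalIdeal O) ⊤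
          Module.Finite.fg_top hN.ge (IsLocalRing.maximalIdeal_le_jacobson _)
      rw [this, Submodule.smul_bot]
    · have h1 : relRank k O M = relRank k O N + relRank k O (M ⧸ N) :=
        relRank_add N.subtype N.mkQ N.injective_subtype N.mkQ_surjective
          (LinearMap.exact_subtype_mkQ N)
      have h2 : relRank k O (M ⧸ N) ≠ 0 := by
        rw [Ne, relRank_eq_zero_iff, Submodule.Quotient.subsingleton_iff]
        exact hN
      have h3 : relRank k O N ≤ d := by
        rw [h1] at h
        have h4 : relRank k O N + 1 ≤ d + 1 := by
          refine le_trans ?_ (h.trans_eq (by push_cast; rfl))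
          gcongr
          exact Cardinal.one_le_iff_ne_zero.2 h2
        exact (Cardinal.add_le_add_iff_of_lt_aleph0 Cardinal.one_lt_aleph0).1 h4
      have h5 := ih N h3
      have h6 := congrArg (Submodule.map N.subtype) h5
      rw [Submodule.map_smul'', Submodule.map_top, Submodule.range_subtype, Submodule.map_bot]
        at h6
      rw [pow_succ, Submodule.mul_smul]
      exact h6

variable {L K : Type u} [Field L] [Field K] [Algebra L K]

/-- The submodule generated by the images of a lattice under several linear maps. -/
def imageSub {V V' : Type u} [AddCommGroup V] [Module K V] [AddCommGroup V'] [Module K V']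
    {ι : Type*} (g : ι → V →ₗ[K] V') (P : CurvePoint L K) (N : Submodule P.ring V) :
    Submodule P.ring V' :=
  ⨆ j, N.map ((g j).restrictScalars P.ring)

section

variable {V V' : Type u} [AddCommGroup V] [Module K V] [AddCommGroup V'] [Module K V'] {ι : Type*}
  (g : ι → V →ₗ[K] V') {P : CurvePoint L K}

theorem mem_imageSub {N : Submodule P.ring V} {v : V} (hv : v ∈ N) (j : ι) :
    g j v ∈ imageSub g P N :=
  Submodule.mem_iSup_of_mem j (Submodule.mem_map_of_mem (f := (g j).restrictScalars P.ring) hv)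

theorem imageSub_le {N : Submodule P.ring V} {N' : Submodule P.ring V'} :
    imageSub g P N ≤ N' ↔ ∀ j, ∀ v ∈ N, g j v ∈ N' := by
  rw [imageSub, iSup_le_iff]
  refine forall_congr' fun j => ?_
  rw [Submodule.map_le_iff_le_comap]
  rfl

theorem imageSub_mono {N N' : Submodule P.ring V} (h : N ≤ N') :
    imageSub g P N ≤ imageSub g P N' :=
  (imageSub_le g).2 fun j _ hv => mem_imageSub g (h hv) j

theorem imageSub_smul (I : Ideal P.ring) (N : Submodule P.ring V) :
    imageSub g P (I • N) = I • imageSub g P N := by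
  rw [imageSub, imageSub, Submodule.smul_iSup]
  exact iSup_congr fun j => Submodule.map_smul'' _ _ _

theorem imageSub_span {κ : Type*} (b : κ → V) :
    imageSub g P (Submodule.span P.ring (Set.range b)) =
      Submodule.span P.ring (Set.range fun p : ι × κ => g p.1 (b p.2)) := by
  apply le_antisymm
  · rw [imageSub_le]
    intro j v hv
    have h1 : g j v ∈ (Submodule.span P.ring (Set.range b)).map ((g j).restrictScalars P.ring) :=
      ⟨v, hv, rfl⟩
    rw [Submodule.map_span, ← Set.range_comp] at h1
    refine Submodule.span_mono ?_ h1
    rintro _ ⟨i, rfl⟩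
    exact ⟨(j, i), rfl⟩
  · rw [Submodule.span_le]
    rintro _ ⟨⟨j, i⟩, rfl⟩
    exact mem_imageSub g (Submodule.subset_span (Set.mem_range_self i)) j

variable [IsCurveFunctionField L K]

/-- The finitely many coefficients expressing `w'` by `w` have finitely many poles. -/
theorem finite_not_span_le {κ κ' : Type*} [Finite κ] [Finite κ'] (w : κ → V) (w' : κ' → V)
    (h : ∀ j, w' j ∈ Submodule.span K (Set.range w)) :
    {P : CurvePoint L K | ¬ Submodule.span P.ring (Set.range w') ≤
      Submodule.span P.ring (Set.range w)}.Finite := by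
  have := Fintype.ofFinite κ
  simp only [Submodule.mem_span_range_iff_exists_fun] at h
  choose a ha using h
  refine (Set.finite_iUnion fun p : κ' × κ => finite_poles (k := L) (a p.1 p.2)).subset ?_
  intro P hP
  by_contra hP'
  simp only [Set.mem_iUnion, Set.mem_ofPred_eq, not_exists, not_not] at hP'
  apply hP
  rw [Submodule.span_le]
  rintro _ ⟨j, rfl⟩
  rw [← ha j]
  exact sum_mem fun i _ => Submodule.smul_mem _ (⟨a j i, hP' (j, i)⟩ : P.ring)
    (Submodule.subset_span ⟨i, rfl⟩)

theorem finite_span_ne {κ κ' : Type*} [Finite κ] [Finite κ'] (w : κ → V) (w' : κ' → V)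
    (h : Submodule.span K (Set.range w) = ⊤) (h' : Submodule.span K (Set.range w') = ⊤) :
    {P : CurvePoint L K | Submodule.span P.ring (Set.range w) ≠
      Submodule.span P.ring (Set.range w')}.Finite := by
  refine ((finite_not_span_le (L := L) w w' fun j => h ▸ trivial).union
    (finite_not_span_le (L := L) w' w fun j => h' ▸ trivial)).subset ?_
  intro P hP
  by_contra hP'
  simp only [Set.mem_union, Set.mem_ofPred_eq, not_or, not_not] at hP'
  exact hP (le_antisymm hP'.2 hP'.1)

theorem finite_ne_of_eq_span [Module.Finite K V] (N N' : ∀ P : CurvePoint L K, Submodule P.ring V)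
    {κ κ' : Type*} [Finite κ] [Finite κ'] {w : κ → V} {w' : κ' → V}
    (h : Submodule.span K (Set.range w) = ⊤) (h' : Submodule.span K (Set.range w') = ⊤)
    (hN : {P | N P ≠ Submodule.span P.ring (Set.range w)}.Finite)
    (hN' : {P | N' P ≠ Submodule.span P.ring (Set.range w')}.Finite) :
    {P | N P ≠ N' P}.Finite := by
  refine ((hN.union hN').union (finite_span_ne (L := L) w w' h h')).subset fun P hP => ?_
  by_contra hP'
  simp only [Set.mem_union, Set.mem_ofPred_eq, not_or, not_not] at hP'
  exact hP (by rw [hP'.1.1, hP'.1.2, hP'.2])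

/-- A vector bundle given by stalks which are generated by a finite generating system, the same
one outside of finitely many points. -/
abbrev VectorBundle.ofFamilies (V : Type u) [AddCommGroup V] [Module K V] [FiniteDimensional K V]
    (N : ∀ P : CurvePoint L K, Submodule P.ring V) (κ : Type) [Finite κ]
    (h : ∀ P, ∃ w : κ → V, Submodule.span K (Set.range w) = ⊤ ∧
      N P = Submodule.span P.ring (Set.range w) ∧
      {P' | N P' ≠ Submodule.span P'.ring (Set.range w)}.Finite) : VectorBundle L K where
  fiber := V
  stalk := N
  locallyFree P := by
    obtain ⟨w, hw, hP, hfin⟩ := h P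
    obtain ⟨b, hb⟩ := exists_basis_span_eq (O := P.ring) w hw
    refine ⟨b, hP.trans hb, ?_⟩
    exact finite_ne_of_eq_span N (fun P => Submodule.span P.ring (Set.range b)) hw b.span_eq hfin
      (by simp)

theorem span_imageSub_top {κ : Type*} (b : κ → V) (hb : Submodule.span K (Set.range b) = ⊤)
    (hg : ⨆ j, LinearMap.range (g j) = ⊤) :
    Submodule.span K (Set.range fun p : ι × κ => g p.1 (b p.2)) = ⊤ := by
  rw [← hg, eq_comm]
  apply le_antisymm
  · refine iSup_le fun j => ?_
    rw [LinearMap.range_eq_map, ← hb, Submodule.map_span, ← Set.range_comp]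
    refine Submodule.span_mono ?_
    rintro _ ⟨i, rfl⟩
    exact ⟨(j, i), rfl⟩
  · rw [hg]
    exact le_top

end

/-- The image of a vector bundle under several linear maps which are jointly surjective. -/
abbrev VectorBundle.image [IsCurveFunctionField L K] (E : VectorBundle L K) {V' : Type u}
    [AddCommGroup V'] [Module K V'] [FiniteDimensional K V'] {n : ℕ}
    (g : Fin n → E.fiber →ₗ[K] V') (hg : ⨆ j, LinearMap.range (g j) = ⊤) : VectorBundle L K :=
  .ofFamilies V' (fun P => imageSub g P (E.stalk P)) (Fin n × Fin (finrank K E.fiber)) fun P => by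
    obtain ⟨b, hb, hfin⟩ := E.locallyFree P
    refine ⟨fun p => g p.1 (b p.2), span_imageSub_top g b b.span_eq hg, ?_, ?_⟩
    · rw [hb, imageSub_span]
    · refine hfin.subset fun P' hP' h => hP' ?_
      rw [h, imageSub_span]

end ImageBundle

end

end TauSheaf

namespace TauSheaf

noncomputable section

/-! ### Images of abelian `τ`-sheaves -/

section ImageSheaf

open Module

variable {Fq Q L K : Type u} [Field Fq] [Field Q] [Field L] [Field K]
  [Algebra Fq Q] [Algebra Fq L] [Algebra Fq K] [Algebra Q K] [Algebra L K]
  [IsScalarTower Fq Q K] [IsScalarTower Fq L K]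

theorem algebraMap_mem_ring {x : CurvePoint Fq Q} {P : CurvePoint L K} (h : P.proj Fq Q = x) {a : Q}
    (ha : a ∈ x.ring) : algebraMap Q K a ∈ P.ring := by
  subst h
  exact ha

/-- The stalk at `P` of the ideal sheaf of the divisor `n·x`. -/
def twistIdeal (n : ℕ) (x : CurvePoint Fq Q) (P : CurvePoint L K) : Ideal P.ring :=
  Ideal.span {z : P.ring | P.proj Fq Q = x → ∃ a ∈ IsLocalRing.maximalIdeal x.ring ^ n,
    (z : K) = algebraMap Q K a}

/-- In this form the twist is compatible with images under linear maps, since these commute with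
multiplication by ideals. -/
theorem stalkTwistNeg_eq (n : ℕ) (x : CurvePoint Fq Q) (E : VectorBundle L K)
    (P : CurvePoint L K) : stalkTwistNeg n x E P = twistIdeal n x P • E.stalk P := by
  by_cases hP : P.proj Fq Q = x
  · rw [stalkTwistNeg, if_pos hP]
    apply le_antisymm
    · rw [Submodule.span_le]
      rintro _ ⟨a, ha, v, hv, rfl⟩
      exact Submodule.smul_mem_smul (r := (⟨_, algebraMap_mem_ring hP a.2⟩ : P.ring))
        (Ideal.subset_span fun _ => ⟨a, ha, rfl⟩) hv
    · rw [twistIdeal, Ideal.span, Submodule.span_smul_eq, Submodule.set_smul_le_iff]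
      intro z v hz hv
      obtain ⟨a, ha, hza⟩ := hz hP
      exact Submodule.subset_span ⟨a, ha, v, hv, by rw [← hza]; rfl⟩
  -- Away from `x` the condition on the generators is void, so `1` is one of them.
  · have h1 : twistIdeal n x P = ⊤ :=
      (Ideal.eq_top_iff_one _).2 (Ideal.subset_span fun h => (hP h).elim)
    rw [stalkTwistNeg, if_neg hP, h1, Submodule.top_smul]

theorem map_iterateMap {E : ℤ → VectorBundle L K}
    {Pi : ∀ i, (E i).fiber →ₗ[K] (E (i + 1)).fiber} {V : Type u} [AddCommGroup V] [Module K V]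
    (g : ∀ i, (E i).fiber →ₗ[K] V) (hg : ∀ i v, g (i + 1) (Pi i v) = g i v) (i : ℤ) (n : ℕ)
    (v : (E i).fiber) : g (i + n) (iterateMap E Pi i n v) = g i v := by
  have hc : ∀ {i j : ℤ} (h : i = j) (v : (E i).fiber), g j (fiberCast E h v) = g i v := by
    rintro i j rfl v
    rfl
  induction n with
  | zero => exact hc _ v
  | succ n ih =>
    change g _ (fiberCast E _ (Pi (i + n) (iterateMap E Pi i n v))) = _
    rw [hc, hg, ih]

variable [Fintype Fq] [IsBaseChangeFunctionField Fq Q L K]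

/-- Coefficients in the local ring at `σ(P)` are carried by `σ` into the local ring at `P`, so
generators suffice. -/
theorem span_image_sigma {V V' : Type*} [AddCommGroup V] [Module K V] [AddCommGroup V']
    [Module K V'] (f : V →ₛₗ[sigma Fq Q L K] V') (P : CurvePoint L K) (S : Set V) :
    Submodule.span P.ring (f '' (Submodule.span (sigmaPoint Fq Q L P).ring S : Set V)) =
      Submodule.span P.ring (f '' S) := by
  apply le_antisymm
  · rw [Submodule.span_le]
    rintro _ ⟨v, hv, rfl⟩
    induction hv using Submodule.span_induction with
    | mem v hv => exact Submodule.subset_span ⟨v, hv, rfl⟩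
    | zero => rw [map_zero]; exact zero_mem _
    | add v w _ _ hv hw => rw [map_add]; exact add_mem hv hw
    | smul a v _ hv =>
      have h : f (a • v) = sigma Fq Q L K a • f v := f.map_smulₛₗ (a : K) v
      rw [h]
      exact Submodule.smul_mem _ (⟨_, a.2⟩ : P.ring) hv
  · exact Submodule.span_mono (Set.image_mono Submodule.subset_span)

variable {infty : CurvePoint Fq Q} {c : Characteristic Fq Q L}

/-- The `Π`'s are compatible with the maps `g j i` to `V`, and the `τ`'s are compatible with the
semilinear map `φ` on `V`. -/
structure IsImageDatum (F : AbelianTauSheaf K infty c) {V : Type u} [AddCommGroup V] [Module K V]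
    (φ : V →ₛₗ[sigma Fq Q L K] V) {n : ℕ} (g : Fin n → ∀ i, (F.sheaf i).fiber →ₗ[K] V) : Prop where
  Pi : ∀ j i v, g j (i + 1) (F.Pi i v) = g j i v
  tau : ∀ j i v, g j (i + 1) (F.tau i v) = φ (g j i v)
  top : ∀ i, ⨆ j, LinearMap.range (g j i) = ⊤
  linearIndependent : ∀ (n : ℕ) (v : Fin n → V), LinearIndependent K v →
    LinearIndependent K (fun j => φ (v j))

/-- The condition on `F` that the `l`-fold iterate of `Π` identifies `F_i` with
`F_{i+l}(-k·∞)`. -/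
def IsPeriodic (F : AbelianTauSheaf K infty c) (k l : ℕ) : Prop :=
  ∀ (i : ℤ) (P : CurvePoint L K),
    iterateMap F.sheaf F.Pi i l '' ((F.sheaf i).stalk P : Set (F.sheaf i).fiber) =
      (stalkTwistNeg k infty (F.sheaf (i + l)) P : Set (F.sheaf (i + l)).fiber)

namespace IsImageDatum

variable {F : AbelianTauSheaf K infty c} {V : Type u} [AddCommGroup V] [Module K V]
  {φ : V →ₛₗ[sigma Fq Q L K] V} {n : ℕ} {g : Fin n → ∀ i, (F.sheaf i).fiber →ₗ[K] V}

/-- The stalks of the image. -/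
def stalk (_ : IsImageDatum F φ g) (i : ℤ) (P : CurvePoint L K) : Submodule P.ring V :=
  imageSub (fun j => g j i) P ((F.sheaf i).stalk P)

/-- The stalks of the image of `τ` on the image. -/
def tauStalk (h : IsImageDatum F φ g) (i : ℤ) (P : CurvePoint L K) : Submodule P.ring V :=
  Submodule.span P.ring (φ '' h.stalk i (sigmaPoint Fq Q L P))

/-- Since the maps `g` intertwine `τ` and `φ`, generating by `φ` after taking images equals taking
images after generating by `τ`. Properties of the cokernel of `τ` on `F` thereby pass to the image.
-/
theorem tauStalk_eq (h : IsImageDatum F φ g) (i : ℤ) (P : CurvePoint L K) :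
    h.tauStalk i P = imageSub (fun j => g j (i + 1)) P
      (Submodule.span P.ring (F.tau i '' (F.sheaf i).stalk (sigmaPoint Fq Q L P))) := by
  apply le_antisymm
  · rw [tauStalk, Submodule.span_le]
    rintro _ ⟨v, hv, rfl⟩
    refine Submodule.iSup_induction _ (motive := fun v => φ v ∈ imageSub (fun j => g j (i + 1)) P
      (Submodule.span P.ring (F.tau i '' (F.sheaf i).stalk (sigmaPoint Fq Q L P)))) hv ?_ ?_ ?_
    · rintro j _ ⟨w, hw, rfl⟩
      have h1 : φ (g j i w) = g j (i + 1) (F.tau i w) := (h.tau j i w).symm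
      change φ (g j i w) ∈ _
      rw [h1]
      exact mem_imageSub (fun j => g j (i + 1)) (Submodule.subset_span (Set.mem_image_of_mem _ hw)) j
    · rw [map_zero]; exact zero_mem _
    · intro v w hv hw
      rw [map_add]; exact add_mem hv hw
  · rw [imageSub_le]
    intro j v hv
    induction hv using Submodule.span_induction with
    | mem v hv =>
      obtain ⟨w, hw, rfl⟩ := hv
      rw [h.tau]
      exact Submodule.subset_span (Set.mem_image_of_mem _ (mem_imageSub (fun j => g j i) hw j))
    | zero => rw [map_zero]; exact zero_mem _
    | add v w _ _ hv hw => rw [map_add]; exact add_mem hv hw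
    | smul a v _ hv =>
      have h1 : g j (i + 1) (a • v) = a • g j (i + 1) v := (g j (i + 1)).map_smul (a : K) v
      rw [h1]
      exact Submodule.smul_mem _ a hv

theorem tauStalk_le (h : IsImageDatum F φ g) (i : ℤ) (P : CurvePoint L K) :
    h.tauStalk i P ≤ h.stalk (i + 1) P := by
  rw [tauStalk_eq]
  refine imageSub_mono _ (Submodule.span_le.2 ?_)
  rintro _ ⟨v, hv, rfl⟩
  exact F.tau_mem i P v hv

theorem stalk_le (h : IsImageDatum F φ g) (i : ℤ) (P : CurvePoint L K) :
    h.stalk i P ≤ h.stalk (i + 1) P := by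
  refine (imageSub_le _).2 fun j v hv => ?_
  rw [← h.Pi]
  exact mem_imageSub (fun j => g j (i + 1)) (F.Pi_mem i P v hv) j

/-- `τ` is an isomorphism outside of the graph of the characteristic. -/
theorem tauStalk_eq_of_graphIdeal (h : IsImageDatum F φ g) (i : ℤ) {P : CurvePoint L K}
    (hP : graphIdeal c P = ⊤) : h.tauStalk i P = h.stalk (i + 1) P := by
  refine le_antisymm (h.tauStalk_le i P) ?_
  rw [tauStalk_eq]
  refine imageSub_mono _ fun v hv => ?_
  have := F.annihilated i P 1 (by rw [hP, Ideal.top_pow]; trivial) v hv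
  rwa [one_smul] at this

/-- On `V` all `Π`'s have become the identity, and images commute with multiplication by ideals, so
the periodicity of `F` with the same `k` and `l` passes to the image. -/
theorem stalk_eq_smul (h : IsImageDatum F φ g) {k l : ℕ} (hF : IsPeriodic F k l) (i : ℤ)
    (P : CurvePoint L K) : h.stalk i P = twistIdeal k infty P • h.stalk (i + l) P := by
  rw [stalk, stalk, ← imageSub_smul, ← stalkTwistNeg_eq]
  apply le_antisymm
  · refine (imageSub_le _).2 fun j v hv => ?_
    rw [← map_iterateMap (g j) (h.Pi j) i l v]
    refine mem_imageSub (fun j => g j (i + l)) ?_ j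
    have : iterateMap F.sheaf F.Pi i l v ∈
      iterateMap F.sheaf F.Pi i l '' ((F.sheaf i).stalk P : Set (F.sheaf i).fiber) := ⟨v, hv, rfl⟩
    rwa [hF] at this
  · refine (imageSub_le _).2 fun j w hw => ?_
    have hw' : w ∈ (stalkTwistNeg k infty (F.sheaf (i + l)) P : Set (F.sheaf (i + l)).fiber) := hw
    rw [← hF] at hw'
    obtain ⟨v, hv, rfl⟩ := hw'
    rw [map_iterateMap (g j) (h.Pi j) i l v]
    exact mem_imageSub (fun j => g j i) hv j

variable [IsCurveFunctionField L K] [FiniteDimensional K V]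

/-- Off the graph there is no cokernel. On the graph the ideal lies in the maximal ideal, and a
finitely generated cokernel of dimension at most `d` is killed by `𝔪 ^ d`. So the annihilation
condition is automatic once the dimension is right. -/
theorem annihilated (h : IsImageDatum F φ g) {d : ℕ}
    (hd : ∀ i, cokerDim (h.tauStalk i) (h.stalk (i + 1)) = d) (i : ℤ) (P : CurvePoint L K)
    (a : P.ring) (ha : a ∈ graphIdeal c P ^ d) (v : V) (hv : v ∈ h.stalk (i + 1) P) :
    a • v ∈ h.tauStalk i P := by
  by_cases hP : graphIdeal c P = ⊤
  · rw [h.tauStalk_eq_of_graphIdeal i hP]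
    exact Submodule.smul_mem _ a hv
  · have hfin : Module.Finite P.ring (h.stalk (i + 1) P) := by
      obtain ⟨b, hb, -⟩ := (VectorBundle.image (F.sheaf (i + 1)) (fun j => g j (i + 1))
        (h.top (i + 1))).locallyFree P
      rw [Module.Finite.iff_fg, Submodule.fg_def]
      exact ⟨_, Set.finite_range b, hb.symm⟩
    have h1 : relRank L P.ring
        (h.stalk (i + 1) P ⧸ (h.tauStalk i P).submoduleOf (h.stalk (i + 1) P)) ≤ d := by
      rw [← hd i, cokerDim_eq_sum]
      exact Cardinal.le_sum (fun P : CurvePoint L K => relRank L P.ring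
        (h.stalk (i + 1) P ⧸ (h.tauStalk i P).submoduleOf (h.stalk (i + 1) P))) P
    have h2 := maximalIdeal_pow_smul_eq_bot d _ h1
    have h3 : a ∈ IsLocalRing.maximalIdeal P.ring ^ d :=
      Ideal.pow_right_mono (IsLocalRing.le_maximalIdeal hP) d ha
    have h4 := Submodule.smul_mem_smul h3 (Submodule.mem_top
      (x := Submodule.Quotient.mk (p := (h.tauStalk i P).submoduleOf (h.stalk (i + 1) P)) ⟨v, hv⟩))
    rw [h2, Submodule.mem_bot, ← Submodule.Quotient.mk_smul, Submodule.Quotient.mk_eq_zero] at h4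
    exact h4

/-- The bundles of the image. -/
abbrev bundle (h : IsImageDatum F φ g) (i : ℤ) : VectorBundle L K :=
  (F.sheaf i).image (fun j => g j i) (h.top i)

theorem fiberCast_bundle (h : IsImageDatum F φ g) {i j : ℤ} (hij : i = j) (v : V) :
    (fiberCast h.bundle hij (show (h.bundle i).fiber from v) : V) = v := by
  subst hij
  rfl

/-- All bundles of the image share the fibre `V`, so the transports between indices are the
identity. -/
theorem iterateMap_bundle (h : IsImageDatum F φ g) (i : ℤ) (n : ℕ) (v : V) :
    (iterateMap h.bundle (fun _ => (LinearMap.id : V →ₗ[K] V)) i n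
      (show (h.bundle i).fiber from v) : V) = v := by
  induction n with
  | zero => exact h.fiberCast_bundle _ v
  | succ n ih => exact (h.fiberCast_bundle _ _).trans ih

theorem isPeriodic_bundle (h : IsImageDatum F φ g) {k l : ℕ} (hF : IsPeriodic F k l) (i : ℤ)
    (P : CurvePoint L K) :
    iterateMap h.bundle (fun _ => (LinearMap.id : V →ₗ[K] V)) i l ''
      ((h.bundle i).stalk P : Set (h.bundle i).fiber) =
      (stalkTwistNeg k infty (h.bundle (i + l)) P : Set (h.bundle (i + l)).fiber) := by
  rw [stalkTwistNeg_eq]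
  refine Eq.trans ?_ (congrArg (fun N : Submodule P.ring V => (N : Set V)) (h.stalk_eq_smul hF i P))
  exact (Set.image_congr fun v _ => h.iterateMap_bundle i l v).trans (Set.image_id' _)

omit [IsCurveFunctionField L K] [FiniteDimensional K V] in
theorem cokerDim_id (h : IsImageDatum F φ g) (i : ℤ) :
    cokerDim (fun P => Submodule.span P.ring
      ((LinearMap.id : V →ₗ[K] V) '' ((h.stalk i P : Submodule P.ring V) : Set V)))
      (h.stalk (i + 1)) = cokerDim (h.stalk i) (h.stalk (i + 1)) := by
  congr 1
  funext P
  exact (congrArg _ (Set.image_id' _)).trans (Submodule.span_eq (h.stalk i P))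

/-- The image of an abelian `τ`-sheaf, provided that it has the right invariants. -/
def sheaf (h : IsImageDatum F φ g) {k l d : ℕ} (hk : 0 < k) (hl : 0 < l) (hF : IsPeriodic F k l)
    (hd : l * d = k * finrank K V) (hPi : ∀ i, cokerDim (h.stalk i) (h.stalk (i + 1)) = d)
    (htau : ∀ i, cokerDim (h.tauStalk i) (h.stalk (i + 1)) = d) : AbelianTauSheaf K infty c where
  rank := finrank K V
  dim := d
  sheaf := h.bundle
  Pi _ := (LinearMap.id : V →ₗ[K] V)
  tau _ := φ
  rank_sheaf _ := rfl
  Pi_mem i P _ hv := h.stalk_le i P hv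
  tau_mem i P _ hv := h.tauStalk_le i P (Submodule.subset_span (Set.mem_image_of_mem φ hv))
  Pi_injective _ := Function.injective_id
  tau_injective _ := h.linearIndependent
  comm _ _ := rfl
  periodic := ⟨k, l, hk, hl, hd, h.isPeriodic_bundle hF⟩
  dim_coker_Pi i := (h.cokerDim_id i).trans (hPi i)
  dim_coker_tau := htau
  annihilated := h.annihilated htau

end IsImageDatum

end ImageSheaf

end

end TauSheaf

namespace TauSheaf

noncomputable section

/-! ### The generic fibre of an abelian `τ`-sheaf -/

section GenericFiber

open Module

variable {Fq Q L K : Type u} [Field Fq] [Field Q] [Field L] [Field K]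
  [Algebra Fq Q] [Algebra Fq L] [Algebra Fq K] [Algebra Q K] [Algebra L K]
  [IsScalarTower Fq Q K] [IsScalarTower Fq L K] [Fintype Fq] [IsBaseChangeFunctionField Fq Q L K]
  {infty : CurvePoint Fq Q} {c : Characteristic Fq Q L}

namespace AbelianTauSheaf

variable (F : AbelianTauSheaf K infty c)

theorem finrank_fiber (i : ℤ) : finrank K (F.sheaf i).fiber = F.rank := F.rank_sheaf i

/-- `Π_i` is bijective on the generic fibres. -/
def piEquiv (i : ℤ) : (F.sheaf i).fiber ≃ₗ[K] (F.sheaf (i + 1)).fiber :=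
  LinearEquiv.ofInjectiveOfFinrankEq (F.Pi i) (F.Pi_injective i)
    ((F.finrank_fiber i).trans (F.finrank_fiber (i + 1)).symm)

theorem piEquiv_apply (i : ℤ) (v : (F.sheaf i).fiber) : F.piEquiv i v = F.Pi i v := rfl

/-- The identification of the generic fibres by means of the `Π`'s. -/
def fromZero (i : ℤ) : (F.sheaf 0).fiber ≃ₗ[K] (F.sheaf i).fiber :=
  Int.inductionOn' i 0 (LinearEquiv.refl K _) (fun k _ e => e.trans (F.piEquiv k))
    (fun k _ e => e.trans ((fiberCast F.sheaf (sub_add_cancel k 1).symm).trans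
      (F.piEquiv (k - 1)).symm))

theorem fromZero_zero (v : (F.sheaf 0).fiber) : F.fromZero 0 v = v := by
  rw [fromZero, Int.inductionOn'_self]
  rfl

theorem fromZero_add_one (i : ℤ) (v : (F.sheaf 0).fiber) :
    F.fromZero (i + 1) v = F.Pi i (F.fromZero i v) := by
  rcases le_or_gt 0 i with hi | hi
  · rw [fromZero, Int.inductionOn'_add_one hi]
    rfl
  · obtain ⟨j, rfl⟩ : ∃ j, i = j - 1 := ⟨i + 1, by ring⟩
    have h1 : F.fromZero (j - 1) = (F.fromZero j).trans
        ((fiberCast F.sheaf (sub_add_cancel j 1).symm).trans (F.piEquiv (j - 1)).symm) := by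
      rw [fromZero, Int.inductionOn'_sub_one (by omega)]
      rfl
    rw [h1]
    change _ = F.piEquiv (j - 1) ((F.piEquiv (j - 1)).symm _)
    rw [LinearEquiv.apply_symm_apply]
    have h2 : ∀ {i j : ℤ} (h : i = j), F.fromZero i v = fiberCast F.sheaf h.symm (F.fromZero j v) := by
      rintro i j rfl
      rfl
    exact h2 (sub_add_cancel j 1)

/-- The identification of the generic fibres by means of the `Π`'s. -/
def psi (i : ℤ) : (F.sheaf i).fiber ≃ₗ[K] (F.sheaf 0).fiber := (F.fromZero i).symm

theorem psi_Pi (i : ℤ) (v : (F.sheaf i).fiber) : F.psi (i + 1) (F.Pi i v) = F.psi i v := by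
  rw [psi, LinearEquiv.symm_apply_eq, fromZero_add_one, psi, LinearEquiv.apply_symm_apply]

theorem psi_zero (v : (F.sheaf 0).fiber) : F.psi 0 v = v := by
  rw [psi, LinearEquiv.symm_apply_eq, fromZero_zero]

/-- The semilinear map `Π⁻¹ ∘ τ` on the generic fibre. -/
def phi : (F.sheaf 0).fiber →ₛₗ[sigma Fq Q L K] (F.sheaf 0).fiber :=
  (F.psi (0 + 1)).toLinearMap.comp (F.tau 0)

/-- The relation between `Π` and `τ` makes `Π⁻¹ ∘ τ` independent of the index. Going up uses that
`Π` is onto on generic fibres, going down that the relation for `i + 1` restricts along `Π`. -/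
theorem psi_tau (i : ℤ) (v : (F.sheaf i).fiber) : F.psi (i + 1) (F.tau i v) = F.phi (F.psi i v) := by
  induction i using Int.induction_on with
  | zero => rw [psi_zero]; rfl
  | succ i ih =>
    obtain ⟨w, rfl⟩ := (F.piEquiv i).surjective v
    rw [piEquiv_apply, ← F.comm, psi_Pi, psi_Pi, ih]
  | pred i ih =>
    have h : ∀ j : ℤ, (∀ v : (F.sheaf (j + 1)).fiber, F.psi (j + 1 + 1) (F.tau (j + 1) v) =
        F.phi (F.psi (j + 1) v)) → ∀ v : (F.sheaf j).fiber, F.psi (j + 1) (F.tau j v) =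
        F.phi (F.psi j v) := by
      intro j hj v
      rw [← psi_Pi, F.comm, hj, psi_Pi]
    refine h _ ?_ v
    rw [sub_add_cancel]
    exact ih

theorem phi_linearIndependent (n : ℕ) (v : Fin n → (F.sheaf 0).fiber)
    (hv : LinearIndependent K v) : LinearIndependent K (fun j => F.phi (v j)) :=
  (F.tau_injective 0 n v hv).map' (F.psi (0 + 1)).toLinearMap (F.psi (0 + 1)).ker

theorem isImageDatum {V : Type u} [AddCommGroup V] [Module K V] (φ : V →ₛₗ[sigma Fq Q L K] V)
    (hφ : ∀ (n : ℕ) (v : Fin n → V), LinearIndependent K v →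
      LinearIndependent K (fun j => φ (v j)))
    {n : ℕ} (q : Fin n → (F.sheaf 0).fiber →ₗ[K] V) (hq : ∀ j v, q j (F.phi v) = φ (q j v))
    (hq' : ⨆ j, LinearMap.range (q j) = ⊤) :
    IsImageDatum F φ (fun j i => q j ∘ₗ (F.psi i).toLinearMap) where
  Pi j i v := congrArg (q j) (F.psi_Pi i v)
  tau j i v := (congrArg (q j) (F.psi_tau i v)).trans (hq j _)
  top i := by
    rw [← hq']
    exact iSup_congr fun j => LinearMap.range_comp_of_range_eq_top _ (F.psi i).range
  linearIndependent := hφ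

/-- The generic fibre itself. -/
theorem selfDatum : IsImageDatum F F.phi
    (fun (_ : Fin 1) i => LinearMap.id ∘ₗ (F.psi i).toLinearMap) :=
  F.isImageDatum F.phi F.phi_linearIndependent (fun _ => LinearMap.id) (fun _ _ => rfl) (by simp)

/-- `F` is regarded as its own image inside one generic fibre, so that all results on images apply
to `F` itself. -/
theorem mem_selfDatum_stalk {i : ℤ} {P : CurvePoint L K} {v : (F.sheaf i).fiber} :
    F.psi i v ∈ F.selfDatum.stalk i P ↔ v ∈ (F.sheaf i).stalk P := by
  constructor
  · intro h
    rw [IsImageDatum.stalk, imageSub, iSup_unique] at h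
    obtain ⟨w, hw, h⟩ := h
    exact (F.psi i).injective h ▸ hw
  · exact fun h => mem_imageSub (fun (_ : Fin 1) => LinearMap.id ∘ₗ (F.psi i).toLinearMap) h 0

theorem relRank_psi (i : ℤ) (P : CurvePoint L K) (N N' : Submodule P.ring (F.sheaf i).fiber) :
    relRank L P.ring (N'.map ((F.psi i).restrictScalars P.ring).toLinearMap ⧸
      (N.map ((F.psi i).restrictScalars P.ring).toLinearMap).submoduleOf
        (N'.map ((F.psi i).restrictScalars P.ring).toLinearMap)) =
    relRank L P.ring (N' ⧸ N.submoduleOf N') := by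
  refine (relRank_congr (Submodule.Quotient.equiv _ _
    (((F.psi i).restrictScalars P.ring).submoduleMap N') ?_)).symm
  ext ⟨w, hw⟩
  obtain ⟨v, hv, rfl⟩ := hw
  constructor
  · rintro ⟨⟨v', hv'⟩, h1, h2⟩
    exact ⟨v', h1, congrArg Subtype.val h2⟩
  · rintro ⟨v', hv', h⟩
    have : v' = v := (F.psi i).injective h
    subst this
    exact ⟨⟨v', hv⟩, hv', rfl⟩

theorem map_psi_stalk (i : ℤ) (P : CurvePoint L K) :
    F.selfDatum.stalk i P =
      ((F.sheaf i).stalk P).map ((F.psi i).restrictScalars P.ring).toLinearMap := by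
  rw [IsImageDatum.stalk, imageSub, iSup_unique]
  rfl

theorem cokerDim_tauStalk (i : ℤ) :
    cokerDim (F.selfDatum.tauStalk i) (F.selfDatum.stalk (i + 1)) = F.dim := by
  rw [← F.dim_coker_tau i, cokerDim_eq_sum, cokerDim_eq_sum]
  congr 1
  funext P
  rw [IsImageDatum.tauStalk_eq, map_psi_stalk, imageSub, iSup_unique]
  exact F.relRank_psi (i + 1) P _ _

theorem cokerDim_stalk (i : ℤ) :
    cokerDim (F.selfDatum.stalk i) (F.selfDatum.stalk (i + 1)) = F.dim := by
  rw [← F.dim_coker_Pi i, cokerDim_eq_sum, cokerDim_eq_sum]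
  congr 1
  funext P
  have : F.selfDatum.stalk i P = (Submodule.span P.ring (F.Pi i '' (F.sheaf i).stalk P)).map
      ((F.psi (i + 1)).restrictScalars P.ring).toLinearMap := by
    rw [Submodule.map_span, ← Set.image_comp, map_psi_stalk]
    conv_lhs => rw [← Submodule.span_eq ((F.sheaf i).stalk P), Submodule.map_span]
    congr 1
    exact Set.image_congr fun v _ => (F.psi_Pi i v).symm
  rw [this, map_psi_stalk]
  exact F.relRank_psi (i + 1) P _ _

variable {F} {F' : AbelianTauSheaf K infty c}

/-- A commuting family is determined by its component of index `0`; conversely `ofZero` rebuilds a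
family from a map compatible with `phi`. -/
theorem Commutes.psi {f : GenericHom F F'} (hf : Commutes f) (i : ℤ) (v : (F.sheaf i).fiber) :
    F'.psi i (f i v) = f 0 (F.psi i v) := by
  induction i using Int.induction_on with
  | zero => rw [psi_zero, psi_zero]
  | succ i ih =>
    obtain ⟨w, rfl⟩ := (F.piEquiv i).surjective v
    rw [piEquiv_apply, hf.Pi, psi_Pi, psi_Pi, ih]
  | pred i ih =>
    have h : ∀ j : ℤ, (∀ v : (F.sheaf (j + 1)).fiber, F'.psi (j + 1) (f (j + 1) v) =
        f 0 (F.psi (j + 1) v)) → ∀ v : (F.sheaf j).fiber, F'.psi j (f j v) = f 0 (F.psi j v) := by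
      intro j hj v
      rw [← F'.psi_Pi, ← F.psi_Pi, ← hf.Pi, hj]
    refine h _ ?_ v
    rw [sub_add_cancel]
    exact ih

theorem Commutes.phi {f : GenericHom F F'} (hf : Commutes f) (v : (F.sheaf 0).fiber) :
    f 0 (F.phi v) = F'.phi (f 0 v) := by
  have h1 := F'.psi_tau 0 (f 0 v)
  rw [← hf.tau, hf.psi, psi_tau, psi_zero, psi_zero] at h1
  exact h1

/-- The family of maps given by a map of the generic fibres. -/
def ofZero (f : (F.sheaf 0).fiber →ₗ[K] (F'.sheaf 0).fiber) : GenericHom F F' := fun i =>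
  (F'.psi i).symm.toLinearMap ∘ₗ f ∘ₗ (F.psi i).toLinearMap

theorem psi_ofZero (f : (F.sheaf 0).fiber →ₗ[K] (F'.sheaf 0).fiber) (i : ℤ)
    (v : (F.sheaf i).fiber) : F'.psi i (ofZero f i v) = f (F.psi i v) :=
  (F'.psi i).apply_symm_apply _

theorem ofZero_zero (f : (F.sheaf 0).fiber →ₗ[K] (F'.sheaf 0).fiber) : ofZero f 0 = f := by
  ext v
  rw [← psi_zero F' (ofZero f 0 v), psi_ofZero, psi_zero]

theorem commutes_ofZero {f : (F.sheaf 0).fiber →ₗ[K] (F'.sheaf 0).fiber}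
    (hf : ∀ v, f (F.phi v) = F'.phi (f v)) : Commutes (ofZero f) where
  Pi i v := (F'.psi (i + 1)).injective (by rw [psi_ofZero, psi_Pi, psi_Pi, psi_ofZero])
  tau i v := (F'.psi (i + 1)).injective (by rw [psi_ofZero, psi_tau, psi_tau, psi_ofZero, hf])

theorem Commutes.injective {f : GenericHom F F'} (hf : Commutes f)
    (h : Function.Injective (f 0)) : IsInjective f := fun i v w hvw => by
  apply (F.psi i).injective
  apply h
  rw [← hf.psi, ← hf.psi, hvw]

end AbelianTauSheaf

end GenericFiber

end

end TauSheaf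

namespace TauSheaf

noncomputable section

/-! ### Finite extensions of the field of constants -/

set_option linter.unusedSectionVars false

section FiniteConstants

open Module

variable (Fq Q L K : Type u) [Field Fq] [Field Q] [Field L] [Field K]
  [Algebra Fq Q] [Algebra Fq L] [Algebra Fq K] [Algebra Q K] [Algebra L K]
  [IsScalarTower Fq Q K] [IsScalarTower Fq L K] [Fintype Fq] [IsBaseChangeFunctionField Fq Q L K]
  [Finite L]

/-- For finite `L` the domain `Q ⊗ L` is integral over the field `Q`, hence already a field, and no
denominators are needed. -/
theorem mulMap_surjective : Function.Surjective (mulMap Fq Q L K) := by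
  have hinj := IsBaseChangeFunctionField.injective (Fq := Fq) (Q := Q) (L := L) (K := K)
  have : IsDomain (Q ⊗[Fq] L) := hinj.isDomain (mulMap Fq Q L K).toRingHom
  have : Module.Finite Fq L := Module.Finite.of_finite
  have hfield : IsField (Q ⊗[Fq] L) :=
    isField_of_isIntegral_of_isField' (R := Q) (Field.toIsField Q)
  intro z
  obtain ⟨a, b, hb, rfl⟩ := IsBaseChangeFunctionField.exists_div (Fq := Fq) (Q := Q) (L := L) z
  have hb0 : b ≠ 0 := fun h => hb (by rw [h, map_zero])
  obtain ⟨b', hbb'⟩ := hfield.mul_inv_cancel hb0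
  refine ⟨a * b', ?_⟩
  rw [map_mul, eq_div_iff hb, mul_assoc, mul_comm (mulMap Fq Q L K b'), ← map_mul, hbb', map_one,
    mul_one]

theorem mulMap_tmul (a : Q) (b : L) :
    mulMap Fq Q L K (a ⊗ₜ b) = algebraMap Q K a * algebraMap L K b := by
  simp [mulMap]

include Fq in
/-- Every element of `K` is a sum of products of elements of `Q` and `L`. -/
theorem induction_mul_add (p : K → Prop) (hmul : ∀ (a : Q) (b : L), p (algebraMap Q K a * algebraMap L K b))
    (hadd : ∀ z w, p z → p w → p (z + w)) (z : K) : p z := by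
  obtain ⟨x, rfl⟩ := mulMap_surjective Fq Q L K z
  induction x using TensorProduct.induction_on with
  | zero => simpa using hmul 0 0
  | tmul a b => rw [mulMap_tmul]; exact hmul a b
  | add x y hx hy => rw [map_add]; exact hadd _ _ hx hy

theorem frobenius_bijective : Function.Bijective (fun b : L => b ^ Fintype.card Fq) :=
  Finite.injective_iff_bijective.1 (FiniteField.frobeniusAlgHom Fq L).injective

/-- Frobenius is bijective on the finite field `L`, and `K` consists of sums of products of elements
of `Q` and `L`. -/
theorem sigma_bijective : Function.Bijective (sigma Fq Q L K) := by
  refine ⟨(sigma Fq Q L K).injective, fun z => ?_⟩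
  refine induction_mul_add Fq Q L K (fun z => ∃ w, sigma Fq Q L K w = z) (fun a b => ?_) ?_ z
  · obtain ⟨b', rfl⟩ := (frobenius_bijective Fq L).2 b
    refine ⟨algebraMap Q K a * algebraMap L K b', ?_⟩
    rw [map_mul, sigma_algebraMap_left, sigma_algebraMap_right, map_pow]
  · rintro _ _ ⟨w, rfl⟩ ⟨w', rfl⟩
    exact ⟨w + w', map_add _ _ _⟩

/-- `σ` as an automorphism of `K`. -/
def sigmaEquiv : RingAut K := RingEquiv.ofBijective (sigma Fq Q L K) (sigma_bijective Fq Q L K)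

theorem sigmaEquiv_apply (z : K) : sigmaEquiv Fq Q L K z = sigma Fq Q L K z := rfl

theorem sigmaEquiv_pow_algebraMap_left (n : ℕ) (a : Q) :
    (sigmaEquiv Fq Q L K ^ n) (algebraMap Q K a) = algebraMap Q K a := by
  induction n with
  | zero => rfl
  | succ n ih => rw [pow_succ, RingAut.mul_apply, sigmaEquiv_apply, sigma_algebraMap_left, ih]

theorem isOfFinOrder_sigmaEquiv : IsOfFinOrder (sigmaEquiv Fq Q L K) := by
  let f : Equiv.Perm L := Equiv.ofBijective _ (frobenius_bijective Fq L)
  obtain ⟨n, hn, hf⟩ := isOfFinOrder_iff_pow_eq_one.1 (isOfFinOrder_of_finite f)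
  refine isOfFinOrder_iff_pow_eq_one.2 ⟨n, hn, ?_⟩
  have h1 : ∀ (m : ℕ) (b : L), (sigmaEquiv Fq Q L K ^ m) (algebraMap L K b) =
      algebraMap L K ((f ^ m) b) := by
    intro m b
    induction m with
    | zero => rfl
    | succ m ih =>
      rw [pow_succ', RingAut.mul_apply, ih, sigmaEquiv_apply, sigma_algebraMap_right, pow_succ',
        Equiv.Perm.mul_apply, ← map_pow]
      rfl
  ext z
  refine induction_mul_add Fq Q L K (fun z => (sigmaEquiv Fq Q L K ^ n) z = (1 : RingAut K) z)
    (fun a b => ?_) ?_ z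
  · rw [map_mul, sigmaEquiv_pow_algebraMap_left, h1, hf]
    rfl
  · intro z w hz hw
    rw [map_add, map_add, hz, hw]

/-- The order of `σ`. -/
def sigmaOrder : ℕ := orderOf (sigmaEquiv Fq Q L K)

theorem sigmaOrder_pos : 0 < sigmaOrder Fq Q L K := (isOfFinOrder_sigmaEquiv Fq Q L K).orderOf_pos

theorem sigmaEquiv_pow_sigmaOrder : sigmaEquiv Fq Q L K ^ sigmaOrder Fq Q L K = 1 :=
  pow_orderOf_eq_one _

/-- The powers of `σ` are linearly independent. -/
theorem eq_zero_of_sum_sigma {V : Type*} [AddCommGroup V] [Module K V]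
    (w : Fin (sigmaOrder Fq Q L K) → V)
    (h : ∀ a : K, ∑ j : Fin (sigmaOrder Fq Q L K), (sigmaEquiv Fq Q L K ^ (j : ℕ)) a • w j = 0)
    (j : Fin (sigmaOrder Fq Q L K)) : w j = 0 := by
  -- Dedekind's independence of characters, for the distinct powers of `σ` below its order; vectors
  -- are tested by linear functionals.
  have hli := (linearIndependent_monoidHom K K).comp
    (fun j : Fin (sigmaOrder Fq Q L K) => ((sigmaEquiv Fq Q L K ^ (j : ℕ) : RingAut K) : K →* K)) (by
      intro i j hij
      have : sigmaEquiv Fq Q L K ^ (i : ℕ) = sigmaEquiv Fq Q L K ^ (j : ℕ) :=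
        RingEquiv.ext fun z => DFunLike.congr_fun hij z
      exact Fin.ext (pow_injOn_Iio_orderOf i.2 j.2 this))
  rw [← Module.forall_dual_apply_eq_zero_iff K]
  intro l
  refine Fintype.linearIndependent_iff.1 hli (fun j => l (w j)) ?_ j
  funext a
  have h1 := congrArg l (h a)
  rw [map_sum, map_zero] at h1
  rw [Finset.sum_apply, Pi.zero_apply, ← h1]
  refine Finset.sum_congr rfl fun i _ => ?_
  rw [map_smul, Pi.smul_apply, smul_eq_mul, smul_eq_mul, mul_comm]
  rfl

omit [Finite L] in
-- `X ^ q - X` is the product of all `X - a` with `a` in `Fq`.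
theorem exists_algebraMap_eq_of_pow_card {b : L} (hb : b ^ Fintype.card Fq = b) :
    ∃ a : Fq, algebraMap Fq L a = b := by
  have hq : 1 < Fintype.card Fq := Fintype.one_lt_card
  have hdeg := FiniteField.X_pow_card_sub_X_natDegree_eq Fq hq
  have hmonic : (Polynomial.X ^ Fintype.card Fq - Polynomial.X : Polynomial Fq).Monic :=
    Polynomial.monic_X_pow_sub (by rw [Polynomial.degree_X]; exact_mod_cast hq)
  have h1 := Polynomial.prod_multiset_X_sub_C_of_monic_of_roots_card_eq hmonic (by
    rw [FiniteField.roots_X_pow_card_sub_X, hdeg]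
    rfl)
  rw [FiniteField.roots_X_pow_card_sub_X] at h1
  have h2 : Polynomial.aeval b (∏ a : Fq, (Polynomial.X - Polynomial.C a)) = 0 := by
    refine (congrArg (Polynomial.aeval b) h1).trans ?_
    simp [hb]
  rw [map_prod, Finset.prod_eq_zero_iff] at h2
  obtain ⟨a, -, ha⟩ := h2
  refine ⟨a, ?_⟩
  rw [map_sub, Polynomial.aeval_X, Polynomial.aeval_C, sub_eq_zero] at ha
  exact ha.symm

/-- The fixed field of `σ`. -/
theorem mem_range_of_sigma_eq {z : K} (hz : sigma Fq Q L K z = z) : z ∈ (algebraMap Q K).range := by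
  classical
  obtain ⟨x, rfl⟩ := mulMap_surjective Fq Q L K z
  have hinj := IsBaseChangeFunctionField.injective (Fq := Fq) (Q := Q) (L := L) (K := K)
  rw [sigma_mulMap] at hz
  have hx : Algebra.TensorProduct.map (AlgHom.id Fq Q) (FiniteField.frobeniusAlgHom Fq L) x = x :=
    hinj hz
  -- In coordinates with respect to an `Fq`-basis of `Q`, the map `σ` raises coefficients in `L` to
  -- the power `q`. A fixed element therefore has its coefficients in `Fq`.
  let b := Basis.ofVectorSpace Fq Q
  let e := TensorProduct.equivFinsuppOfBasisLeft (N := L) b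
  have hb : ∀ i, ∃ a : Fq, algebraMap Fq L a = e x i := by
    intro i
    have h1 : ∀ y : Q ⊗[Fq] L, e
        (Algebra.TensorProduct.map (AlgHom.id Fq Q) (FiniteField.frobeniusAlgHom Fq L) y) i =
        (e y i) ^ Fintype.card Fq := by
      intro y
      have hfrob : ∀ a b : L, (a + b) ^ Fintype.card Fq = a ^ Fintype.card Fq + b ^ Fintype.card Fq :=
        fun a b => (FiniteField.frobeniusAlgHom Fq L).map_add a b
      induction y using TensorProduct.induction_on with
      | zero => simp
      | tmul q l =>
        rw [Algebra.TensorProduct.map_tmul, TensorProduct.equivFinsuppOfBasisLeft_apply_tmul_apply,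
          TensorProduct.equivFinsuppOfBasisLeft_apply_tmul_apply]
        change _ • l ^ Fintype.card Fq = _
        rw [smul_pow, FiniteField.pow_card]
        rfl
      | add y y' hy hy' =>
        rw [map_add, map_add, map_add, Finsupp.add_apply, Finsupp.add_apply, hy, hy', hfrob]
    have h2 := h1 x
    rw [hx] at h2
    exact exists_algebraMap_eq_of_pow_card Fq L h2.symm
  choose a ha using hb
  have h3 : x = e.symm (e x) := (e.symm_apply_apply x).symm
  rw [TensorProduct.equivFinsuppOfBasisLeft_symm_apply] at h3
  refine ⟨(e x).sum fun i _ => a i • b i, ?_⟩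
  conv_rhs => rw [h3]
  rw [map_finsuppSum, map_finsuppSum]
  refine Finsupp.sum_congr fun i _ => ?_
  rw [mulMap_tmul, ← ha i, Algebra.smul_def, map_mul, mul_comm, ← IsScalarTower.algebraMap_apply,
    ← IsScalarTower.algebraMap_apply]

include Fq L in
theorem finite_functionField : Module.Finite Q K := by
  have : Module.Finite Fq L := Module.Finite.of_finite
  suffices h : ∀ (a : Q) (x : Q ⊗[Fq] L), mulMap Fq Q L K (a • x) = a • mulMap Fq Q L K x by
    let f : Q ⊗[Fq] L →ₗ[Q] K := { (mulMap Fq Q L K).toLinearMap with map_smul' := h }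
    exact Module.Finite.of_surjective f (mulMap_surjective Fq Q L K)
  intro a x
  induction x using TensorProduct.induction_on with
  | zero => simp
  | tmul q l =>
    rw [TensorProduct.smul_tmul']
    rw [mulMap_tmul, mulMap_tmul, smul_eq_mul, map_mul, Algebra.smul_def, mul_assoc]
  | add x y hx hy => rw [smul_add, map_add, map_add, smul_add, hx, hy]

include Fq L in
theorem isSeparable_functionField : Algebra.IsSeparable Q K := by
  have : Module.Finite Fq L := Module.Finite.of_finite
  have hL : ∀ b : L, IsSeparable Q (algebraMap L K b) := by
    intro b
    have h1 : IsSeparable Fq b := Algebra.IsSeparable.isSeparable Fq b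
    have h2 : IsSeparable Fq (algebraMap L K b) := by
      have h := h1
      rw [IsSeparable] at h ⊢
      rwa [minpoly.algebraMap_eq (algebraMap L K).injective]
    exact h2.tower_top Q
  refine ⟨fun z => ?_⟩
  rw [← mem_separableClosure_iff]
  refine induction_mul_add Fq Q L K (fun z => z ∈ separableClosure Q K) (fun a b => ?_)
    (fun z w => add_mem) z
  exact mul_mem (algebraMap_mem _ _) (mem_separableClosure_iff.2 (hL b))

variable [IsCurveFunctionField Fq Q]

include Fq Q in
-- A separating element `t` of `Q` remains one: `K` is finite and separable over `Q`, hence over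
-- `Fq(t)`, hence over `L(t)`.
theorem exists_separating_functionField : ∃ t : K, Transcendental L t ∧ FiniteDimensional L⟮t⟯ K ∧
    Algebra.IsSeparable L⟮t⟯ K := by
  obtain ⟨t, ht, hfd, hsep⟩ := IsCurveFunctionField.exists_separating (k := Fq) (E := Q)
  have : Module.Finite Fq L := Module.Finite.of_finite
  have := finite_functionField Fq Q L K
  have := isSeparable_functionField Fq Q L K
  let f : Fq⟮t⟯ →+* L⟮algebraMap Q K t⟯ :=
    ((algebraMap Q K).comp (algebraMap Fq⟮t⟯ Q)).codRestrict L⟮algebraMap Q K t⟯ (by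
      rintro ⟨z, hz⟩
      change algebraMap Q K z ∈ _
      induction hz using IntermediateField.adjoin_induction with
      | mem z hz =>
        rw [Set.mem_singleton_iff.1 hz]
        exact IntermediateField.mem_adjoin_simple_self L _
      | algebraMap a =>
        rw [← IsScalarTower.algebraMap_apply, IsScalarTower.algebraMap_apply Fq L K]
        exact algebraMap_mem _ _
      | add z w _ _ hz hw => rw [map_add]; exact add_mem hz hw
      | mul z w _ _ hz hw => rw [map_mul]; exact mul_mem hz hw
      | inv z _ hz => rw [map_inv₀]; exact inv_mem hz)
  let : Algebra Fq⟮t⟯ L⟮algebraMap Q K t⟯ := f.toAlgebra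
  have : IsScalarTower Fq⟮t⟯ L⟮algebraMap Q K t⟯ K := .of_algebraMap_eq fun _ => rfl
  have h1 : FiniteDimensional Fq⟮t⟯ K := FiniteDimensional.trans Fq⟮t⟯ Q K
  have h2 : Algebra.IsSeparable Fq⟮t⟯ K := Algebra.IsSeparable.trans Fq⟮t⟯ Q K
  refine ⟨algebraMap Q K t, ?_, FiniteDimensional.right Fq⟮t⟯ L⟮algebraMap Q K t⟯ K,
    Algebra.isSeparable_tower_top_of_isSeparable Fq⟮t⟯ L⟮algebraMap Q K t⟯ K⟩
  intro h
  apply ht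
  have h3 : IsAlgebraic Fq (algebraMap Q K t) := h.restrictScalars Fq
  exact (isAlgebraic_algebraMap_iff (algebraMap Q K).injective).1 h3

/-- The trace is fixed by `σ`, which permutes its summands cyclically. -/
theorem sum_sigma_mem_range (z : K) :
    ∑ j : Fin (sigmaOrder Fq Q L K), (sigmaEquiv Fq Q L K ^ (j : ℕ)) z ∈
      (algebraMap Q K).range := by
  apply mem_range_of_sigma_eq Fq Q L K
  obtain ⟨e, he⟩ : ∃ e, sigmaOrder Fq Q L K = e + 1 :=
    ⟨_, (Nat.succ_pred_eq_of_pos (sigmaOrder_pos Fq Q L K)).symm⟩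
  have h := sigmaEquiv_pow_sigmaOrder Fq Q L K
  rw [map_sum, he] at *
  rw [Fin.sum_univ_castSucc, Fin.sum_univ_succ, add_comm]
  congr 1
  · simp only [Fin.val_last, Fin.val_zero, pow_zero]
    rw [← sigmaEquiv_apply, ← RingAut.mul_apply, ← pow_succ', h]
  · refine Finset.sum_congr rfl fun j _ => ?_
    rw [← sigmaEquiv_apply, ← RingAut.mul_apply, ← pow_succ']
    rfl

theorem algebraMap_sigmaEquiv_pow (n : ℕ) (a : Fq) :
    (sigmaEquiv Fq Q L K ^ n) (algebraMap Fq K a) = algebraMap Fq K a := by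
  rw [IsScalarTower.algebraMap_apply Fq Q K, sigmaEquiv_pow_algebraMap_left]

include Fq Q in
/-- The field of constants of the base change. -/
theorem mem_range_of_isAlgebraic {x : K} (hx : IsAlgebraic L x) : x ∈ (algebraMap L K).range := by
  have : Module.Finite Fq L := Module.Finite.of_finite
  have hx' : IsAlgebraic Fq x := hx.restrictScalars Fq
  -- Let `T` be the trace to `Q`. For `z` algebraic over `Fq`, the values `T(z b)` with `b` in `L`
  -- are algebraic over `Fq` and lie in `Q`, hence in `Fq`. The trace form on `L` is nondegenerate,
  -- so some `y` in `L` has `T(y b) = T(x b)` for all `b`. Then `x - y` is orthogonal to `L`, hence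
  -- to `K`, hence zero.
  let T : K → K := fun z => ∑ j : Fin (sigmaOrder Fq Q L K), (sigmaEquiv Fq Q L K ^ (j : ℕ)) z
  have hTadd : ∀ z w, T (z + w) = T z + T w := fun z w => by
    simp only [T, map_add, Finset.sum_add_distrib]
  have hTmul : ∀ (q : Q) (z : K), T (algebraMap Q K q * z) = algebraMap Q K q * T z := fun q z => by
    simp only [T, map_mul, sigmaEquiv_pow_algebraMap_left, Finset.mul_sum]
  have hT : ∀ z, IsAlgebraic Fq z → ∃ a : Fq, algebraMap Fq K a = T z := by
    intro z hz
    obtain ⟨q, hq⟩ := sum_sigma_mem_range Fq Q L K z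
    have h1 : IsAlgebraic Fq (T z) := by
      rw [← mem_algebraicClosure_iff]
      refine sum_mem fun j _ => mem_algebraicClosure_iff.2 ?_
      let f : K →ₐ[Fq] K := AlgHom.mk ((sigmaEquiv Fq Q L K ^ (j : ℕ) : RingAut K) : K →+* K)
        (algebraMap_sigmaEquiv_pow Fq Q L K j)
      exact hz.algHom f
    have h2 : IsAlgebraic Fq q := by
      rw [← isAlgebraic_algebraMap_iff (algebraMap Q K).injective, hq]
      exact h1
    obtain ⟨a, rfl⟩ := IsCurveFunctionField.algebraic_mem q h2
    exact ⟨a, by rw [IsScalarTower.algebraMap_apply Fq Q K]; exact hq⟩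
  -- `L` spans `K` over `Q`, so orthogonality to `L` gives orthogonality to `K`, which independence
  -- of the powers of `σ` excludes unless `z = 0`.
  have hzero : ∀ z, (∀ b : L, T (z * algebraMap L K b) = 0) → z = 0 := by
    intro z hz
    have h1 : ∀ a : K, T (a * z) = 0 := by
      refine induction_mul_add Fq Q L K _ (fun q b => ?_) (fun a a' ha ha' => ?_)
      · rw [mul_assoc, hTmul, mul_comm _ z, hz, mul_zero]
      · rw [add_mul, hTadd, ha, ha', add_zero]
    have h2 := eq_zero_of_sum_sigma Fq Q L K
      (fun j => (sigmaEquiv Fq Q L K ^ (j : ℕ)) z) (fun a => by simpa [T] using h1 a)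
      ⟨0, sigmaOrder_pos Fq Q L K⟩
    simpa using h2
  have hLalg : ∀ b : L, IsAlgebraic Fq (algebraMap L K b) := fun b =>
    (Algebra.IsAlgebraic.isAlgebraic (R := Fq) b).algebraMap
  have hex : ∀ z : K, IsAlgebraic Fq z → ∃ f : Module.Dual Fq L, ∀ b,
      algebraMap Fq K (f b) = T (z * algebraMap L K b) := by
    intro z hz
    choose f hf using fun b => hT (z * algebraMap L K b) (hz.mul (hLalg b))
    refine ⟨⟨⟨f, fun b b' => ?_⟩, fun a b => ?_⟩, hf⟩
    · apply (algebraMap Fq K).injective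
      rw [map_add, hf, hf, hf, map_add, mul_add, hTadd]
    · apply (algebraMap Fq K).injective
      rw [hf, Algebra.smul_def, map_mul, ← IsScalarTower.algebraMap_apply,
        IsScalarTower.algebraMap_apply Fq Q K, mul_left_comm, hTmul, smul_eq_mul, map_mul, hf,
        IsScalarTower.algebraMap_apply Fq Q K]
      rfl
  choose f hf using fun y : L => hex (algebraMap L K y) (hLalg y)
  let g : L →ₗ[Fq] Module.Dual Fq L :=
    { toFun := f
      map_add' := fun y y' => by
        ext b
        apply (algebraMap Fq K).injective
        rw [LinearMap.add_apply, map_add, hf, hf, hf, map_add, add_mul, hTadd]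
      map_smul' := fun a y => by
        ext b
        apply (algebraMap Fq K).injective
        rw [LinearMap.smul_apply, smul_eq_mul, map_mul, hf, RingHom.id_apply, hf, Algebra.smul_def,
          map_mul, ← IsScalarTower.algebraMap_apply, IsScalarTower.algebraMap_apply Fq Q K, mul_assoc,
          hTmul] }
  have hg : Function.Injective g := by
    rw [← LinearMap.ker_eq_bot, LinearMap.ker_eq_bot']
    intro y hy
    apply (algebraMap L K).injective
    rw [map_zero]
    refine hzero _ fun b => ?_
    rw [← hf, show f y = 0 from hy, LinearMap.zero_apply, map_zero]
  have hg' : Function.Surjective g :=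
    (LinearMap.injective_iff_surjective_of_finrank_eq_finrank
      (Subspace.dual_finrank_eq).symm).1 hg
  obtain ⟨fx, hfx⟩ := hex x hx'
  obtain ⟨y, hy⟩ := hg' fx
  refine ⟨y, ?_⟩
  rw [← sub_eq_zero]
  refine hzero _ fun b => ?_
  have h1 : T (algebraMap L K y * algebraMap L K b) = T (x * algebraMap L K b) := by
    rw [← hf, ← hfx, ← hy]
    rfl
  have h2 := hTadd ((algebraMap L K y - x) * algebraMap L K b) (x * algebraMap L K b)
  rw [← add_mul, sub_add_cancel, h1] at h2
  exact left_eq_add.1 (h2.trans (add_comm _ _))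

include Fq Q in
theorem isCurveFunctionField : IsCurveFunctionField L K :=
  ⟨exists_separating_functionField Fq Q L K, fun _ hx => mem_range_of_isAlgebraic Fq Q L K hx⟩

end FiniteConstants

end

end TauSheaf

namespace TauSheaf

noncomputable section

/-! ### Points of the base change -/

set_option linter.unusedSectionVars false

theorem infinite_functionField (k E : Type*) [Field k] [Field E] [Algebra k E]
    [IsCurveFunctionField k E] : Infinite E := by
  obtain ⟨t, ht, -, -⟩ := IsCurveFunctionField.exists_separating (k := k) (E := E)
  exact Infinite.of_injective _ (transcendental_iff_injective.1 ht)

theorem CurvePoint.IsRational.isClosedPoint {k E : Type*} [Field k] [Finite k] [Field E]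
    [Algebra k E] [IsCurveFunctionField k E] {x : CurvePoint k E} (hx : x.IsRational) :
    x.IsClosedPoint := by
  intro h
  have := infinite_functionField k E
  have h1 : Finite (IsLocalRing.ResidueField x.ring) := Finite.of_surjective _ hx
  let f : E →+* x.ring := (RingHom.id E).codRestrict x.ring (fun z => h ▸ ValuationSubring.mem_top z)
  exact (Infinite.of_injective _ ((IsLocalRing.residue x.ring).comp f).injective).not_finite h1

section Points

open Module

variable {Fq Q L K : Type u} [Field Fq] [Field Q] [Field L] [Field K]
  [Algebra Fq Q] [Algebra Fq L] [Algebra Fq K] [Algebra Q K] [Algebra L K]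
  [IsScalarTower Fq Q K] [IsScalarTower Fq L K]

/-- At the generic point the infinite field `Q` would embed into the finite field `L`. -/
theorem Characteristic.isClosedPoint [Finite L] [IsCurveFunctionField Fq Q]
    (c : Characteristic Fq Q L) : c.point.IsClosedPoint := by
  intro h
  have := infinite_functionField Fq Q
  let f : Q →+* c.point.ring :=
    (RingHom.id Q).codRestrict c.point.ring (fun z => h ▸ ValuationSubring.mem_top z)
  exact (Infinite.of_injective _ ((c.hom : c.point.ring →+* L).comp f).injective).not_finite
    ‹Finite L›

theorem CurvePoint.isClosedPoint_of_proj {P : CurvePoint L K} (hP : (P.proj Fq Q).IsClosedPoint) :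
    P.IsClosedPoint := by
  intro h
  apply hP
  rw [eq_top_iff]
  intro z _
  change algebraMap Q K z ∈ P.ring
  rw [h]
  trivial

/-- A valuation ring containing `Q` contains all elements integral over `Q`, which is all of `K`. -/
theorem CurvePoint.IsClosedPoint.proj [Algebra.IsAlgebraic Q K] {P : CurvePoint L K}
    (hP : P.IsClosedPoint) : (P.proj Fq Q).IsClosedPoint := by
  intro h
  apply hP
  rw [eq_top_iff]
  intro z _
  have h1 : ∀ a : Q, algebraMap Q K a ∈ P.ring := fun a => by
    have : a ∈ (P.proj Fq Q).ring := h ▸ ValuationSubring.mem_top a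
    exact this
  obtain ⟨p, hp, hpz⟩ : IsIntegral Q z := (Algebra.IsAlgebraic.isAlgebraic z).isIntegral
  have hz' : IsIntegral P.ring z := by
    refine ⟨p.map ((algebraMap Q K).codRestrict P.ring h1), hp.map _, ?_⟩
    rw [Polynomial.eval₂_map]
    exact hpz
  obtain ⟨y, hy⟩ := IsIntegrallyClosed.isIntegral_iff.1 hz'
  rw [← hy]
  exact y.2

/-- The points above `x` are poles of any function on `C` with a pole at `x`. -/
theorem CurvePoint.IsClosedPoint.finite_fiber [IsCurveFunctionField L K] {x : CurvePoint Fq Q}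
    (hx : x.IsClosedPoint) : {P : CurvePoint L K | P.proj Fq Q = x}.Finite := by
  obtain ⟨z, hz⟩ : ∃ z, z ∉ x.ring := by
    by_contra! h
    exact hx (eq_top_iff.2 fun z _ => h z)
  refine (finite_poles (k := L) (algebraMap Q K z)).subset fun P hP hzP => hz ?_
  rw [← hP]
  exact hzP

/-- The order at `P`, restricted to `Q`, vanishes on units at the image point, so it is a multiple
of the order there. The factor `e` is the ramification index; it is positive because a uniformizer
below has no regular inverse at `P`. -/
theorem CurvePoint.IsClosedPoint.exists_ramification [Finite L] [IsCurveFunctionField Fq Q]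
    [IsCurveFunctionField L K] {P : CurvePoint L K} (hP : (P.proj Fq Q).IsClosedPoint) :
    ∃ e : ℕ, 0 < e ∧ ∀ z : Q, z ≠ 0 → P.ord (algebraMap Q K z) = e * (P.proj Fq Q).ord z := by
  have hP' := isClosedPoint_of_proj hP
  obtain ⟨w, hw⟩ := hP.exists_irreducible
  have hw0 : (w : Q) ≠ 0 := by exact_mod_cast hw.ne_zero
  have hinj := (algebraMap Q K).injective
  have h1 : ∀ z : Q, z ≠ 0 → P.ord (algebraMap Q K z) =
      P.ord (algebraMap Q K w) * (P.proj Fq Q).ord z := fun z hz => by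
    refine hP.eq_mul_ord (fun z => P.ord (algebraMap Q K z)) (fun z z' hz hz' => ?_)
      (fun z _ hz hz' => ?_) hw hz
    · rw [map_mul]
      exact P.ord_mul ((map_ne_zero _).2 hz) ((map_ne_zero _).2 hz')
    · exact P.ord_eq_zero hz (by rw [← map_inv₀]; exact hz')
  have h2 : 0 < P.ord (algebraMap Q K w) := by
    by_contra! h
    have h3 : (algebraMap Q K w)⁻¹ ∈ P.ring := by
      apply mem_ring_of_ord_nonneg hP'
      rw [ord_inv]
      linarith
    rw [← map_inv₀] at h3
    have h4 : ((w : Q)⁻¹) ∈ (P.proj Fq Q).ring := h3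
    refine hw.not_isUnit (.of_mul_eq_one ⟨(w : Q)⁻¹, h4⟩ (Subtype.ext (mul_inv_cancel₀ hw0)))
  refine ⟨(P.ord (algebraMap Q K w)).toNat, by omega, fun z hz => ?_⟩
  rw [Int.toNat_of_nonneg h2.le]
  exact h1 z hz

variable [Fintype Fq] [IsBaseChangeFunctionField Fq Q L K]

theorem proj_sigmaPoint (P : CurvePoint L K) : (sigmaPoint Fq Q L P).proj Fq Q = P.proj Fq Q := by
  apply CurvePoint.ext
  ext z
  change sigma Fq Q L K (algebraMap Q K z) ∈ P.ring ↔ _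
  rw [sigma_algebraMap_left]
  rfl

theorem mem_sigmaPoint {P : CurvePoint L K} {z : K} :
    z ∈ (sigmaPoint Fq Q L P).ring ↔ sigma Fq Q L K z ∈ P.ring := Iff.rfl

variable [Finite L]

variable (Fq Q) in
theorem sigmaPoint_injective : Function.Injective (sigmaPoint Fq Q L (K := K)) := by
  intro P P' h
  apply CurvePoint.ext
  ext z
  obtain ⟨z, rfl⟩ := (sigma_bijective Fq Q L K).2 z
  rw [← mem_sigmaPoint, h, mem_sigmaPoint]

variable (Fq Q) in
/-- The isomorphism of the local rings at `σ(P)` and `P`. -/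
def sigmaRingEquiv (P : CurvePoint L K) : (sigmaPoint Fq Q L P).ring ≃+* P.ring :=
  RingEquiv.ofBijective ((sigma Fq Q L K).restrict (sigmaPoint Fq Q L P).ring P.ring fun _ h => h) (by
    constructor
    · intro z w h
      exact Subtype.ext ((sigma Fq Q L K).injective (congrArg Subtype.val h))
    · rintro ⟨w, hw⟩
      obtain ⟨z, rfl⟩ := (sigma_bijective Fq Q L K).2 w
      exact ⟨⟨z, hw⟩, rfl⟩)

theorem sigmaRingEquiv_apply (P : CurvePoint L K) (z : (sigmaPoint Fq Q L P).ring) :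
    (sigmaRingEquiv Fq Q P z : K) = sigma Fq Q L K z := rfl

theorem isClosedPoint_sigmaPoint {P : CurvePoint L K} :
    (sigmaPoint Fq Q L P).IsClosedPoint ↔ P.IsClosedPoint := by
  have : (sigmaPoint Fq Q L P).ring = ⊤ ↔ P.ring = ⊤ := by
    constructor
    · intro h
      rw [eq_top_iff]
      intro w _
      obtain ⟨z, rfl⟩ := (sigma_bijective Fq Q L K).2 w
      rw [← mem_sigmaPoint, h]
      trivial
    · intro h
      rw [eq_top_iff]
      intro w _
      rw [mem_sigmaPoint, h]
      trivial
  exact not_congr this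

/-- The isomorphism of residue fields induced by `σ` is semilinear for the Frobenius of `L`, which
is bijective, so dimensions agree. -/
theorem deg_sigmaPoint (P : CurvePoint L K) : (sigmaPoint Fq Q L P).deg = P.deg := by
  let e := IsLocalRing.ResidueField.mapEquiv (sigmaRingEquiv Fq Q P)
  have := rank_eq_of_equiv_equiv (R := L) (R' := L)
    (M := IsLocalRing.ResidueField (sigmaPoint Fq Q L P).ring)
    (M₁ := IsLocalRing.ResidueField P.ring) (fun b => b ^ Fintype.card Fq) e.toAddEquiv
    (frobenius_bijective Fq L) (by
      intro b z
      obtain ⟨z, rfl⟩ := IsLocalRing.residue_surjective z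
      rw [Algebra.smul_def, Algebra.smul_def]
      change IsLocalRing.residue _ (sigmaRingEquiv Fq Q P (algebraMap L _ b * z)) =
        IsLocalRing.residue _ (algebraMap L _ (b ^ Fintype.card Fq) * sigmaRingEquiv Fq Q P z)
      rw [map_mul]
      congr 2
      apply Subtype.ext
      change sigma Fq Q L K (algebraMap L K b) = algebraMap L K (b ^ Fintype.card Fq)
      rw [sigma_algebraMap_right, map_pow])
  exact congrArg Cardinal.toNat this

/-- `σ` identifies the local rings at `σ(P)` and `P` and carries a uniformizer to a uniformizer. -/
theorem ord_sigma [IsCurveFunctionField L K] (P : CurvePoint L K) (z : K) :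
    P.ord (sigma Fq Q L K z) = (sigmaPoint Fq Q L P).ord z := by
  by_cases hP : P.IsClosedPoint
  swap
  · rw [CurvePoint.ord_of_not_isClosedPoint hP, CurvePoint.ord_of_not_isClosedPoint]
    rwa [isClosedPoint_sigmaPoint]
  by_cases hz : z = 0
  · simp [hz]
  obtain ⟨w, hw⟩ := hP.exists_irreducible
  have hw' : Irreducible ((sigmaRingEquiv Fq Q P).symm w) :=
    (MulEquiv.irreducible_iff (sigmaRingEquiv Fq Q P).symm).2 hw
  have h0 := (isClosedPoint_sigmaPoint (Fq := Fq) (Q := Q)).2 hP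
  have h1 := h0.eq_mul_ord (fun z => P.ord (sigma Fq Q L K z))
    (fun z z' hz hz' => by rw [map_mul]; exact P.ord_mul ((map_ne_zero _).2 hz) ((map_ne_zero _).2 hz'))
    (fun z _ hz hz' => P.ord_eq_zero hz (by rw [← map_inv₀]; exact hz')) hw' hz
  rw [h1, ← sigmaRingEquiv_apply, RingEquiv.apply_symm_apply, CurvePoint.ord_irreducible hw, one_mul]

/-- Over a finite field closed points lie above closed points, and between local rings of closed
points an inclusion is an equality. -/
theorem graphIdeal_eq_top [IsCurveFunctionField Fq Q] {c : Characteristic Fq Q L}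
    {P : CurvePoint L K} (hP : P.IsClosedPoint) (h : P.proj Fq Q ≠ c.point) :
    graphIdeal c P = ⊤ := by
  have := finite_functionField Fq Q L K
  rw [graphIdeal, if_neg]
  intro h'
  exact h (CurvePoint.eq_of_le h' hP.proj).symm

end Points

/-! ### Sums over the points above a point -/

section Sums

variable {Fq Q L K : Type u} [Field Fq] [Field Q] [Field L] [Field K]
  [Algebra Fq Q] [Algebra Fq L] [Algebra Fq K] [Algebra Q K] [Algebra L K]
  [IsScalarTower Fq Q K] [IsScalarTower Fq L K] [IsCurveFunctionField L K]

open Classical in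
variable (L K) in
/-- The points above a closed point `x`. -/
def pointsAbove (x : CurvePoint Fq Q) : Finset (CurvePoint L K) :=
  if h : x.IsClosedPoint then h.finite_fiber.toFinset else ∅

theorem mem_pointsAbove {x : CurvePoint Fq Q} (hx : x.IsClosedPoint) {P : CurvePoint L K} :
    P ∈ pointsAbove L K x ↔ P.proj Fq Q = x := by
  rw [pointsAbove, dif_pos hx, Set.Finite.mem_toFinset]
  rfl

/-- The degree of the part of a divisor which is supported above `x`. -/
def degAbove (x : CurvePoint Fq Q) (f : CurvePoint L K → ℤ) : ℤ :=
  ∑ P ∈ pointsAbove L K x, P.deg * f P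

variable {x : CurvePoint Fq Q}

theorem degAbove_add (f g : CurvePoint L K → ℤ) :
    degAbove x (fun P => f P + g P) = degAbove x f + degAbove x g := by
  simp only [degAbove, mul_add, Finset.sum_add_distrib]

theorem degAbove_sub (f g : CurvePoint L K → ℤ) :
    degAbove x (fun P => f P - g P) = degAbove x f - degAbove x g := by
  simp only [degAbove, mul_sub, Finset.sum_sub_distrib]

theorem degAbove_mul (m : ℤ) (f : CurvePoint L K → ℤ) :
    degAbove x (fun P => m * f P) = m * degAbove x f := by
  simp only [degAbove, Finset.mul_sum]
  exact Finset.sum_congr rfl fun P _ => by ring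

theorem degAbove_sum {ι : Type*} (s : Finset ι) (f : ι → CurvePoint L K → ℤ) :
    degAbove x (fun P => ∑ i ∈ s, f i P) = ∑ i ∈ s, degAbove x (f i) := by
  simp only [degAbove, Finset.mul_sum]
  exact Finset.sum_comm

theorem degAbove_congr (hx : x.IsClosedPoint) {f g : CurvePoint L K → ℤ}
    (h : ∀ P : CurvePoint L K, P.proj Fq Q = x → f P = g P) : degAbove x f = degAbove x g :=
  Finset.sum_congr rfl fun P hP => by rw [h P ((mem_pointsAbove hx).1 hP)]

theorem degAbove_nonneg (hx : x.IsClosedPoint) {f : CurvePoint L K → ℤ}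
    (h : ∀ P : CurvePoint L K, P.proj Fq Q = x → 0 ≤ f P) : 0 ≤ degAbove x f :=
  Finset.sum_nonneg fun P hP => mul_nonneg (Int.natCast_nonneg _) (h P ((mem_pointsAbove hx).1 hP))

theorem degAbove_eq_zero_iff (hx : x.IsClosedPoint) {f : CurvePoint L K → ℤ}
    (h : ∀ P : CurvePoint L K, P.proj Fq Q = x → 0 ≤ f P) :
    degAbove x f = 0 ↔ ∀ P : CurvePoint L K, P.proj Fq Q = x → f P = 0 := by
  rw [degAbove, Finset.sum_eq_zero_iff_of_nonneg
    fun P hP => mul_nonneg (Int.natCast_nonneg _) (h P ((mem_pointsAbove hx).1 hP))]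
  refine forall_congr' fun P => ?_
  rw [mem_pointsAbove hx]
  refine imp_congr_right fun hP => ?_
  have : (P.deg : ℤ) ≠ 0 := by
    exact_mod_cast (CurvePoint.isClosedPoint_of_proj (Fq := Fq) (Q := Q) (hP ▸ hx)).deg_pos.ne'
  exact mul_eq_zero_iff_left this

/-- `σ` permutes the finitely many points above `x` and preserves their degrees. -/
theorem degAbove_sigma [Fintype Fq] [IsBaseChangeFunctionField Fq Q L K] [Finite L]
    (f : CurvePoint L K → ℤ) :
    degAbove x (fun P => f (sigmaPoint Fq Q L P)) = degAbove x f := by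
  by_cases hx : x.IsClosedPoint
  swap
  · simp [degAbove, pointsAbove, hx]
  have hmaps : Set.MapsTo (sigmaPoint Fq Q L (K := K)) (pointsAbove L K x) (pointsAbove L K x) := by
    intro P hP
    rw [Finset.mem_coe, mem_pointsAbove hx] at hP ⊢
    rw [proj_sigmaPoint, hP]
  refine Finset.sum_nbij (sigmaPoint Fq Q L) hmaps (sigmaPoint_injective Fq Q).injOn
    (Finset.surjOn_of_injOn_of_card_le _ hmaps (sigmaPoint_injective Fq Q).injOn le_rfl) fun P _ => ?_
  rw [deg_sigmaPoint]

end Sums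

end

end TauSheaf

namespace TauSheaf

noncomputable section

/-! ### The dimensions of the cokernels of an image -/

set_option linter.unusedSectionVars false

/-! ### Determinants of semilinear maps -/

section SemilinearDet

open Module

variable {K V : Type*} [Field K] [AddCommGroup V] [Module K V] {s : K →+* K} (φ : V →ₛₗ[s] V)

theorem det_semilinear {ι : Type*} [Fintype ι] [DecidableEq ι] (b b' : Basis ι K V)
    (hb' : ∀ j, b' j = φ (b j)) (v : ι → V) : b'.det (fun j => φ (v j)) = s (b.det v) := by
  rw [Basis.det_apply, Basis.det_apply, RingHom.map_det]
  congr 1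
  ext i j
  rw [Basis.toMatrix_apply, RingHom.mapMatrix_apply, Matrix.map_apply, Basis.toMatrix_apply]
  conv_lhs => rw [← b.sum_repr (v j)]
  simp only [map_sum, LinearMap.map_smulₛₗ, ← hb', map_smul, Basis.repr_self, Finsupp.coe_finsetSum,
    Finset.sum_apply, Finsupp.smul_single, smul_eq_mul, mul_one]
  exact (Finset.sum_eq_single i (fun k _ hk => Finsupp.single_eq_of_ne hk.symm)
    (fun h => (h (Finset.mem_univ i)).elim)).trans Finsupp.single_eq_same

/-- The image of a basis under a semilinear map which preserves linear independence. -/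
theorem exists_semilinear_basis [FiniteDimensional K V]
    (hφ : ∀ (n : ℕ) (v : Fin n → V), LinearIndependent K v → LinearIndependent K (fun j => φ (v j)))
    (b : Basis (Fin (finrank K V)) K V) :
    ∃ b' : Basis (Fin (finrank K V)) K V, ∀ j, b' j = φ (b j) := by
  have h1 := hφ _ b b.linearIndependent
  exact ⟨Basis.mk h1 (h1.span_eq_top_of_card_eq_finrank' (by simp)).ge, fun j => Basis.mk_apply _ _ j⟩

end SemilinearDet

/-! ### Cokernel dimensions through divisors of determinants -/

section Counting

open Module

variable {Fq Q L K : Type u} [Field Fq] [Field Q] [Field L] [Field K]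
  [Algebra Fq Q] [Algebra Fq L] [Algebra Fq K] [Algebra Q K] [Algebra L K]
  [IsScalarTower Fq Q K] [IsScalarTower Fq L K]

/-- Measuring both lattices against one reference basis `b₀` turns indices into differences of
divisors, which telescope and can be summed over points. -/
theorem CurvePoint.relRank_quotient_of_eq_span [IsCurveFunctionField L K] {V : Type u}
    [AddCommGroup V] [Module K V] (P : CurvePoint L K) {n : ℕ} (b₀ b b' : Basis (Fin n) K V)
    {N N' : Submodule P.ring V} (hN : N = Submodule.span P.ring (Set.range b'))
    (hN' : N' = Submodule.span P.ring (Set.range b)) (hle : N ≤ N') :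
    0 ≤ P.ord (b₀.det b') - P.ord (b₀.det b) ∧
      relRank L P.ring (N' ⧸ N.submoduleOf N') =
        ((P.deg * (P.ord (b₀.det b') - P.ord (b₀.det b)).toNat : ℕ) : Cardinal) := by
  subst hN hN'
  have h1 := P.ord_det_trans b₀ b b'
  have h2 : P.ord (b₀.det b') - P.ord (b₀.det b) = P.ord (b.det b') := by omega
  rw [h2]
  exact ⟨CurvePoint.ord_nonneg (det_mem b b' fun i => hle (Submodule.subset_span ⟨i, rfl⟩)),
    P.relRank_span_quotient b b' hle⟩

theorem twistIdeal_eq_span [IsCurveFunctionField Fq Q] {x : CurvePoint Fq Q} (hx : x.IsClosedPoint)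
    {w : x.ring} (hw : Irreducible w) {P : CurvePoint L K} (hP : P.proj Fq Q = x) (n : ℕ) :
    twistIdeal n x P =
      Ideal.span {(⟨algebraMap Q K w, algebraMap_mem_ring hP w.2⟩ : P.ring) ^ n} := by
  have := hx.isDiscreteValuationRing
  have h1 : IsLocalRing.maximalIdeal x.ring ^ n = Ideal.span {w ^ n} := by
    rw [hw.maximalIdeal_eq, Ideal.span_singleton_pow]
  apply le_antisymm
  · rw [twistIdeal, Ideal.span_le]
    intro z hz
    obtain ⟨a, ha, hza⟩ := hz hP
    rw [h1, Ideal.mem_span_singleton] at ha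
    obtain ⟨u, rfl⟩ := ha
    rw [SetLike.mem_coe, Ideal.mem_span_singleton]
    refine ⟨⟨algebraMap Q K u, algebraMap_mem_ring hP u.2⟩, Subtype.ext ?_⟩
    rw [hza]
    change algebraMap Q K ((w : Q) ^ n * u) = algebraMap Q K w ^ n * algebraMap Q K u
    rw [map_mul, map_pow]
  · rw [Ideal.span_le, Set.singleton_subset_iff]
    refine Ideal.subset_span fun _ => ⟨w ^ n, ?_, ?_⟩
    · rw [h1]
      exact Ideal.mem_span_singleton_self _
    · change algebraMap Q K w ^ n = algebraMap Q K ((w : Q) ^ n)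
      rw [map_pow]

theorem cokerDim_eq_degAbove [IsCurveFunctionField L K] {V : Type u} [AddCommGroup V] [Module K V]
    {N N' : ∀ P : CurvePoint L K, Submodule P.ring V} {x : CurvePoint Fq Q} (hx : x.IsClosedPoint)
    {f : CurvePoint L K → ℤ} (hf : ∀ P, 0 ≤ f P)
    (h : ∀ P : CurvePoint L K, relRank L P.ring (N' P ⧸ (N P).submoduleOf (N' P)) =
      ((P.deg * (f P).toNat : ℕ) : Cardinal))
    (h0 : ∀ P : CurvePoint L K, P.proj Fq Q ≠ x → f P = 0) :
    0 ≤ degAbove x f ∧ cokerDim N N' = ((degAbove x f).toNat : Cardinal) := by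
  refine ⟨degAbove_nonneg hx fun P _ => hf P, ?_⟩
  rw [cokerDim_eq_sum, Cardinal.sum_eq_finset_sum.{u, u} _ (pointsAbove L K x) fun P hP => ?_]
  · simp only [h]
    rw [← Nat.cast_sum]
    congr 1
    zify
    rw [Int.toNat_of_nonneg (degAbove_nonneg hx fun P _ => hf P)]
    exact Finset.sum_congr rfl fun P _ => by rw [Int.toNat_of_nonneg (hf P)]
  · rw [mem_pointsAbove hx] at hP
    rw [h, h0 P hP, Int.toNat_zero, mul_zero, Nat.cast_zero]

variable [Fintype Fq] [IsBaseChangeFunctionField Fq Q L K]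
  {infty : CurvePoint Fq Q} {c : Characteristic Fq Q L}

namespace IsImageDatum

variable {F : AbelianTauSheaf K infty c} {V : Type u} [AddCommGroup V] [Module K V]
  {φ : V →ₛₗ[sigma Fq Q L K] V} {n : ℕ} {g : Fin n → ∀ i, (F.sheaf i).fiber →ₗ[K] V}

/-- `a` is the determinant of `φ` and `D i` is the divisor of the determinant of the `i`-th bundle,
with respect to a basis of `V`. -/
structure HasDet (h : IsImageDatum F φ g) (a : K) (D : ℤ → CurvePoint L K → ℤ) : Prop where
  ne_zero : a ≠ 0
  generic : ∀ i P, ¬ P.IsClosedPoint → D i P = 0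
  Pi_nonneg : ∀ i P, 0 ≤ D i P - D (i + 1) P
  Pi_rank : ∀ i (P : CurvePoint L K),
    relRank L P.ring (h.stalk (i + 1) P ⧸ (h.stalk i P).submoduleOf (h.stalk (i + 1) P)) =
      ((P.deg * (D i P - D (i + 1) P).toNat : ℕ) : Cardinal)
  tau_nonneg : ∀ i P, 0 ≤ P.ord a + D i (sigmaPoint Fq Q L P) - D (i + 1) P
  tau_rank : ∀ i (P : CurvePoint L K),
    relRank L P.ring (h.stalk (i + 1) P ⧸ (h.tauStalk i P).submoduleOf (h.stalk (i + 1) P)) =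
      ((P.deg * (P.ord a + D i (sigmaPoint Fq Q L P) - D (i + 1) P).toNat : ℕ) : Cardinal)
  periodic : ∀ k l, IsPeriodic F k l → ∀ i (P : CurvePoint L K), P.proj Fq Q = infty →
    ∀ w : infty.ring, Irreducible w →
      D i P - D (i + l) P = k * finrank K V * P.ord (algebraMap Q K w)

theorem stalk_mono (h : IsImageDatum F φ g) (i : ℤ) (m : ℕ) (P : CurvePoint L K) :
    h.stalk i P ≤ h.stalk (i + m) P := by
  induction m with
  | zero => simp
  | succ m ih =>
    refine ih.trans ((h.stalk_le (i + m) P).trans_eq ?_)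
    rw [Nat.cast_succ, add_assoc]

/-- Away from `∞` the twist is trivial, so the ascending chain returns to its start after `l` steps
and is constant. -/
theorem stalk_succ_le (h : IsImageDatum F φ g) {k l : ℕ} (hF : IsPeriodic F k l) (hl : 0 < l)
    (i : ℤ) {P : CurvePoint L K} (hP : P.proj Fq Q ≠ infty) :
    h.stalk (i + 1) P ≤ h.stalk i P := by
  have h1 : twistIdeal k infty P = ⊤ :=
    (Ideal.eq_top_iff_one _).2 (Ideal.subset_span fun h => (hP h).elim)
  rw [h.stalk_eq_smul hF i P, h1, Submodule.top_smul]
  obtain ⟨m, rfl⟩ : ∃ m, l = m + 1 := ⟨_, (Nat.succ_pred_eq_of_pos hl).symm⟩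
  refine (h.stalk_mono (i + 1) m P).trans_eq ?_
  rw [Nat.cast_succ, add_assoc, add_comm (1 : ℤ)]

variable [Finite L] [IsCurveFunctionField Fq Q] [IsCurveFunctionField L K] [FiniteDimensional K V]

/-- With a reference basis `b₀` of `V`, `a` is the determinant of `φ` and `D i P` is the order at
`P` of the determinant of a local basis of the `i`-th bundle. -/
theorem exists_hasDet (h : IsImageDatum F φ g) (hinf : infty.IsClosedPoint) :
    ∃ a D, h.HasDet a D := by
  have h1 := fun i P => (h.bundle i).locallyFree P
  choose b hb _ using h1
  have hb : ∀ i P, h.stalk i P = Submodule.span P.ring (Set.range (b i P)) := hb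
  let b₀ : Basis (Fin (finrank K V)) K V := Module.finBasis K V
  obtain ⟨b₁, hb₁⟩ := exists_semilinear_basis φ h.linearIndependent b₀
  -- The image under `φ` of a local basis at `σ(P)` generates the image of `τ` at `P`; its
  -- determinant is `a` times the `σ`-transform of the old one.
  choose bt hbt using fun i P => exists_semilinear_basis φ h.linearIndependent
    (b i (sigmaPoint Fq Q L P))
  have ht : ∀ i P, h.tauStalk i P = Submodule.span P.ring (Set.range (bt i P)) := by
    intro i P
    rw [tauStalk, hb, span_image_sigma, ← Set.range_comp]
    congr 2
    exact funext fun j => (hbt i P j).symm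
  have hdet : ∀ i P, P.ord (b₀.det (bt i P)) = P.ord (b₀.det b₁) +
      (sigmaPoint Fq Q L P).ord (b₀.det (b i (sigmaPoint Fq Q L P))) := by
    intro i P
    rw [P.ord_det_trans b₀ b₁, show (bt i P : Fin (finrank K V) → V) = fun j =>
      φ (b i (sigmaPoint Fq Q L P) j) from funext (hbt i P), det_semilinear φ b₀ b₁ hb₁, ord_sigma]
  have hPi := fun i (P : CurvePoint L K) => P.relRank_quotient_of_eq_span b₀ (b (i + 1) P) (b i P) (hb i P)
    (hb (i + 1) P) (h.stalk_le i P)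
  have htau := fun i (P : CurvePoint L K) => P.relRank_quotient_of_eq_span b₀ (b (i + 1) P) (bt i P) (ht i P)
    (hb (i + 1) P) (h.tauStalk_le i P)
  simp only [hdet] at htau
  refine ⟨b₀.det b₁, fun i P => P.ord (b₀.det (b i P)), det_basis_ne_zero _ _,
    fun _ _ hP => CurvePoint.ord_of_not_isClosedPoint hP _, fun i P => (hPi i P).1, fun i P => (hPi i P).2, fun i P => (htau i P).1,
    fun i P => (htau i P).2, fun k l hF i P hP w hw => ?_⟩
  have hw0 : algebraMap Q K w ≠ 0 := by
    rw [map_ne_zero]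
    exact_mod_cast hw.ne_zero
  -- Above `∞` the `i`-th stalk is `w ^ k` times the stalk of index `i + l`; scaling all basis
  -- vectors gives the contribution `k · rank · ord w`.
  let bs : Basis (Fin (finrank K V)) K V := (b (i + l) P).isUnitSMul
    (w := fun _ => algebraMap Q K w ^ k) fun _ => (pow_ne_zero k hw0).isUnit
  have hbs : (bs : Fin (finrank K V) → V) = fun j => algebraMap Q K w ^ k • b (i + l) P j :=
    funext fun j => Basis.isUnitSMul_apply _ j
  have h2 : Submodule.span P.ring (Set.range (b i P)) = Submodule.span P.ring (Set.range bs) := by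
    rw [← hb, h.stalk_eq_smul hF, twistIdeal_eq_span hinf hw hP, hb, Submodule.span_smul_span, hbs]
    congr 1
    ext v
    rw [Set.singleton_smul]
    constructor
    · rintro ⟨_, ⟨j, rfl⟩, rfl⟩
      exact ⟨j, rfl⟩
    · rintro ⟨j, rfl⟩
      exact ⟨_, ⟨j, rfl⟩, rfl⟩
  have h3 := P.ord_det_trans b₀ bs (b i P)
  rw [P.ord_det_eq_zero h2.symm, add_zero, hbs, AlternatingMap.map_smul_univ, Finset.prod_const,
    smul_eq_mul, P.ord_mul (pow_ne_zero _ (pow_ne_zero _ hw0)) (det_basis_ne_zero _ _),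
    P.ord_pow (pow_ne_zero _ hw0), P.ord_pow hw0, Finset.card_univ, Fintype.card_fin] at h3
  dsimp only
  rw [h3]
  ring

namespace HasDet

variable {h : IsImageDatum F φ g} {a : K} {D : ℤ → CurvePoint L K → ℤ}

theorem Pi_eq (hD : h.HasDet a D) {k l : ℕ} (hF : IsPeriodic F k l)
    (hl : 0 < l) (i : ℤ) {P : CurvePoint L K} (hP : P.proj Fq Q ≠ infty) :
    D i P - D (i + 1) P = 0 := by
  by_cases hPc : P.IsClosedPoint
  swap
  · rw [hD.generic _ _ hPc, hD.generic _ _ hPc, sub_zero]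
  have h1 := hD.Pi_rank i P
  rw [relRank_quotient_eq_zero_of_le (h.stalk_succ_le hF hl i hP)] at h1
  have h2 : P.deg * (D i P - D (i + 1) P).toNat = 0 := by exact_mod_cast h1.symm
  have h3 := (mul_eq_zero.1 h2).resolve_left hPc.deg_pos.ne'
  have := hD.Pi_nonneg i P
  omega

theorem tau_eq (hD : h.HasDet a D) (i : ℤ) {P : CurvePoint L K} (hP : P.proj Fq Q ≠ c.point) :
    P.ord a + D i (sigmaPoint Fq Q L P) - D (i + 1) P = 0 := by
  by_cases hPc : P.IsClosedPoint
  swap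
  · rw [hD.generic _ _ hPc, hD.generic _ _ (by rwa [isClosedPoint_sigmaPoint]),
      CurvePoint.ord_of_not_isClosedPoint hPc, add_zero, sub_zero]
  have h1 := hD.tau_rank i P
  rw [relRank_quotient_eq_zero_of_le
    (h.tauStalk_eq_of_graphIdeal i (graphIdeal_eq_top hPc hP)).ge] at h1
  have h2 : P.deg * (P.ord a + D i (sigmaPoint Fq Q L P) - D (i + 1) P).toNat = 0 := by
    exact_mod_cast h1.symm
  have h3 := (mul_eq_zero.1 h2).resolve_left hPc.deg_pos.ne'
  have := hD.tau_nonneg i P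
  omega

variable {k l : ℕ}

theorem degAbove_Pi_eq_zero (hD : h.HasDet a D) (hF : IsPeriodic F k l) (hl : 0 < l) (i : ℤ)
    {x : CurvePoint Fq Q} (hx : x.IsClosedPoint) (hx' : x ≠ infty) :
    degAbove x (D i) - degAbove x (D (i + 1)) = 0 := by
  rw [← degAbove_sub, degAbove_eq_zero_iff hx fun P _ => hD.Pi_nonneg i P]
  exact fun P hP => hD.Pi_eq hF hl i (hP ▸ hx')

/-- Summing over all points above `x` makes the shift by `σ` disappear. -/
theorem degAbove_tau (i : ℤ) (x : CurvePoint Fq Q) :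
    degAbove x (fun P : CurvePoint L K => P.ord a + D i (sigmaPoint Fq Q L P) - D (i + 1) P) =
      degAbove x (fun P : CurvePoint L K => P.ord a) + (degAbove x (D i) - degAbove x (D (i + 1))) := by
  rw [degAbove_sub, degAbove_add, degAbove_sigma]
  ring

theorem degAbove_tau_eq_zero (hD : h.HasDet a D) (i : ℤ)
    {x : CurvePoint Fq Q} (hx : x.IsClosedPoint) (hx' : x ≠ c.point) :
    degAbove x (fun P : CurvePoint L K => P.ord a) + (degAbove x (D i) - degAbove x (D (i + 1))) = 0 := by
  rw [← degAbove_tau (a := a) (D := D), degAbove_eq_zero_iff hx fun P _ => hD.tau_nonneg i P]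
  exact fun P hP => hD.tau_eq i (hP ▸ hx')

/-- Here `ε ≠ ∞` is used: `τ` is an isomorphism above `∞`, so the drop of degree from `D i` to `D (i
+ 1)` there is minus the degree of `det φ`. In particular it does not depend on `i`. -/
theorem cokerDim_Pi (hD : h.HasDet a D) (hF : IsPeriodic F k l) (hl : 0 < l)
    (hinf : infty.IsClosedPoint) (hc : c.point ≠ infty) (i : ℤ) :
    0 ≤ -degAbove infty (fun P : CurvePoint L K => P.ord a) ∧ cokerDim (h.stalk i) (h.stalk (i + 1)) =
      ((-degAbove infty (fun P : CurvePoint L K => P.ord a)).toNat : Cardinal) := by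
  have h1 := cokerDim_eq_degAbove hinf (N := h.stalk i) (N' := h.stalk (i + 1)) (hD.Pi_nonneg i)
    (hD.Pi_rank i) fun P hP => hD.Pi_eq hF hl i hP
  have h2 := hD.degAbove_tau_eq_zero i hinf hc.symm
  rw [degAbove_sub, show degAbove infty (D i) - degAbove infty (D (i + 1)) =
    -degAbove infty (fun P : CurvePoint L K => P.ord a) by linarith] at h1
  exact h1

/-- Above `ε ≠ ∞` the bundles do not change with `i`, so only the divisor of `det φ` contributes. -/
theorem cokerDim_tau (hD : h.HasDet a D) (hF : IsPeriodic F k l) (hl : 0 < l)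
    (hc : c.point ≠ infty) (i : ℤ) :
    0 ≤ degAbove c.point (fun P : CurvePoint L K => P.ord a) ∧ cokerDim (h.tauStalk i) (h.stalk (i + 1)) =
      ((degAbove c.point (fun P : CurvePoint L K => P.ord a)).toNat : Cardinal) := by
  have h1 := cokerDim_eq_degAbove c.isClosedPoint (N := h.tauStalk i) (N' := h.stalk (i + 1))
    (hD.tau_nonneg i) (hD.tau_rank i) fun P hP => hD.tau_eq i hP
  rw [degAbove_tau (a := a) (D := D), hD.degAbove_Pi_eq_zero hF hl i c.isClosedPoint hc, add_zero] at h1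
  exact h1

theorem degAbove_eq_zero (hD : h.HasDet a D) (hF : IsPeriodic F k l) (hl : 0 < l)
    {x : CurvePoint Fq Q} (hx : x.IsClosedPoint) (h1 : x ≠ infty) (h2 : x ≠ c.point) :
    degAbove x (fun P : CurvePoint L K => P.ord a) = 0 := by
  have h3 := hD.degAbove_Pi_eq_zero hF hl 0 hx h1
  have h4 := hD.degAbove_tau_eq_zero 0 hx h2
  rwa [h3, add_zero] at h4

/-- The drop of degree above `∞` in `l` steps is computed twice: step by step from `det φ`, and at
once from the periodicity. -/
theorem degAbove_infty (hD : h.HasDet a D) (hF : IsPeriodic F k l)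
    (hinf : infty.IsClosedPoint) (hc : c.point ≠ infty) {w : infty.ring} (hw : Irreducible w) :
    -(l * degAbove infty (fun P : CurvePoint L K => P.ord a)) = k * finrank K V *
      degAbove infty (fun P : CurvePoint L K => P.ord (algebraMap Q K w)) := by
  have h1 : ∀ m : ℕ, degAbove infty (D 0) - degAbove infty (D (0 + m)) =
      -(m * degAbove infty (fun P : CurvePoint L K => P.ord a)) := by
    intro m
    induction m with
    | zero => simp
    | succ m ih =>
      have h2 := hD.degAbove_tau_eq_zero (0 + m) hinf hc.symm
      rw [add_assoc] at h2
      push_cast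
      linarith
  rw [← h1, ← degAbove_sub, ← degAbove_mul]
  exact degAbove_congr hinf fun P hP => hD.periodic k l hF 0 P hP w hw

end HasDet

end IsImageDatum

/-! ### The product formula -/

variable (Fq Q L) in
-- `y` is the norm, the product of the conjugates of `a` under the powers of `σ`. Each conjugate has
-- the same degree above `x`.
theorem exists_norm [Finite L] [IsCurveFunctionField Fq Q]
    [IsCurveFunctionField L K] {a : K} (ha : a ≠ 0) :
    ∃ y : Q, y ≠ 0 ∧ ∀ x : CurvePoint Fq Q,
      degAbove x (fun P : CurvePoint L K => P.ord (algebraMap Q K y)) =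
        sigmaOrder Fq Q L K * degAbove x (fun P : CurvePoint L K => P.ord a) := by
  obtain ⟨y, hy⟩ : ∏ j : Fin (sigmaOrder Fq Q L K), (sigmaEquiv Fq Q L K ^ (j : ℕ)) a ∈
      (algebraMap Q K).range := by
    apply mem_range_of_sigma_eq Fq Q L K
    obtain ⟨e, he⟩ : ∃ e, sigmaOrder Fq Q L K = e + 1 :=
      ⟨_, (Nat.succ_pred_eq_of_pos (sigmaOrder_pos Fq Q L K)).symm⟩
    have h := sigmaEquiv_pow_sigmaOrder Fq Q L K
    rw [map_prod, he] at *
    rw [Fin.prod_univ_castSucc, Fin.prod_univ_succ, mul_comm]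
    congr 1
    · simp only [Fin.val_last, Fin.val_zero, pow_zero]
      rw [← sigmaEquiv_apply, ← RingAut.mul_apply, ← pow_succ', h]
    · refine Finset.prod_congr rfl fun j _ => ?_
      rw [← sigmaEquiv_apply, ← RingAut.mul_apply, ← pow_succ']
      rfl
  have h0 : ∀ j : ℕ, (sigmaEquiv Fq Q L K ^ j) a ≠ 0 := fun j =>
    (map_ne_zero_iff _ (RingEquiv.injective _)).2 ha
  refine ⟨y, fun h => ?_, fun x => ?_⟩
  · rw [h, map_zero, eq_comm, Finset.prod_eq_zero_iff] at hy
    obtain ⟨j, -, hj⟩ := hy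
    exact h0 j hj
  · have h1 : ∀ j : ℕ, degAbove x (fun P : CurvePoint L K => P.ord ((sigmaEquiv Fq Q L K ^ j) a)) =
        degAbove x (fun P : CurvePoint L K => P.ord a) := by
      intro j
      induction j with
      | zero => rfl
      | succ j ih =>
        rw [← ih, ← degAbove_sigma (fun P : CurvePoint L K => P.ord ((sigmaEquiv Fq Q L K ^ j) a))]
        simp only [pow_succ', RingAut.mul_apply, sigmaEquiv_apply, ord_sigma]
    simp only [hy, CurvePoint.ord_prod _ Finset.univ
      (fun j : Fin (sigmaOrder Fq Q L K) => (sigmaEquiv Fq Q L K ^ (j : ℕ)) a) fun j _ => h0 j]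
    rw [degAbove_sum, Finset.sum_congr rfl fun (j : Fin (sigmaOrder Fq Q L K)) _ => h1 j]
    simp

/-- For a function coming from `C`, the orders at the points above `x` are positive multiples of one
integer, so no cancellation occurs in the sum. -/
theorem ord_eq_zero_of_degAbove_eq_zero [Finite L] [IsCurveFunctionField Fq Q]
    [IsCurveFunctionField L K] {x : CurvePoint Fq Q} (hx : x.IsClosedPoint) {y : Q} (hy : y ≠ 0)
    (h : degAbove x (fun P : CurvePoint L K => P.ord (algebraMap Q K y)) = 0) {P : CurvePoint L K}
    (hP : P.proj Fq Q = x) : P.ord (algebraMap Q K y) = 0 := by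
  rcases le_total 0 (x.ord y) with h0 | h0
  · refine (degAbove_eq_zero_iff hx fun P hP => ?_).1 h P hP
    subst hP
    obtain ⟨e, -, he⟩ := CurvePoint.IsClosedPoint.exists_ramification hx
    rw [he y hy]
    positivity
  · have h' := congrArg (fun z : ℤ => -1 * z) h
    rw [← degAbove_mul, mul_zero] at h'
    have := (degAbove_eq_zero_iff hx fun P hP => ?_).1 h' P hP
    · linarith
    · subst hP
      obtain ⟨e, -, he⟩ := CurvePoint.IsClosedPoint.exists_ramification hx
      rw [he y hy]
      nlinarith [Int.natCast_nonneg e]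

/-- A function on `C` whose zeros and poles lie above one point is constant on `C_L`. -/
theorem ord_eq_zero_of_forall_ne [Finite L] [IsCurveFunctionField Fq Q]
    [IsCurveFunctionField L K] {x : CurvePoint Fq Q} (hx : x.IsClosedPoint) {y : Q} (hy : y ≠ 0)
    (h : ∀ P : CurvePoint L K, P.proj Fq Q ≠ x → P.ord (algebraMap Q K y) = 0)
    (P : CurvePoint L K) : P.ord (algebraMap Q K y) = 0 := by
  have hy' : algebraMap Q K y ≠ 0 := (map_ne_zero _).2 hy
  -- A function without poles is constant and so has no zeros either. The sign of the order of `y`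
  -- at `x` decides whether this applies to `y` or to its inverse.
  have hconst : ∀ z : K, z ≠ 0 → (∀ P : CurvePoint L K, 0 ≤ P.ord z) →
      ∀ P : CurvePoint L K, P.ord z = 0 := by
    intro z hz hz' P
    obtain ⟨b, rfl⟩ := mem_range_algebraMap_of_forall_mem (k := L) (z := z) fun P => by
      by_cases hP : P.IsClosedPoint
      · exact CurvePoint.mem_ring_of_ord_nonneg hP (hz' P)
      · rw [not_not.1 hP]
        trivial
    exact P.ord_eq_zero (P.const_mem b) (by rw [← map_inv₀]; exact P.const_mem _)
  rcases le_total 0 (x.ord y) with h0 | h0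
  · refine hconst _ hy' (fun P => ?_) P
    by_cases hP : P.proj Fq Q = x
    · subst hP
      obtain ⟨e, -, he⟩ := CurvePoint.IsClosedPoint.exists_ramification hx
      rw [he y hy]
      positivity
    · exact (h P hP).ge
  · have h1 := hconst _ (inv_ne_zero hy') (fun P => ?_) P
    · rw [CurvePoint.ord_inv] at h1
      linarith
    · rw [CurvePoint.ord_inv]
      by_cases hP : P.proj Fq Q = x
      · subst hP
        obtain ⟨e, -, he⟩ := CurvePoint.IsClosedPoint.exists_ramification hx
        rw [he y hy]
        nlinarith [Int.natCast_nonneg e]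
      · rw [h P hP, neg_zero]

/-- For the norms `y`, `y'` of `a`, `a'`, the function `y' ^ m / y ^ m'` has degree zero above every
closed point other than `x`: above `x'` by the choice of exponents. Hence it has no zeros or poles
off `x`, so none at all. This replaces the theorem that principal divisors have degree zero. -/
theorem degAbove_mul_degAbove [Finite L] [IsCurveFunctionField Fq Q]
    [IsCurveFunctionField L K] {x x' : CurvePoint Fq Q} (hx : x.IsClosedPoint)
    {a a' : K} (ha : a ≠ 0) (ha' : a' ≠ 0) {m m' : ℕ}
    (hm : degAbove x' (fun P : CurvePoint L K => P.ord a) = m)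
    (hm' : degAbove x' (fun P : CurvePoint L K => P.ord a') = m')
    (h : ∀ y : CurvePoint Fq Q, y.IsClosedPoint → y ≠ x → y ≠ x' →
      degAbove y (fun P : CurvePoint L K => P.ord a) = 0)
    (h' : ∀ y : CurvePoint Fq Q, y.IsClosedPoint → y ≠ x → y ≠ x' →
      degAbove y (fun P : CurvePoint L K => P.ord a') = 0) :
    m * degAbove x (fun P : CurvePoint L K => P.ord a') =
      m' * degAbove x (fun P : CurvePoint L K => P.ord a) := by
  obtain ⟨y, hy0, hy⟩ := exists_norm Fq Q L ha
  obtain ⟨y', hy0', hy'⟩ := exists_norm Fq Q L ha'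
  have he : (sigmaOrder Fq Q L K : ℤ) ≠ 0 := by exact_mod_cast (sigmaOrder_pos Fq Q L K).ne'
  have hz0 : y' ^ m * (y ^ m')⁻¹ ≠ 0 := mul_ne_zero (pow_ne_zero _ hy0') (inv_ne_zero (pow_ne_zero _ hy0))
  have h1 : ∀ z : CurvePoint Fq Q, degAbove z
      (fun P : CurvePoint L K => P.ord (algebraMap Q K (y' ^ m * (y ^ m')⁻¹))) =
      sigmaOrder Fq Q L K * (m * degAbove z (fun P : CurvePoint L K => P.ord a') -
        m' * degAbove z (fun P : CurvePoint L K => P.ord a)) := by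
    intro z
    have h2 : ∀ P : CurvePoint L K, P.ord (algebraMap Q K (y' ^ m * (y ^ m')⁻¹)) =
        m * P.ord (algebraMap Q K y') - m' * P.ord (algebraMap Q K y) := by
      intro P
      have i1 : algebraMap Q K y ≠ 0 := (map_ne_zero _).2 hy0
      have i2 : algebraMap Q K y' ≠ 0 := (map_ne_zero _).2 hy0'
      rw [map_mul, map_inv₀, map_pow, map_pow,
        P.ord_mul (pow_ne_zero _ i2) (inv_ne_zero (pow_ne_zero _ i1)), P.ord_inv, P.ord_pow i1,
        P.ord_pow i2, sub_eq_add_neg]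
    simp only [h2]
    rw [degAbove_sub, degAbove_mul, degAbove_mul, hy, hy']
    ring
  have h2 := ord_eq_zero_of_forall_ne (L := L) (K := K) hx hz0 fun P hP => by
    by_cases hPc : P.IsClosedPoint
    swap
    · exact CurvePoint.ord_of_not_isClosedPoint hPc _
    have := finite_functionField Fq Q L K
    refine ord_eq_zero_of_degAbove_eq_zero (hPc.proj (Fq := Fq) (Q := Q)) hz0 ?_ rfl
    rw [h1]
    by_cases hPx : P.proj Fq Q = x'
    · rw [hPx, hm, hm']
      ring
    · rw [h _ hPc.proj hP hPx, h' _ hPc.proj hP hPx]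
      ring
  have h3 := h1 x
  simp only [h2] at h3
  rw [show degAbove x (fun _ : CurvePoint L K => 0) = 0 by simp [degAbove], eq_comm,
    mul_eq_zero, sub_eq_zero] at h3
  exact h3.resolve_left he

namespace IsImageDatum

variable [Finite L] [IsCurveFunctionField Fq Q] [IsCurveFunctionField L K]
  {F : AbelianTauSheaf K infty c} {V : Type u} [AddCommGroup V] [Module K V]
  {φ : V →ₛₗ[sigma Fq Q L K] V} {n : ℕ} {g : Fin n → ∀ i, (F.sheaf i).fiber →ₗ[K] V}
  [FiniteDimensional K V]

theorem cokerDim_eq_zero_of_subsingleton [Subsingleton V]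
    (N N' : ∀ P : CurvePoint L K, Submodule P.ring V) : cokerDim N N' = 0 := by
  rw [cokerDim_eq_sum]
  have : (fun P : CurvePoint L K => relRank L P.ring (N' P ⧸ (N P).submoduleOf (N' P))) =
      fun _ => 0 := funext fun P => relRank_eq_zero_of_subsingleton
  rw [this]
  simp

/-- If the characteristic is not at infinity, the image of an abelian `τ`-sheaf has the right
invariants. -/
theorem exists_dim (h : IsImageDatum F φ g) (hinf : infty.IsClosedPoint) (hc : c.point ≠ infty) :
    ∃ k l d : ℕ, 0 < k ∧ 0 < l ∧ IsPeriodic F k l ∧ l * d = k * finrank K V ∧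
      (∀ i, cokerDim (h.stalk i) (h.stalk (i + 1)) = d) ∧
      ∀ i, cokerDim (h.tauStalk i) (h.stalk (i + 1)) = d := by
  obtain ⟨k, l, hk, hl, hr, hF⟩ := F.periodic
  -- Rank zero is separate because the comparison below divides by the rank and the dimension of
  -- `F`.
  rcases Nat.eq_zero_or_pos F.rank with h0 | h0
  · have h1 : Subsingleton (F.sheaf 0).fiber := by
      rw [← finrank_zero_iff (R := K), F.finrank_fiber, h0]
    have h2 : Subsingleton V := by
      have h3 := h.top 0
      have h4 : ∀ j, LinearMap.range (g j 0) = ⊥ := fun j => by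
        rw [LinearMap.range_eq_bot]
        exact LinearMap.ext fun v => by rw [Subsingleton.elim v 0, map_zero, map_zero]
      simp only [h4, iSup_bot] at h3
      exact (Submodule.subsingleton_iff K).1 (subsingleton_of_bot_eq_top h3)
    refine ⟨k, l, 0, hk, hl, hF, ?_, fun i => ?_, fun i => ?_⟩
    · rw [finrank_zero_of_subsingleton, mul_zero, mul_zero]
    · exact (cokerDim_eq_zero_of_subsingleton _ _).trans Nat.cast_zero.symm
    · exact (cokerDim_eq_zero_of_subsingleton _ _).trans Nat.cast_zero.symm
  · obtain ⟨a, D, hD⟩ := F.selfDatum.exists_hasDet hinf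
    obtain ⟨a', D', hD'⟩ := h.exists_hasDet hinf
    obtain ⟨w, hw⟩ := hinf.exists_irreducible
    obtain ⟨n1, e1⟩ := hD.cokerDim_Pi hF hl hinf hc 0
    obtain ⟨n2, e2⟩ := hD.cokerDim_tau hF hl hc 0
    have n3 := (hD'.cokerDim_Pi hF hl hinf hc 0).1
    have n4 := (hD'.cokerDim_tau hF hl hc 0).1
    rw [F.cokerDim_stalk] at e1
    rw [F.cokerDim_tauStalk] at e2
    have e1' : F.dim = (-degAbove infty (fun P : CurvePoint L K => P.ord a)).toNat := by
      exact_mod_cast e1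
    have e2' : F.dim = (degAbove c.point (fun P : CurvePoint L K => P.ord a)).toNat := by
      exact_mod_cast e2
    have e3 := hD.degAbove_infty hF hinf hc hw
    have e4 := hD'.degAbove_infty hF hinf hc hw
    have e5 : degAbove infty (fun P : CurvePoint L K => P.ord a) = -F.dim := by omega
    have e6 : degAbove c.point (fun P : CurvePoint L K => P.ord a) = F.dim := by omega
    have hr' : (l * F.dim : ℤ) = k * F.rank := by exact_mod_cast hr
    have hk' : (0 : ℤ) < k := by exact_mod_cast hk
    have hl' : (0 : ℤ) < l := by exact_mod_cast hl
    have h0' : (0 : ℤ) < F.rank := by exact_mod_cast h0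
    have hd' : (0 : ℤ) < F.dim := pos_of_mul_pos_right (hr' ▸ mul_pos hk' h0') hl'.le
    -- The degree above `∞` of a uniformizer at `∞` need not be computed: the relation `l d = k r`
    -- for `F` itself forces it to be `1`.
    have e7 : degAbove infty (fun P : CurvePoint L K => P.ord (algebraMap Q K w)) = 1 := by
      rw [e5, F.finrank_fiber] at e3
      have : (k * F.rank : ℤ) ≠ 0 := (mul_pos hk' h0').ne'
      apply mul_left_cancel₀ this
      rw [← e3, ← hr']
      ring
    -- `det φ` of `F` has degree `d` above `ε` and `-d` above `∞`. The product formula transfers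
    -- this balance to the determinant of the image.
    have e8 := degAbove_mul_degAbove hinf hD.ne_zero hD'.ne_zero e6
      (Int.toNat_of_nonneg n4).symm (fun y hy h1 h2 => hD.degAbove_eq_zero hF hl hy h1 h2)
      (fun y hy h1 h2 => hD'.degAbove_eq_zero hF hl hy h1 h2)
    rw [Int.toNat_of_nonneg n4, e5] at e8
    have e9 : degAbove c.point (fun P : CurvePoint L K => P.ord a') =
        -degAbove infty (fun P : CurvePoint L K => P.ord a') := by
      apply mul_left_cancel₀ hd'.ne'
      linarith
    refine ⟨k, l, (-degAbove infty (fun P : CurvePoint L K => P.ord a')).toNat, hk, hl, hF, ?_,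
      fun i => (hD'.cokerDim_Pi hF hl hinf hc i).2, fun i => ?_⟩
    · zify
      rw [Int.toNat_of_nonneg n3, ← mul_one (k * finrank K V : ℤ), ← e7, ← e4]
      ring
    · rw [← e9]
      exact (hD'.cokerDim_tau hF hl hc i).2

/-- The image of an abelian `τ`-sheaf, if the characteristic is not at infinity. -/
def imageSheaf (h : IsImageDatum F φ g) (hinf : infty.IsClosedPoint) (hc : c.point ≠ infty) :
    AbelianTauSheaf K infty c :=
  have H := (h.exists_dim hinf hc).choose_spec.choose_spec.choose_spec
  h.sheaf H.1 H.2.1 H.2.2.1 H.2.2.2.1 H.2.2.2.2.1 H.2.2.2.2.2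

end IsImageDatum

end Counting

end

end TauSheaf

namespace TauSheaf

noncomputable section

/-! ### Semilinear maps -/

set_option linter.unusedSectionVars false

section Semilinear

open Module

variable {Fq Q L K : Type u} [Field Fq] [Field Q] [Field L] [Field K]
  [Algebra Fq Q] [Algebra Fq L] [Algebra Fq K] [Algebra Q K] [Algebra L K]
  [IsScalarTower Fq Q K] [IsScalarTower Fq L K] [Fintype Fq] [IsBaseChangeFunctionField Fq Q L K]
  [Finite L]
  {V V' : Type u} [AddCommGroup V] [Module K V] [AddCommGroup V'] [Module K V']

theorem linearIndependent_of_injective {φ : V →ₛₗ[sigma Fq Q L K] V} (hφ : Function.Injective φ)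
    (n : ℕ) (v : Fin n → V) (hv : LinearIndependent K v) : LinearIndependent K (fun j => φ (v j)) :=
  hv.map_of_surjective_injective (sigma Fq Q L K) φ.toAddMonoidHom (sigma_bijective Fq Q L K).2
    ((injective_iff_map_eq_zero φ.toAddMonoidHom).1 hφ) fun r m => φ.map_smulₛₗ r m

theorem bijective_of_linearIndependent [FiniteDimensional K V] {φ : V →ₛₗ[sigma Fq Q L K] V}
    (hφ : ∀ (n : ℕ) (v : Fin n → V), LinearIndependent K v →
      LinearIndependent K (fun j => φ (v j))) : Function.Bijective φ := by
  constructor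
  · rw [injective_iff_map_eq_zero]
    intro v hv
    by_contra h
    have h1 := hφ 1 (fun _ => v) (linearIndependent_unique_iff.2 h)
    exact linearIndependent_unique_iff.1 h1 hv
  · intro w
    obtain ⟨b, hb⟩ := exists_semilinear_basis φ hφ (finBasis K V)
    choose s hs using (sigma_bijective Fq Q L K).2
    refine ⟨∑ j, s (b.repr w j) • finBasis K V j, ?_⟩
    rw [map_sum]
    conv_rhs => rw [← b.sum_repr w]
    refine Finset.sum_congr rfl fun j _ => ?_
    rw [LinearMap.map_smulₛₗ, hs, hb]

/-- Images of a basis span, hence are independent by counting; the coefficients of a kernel vector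
are then killed by the injective map `σ`. -/
theorem injective_of_surjective_semilinear [FiniteDimensional K V] {φ : V →ₛₗ[sigma Fq Q L K] V}
    (hφ : Function.Surjective φ) : Function.Injective φ := by
  let b := finBasis K V
  have h1 : LinearIndependent K (fun j => φ (b j)) := by
    refine linearIndependent_of_top_le_span_of_card_eq_finrank (fun w _ => ?_) (Fintype.card_fin _)
    obtain ⟨v, rfl⟩ := hφ w
    rw [← b.sum_repr v, map_sum]
    refine sum_mem fun j _ => ?_
    rw [LinearMap.map_smulₛₗ]
    exact Submodule.smul_mem _ _ (Submodule.subset_span ⟨j, rfl⟩)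
  rw [injective_iff_map_eq_zero]
  intro v hv
  rw [← b.sum_repr v, map_sum] at hv
  simp only [LinearMap.map_smulₛₗ] at hv
  have h2 := Fintype.linearIndependent_iff.1 h1 _ hv
  rw [← b.sum_repr v]
  exact Finset.sum_eq_zero fun j _ => by rw [(map_eq_zero _).1 (h2 j), zero_smul]

/-! ### Averages -/

theorem iterate_smul {H : Type*} [AddCommGroup H] [Module K H] {Ψ : H →+ H}
    (hΨ : ∀ (a : K) f, Ψ (a • f) = sigma Fq Q L K a • Ψ f) (j : ℕ) (a : K) (f : H) :
    Ψ^[j] (a • f) = (sigmaEquiv Fq Q L K ^ j) a • Ψ^[j] f := by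
  induction j with
  | zero => rfl
  | succ j ih =>
    rw [Function.iterate_succ_apply', ih, hΨ, Function.iterate_succ_apply', pow_succ',
      RingAut.mul_apply, sigmaEquiv_apply]

variable (Fq Q L K) in
/-- The sum over the orbit under a semilinear automorphism whose order divides the order of `σ`. -/
def orbitSum {H : Type*} [AddCommGroup H] (Ψ : H →+ H) (f : H) : H :=
  ∑ j : Fin (sigmaOrder Fq Q L K), Ψ^[j] f

/-- When `f` is fixed by the `e`-th iterate, `Ψ` only permutes the summands cyclically. The scalar
`a` does no harm, because `σ ^ e = 1`. -/
theorem map_orbitSum {H : Type*} [AddCommGroup H] [Module K H] {Ψ : H →+ H}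
    (hΨ : ∀ (a : K) f, Ψ (a • f) = sigma Fq Q L K a • Ψ f) {f : H}
    (hf : Ψ^[sigmaOrder Fq Q L K] f = f) (a : K) :
    Ψ (orbitSum Fq Q L K Ψ (a • f)) = orbitSum Fq Q L K Ψ (a • f) := by
  have h1 : Ψ^[sigmaOrder Fq Q L K] (a • f) = a • f := by
    rw [iterate_smul hΨ, hf, sigmaEquiv_pow_sigmaOrder]
    rfl
  rw [orbitSum, map_sum, Fin.sum_univ_eq_sum_range (fun j => Ψ^[j] (a • f)),
    Fin.sum_univ_eq_sum_range (fun j => Ψ (Ψ^[j] (a • f)))]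
  have h2 := Finset.sum_range_succ (fun j => Ψ^[j] (a • f)) (sigmaOrder Fq Q L K)
  rw [Finset.sum_range_succ', h1, Function.iterate_zero_apply, add_left_inj] at h2
  rw [← h2]
  exact Finset.sum_congr rfl fun j _ => (Function.iterate_succ_apply' _ _ _).symm

/-- Were all averages zero, independence of the powers of `σ` would kill every summand, including
`f` itself. -/
theorem exists_orbitSum_ne_zero {H : Type*} [AddCommGroup H] [Module K H] {Ψ : H →+ H}
    (hΨ : ∀ (a : K) f, Ψ (a • f) = sigma Fq Q L K a • Ψ f) {f : H} (hf : f ≠ 0) :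
    ∃ a : K, orbitSum Fq Q L K Ψ (a • f) ≠ 0 := by
  by_contra! h
  refine hf (eq_zero_of_sum_sigma Fq Q L K (fun j => Ψ^[j] f) (fun a => ?_)
    ⟨0, sigmaOrder_pos Fq Q L K⟩)
  rw [← h a, orbitSum]
  exact Finset.sum_congr rfl fun j _ => (iterate_smul hΨ j a f).symm

variable (Fq Q L K) in
-- The trace is nonzero, takes values in `Q` and is `Q`-linear, so it can be normalised. An element
-- of trace one makes averages of projections into projections.
theorem exists_sum_sigma_eq_one [IsCurveFunctionField Fq Q] :
    ∃ a : K, ∑ j : Fin (sigmaOrder Fq Q L K), (sigmaEquiv Fq Q L K ^ (j : ℕ)) a = 1 := by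
  obtain ⟨a, ha⟩ : ∃ a : K, ∑ j : Fin (sigmaOrder Fq Q L K), (sigmaEquiv Fq Q L K ^ (j : ℕ)) a ≠ 0 := by
    by_contra! h
    exact one_ne_zero (eq_zero_of_sum_sigma Fq Q L K (V := K) (fun _ => 1) (fun a => by simpa using h a)
      ⟨0, sigmaOrder_pos Fq Q L K⟩)
  obtain ⟨y, hy⟩ := sum_sigma_mem_range Fq Q L K a
  refine ⟨algebraMap Q K y⁻¹ * a, ?_⟩
  simp only [map_mul, sigmaEquiv_pow_algebraMap_left]
  rw [← Finset.mul_sum, ← hy, ← map_mul, inv_mul_cancel₀, map_one]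
  rintro rfl
  exact ha (by rw [← hy, map_zero])

/-- The conjugation by bijective semilinear maps. -/
def conj (φ' : V' →ₛₗ[sigma Fq Q L K] V') (φ : V →ₛₗ[sigma Fq Q L K] V)
    (hφ' : Function.Bijective φ') : (V' →ₗ[K] V) →+ (V' →ₗ[K] V) where
  toFun f :=
    { toFun := fun v => φ (f ((Equiv.ofBijective φ' hφ').symm v))
      map_add' := fun v w => by
        obtain ⟨v, rfl⟩ := (Equiv.ofBijective φ' hφ').surjective v
        obtain ⟨w, rfl⟩ := (Equiv.ofBijective φ' hφ').surjective w
        rw [← map_add φ, ← map_add f, Equiv.symm_apply_apply, Equiv.symm_apply_apply]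
        congr 2
        rw [Equiv.symm_apply_eq]
        exact (map_add φ' v w).symm
      map_smul' := fun a v => by
        obtain ⟨a, rfl⟩ := (sigma_bijective Fq Q L K).2 a
        obtain ⟨v, rfl⟩ := (Equiv.ofBijective φ' hφ').surjective v
        rw [RingHom.id_apply, ← LinearMap.map_smulₛₗ φ, ← map_smul f, Equiv.symm_apply_apply]
        congr 2
        rw [Equiv.symm_apply_eq]
        exact (φ'.map_smulₛₗ a v).symm }
  map_zero' := LinearMap.ext fun v => φ.map_zero
  map_add' f g := LinearMap.ext fun v => φ.map_add _ _

section Conj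

variable {φ' : V' →ₛₗ[sigma Fq Q L K] V'} {φ : V →ₛₗ[sigma Fq Q L K] V}
  {hφ' : Function.Bijective φ'}

theorem conj_apply (f : V' →ₗ[K] V) (v : V') : conj φ' φ hφ' f (φ' v) = φ (f v) :=
  congrArg (fun v => φ (f v)) ((Equiv.ofBijective φ' hφ').symm_apply_apply v)

theorem conj_smul (a : K) (f : V' →ₗ[K] V) :
    conj φ' φ hφ' (a • f) = sigma Fq Q L K a • conj φ' φ hφ' f :=
  LinearMap.ext fun _ => φ.map_smulₛₗ a _

/-- Conjugation is `f ↦ φ ∘ f ∘ φ'⁻¹`; its fixed points are the maps wanted, and averaging produces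
them. -/
theorem conj_eq_self_iff {f : V' →ₗ[K] V} :
    conj φ' φ hφ' f = f ↔ ∀ v, f (φ' v) = φ (f v) := by
  constructor
  · intro h v
    rw [← conj_apply (hφ' := hφ'), h]
  · intro h
    ext v
    obtain ⟨v, rfl⟩ := hφ'.2 v
    rw [conj_apply, h]

theorem conj_iterate_apply (j : ℕ) (f : V' →ₗ[K] V) (v : V') :
    (conj φ' φ hφ')^[j] f (φ'^[j] v) = φ^[j] (f v) := by
  induction j with
  | zero => rfl
  | succ j ih =>
    rw [Function.iterate_succ_apply', Function.iterate_succ_apply', conj_apply, ih,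
      Function.iterate_succ_apply']

theorem conj_iterate_eq_self {j : ℕ} {f : V' →ₗ[K] V} (h : ∀ v, f (φ'^[j] v) = φ^[j] (f v)) :
    (conj φ' φ hφ')^[j] f = f := by
  ext v
  obtain ⟨v, rfl⟩ := (hφ'.iterate j).2 v
  rw [conj_iterate_apply, h]

end Conj

/-- The linear map `φ ^ e`, where `e` is the order of `σ`. -/
def frobPow (φ : V →ₛₗ[sigma Fq Q L K] V) : V →ₗ[K] V where
  toFun := φ^[sigmaOrder Fq Q L K]
  map_add' v w := iterate_map_add φ _ v w
  map_smul' a v := by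
    have := iterate_smul (Ψ := φ.toAddMonoidHom) (fun a v => φ.map_smulₛₗ a v)
      (sigmaOrder Fq Q L K) a v
    rw [sigmaEquiv_pow_sigmaOrder] at this
    exact this

theorem frobPow_apply (φ : V →ₛₗ[sigma Fq Q L K] V) (v : V) :
    frobPow φ v = φ^[sigmaOrder Fq Q L K] v := rfl

/-- If there is a surjective map from `V` to a nonzero `V'`, there is also a nonzero map from `V'`
to `V`. -/
theorem exists_ne_zero_of_surjective [FiniteDimensional K V] [FiniteDimensional K V']
    [Nontrivial V'] {φ' : V' →ₛₗ[sigma Fq Q L K] V'} {φ : V →ₛₗ[sigma Fq Q L K] V}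
    (hφ' : Function.Bijective φ') {f : V →ₗ[K] V'} (hf : Function.Surjective f)
    (hfφ : ∀ v, f (φ v) = φ' (f v)) :
    ∃ g : V' →ₗ[K] V, g ≠ 0 ∧ ∀ v, g (φ' v) = φ (g v) := by
  obtain ⟨g, hg, hgφ⟩ : ∃ g : V' →ₗ[K] V, g ≠ 0 ∧ ∀ v, g (frobPow φ' v) = frobPow φ (g v) := by
    -- First only compatibility with the linear maps `π = φ ^ e` is required, which says that `g` is
    -- in the kernel of `T g = g π' - π g`. If `T` were injective it would be surjective. Lifting
    -- through a linear section of `f` would make the same operator `T'` on `End V'` surjective,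
    -- hence injective; but it kills the identity.
    let T : (V' →ₗ[K] V) →ₗ[K] (V' →ₗ[K] V) :=
      LinearMap.lcomp K V (frobPow φ') - LinearMap.compRight K (frobPow φ)
    let T' : (V' →ₗ[K] V') →ₗ[K] (V' →ₗ[K] V') :=
      LinearMap.lcomp K V' (frobPow φ') - LinearMap.compRight K (frobPow φ')
    by_contra! h
    have hT : Function.Injective T := by
      rw [injective_iff_map_eq_zero]
      intro g hg
      by_contra hg0
      obtain ⟨v, hv⟩ := h g hg0
      exact hv (sub_eq_zero.1 (LinearMap.congr_fun hg v))
    have hT' : Function.Surjective T' := by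
      intro g'
      obtain ⟨s, hs⟩ := f.exists_rightInverse_of_surjective (LinearMap.range_eq_top.2 hf)
      obtain ⟨g, hg⟩ := (LinearMap.injective_iff_surjective.1 hT) (s ∘ₗ g')
      refine ⟨f ∘ₗ g, ?_⟩
      have h1 : ∀ v, f (frobPow φ v) = frobPow φ' (f v) := fun v => by
        have : ∀ (j : ℕ) v, f (φ^[j] v) = φ'^[j] (f v) := fun j =>
          Function.Semiconj.iterate_right (f := f) hfφ j
        exact this _ v
      have h2 : T' (f ∘ₗ g) = f ∘ₗ T g := by
        ext v
        change f (g (frobPow φ' v)) - frobPow φ' (f (g v)) =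
          f (g (frobPow φ' v) - frobPow φ (g v))
        rw [map_sub, h1]
      rw [h2, hg, ← LinearMap.comp_assoc, hs, LinearMap.id_comp]
    have h3 := (LinearMap.injective_iff_surjective.2 hT') (a₁ := LinearMap.id) (a₂ := 0) (by
      ext v
      change frobPow φ' v - frobPow φ' v = T' 0 v
      rw [map_zero, sub_self, LinearMap.zero_apply])
    obtain ⟨v, hv⟩ := exists_ne (0 : V')
    exact hv (LinearMap.congr_fun h3 v)
  -- Averaging over the `σ`-orbit upgrades compatibility with `π` to compatibility with `φ`.
  obtain ⟨a, ha⟩ := exists_orbitSum_ne_zero (Ψ := conj φ' φ hφ') conj_smul hg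
  exact ⟨_, ha, conj_eq_self_iff.1 (map_orbitSum conj_smul (conj_iterate_eq_self hgφ) a)⟩

/-! ### Endomorphisms and stable subspaces -/

/-- The ring of linear endomorphisms which commute with `φ`. -/
def phiEnd (φ : V →ₛₗ[sigma Fq Q L K] V) : Subring (Module.End K V) where
  carrier := {f | ∀ v, f (φ v) = φ (f v)}
  mul_mem' {f g} hf hg v := by
    rw [Module.End.mul_apply, Module.End.mul_apply, hg, hf]
  one_mem' _ := rfl
  add_mem' {f g} hf hg v := by
    rw [LinearMap.add_apply, LinearMap.add_apply, hf, hg, map_add]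
  zero_mem' _ := φ.map_zero.symm
  neg_mem' {f} hf v := by
    rw [LinearMap.neg_apply, LinearMap.neg_apply, hf, map_neg]

/-- The left ideal generated by `x` is generated by an idempotent `y x`. As `x` is central, `y x` is
nilpotent, so it vanishes, and with it the ideal. -/
theorem eq_zero_of_isNilpotent_of_commute {R : Type*} [Ring R] [IsSemisimpleRing R] {x : R}
    (hx : IsNilpotent x) (hc : ∀ y, Commute y x) : x = 0 := by
  obtain ⟨e, he, hI⟩ := IsSemisimpleRing.ideal_eq_span_idempotent (Ideal.span {x})
  have h1 : e ∈ Ideal.span {x} := hI ▸ Ideal.mem_span_singleton_self e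
  obtain ⟨y, rfl⟩ := Ideal.mem_span_singleton'.1 h1
  obtain ⟨n, hn⟩ := hx
  have h2 : (y * x) ^ (n + 1) = y * x := he.pow_succ_eq n
  rw [(hc y).mul_pow, pow_succ x, hn, zero_mul, mul_zero] at h2
  have h3 : x ∈ Ideal.span {y * x} := hI ▸ Ideal.mem_span_singleton_self x
  rw [← h2] at h3
  simpa using h3

variable [FiniteDimensional K V] {φ : V →ₛₗ[sigma Fq Q L K] V}

theorem conj_mul {hφ : Function.Bijective φ} (f g : Module.End K V) :
    conj φ φ hφ (f * g) = (conj φ φ hφ f * conj φ φ hφ g : Module.End K V) := by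
  refine LinearMap.ext fun v => ?_
  obtain ⟨v, rfl⟩ := hφ.2 v
  rw [conj_apply, Module.End.mul_apply, Module.End.mul_apply, conj_apply, conj_apply]

/-- `π` commutes with `φ`, so conjugation only touches coefficients. Averages of polynomials in `π`
are again polynomials in `π`, hence commute with every endomorphism of `(V, φ)`. -/
theorem conj_frobPow_polynomial (hφ : Function.Bijective φ) (p : Polynomial K) :
    conj φ φ hφ (Polynomial.aeval (R := K) (A := Module.End K V) (frobPow φ) p) =
      Polynomial.aeval (R := K) (A := Module.End K V) (frobPow φ) (p.map (sigma Fq Q L K)) := by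
  have hpi : conj φ φ hφ (frobPow φ) = frobPow φ := by
    rw [conj_eq_self_iff]
    intro v
    rw [frobPow_apply, frobPow_apply, ← Function.iterate_succ_apply, Function.iterate_succ_apply']
  have hone : conj φ φ hφ (1 : Module.End K V) = (1 : Module.End K V) := by
    rw [conj_eq_self_iff]
    exact fun _ => rfl
  have hpow : ∀ n : ℕ, conj φ φ hφ ((frobPow φ : Module.End K V) ^ n) =
      (frobPow φ : Module.End K V) ^ n := by
    intro n
    induction n with
    | zero => rw [pow_zero, hone]
    | succ n ih => rw [pow_succ, conj_mul, ih, hpi]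
  induction p using Polynomial.induction_on' with
  | add p q hp hq =>
    rw [map_add, map_add (conj φ φ hφ), hp, hq, Polynomial.map_add, map_add]
  | monomial n a =>
    rw [Polynomial.map_monomial, Polynomial.aeval_monomial, Polynomial.aeval_monomial,
      ← Algebra.smul_def, ← Algebra.smul_def, conj_smul, hpow]

/-- It is enough that the minimal polynomial of `π` is squarefree. A square factor `d²` would give a
nonzero element `(d s)(π)` of square zero. A nonzero average of it commutes with `φ`, is a
polynomial in `π`, hence central and nilpotent, which a semisimple ring does not allow. -/
theorem isSemisimple_frobPow (hφ : Function.Bijective φ) [IsSemisimpleRing (phiEnd φ)] :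
    Module.End.IsSemisimple (frobPow φ) := by
  let ev := Polynomial.aeval (R := K) (A := Module.End K V) (frobPow φ)
  have hmu : minpoly K (frobPow φ : Module.End K V) ≠ 0 :=
    minpoly.ne_zero (Algebra.IsIntegral.isIntegral _)
  have hcomm : ∀ f : Module.End K V, f ∈ phiEnd φ → ∀ p : Polynomial K, Commute f (ev p) := by
    intro f hf p
    have h1 : Commute f (frobPow φ) := LinearMap.ext fun v =>
      Function.Semiconj.iterate_right (f := f) hf _ v
    exact Algebra.commute_of_mem_adjoin_singleton_of_commute
      (Polynomial.aeval_mem_adjoin_singleton K (frobPow φ)) h1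
  refine Module.End.isSemisimple_of_squarefree_aeval_eq_zero
    (p := minpoly K (frobPow φ : Module.End K V)) (fun d hd => ?_) (minpoly.aeval _ _)
  obtain ⟨s, hs⟩ := hd
  by_cases hx : ev (d * s) = 0
  -- If `(d s)(π) = 0`, the minimal polynomial `d² s` divides `d s`, so `d` is a unit.
  · obtain ⟨t, ht⟩ := minpoly.dvd K _ hx
    have h0 : d * s ≠ 0 := fun h => hmu (by rw [hs, mul_assoc, h, mul_zero])
    refine .of_mul_eq_one t (mul_left_cancel₀ h0 ?_)
    rw [mul_one]
    conv_rhs => rw [ht, hs]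
    ring
  · exfalso
    have hxx : ev (d * s) ^ 2 = 0 := by
      rw [← map_pow, show (d * s) ^ 2 = d * d * s * s by ring, ← hs, map_mul, minpoly.aeval,
        zero_mul]
    obtain ⟨a, ha⟩ := exists_orbitSum_ne_zero (Ψ := conj φ φ hφ) conj_smul hx
    have hj : ∀ j : ℕ, ∃ p, (conj φ φ hφ)^[j] (a • ev (d * s)) = ev p ∧
        ev p ^ 2 = 0 := by
      intro j
      induction j with
      | zero =>
        refine ⟨a • (d * s), ?_, ?_⟩
        · rw [map_smul, Function.iterate_zero_apply]
        · rw [map_smul, smul_pow, hxx, smul_zero]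
      | succ j ih =>
        obtain ⟨p, hp, hp2⟩ := ih
        refine ⟨p.map (sigma Fq Q L K), ?_, ?_⟩
        · rw [Function.iterate_succ_apply', hp]
          exact conj_frobPow_polynomial hφ p
        · have h1 := conj_frobPow_polynomial hφ p
          change _ = ev (p.map (sigma Fq Q L K)) at h1
          rw [← h1, pow_two]
          refine (conj_mul (hφ := hφ) _ _).symm.trans ?_
          rw [pow_two] at hp2
          exact (congrArg (conj φ φ hφ) hp2).trans (map_zero _)
    choose p hp hp2 using hj
    have hfix : conj φ φ hφ (orbitSum Fq Q L K (conj φ φ hφ) (a • ev (d * s))) = _ :=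
      map_orbitSum conj_smul (conj_iterate_eq_self fun v => by
        have := LinearMap.congr_fun ((Commute.refl (frobPow φ : Module.End K V)).eq) v
        exact LinearMap.congr_fun (Algebra.commute_of_mem_adjoin_singleton_of_commute
          (Polynomial.aeval_mem_adjoin_singleton K (frobPow φ))
          (Commute.refl (frobPow φ : Module.End K V))).eq.symm v) a
    have hmem := conj_eq_self_iff.1 hfix
    have heq : orbitSum Fq Q L K (conj φ φ hφ) (a • ev (d * s)) =
        ev (∑ j : Fin (sigmaOrder Fq Q L K), p j) := by
      rw [orbitSum, map_sum]
      exact Finset.sum_congr rfl fun j _ => hp j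
    -- Each conjugate has square zero, and polynomials in `π` commute, so the sum is nilpotent.
    have hnil : IsNilpotent (ev (∑ j : Fin (sigmaOrder Fq Q L K), p j)) := by
      rw [map_sum]
      refine Commute.isNilpotent_sum (fun j _ => ⟨2, hp2 j⟩) fun i j _ _ => ?_
      exact Commute.map (Commute.all _ _) ev
    have hz := eq_zero_of_isNilpotent_of_commute (R := phiEnd φ)
      (x := ⟨orbitSum Fq Q L K (conj φ φ hφ) (a • ev (d * s)), hmem⟩) (by
        obtain ⟨n, hn⟩ := hnil
        refine ⟨n, Subtype.ext ?_⟩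
        change (orbitSum Fq Q L K (conj φ φ hφ) (a • ev (d * s)) : Module.End K V) ^ n = 0
        rw [heq, hn]) fun y => Subtype.ext (by
        change y.1 * (orbitSum Fq Q L K (conj φ φ hφ) (a • ev (d * s)) : Module.End K V) =
          (orbitSum Fq Q L K (conj φ φ hφ) (a • ev (d * s)) : Module.End K V) * y.1
        rw [heq]
        exact hcomm y.1 y.2 _)
    exact ha (congrArg Subtype.val hz)

/-- A subspace which is stable under `φ`. -/
def IsStable (φ : V →ₛₗ[sigma Fq Q L K] V) (U : Submodule K V) : Prop := ∀ v ∈ U, φ v ∈ U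

/-- The restriction of a semilinear map to a stable subspace. -/
def IsStable.restrict {U : Submodule K V} (hU : IsStable φ U) : U →ₛₗ[sigma Fq Q L K] U where
  toFun v := ⟨φ v, hU v v.2⟩
  map_add' v w := Subtype.ext (map_add φ (v : V) w)
  map_smul' a v := Subtype.ext (φ.map_smulₛₗ a (v : V))

theorem IsStable.restrict_bijective {U : Submodule K V} (hU : IsStable φ U)
    (hφ : Function.Injective φ) : Function.Bijective hU.restrict :=
  bijective_of_linearIndependent (linearIndependent_of_injective fun _ _ h =>
    Subtype.ext (hφ (congrArg Subtype.val h)))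

/-- By dimension `φ` maps a stable subspace onto itself, and `φ` is injective on `V`. -/
theorem IsStable.of_apply_mem {U : Submodule K V} (hU : IsStable φ U)
    (hφ : Function.Injective φ) {v : V} (hv : φ v ∈ U) : v ∈ U := by
  obtain ⟨w, hw⟩ := (hU.restrict_bijective hφ).2 ⟨_, hv⟩
  have : (w : V) = v := hφ (congrArg Subtype.val hw)
  exact this ▸ w.2

theorem isStable_range {φ' : V' →ₛₗ[sigma Fq Q L K] V'} {f : V' →ₗ[K] V}
    (hf : ∀ v, f (φ' v) = φ (f v)) : IsStable φ (LinearMap.range f) := by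
  rintro _ ⟨v, rfl⟩
  exact ⟨φ' v, hf v⟩

theorem isStable_ker {φ' : V' →ₛₗ[sigma Fq Q L K] V'} {f : V →ₗ[K] V'}
    (hf : ∀ v, f (φ v) = φ' (f v)) : IsStable φ (LinearMap.ker f) := by
  intro v hv
  rw [LinearMap.mem_ker] at hv ⊢
  rw [hf, hv, map_zero]

/-- If the ring of endomorphisms is semisimple, every stable subspace has a stable complement. -/
theorem IsStable.exists_isCompl [IsCurveFunctionField Fq Q] (hφ : Function.Bijective φ)
    [IsSemisimpleRing (phiEnd φ)]
    {U : Submodule K V} (hU : IsStable φ U) : ∃ U', IsStable φ U' ∧ IsCompl U U' := by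
  have hUj : ∀ (j : ℕ), ∀ v ∈ U, φ^[j] v ∈ U := by
    intro j v hv
    induction j with
    | zero => exact hv
    | succ j ih => rw [Function.iterate_succ_apply']; exact hU _ ih
  have hUj' : ∀ (j : ℕ) (v : V), φ^[j] v ∈ U → v ∈ U := by
    intro j v hv
    induction j with
    | zero => exact hv
    | succ j ih =>
      rw [Function.iterate_succ_apply'] at hv
      exact ih (hU.of_apply_mem hφ.1 hv)
  -- Semisimplicity of `π` gives a complement that is stable only under `π`. The associated
  -- projection `f` commutes with `π`, and its average with weights of trace one commutes with `φ`.
  obtain ⟨U₁, hU₁, hc⟩ := Module.End.isSemisimple_iff.1 (isSemisimple_frobPow hφ) U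
    (fun v hv => hUj _ v hv)
  let f := U.subtype ∘ₗ U.projectionOnto U₁ hc
  have hfU : ∀ v ∈ U, f v = v := fun v hv =>
    congrArg Subtype.val (Submodule.projectionOnto_apply_left hc ⟨v, hv⟩)
  have hfU₁ : ∀ v ∈ U₁, f v = 0 := fun v hv =>
    congrArg Subtype.val ((Submodule.projectionOnto_apply_eq_zero_iff hc).2 hv)
  have hf : ∀ v, f (frobPow φ v) = frobPow φ (f v) := by
    intro v
    obtain ⟨v, hv, w, hw, rfl⟩ := Submodule.mem_sup.1 (hc.sup_eq_top.ge (Submodule.mem_top (x := v)))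
    rw [map_add, map_add, map_add, hfU v hv, hfU₁ w hw, hfU _ (show frobPow φ v ∈ U from hUj _ v hv), hfU₁ _ (hU₁ hw),
      add_zero, add_zero]
  obtain ⟨a, ha⟩ := exists_sum_sigma_eq_one Fq Q L K
  let g := orbitSum Fq Q L K (conj φ φ hφ) (a • f)
  have hg : ∀ v, g (φ v) = φ (g v) :=
    conj_eq_self_iff.1 (map_orbitSum conj_smul (conj_iterate_eq_self hf) a)
  have hg' : ∀ v, g v = ∑ j : Fin (sigmaOrder Fq Q L K),
      (sigmaEquiv Fq Q L K ^ (j : ℕ)) a • (conj φ φ hφ)^[j] f v := by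
    intro v
    simp only [g, orbitSum, LinearMap.sum_apply]
    exact Finset.sum_congr rfl fun j _ => by rw [iterate_smul conj_smul]; rfl
  -- All conjugates of `f` are the identity on `U`, since `U` is stable in both directions, and the
  -- weights add up to `1`.
  have hgU : ∀ v ∈ U, g v = v := by
    intro v hv
    rw [hg']
    conv_rhs => rw [← one_smul K v, ← ha, Finset.sum_smul]
    refine Finset.sum_congr rfl fun j _ => ?_
    obtain ⟨v, rfl⟩ := (hφ.iterate j).2 v
    rw [conj_iterate_apply, hfU _ (hUj' _ _ hv)]
  have hgmem : ∀ v, g v ∈ U := by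
    intro v
    rw [hg']
    refine sum_mem fun j _ => Submodule.smul_mem _ _ ?_
    obtain ⟨v, rfl⟩ := (hφ.iterate j).2 v
    rw [conj_iterate_apply]
    exact hUj _ _ (U.projectionOnto U₁ hc v).2
  -- `g` is a projection onto `U` that commutes with `φ`; its kernel is the stable complement.
  refine ⟨LinearMap.ker g, isStable_ker hg, ?_⟩
  rw [← LinearMap.ker_codRestrict U g hgmem]
  exact LinearMap.isCompl_of_proj fun v => Subtype.ext (hgU v v.2)

end Semilinear

end

end TauSheaf

namespace TauSheaf

noncomputable section

/-! ### Decompositions into simple stable subspaces -/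

set_option linter.unusedSectionVars false

section Decomposition

open Module

variable {Fq Q L K : Type u} [Field Fq] [Field Q] [Field L] [Field K]
  [Algebra Fq Q] [Algebra Fq L] [Algebra Fq K] [Algebra Q K] [Algebra L K]
  [IsScalarTower Fq Q K] [IsScalarTower Fq L K] [Fintype Fq] [IsBaseChangeFunctionField Fq Q L K]
  {V : Type u} [AddCommGroup V] [Module K V] (φ : V →ₛₗ[sigma Fq Q L K] V)

/-- The ring of additive endomorphisms generated by the scalars and `φ`. -/
def phiRing : Subring (AddMonoid.End V) :=
  Subring.closure (Set.range (Module.toAddMonoidEnd K V) ∪ {φ.toAddMonoidHom})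

/-- The scalars in the ring generated by the scalars and `φ`. -/
def phiRingScalar (a : K) : phiRing φ :=
  ⟨Module.toAddMonoidEnd K V a, Subring.subset_closure (Or.inl ⟨a, rfl⟩)⟩

/-- The map `φ` in the ring generated by the scalars and `φ`. -/
def phiRingPhi : phiRing φ := ⟨φ.toAddMonoidHom, Subring.subset_closure (Or.inr rfl)⟩

variable {φ}

theorem phiRing_smul_mem {U : AddSubgroup V} (h : ∀ (a : K), ∀ v ∈ U, a • v ∈ U)
    (hφ : ∀ v ∈ U, φ v ∈ U) (a : phiRing φ) (v : V) (hv : v ∈ U) : a • v ∈ U := by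
  obtain ⟨a, ha⟩ := a
  change a v ∈ U
  induction ha using Subring.closure_induction generalizing v with
  | mem x hx =>
    rcases hx with ⟨b, rfl⟩ | rfl
    · exact h b v hv
    · exact hφ v hv
  | zero => exact zero_mem _
  | one => exact hv
  | add x y _ _ hx hy => exact add_mem (hx v hv) (hy v hv)
  | neg x _ hx => exact neg_mem (hx v hv)
  | mul x y _ _ hx hy => exact hx _ (hy v hv)

variable (φ) in
/-- The stable subspaces are the submodules over the ring generated by the scalars and `φ`. -/
def stableEquiv : {U : Submodule K V // IsStable φ U} ≃o Submodule (phiRing φ) V where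
  toFun U :=
    { U.1.toAddSubgroup with
      smul_mem' := fun a v hv => phiRing_smul_mem (U := U.1.toAddSubgroup)
        (fun a _ hv => U.1.smul_mem a hv) U.2 a v hv }
  invFun U := ⟨{ U.toAddSubgroup with
    smul_mem' := fun a _ hv => U.smul_mem (phiRingScalar φ a) hv },
    fun _ hv => U.smul_mem (phiRingPhi φ) hv⟩
  left_inv _ := rfl
  right_inv _ := rfl
  map_rel_iff' := Iff.rfl

variable (φ) in
/-- The endomorphisms which commute with `φ` are the linear maps over the ring generated by the
scalars and `φ`. -/
def phiEndEquiv : phiEnd φ ≃+* Module.End (phiRing φ) V where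
  toFun f :=
    { f.1.toAddMonoidHom with
      map_smul' := fun a v => by
        obtain ⟨a, ha⟩ := a
        change f.1 (a v) = a (f.1 v)
        induction ha using Subring.closure_induction generalizing v with
        | mem x hx =>
          rcases hx with ⟨b, rfl⟩ | rfl
          · exact f.1.map_smul b v
          · exact f.2 v
        | zero => exact map_zero f.1
        | one => rfl
        | add x y _ _ hx hy => exact (map_add f.1 _ _).trans (congrArg₂ _ (hx v) (hy v))
        | neg x _ hx => exact (map_neg f.1 _).trans (congrArg _ (hx v))
        | mul x y _ _ hx hy => exact (hx _).trans (congrArg _ (hy v)) }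
  invFun f := ⟨{ f.toAddMonoidHom with map_smul' := fun a v => f.map_smul (phiRingScalar φ a) v },
    fun v => f.map_smul (phiRingPhi φ) v⟩
  left_inv _ := rfl
  right_inv _ := rfl
  map_mul' _ _ := rfl
  map_add' _ _ := rfl

/-- A minimal nonzero stable subspace. -/
structure IsSimpleStable (φ : V →ₛₗ[sigma Fq Q L K] V) (W : Submodule K V) : Prop where
  stable : IsStable φ W
  ne_bot : W ≠ ⊥
  eq_or_eq : ∀ U, IsStable φ U → U ≤ W → U = ⊥ ∨ U = W

theorem isSimpleStable_iff (W : {U : Submodule K V // IsStable φ U}) :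
    IsSimpleStable φ W.1 ↔ IsSimpleModule (phiRing φ) (stableEquiv φ W) := by
  rw [isSimpleModule_iff_isAtom]
  constructor
  · intro h
    refine ⟨fun h0 => h.ne_bot ?_, fun U hU => ?_⟩
    · rw [eq_bot_iff]
      intro v hv
      have : v ∈ stableEquiv φ W := hv
      rw [h0] at this
      exact this
    · obtain ⟨U, rfl⟩ := (stableEquiv φ).surjective U
      rw [OrderIso.lt_iff_lt] at hU
      rcases h.eq_or_eq U.1 U.2 hU.le with h1 | h1
      · rw [eq_bot_iff]
        intro v hv
        have : v ∈ U.1 := hv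
        rw [h1] at this
        exact this
      · exact (hU.ne (Subtype.ext h1)).elim
  · intro h
    refine ⟨W.2, fun h0 => h.1 ?_, fun U hU hUW => ?_⟩
    · rw [eq_bot_iff]
      intro v hv
      have : v ∈ W.1 := hv
      rw [h0] at this
      exact this
    · rcases h.le_iff.1 ((stableEquiv φ).monotone (show (⟨U, hU⟩ : {U // IsStable φ U}) ≤ W from hUW))
        with h1 | h1
      · left
        rw [eq_bot_iff]
        intro v hv
        have : v ∈ stableEquiv φ ⟨U, hU⟩ := hv
        rw [h1] at this
        exact this
      · right
        exact congrArg Subtype.val ((stableEquiv φ).injective h1)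

variable [FiniteDimensional K V] [Finite L]

theorem finite_phiRing : Module.Finite (phiRing φ) V := by
  obtain ⟨s, hs⟩ := (inferInstance : Module.Finite K V)
  refine ⟨s, eq_top_iff.2 ?_⟩
  rintro v -
  have hv : v ∈ Submodule.span K (s : Set V) := hs ▸ Submodule.mem_top
  induction hv using Submodule.span_induction with
  | mem v hv => exact Submodule.subset_span hv
  | zero => exact zero_mem _
  | add v w _ _ hv hw => exact add_mem hv hw
  | smul a v _ hv => exact Submodule.smul_mem _ (phiRingScalar φ a) hv

/-- If `V` is a sum of simple stable subspaces, the ring of endomorphisms is semisimple. -/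
theorem isSemisimpleRing_phiEnd {n : ℕ} {W : Fin n → Submodule K V}
    (hW : ∀ j, IsSimpleStable φ (W j)) (hV : ⨆ j, W j = ⊤) : IsSemisimpleRing (phiEnd φ) := by
  have h1 : ∀ j, IsSemisimpleModule (phiRing φ) (stableEquiv φ ⟨W j, (hW j).stable⟩) := by
    intro j
    have := (isSimpleStable_iff ⟨W j, (hW j).stable⟩).1 (hW j)
    infer_instance
  have h2 : ⨆ j, stableEquiv φ ⟨W j, (hW j).stable⟩ = ⊤ := by
    refine eq_top_iff.2 ?_
    rintro v -
    have hv : v ∈ ⨆ j, W j := hV ▸ Submodule.mem_top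
    induction hv using Submodule.iSup_induction' with
    | mem j v hv => exact Submodule.mem_iSup_of_mem j hv
    | zero => exact zero_mem _
    | add v w _ _ hv hw => exact add_mem hv hw
  -- Stable subspaces are submodules over the ring generated by `K` and `φ`, so standard facts on
  -- semisimple modules apply to `V`.
  have := isSemisimpleModule_of_isSemisimpleModule_submodule' h1 h2
  have := finite_phiRing (φ := φ)
  have := IsSemisimpleRing.moduleEnd (phiRing φ) V
  exact (phiEndEquiv φ).symm.isSemisimpleRing

/-- If all stable subspaces have stable complements, `V` is a direct sum of simple stable
subspaces. -/
theorem exists_decomposition (h : ∀ U, IsStable φ U → ∃ U', IsStable φ U' ∧ IsCompl U U') :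
    ∃ (n : ℕ) (e : Fin n → phiEnd φ), (∀ j, IsSimpleStable φ (LinearMap.range (e j).1)) ∧
      (∀ j v, (e j).1 ((e j).1 v) = (e j).1 v) ∧
      (∀ j j', j ≠ j' → ∀ v, (e j').1 ((e j).1 v) = 0) ∧ ∀ v, ∑ j, (e j).1 v = v := by
  have : ComplementedLattice (Submodule (phiRing φ) V) := by
    refine ⟨fun U => ?_⟩
    obtain ⟨U, rfl⟩ := (stableEquiv φ).surjective U
    obtain ⟨U', hU', hc⟩ := h U.1 U.2
    refine ⟨stableEquiv φ ⟨U', hU'⟩, ?_⟩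
    rw [isCompl_iff, Submodule.disjoint_def, codisjoint_iff_le_sup]
    constructor
    · intro v hv hv'
      exact Submodule.disjoint_def.1 hc.disjoint v hv hv'
    · intro v _
      obtain ⟨w, hw, w', hw', rfl⟩ := Submodule.mem_sup.1 (hc.sup_eq_top.ge (Submodule.mem_top (x := v)))
      exact add_mem (Submodule.mem_sup_left hw) (Submodule.mem_sup_right hw')
  have : IsSemisimpleModule (phiRing φ) V := { __ := this }
  have := finite_phiRing (φ := φ)
  obtain ⟨n, S, E, hS⟩ := IsSemisimpleModule.exists_linearEquiv_fin_dfinsupp (phiRing φ) V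
  -- The idempotents belonging to the summands of the decomposition.
  let p : ∀ j, Module.End (phiRing φ) V := fun j => E.symm.toLinearMap ∘ₗ
    DFinsupp.lsingle j ∘ₗ DFinsupp.lapply j ∘ₗ E.toLinearMap
  have hp : ∀ j v, p j v = E.symm (DFinsupp.single j (E v j)) := fun _ _ => rfl
  refine ⟨n, fun j => (phiEndEquiv φ).symm (p j), fun j => ?_, fun j v => ?_, fun j j' hj v => ?_,
    fun v => ?_⟩
  · have h1 : IsStable φ (LinearMap.range ((phiEndEquiv φ).symm (p j)).1) :=
      isStable_range ((phiEndEquiv φ).symm (p j)).2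
    refine (isSimpleStable_iff ⟨_, h1⟩).2 ?_
    have h2 : stableEquiv φ ⟨_, h1⟩ = LinearMap.range (E.symm.toLinearMap ∘ₗ
        (DFinsupp.lsingle (M := fun j => S j) j)) := by
      ext v
      constructor
      · rintro ⟨w, rfl⟩
        exact ⟨E w j, rfl⟩
      · rintro ⟨w, rfl⟩
        refine ⟨E.symm (DFinsupp.single j w), ?_⟩
        change p j _ = _
        rw [hp, LinearEquiv.apply_symm_apply, DFinsupp.single_eq_same]
        rfl
    rw [h2]
    have := hS j
    have hinj : Function.Injective (E.symm.toLinearMap ∘ₗ (DFinsupp.lsingle (M := fun j => S j) j)) :=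
      fun _ _ h => DFinsupp.single_injective (β := fun j => S j) (E.symm.injective h)
    exact IsSimpleModule.congr (LinearEquiv.ofInjective _ hinj).symm
  · change p j (p j v) = p j v
    rw [hp, hp, LinearEquiv.apply_symm_apply, DFinsupp.single_eq_same]
  · change p j' (p j v) = 0
    rw [hp, hp, LinearEquiv.apply_symm_apply, DFinsupp.single_eq_of_ne hj.symm, DFinsupp.single_zero,
      map_zero]
  · change ∑ j, p j v = v
    simp only [hp]
    rw [← map_sum, LinearEquiv.symm_apply_eq]
    ext j
    simp [DFinsupp.single_apply]

end Decomposition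

end

end TauSheaf

namespace TauSheaf

noncomputable section

/-! ### Quasi-morphisms over finite fields -/

set_option linter.unusedSectionVars false

section Finite

open Module

variable {Fq Q L K : Type u} [Field Fq] [Field Q] [Field L] [Field K]
  [Algebra Fq Q] [Algebra Fq L] [Algebra Fq K] [Algebra Q K] [Algebra L K]
  [IsScalarTower Fq Q K] [IsScalarTower Fq L K] [Fintype Fq] [IsBaseChangeFunctionField Fq Q L K]
  {infty : CurvePoint Fq Q} {c : Characteristic Fq Q L}

variable (L K) in
/-- The generic point. -/
def genericPoint : CurvePoint L K := ⟨⊤, fun _ => ValuationSubring.mem_top _⟩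

theorem span_top_ring {V : Type u} [AddCommGroup V] [Module K V] {P : CurvePoint L K}
    (hP : P.ring = ⊤) {ι : Type*} [Finite ι] (b : Basis ι K V) :
    Submodule.span P.ring (Set.range b) = ⊤ := by
  rw [eq_top_iff]
  intro v _
  rw [mem_span_basis_iff, hP]
  exact fun _ => ValuationSubring.mem_top _

theorem VectorBundle.stalk_eq_top (E : VectorBundle L K) {P : CurvePoint L K} (hP : P.ring = ⊤) :
    E.stalk P = ⊤ := by
  obtain ⟨b, hb, -⟩ := E.locallyFree P
  rw [hb, span_top_ring hP]

theorem IsImageDatum.stalk_eq_top [IsCurveFunctionField L K] {F : AbelianTauSheaf K infty c}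
    {V : Type u} [AddCommGroup V] [Module K V] [FiniteDimensional K V]
    {φ : V →ₛₗ[sigma Fq Q L K] V} {n : ℕ} {g : Fin n → ∀ i, (F.sheaf i).fiber →ₗ[K] V}
    (h : IsImageDatum F φ g) (i : ℤ) {P : CurvePoint L K} (hP : P.ring = ⊤) : h.stalk i P = ⊤ :=
  (h.bundle i).stalk_eq_top hP

/-- A linear map has bounded denominators. -/
theorem exists_ord_smul_mem [IsCurveFunctionField L K] {V : Type u} [AddCommGroup V] [Module K V]
    {P : CurvePoint L K} (hP : P.IsClosedPoint) {ι : Type*} [Finite ι] (b : Basis ι K V)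
    (f : V →ₗ[K] V) : ∃ m : ℕ, ∀ z : K, z ≠ 0 → m ≤ P.ord z →
      ∀ v ∈ Submodule.span P.ring (Set.range b), z • f v ∈ Submodule.span P.ring (Set.range b) := by
  cases nonempty_fintype ι
  -- The bound exceeds the order of every pole of a matrix entry of `f`.
  refine ⟨∑ i, ∑ j, (P.ord (b.repr (f (b i)) j)).natAbs, fun z hz hm v hv => ?_⟩
  induction hv using Submodule.span_induction with
  | mem v hv =>
    obtain ⟨i, rfl⟩ := hv
    rw [mem_span_basis_iff]
    intro j
    rw [map_smul, Finsupp.smul_apply, smul_eq_mul]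
    by_cases h0 : b.repr (f (b i)) j = 0
    · rw [h0, mul_zero]
      exact zero_mem _
    · rw [CurvePoint.mem_ring_iff hP, P.ord_mul hz h0]
      have h1 : (P.ord (b.repr (f (b i)) j)).natAbs ≤
          ∑ i, ∑ j, (P.ord (b.repr (f (b i)) j)).natAbs :=
        (Finset.single_le_sum (f := fun j => (P.ord (b.repr (f (b i)) j)).natAbs)
          (fun _ _ => Nat.zero_le _) (Finset.mem_univ j)).trans
        (Finset.single_le_sum (f := fun i => ∑ j, (P.ord (b.repr (f (b i)) j)).natAbs)
          (fun _ _ => Nat.zero_le _) (Finset.mem_univ i))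
      have h2 := neg_abs_le (P.ord (b.repr (f (b i)) j))
      rw [Int.abs_eq_natAbs] at h2
      have h3 : ((P.ord (b.repr (f (b i)) j)).natAbs : ℤ) ≤ P.ord z := le_trans (by exact_mod_cast h1) hm
      linarith
  | zero => rw [map_zero, smul_zero]; exact zero_mem _
  | add v w _ _ hv hw => rw [map_add, smul_add]; exact add_mem hv hw
  | smul a v _ hv =>
    have h1 : f (a • v) = (a : K) • f v := f.map_smul (a : K) v
    rw [h1, smul_comm]
    exact Submodule.smul_mem _ a hv

/-- Stalks of index `i` and `i + l` differ by a scalar, so a condition on a linear map has to be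
checked only for indices modulo `l`. The scalar is `w ^ k` above `∞` and `1` elsewhere. -/
theorem IsImageDatum.exists_smul_mem_stalk_iff [IsCurveFunctionField Fq Q]
    {F : AbelianTauSheaf K infty c}
    {V : Type u} [AddCommGroup V] [Module K V] {φ : V →ₛₗ[sigma Fq Q L K] V} {n : ℕ}
    {g : Fin n → ∀ i, (F.sheaf i).fiber →ₗ[K] V} (h : IsImageDatum F φ g)
    (hinf : infty.IsClosedPoint) {k l : ℕ} (hF : IsPeriodic F k l) (i : ℤ) (P : CurvePoint L K) :
    ∃ u : K, u ≠ 0 ∧ ∀ v, u • v ∈ h.stalk i P ↔ v ∈ h.stalk (i + l) P := by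
  by_cases hP : P.proj Fq Q = infty
  · obtain ⟨w, hw⟩ := hinf.exists_irreducible
    have hw0 : algebraMap Q K w ≠ 0 := by
      rw [map_ne_zero]
      exact_mod_cast hw.ne_zero
    refine ⟨algebraMap Q K w ^ k, pow_ne_zero k hw0, fun v => ?_⟩
    rw [h.stalk_eq_smul hF, twistIdeal_eq_span hinf hw hP, Submodule.ideal_span_singleton_smul]
    constructor
    · rintro ⟨v', hv', h'⟩
      have h1 : algebraMap Q K w ^ k • v' = algebraMap Q K w ^ k • v := h'
      rwa [← smul_right_injective V (pow_ne_zero k hw0) h1]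
    · exact fun hv => ⟨v, hv, rfl⟩
  · have h1 : twistIdeal k infty P = ⊤ :=
      (Ideal.eq_top_iff_one _).2 (Ideal.subset_span fun h => (hP h).elim)
    refine ⟨1, one_ne_zero, fun v => ?_⟩
    rw [one_smul, h.stalk_eq_smul hF, h1, Submodule.top_smul]

/-- Off `∞` all inclusions in the chain are equalities. -/
theorem IsImageDatum.stalk_eq_stalk_zero {F : AbelianTauSheaf K infty c}
    {V : Type u} [AddCommGroup V] [Module K V] {φ : V →ₛₗ[sigma Fq Q L K] V} {n : ℕ}
    {g : Fin n → ∀ i, (F.sheaf i).fiber →ₗ[K] V} (h : IsImageDatum F φ g) (i : ℤ)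
    {P : CurvePoint L K} (hP : P.proj Fq Q ≠ infty) : h.stalk i P = h.stalk 0 P := by
  obtain ⟨k, l, -, hl, -, hF⟩ := F.periodic
  have h1 : ∀ i, h.stalk (i + 1) P = h.stalk i P := fun i =>
    le_antisymm (h.stalk_succ_le hF hl i hP) (h.stalk_le i P)
  induction i using Int.induction_on with
  | zero => rfl
  | succ i ih => rw [h1, ih]
  | pred i ih =>
    rw [← ih, ← h1 (-(i : ℤ) - 1)]
    rw [sub_add_cancel]

/-- A statement about the stalks is true for all `i` if it is true for `0 ≤ i < l`. -/
theorem forall_of_periodic {p : ℤ → Prop} {l : ℕ} (hl : 0 < l) (hp : ∀ i, p i ↔ p (i + l))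
    (h : ∀ i : ℕ, i < l → p i) (i : ℤ) : p i := by
  have h1 : ∀ (i : ℤ) (m : ℕ), p i ↔ p (i + l * m) := by
    intro i m
    induction m with
    | zero => simp
    | succ m ih =>
      rw [ih, hp (i + l * m)]
      push_cast
      rw [mul_add, mul_one, add_assoc]
  have hl' : (0 : ℤ) < l := by exact_mod_cast hl
  have h2 : p (i % l) := by
    have := h (i % l).toNat (by have := Int.emod_lt_of_pos i hl'; have := Int.emod_nonneg i hl'.ne'; omega)
    rwa [Int.toNat_of_nonneg (Int.emod_nonneg i hl'.ne')] at this
  have h3 := Int.emod_add_mul_ediv i l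
  obtain ⟨m, hm | hm⟩ := (i / l).eq_nat_or_neg
  · rw [← h3, hm, ← h1]
    exact h2
  · rw [h1 i m]
    rw [hm] at h3
    convert h2 using 1
    linarith

variable [Finite L] [IsCurveFunctionField Fq Q]

namespace AbelianTauSheaf

/-- Over a finite field, every endomorphism of the generic fibre is a quasi-morphism. -/
theorem isQuasiMorphism_of_commutes (hinf : infty.IsClosedPoint) (F : AbelianTauSheaf K infty c)
    (f : GenericHom F F) (hf : Commutes f) : IsQuasiMorphism f := by
  classical
  have hL := isCurveFunctionField Fq Q L K
  have hfin := finite_functionField Fq Q L K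
  obtain ⟨k, l, -, hl, -, hF⟩ := F.periodic
  have h1 := fun i P => (F.selfDatum.bundle i).locallyFree P
  choose b hb hbf using h1
  have hb : ∀ i P, F.selfDatum.stalk i P = Submodule.span P.ring (Set.range (b i P)) := hb
  have h2 := fun (i : ℤ) (P : CurvePoint L K) (hP : P.IsClosedPoint) =>
    exists_ord_smul_mem hP (b i P) (f 0)
  choose m hm using h2
  -- Outside finitely many points the stalk is generated by one fixed basis and `f` has regular
  -- matrix entries.
  have hbad : ∀ i : ℤ, {P : CurvePoint L K | ¬ ∀ v ∈ F.selfDatum.stalk i P,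
      f 0 v ∈ F.selfDatum.stalk i P}.Finite := by
    intro i
    let B := b i (genericPoint L K)
    have h3 := hbf i (genericPoint L K)
    have h4 := finite_not_span_le (L := L) B (fun j => f 0 (B j)) (fun j => by rw [B.span_eq]; trivial)
    refine (h3.union h4).subset fun P hP => ?_
    by_contra h5
    rw [Set.mem_union, not_or] at h5
    obtain ⟨h5, h6⟩ := h5
    simp only [Set.mem_ofPred_eq, not_not] at h5 h6
    have h5 : F.selfDatum.stalk i P = Submodule.span P.ring (Set.range B) := h5
    apply hP
    rw [h5]
    intro v hv
    induction hv using Submodule.span_induction with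
    | mem v hv =>
      obtain ⟨j, rfl⟩ := hv
      exact h6 (Submodule.subset_span ⟨j, rfl⟩)
    | zero => rw [map_zero]; exact zero_mem _
    | add v w _ _ hv hw => rw [map_add]; exact add_mem hv hw
    | smul a v _ hv =>
      have : f 0 (a • v) = a • f 0 v := (f 0).map_smul (a : K) v
      rw [this]
      exact Submodule.smul_mem _ a hv
  let bad : Set (CurvePoint L K) := ⋃ i ∈ Finset.range l, {P : CurvePoint L K |
    ¬ ∀ v ∈ F.selfDatum.stalk i P, f 0 v ∈ F.selfDatum.stalk i P}
  have hbad' : bad.Finite := Set.Finite.biUnion (Finset.finite_toSet _) fun i _ => hbad i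
  have hbadc : ∀ P ∈ bad, P.IsClosedPoint := by
    intro P hP h3
    obtain ⟨i, -, hP⟩ := Set.mem_iUnion₂.1 hP
    apply hP
    intro v _
    rw [F.selfDatum.stalk_eq_top i h3]
    trivial
  choose w hw using fun (x : CurvePoint Fq Q) (hx : x.IsClosedPoint) => hx.exists_irreducible
  -- At a point `x` of `C` one exponent must serve all points above `x` and all indices below `l`,
  -- so the local bounds are summed.
  let M : CurvePoint Fq Q → ℕ := fun x => ∑ P ∈ pointsAbove L K x, ∑ i ∈ Finset.range l,
    if h : P.IsClosedPoint then m i P h else 0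
  let D : EffectiveDivisor Fq Q :=
    { eqn := fun x => if h : x.IsClosedPoint ∧ x ∈ CurvePoint.proj Fq Q '' bad then
        (w x h.1 : Q) ^ M x else 1
      eqn_mem := fun x => by
        split_ifs with h
        · exact pow_mem (w x h.1).2 _
        · exact one_mem _
      eqn_ne_zero := fun x => by
        split_ifs with h
        · refine pow_ne_zero _ ?_
          exact_mod_cast (hw x h.1).ne_zero
        · exact one_ne_zero
      finite := by
        refine (hbad'.image (CurvePoint.proj Fq Q)).subset fun x hx => ?_
        by_contra h
        apply hx
        rw [dif_neg (fun h' => h h'.2), inv_one]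
        exact one_mem _ }
  refine ⟨D, hf, fun i P v hv => ?_⟩
  rw [← mem_selfDatum_stalk] at hv
  change algebraMap Q K (D.eqn (P.proj Fq Q)) • f i v ∈ (F.sheaf i).stalk P
  rw [← mem_selfDatum_stalk, map_smul, hf.psi]
  revert hv
  generalize F.psi i v = v
  revert v
  refine forall_of_periodic hl (p := fun i => ∀ v, v ∈ F.selfDatum.stalk i P →
    algebraMap Q K (D.eqn (P.proj Fq Q)) • f 0 v ∈ F.selfDatum.stalk i P) (fun i => ?_)
    (fun i hi => ?_) i
  · obtain ⟨u, hu0, hu⟩ := F.selfDatum.exists_smul_mem_stalk_iff hinf hF i P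
    constructor
    · intro h v hv
      have h3 := h (u • v) ((hu v).2 hv)
      rw [map_smul, smul_comm] at h3
      exact (hu _).1 h3
    · intro h v hv
      have h3 := h (u⁻¹ • v) ((hu _).1 (by rwa [smul_inv_smul₀ hu0]))
      rwa [← hu, map_smul, smul_comm u, smul_inv_smul₀ hu0] at h3
  · intro v hv
    by_cases hP : P ∈ bad
    · have hPc := hbadc P hP
      have hx : (P.proj Fq Q).IsClosedPoint := hPc.proj
      have hD : D.eqn (P.proj Fq Q) = (w _ hx : Q) ^ M (P.proj Fq Q) :=
        dif_pos ⟨hx, Set.mem_image_of_mem _ hP⟩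
      have hw0 : (w _ hx : Q) ≠ 0 := by exact_mod_cast (hw _ hx).ne_zero
      rw [hD]
      rw [hb] at hv ⊢
      refine hm i P hPc _ ((map_ne_zero _).2 (pow_ne_zero _ hw0)) ?_ v hv
      -- The ramification index is at least one, so the pulled back equation vanishes to order at
      -- least `M` at `P`.
      obtain ⟨e, he, he'⟩ := CurvePoint.IsClosedPoint.exists_ramification hx
      rw [he' _ (pow_ne_zero _ hw0), CurvePoint.ord_pow _ hw0, CurvePoint.ord_irreducible (hw _ hx),
        mul_one]
      have h3 : m i P hPc ≤ M (P.proj Fq Q) := by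
        have h4 := Finset.single_le_sum (f := fun i : ℕ => if h : P.IsClosedPoint then m i P h else 0)
          (fun _ _ => Nat.zero_le _) (Finset.mem_range.2 hi)
        rw [dif_pos hPc] at h4
        exact h4.trans (Finset.single_le_sum (f := fun P : CurvePoint L K => ∑ i ∈ Finset.range l,
          if h : P.IsClosedPoint then m i P h else 0) (fun _ _ => Nat.zero_le _)
          ((mem_pointsAbove hx).2 rfl))
      have h4 : M (P.proj Fq Q) ≤ e * M (P.proj Fq Q) := Nat.le_mul_of_pos_left _ he
      exact_mod_cast h3.trans h4
    · have h3 : f 0 v ∈ F.selfDatum.stalk i P := by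
        by_contra h3
        exact hP (Set.mem_iUnion₂.2 ⟨i, Finset.mem_range.2 hi, fun h4 => h3 (h4 v hv)⟩)
      exact Submodule.smul_mem _ (⟨_, algebraMap_mem_ring rfl (D.eqn_mem _)⟩ : P.ring) h3

end AbelianTauSheaf

end Finite

end

end TauSheaf

namespace TauSheaf

noncomputable section

/-! ### Simple and semisimple abelian `τ`-sheaves over finite fields -/

set_option linter.unusedSectionVars false

section Simple

open Module

variable {Fq Q L K : Type u} [Field Fq] [Field Q] [Field L] [Field K]
  [Algebra Fq Q] [Algebra Fq L] [Algebra Fq K] [Algebra Q K] [Algebra L K]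
  [IsScalarTower Fq Q K] [IsScalarTower Fq L K] [Fintype Fq] [IsBaseChangeFunctionField Fq Q L K]
  {infty : CurvePoint Fq Q} {c : Characteristic Fq Q L}

namespace AbelianTauSheaf

theorem isZero_iff (F : AbelianTauSheaf K infty c) : F.IsZero ↔ Subsingleton (F.sheaf 0).fiber :=
  ⟨fun h => h 0, fun _ i => (F.psi i).toEquiv.subsingleton⟩

/-- At the generic point the stalk is the whole fibre. -/
theorem IsSurjective.surjective {F F' : AbelianTauSheaf K infty c} {f : GenericHom F F'}
    (hf : IsSurjective f) (i : ℤ) : Function.Surjective (f i) := by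
  intro w
  have h1 := hf i (genericPoint L K)
  rw [(F'.sheaf i).stalk_eq_top rfl] at h1
  obtain ⟨v, -, hv⟩ := h1.ge (Set.mem_univ w)
  exact ⟨v, hv⟩

theorem IsQuasiIsogeny.surjective {F F' : AbelianTauSheaf K infty c} {f : GenericHom F F'}
    (hf : IsQuasiIsogeny f) (i : ℤ) : Function.Surjective (f i) := by
  obtain ⟨D, -, -, Z, -, hZ, h⟩ := hf
  intro w
  have h1 := h i (genericPoint L K) fun h0 => hZ _ h0 (by
    rw [eq_top_iff]
    exact fun _ _ => ValuationSubring.mem_top _)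
  obtain ⟨v, -, hv⟩ := h1.ge (show w ∈ stalkTwist D (F'.sheaf i) (genericPoint L K) by
    change _ • w ∈ (F'.sheaf i).stalk (genericPoint L K)
    rw [(F'.sheaf i).stalk_eq_top rfl]
    trivial)
  exact ⟨v, hv⟩

/-- The inverse of a bijective morphism. -/
theorem IsSurjective.isomorphic {F F' : AbelianTauSheaf K infty c} {f : GenericHom F F'}
    (hm : IsMorphism f) (hs : IsSurjective f) (hi : IsInjective f) : F'.Isomorphic F := by
  let e : ∀ i, (F.sheaf i).fiber ≃ₗ[K] (F'.sheaf i).fiber := fun i =>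
    LinearEquiv.ofBijective (f i) ⟨hi i, hs.surjective i⟩
  have he : ∀ i v, e i v = f i v := fun _ _ => rfl
  have hmem : ∀ i (P : CurvePoint L K) v, f i v ∈ (F'.sheaf i).stalk P → v ∈ (F.sheaf i).stalk P := by
    intro i P v hv
    obtain ⟨w, hw, h⟩ := (hs i P).ge hv
    exact hi i h ▸ hw
  refine ⟨fun i => (e i).symm.toLinearMap, ⟨⟨fun i v => ?_, fun i v => ?_⟩, fun i P v hv => ?_⟩,
    fun i => (e i).symm.injective, fun i P => ?_⟩
  · obtain ⟨v, rfl⟩ := (e i).surjective v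
    change (e (i + 1)).symm _ = F.Pi i ((e i).symm _)
    rw [LinearEquiv.symm_apply_apply, LinearEquiv.symm_apply_eq, he, he, hm.commutes.Pi]
  · obtain ⟨v, rfl⟩ := (e i).surjective v
    change (e (i + 1)).symm _ = F.tau i ((e i).symm _)
    rw [LinearEquiv.symm_apply_apply, LinearEquiv.symm_apply_eq, he, he, hm.commutes.tau]
  · obtain ⟨v, rfl⟩ := (e i).surjective v
    change (e i).symm _ ∈ _
    rw [LinearEquiv.symm_apply_apply]
    exact hmem i P v hv
  · ext v
    constructor
    · rintro ⟨w, hw, rfl⟩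
      obtain ⟨v, rfl⟩ := (e i).surjective w
      change (e i).symm _ ∈ _
      rw [LinearEquiv.symm_apply_apply]
      exact hmem i P v hw
    · intro hv
      exact ⟨f i v, hm.map_mem i P v hv, (e i).symm_apply_apply v⟩

theorem isomorphic_linearEquiv {F F' : AbelianTauSheaf K infty c} (h : F.Isomorphic F') :
    finrank K (F.sheaf 0).fiber = finrank K (F'.sheaf 0).fiber := by
  obtain ⟨f, -, hi, hs⟩ := h
  exact (LinearEquiv.ofBijective (f 0) ⟨hi 0, hs.surjective 0⟩).finrank_eq

variable [Finite L]

theorem phi_bijective (F : AbelianTauSheaf K infty c) : Function.Bijective F.phi :=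
  bijective_of_linearIndependent F.phi_linearIndependent

/-- If all stable subspaces of the generic fibre are trivial, the sheaf is simple. -/
theorem isSimple_of_forall_isStable (F : AbelianTauSheaf K infty c)
    (h0 : ¬ Subsingleton (F.sheaf 0).fiber) (h : ∀ U, IsStable F.phi U → U = ⊥ ∨ U = ⊤) :
    F.IsSimple := by
  refine ⟨fun h' => h0 (F.isZero_iff.1 h'), ?_⟩
  rintro F' ⟨f, hm, hs⟩
  rcases h _ (isStable_ker (φ' := F'.phi) hm.commutes.phi) with h1 | h1
  · exact Or.inr (hs.isomorphic hm (hm.commutes.injective (LinearMap.ker_eq_bot.1 h1)))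
  · left
    rw [isZero_iff]
    refine ⟨fun v w => ?_⟩
    obtain ⟨v, rfl⟩ := hs.surjective 0 v
    obtain ⟨w, rfl⟩ := hs.surjective 0 w
    rw [LinearMap.ker_eq_top.1 h1]
    rfl

variable [IsCurveFunctionField Fq Q]

/-- A quotient of the generic fibre is the generic fibre of a quotient. -/
theorem exists_isQuotient (F : AbelianTauSheaf K infty c) (hinf : infty.IsClosedPoint)
    (hc : c.point ≠ infty) {W : Type u} [AddCommGroup W] [Module K W] [FiniteDimensional K W]
    {φ : W →ₛₗ[sigma Fq Q L K] W} (hφ : Function.Injective φ) {q : (F.sheaf 0).fiber →ₗ[K] W}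
    (hq : Function.Surjective q) (hqφ : ∀ v, q (F.phi v) = φ (q v)) :
    ∃ G : AbelianTauSheaf K infty c, G.IsQuotient F ∧ Nonempty ((G.sheaf 0).fiber ≃ₗ[K] W) := by
  have := isCurveFunctionField Fq Q L K
  have h := F.isImageDatum φ (linearIndependent_of_injective hφ) (fun _ : Fin 1 => q)
    (fun _ => hqφ) (by rw [iSup_unique]; exact LinearMap.range_eq_top.2 hq)
  refine ⟨h.imageSheaf hinf hc,
    ⟨fun i => (q ∘ₗ (F.psi i).toLinearMap : (F.sheaf i).fiber →ₗ[K] W),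
    ⟨⟨fun i v => h.Pi 0 i v, fun i v => h.tau 0 i v⟩, fun i P v hv =>
      mem_imageSub (fun _ : Fin 1 => q ∘ₗ (F.psi i).toLinearMap) hv 0⟩, fun i P => ?_⟩,
    ⟨LinearEquiv.refl K W⟩⟩
  have h1 : h.stalk i P = ((F.sheaf i).stalk P).map
      ((q ∘ₗ (F.psi i).toLinearMap).restrictScalars P.ring) := by
    rw [IsImageDatum.stalk, imageSub, iSup_unique]
  exact congrArg (fun N : Submodule P.ring W => (N : Set W)) h1.symm

/-- The quotient is realised by a quotient sheaf. If that is isomorphic to `F`, the dimensions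
agree, and a surjection between them is injective. -/
theorem IsSimple.subsingleton_or_injective {F : AbelianTauSheaf K infty c} (hF : F.IsSimple)
    (hinf : infty.IsClosedPoint)
    (hc : c.point ≠ infty) {W : Type u} [AddCommGroup W] [Module K W] [FiniteDimensional K W]
    {φ : W →ₛₗ[sigma Fq Q L K] W} (hφ : Function.Injective φ) {q : (F.sheaf 0).fiber →ₗ[K] W}
    (hq : Function.Surjective q) (hqφ : ∀ v, q (F.phi v) = φ (q v)) :
    Subsingleton W ∨ Function.Injective q := by
  obtain ⟨G, hG, ⟨e⟩⟩ := F.exists_isQuotient hinf hc hφ hq hqφ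
  rcases hF.2 G hG with h | h
  · left
    have := G.isZero_iff.1 h
    exact e.symm.toEquiv.subsingleton
  · right
    rw [LinearMap.injective_iff_surjective_of_finrank_eq_finrank]
    · exact hq
    · rw [← e.finrank_eq, isomorphic_linearEquiv h]

/-- The generic fibre of a simple sheaf has no nontrivial stable subspaces. -/
theorem IsSimple.eq_bot_or_eq_top {F : AbelianTauSheaf K infty c} (hF : F.IsSimple)
    (hinf : infty.IsClosedPoint) (hc : c.point ≠ infty) {U : Submodule K (F.sheaf 0).fiber}
    (hU : IsStable F.phi U) : U = ⊥ ∨ U = ⊤ := by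
  let φ : ((F.sheaf 0).fiber ⧸ U) →ₛₗ[sigma Fq Q L K] ((F.sheaf 0).fiber ⧸ U) :=
    U.mapQ U F.phi hU
  -- Surjectivity of the induced map on `V/U` is inherited from `φ`; injectivity then follows by
  -- dimension.
  have h1 : Function.Surjective φ := by
    intro w
    obtain ⟨w, rfl⟩ := U.mkQ_surjective w
    obtain ⟨v, rfl⟩ := F.phi_bijective.2 w
    exact ⟨U.mkQ v, rfl⟩
  rcases hF.subsingleton_or_injective hinf hc (injective_of_surjective_semilinear h1)
    U.mkQ_surjective (fun _ => rfl) with h | h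
  · right
    exact Submodule.Quotient.subsingleton_iff.1 h
  · left
    rw [← U.ker_mkQ, LinearMap.ker_eq_bot.2 h]

/-- Over a finite field, the quasi-endomorphisms are the endomorphisms of the generic fibre. -/
def qEndEquiv (F : AbelianTauSheaf K infty c) (hinf : infty.IsClosedPoint) :
    F.QEnd ≃+* phiEnd F.phi where
  toFun f := ⟨f.1 0, f.2.choose_spec.commutes.phi⟩
  invFun g := ⟨ofZero g.1, isQuasiMorphism_of_commutes hinf F _ (commutes_ofZero g.2)⟩
  left_inv f := by
    refine Subtype.ext (funext fun i => LinearMap.ext fun v => (F.psi i).injective ?_)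
    change F.psi i (ofZero (f.1 0) i v) = F.psi i (f.1 i v)
    rw [psi_ofZero]
    exact (f.2.choose_spec.commutes.psi i v).symm
  right_inv g := Subtype.ext (ofZero_zero g.1)
  map_mul' _ _ := rfl
  map_add' _ _ := rfl

theorem _root_.RingEquiv.isDivisionAlgebra {R R' : Type*} [Ring R] [Ring R'] (e : R ≃+* R')
    (h : IsDivisionAlgebra R) : IsDivisionAlgebra R' := by
  obtain ⟨h1, h2⟩ := h
  refine ⟨e.symm.toEquiv.nontrivial, fun x hx => ?_⟩
  rw [← isUnit_map_iff e.symm]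
  exact h2 _ ((map_ne_zero_iff _ e.symm.injective).2 hx)

/-- A surjection `f` onto a nonzero `F'` is composed with a nonzero map `g` back. The endomorphism
`g ∘ f` of `V` is nonzero because `f` is onto, hence invertible, so `f` is injective. No quotient
sheaf has to be constructed, which is why the position of `ε` is irrelevant. -/
theorem isSimple_of_isDivisionAlgebra (F : AbelianTauSheaf K infty c)
    (h : IsDivisionAlgebra (phiEnd F.phi)) : F.IsSimple := by
  obtain ⟨h1, h2⟩ := h
  refine ⟨fun h0 => ?_, ?_⟩
  · have := F.isZero_iff.1 h0
    obtain ⟨x, hx⟩ := exists_ne (0 : phiEnd F.phi)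
    exact hx (Subtype.ext (LinearMap.ext fun v => Subsingleton.elim _ _))
  · rintro F' ⟨f, hm, hs⟩
    by_cases hi : Function.Injective (f 0)
    · exact Or.inr (hs.isomorphic hm (hm.commutes.injective hi))
    · left
      rw [isZero_iff]
      by_contra h0
      rw [not_subsingleton_iff_nontrivial] at h0
      obtain ⟨g, hg0, hg⟩ := exists_ne_zero_of_surjective F'.phi_bijective (hs.surjective 0)
        hm.commutes.phi
      have hu := h2 ⟨g ∘ₗ f 0, fun v => by
        rw [LinearMap.comp_apply, hm.commutes.phi, hg]
        rfl⟩ (fun h => hg0 (by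
          ext v
          obtain ⟨v, rfl⟩ := hs.surjective 0 v
          exact LinearMap.congr_fun (congrArg Subtype.val h) v))
      apply hi
      obtain ⟨y, hy⟩ := hu.exists_left_inv
      intro v w hvw
      have h3 : ∀ v, y.1 (g (f 0 v)) = v := fun v =>
        LinearMap.congr_fun (congrArg Subtype.val hy) v
      rw [← h3 v, hvw, h3]

/-- Schur's lemma: the kernel of an endomorphism is stable, so a nonzero endomorphism is injective
and by dimension bijective. -/
theorem IsSimple.isDivisionAlgebra {F : AbelianTauSheaf K infty c} (hF : F.IsSimple)
    (hinf : infty.IsClosedPoint) (hc : c.point ≠ infty) : IsDivisionAlgebra (phiEnd F.phi) := by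
  constructor
  · have h0 : ¬ Subsingleton (F.sheaf 0).fiber := fun h => hF.1 (F.isZero_iff.2 h)
    rw [not_subsingleton_iff_nontrivial] at h0
    obtain ⟨v, hv⟩ := exists_ne (0 : (F.sheaf 0).fiber)
    exact ⟨1, 0, fun h => hv (LinearMap.congr_fun (congrArg Subtype.val h) v)⟩
  · rintro ⟨f, hf⟩ hf0
    have hst : IsStable F.phi (LinearMap.ker f) := isStable_ker hf
    have hinj : Function.Injective f := by
      rcases hF.eq_bot_or_eq_top hinf hc hst with h | h
      · exact LinearMap.ker_eq_bot.1 h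
      · exact (hf0 (Subtype.ext (LinearMap.ker_eq_top.1 h))).elim
    let e := LinearEquiv.ofBijective f ⟨hinj, LinearMap.injective_iff_surjective.1 hinj⟩
    have he : ∀ v, e v = f v := fun _ => rfl
    have hmem : e.symm.toLinearMap ∈ phiEnd F.phi := by
      intro v
      obtain ⟨v, rfl⟩ := e.surjective v
      change e.symm _ = F.phi (e.symm _)
      rw [LinearEquiv.symm_apply_apply, LinearEquiv.symm_apply_eq, he, he, hf]
    exact ⟨⟨⟨f, hf⟩, ⟨e.symm.toLinearMap, hmem⟩, Subtype.ext (LinearMap.ext e.apply_symm_apply),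
      Subtype.ext (LinearMap.ext e.symm_apply_apply)⟩, rfl⟩

/-- A quasi-isogeny is bijective on generic fibres. It presents `V` as a sum of copies of the
generic fibres of simple sheaves, which have no proper nonzero stable subspaces. -/
theorem IsSemisimple.isSemisimpleRing {F : AbelianTauSheaf K infty c} (hF : F.IsSemisimple)
    (hinf : infty.IsClosedPoint) (hc : c.point ≠ infty) : IsSemisimpleRing (phiEnd F.phi) := by
  obtain ⟨n, G, S, hG, ⟨inj, proj, hinj, hproj, hid, hne, hsum⟩, f, hf⟩ := hF
  have hsurj := hf.surjective 0
  obtain ⟨D, hD, hfi, -⟩ := hf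
  let e := LinearEquiv.ofBijective (f 0) ⟨hfi 0, hsurj⟩
  have he : ∀ v, e v = f 0 v := fun _ => rfl
  let ι : ∀ j, ((G j).sheaf 0).fiber →ₗ[K] (F.sheaf 0).fiber := fun j =>
    e.symm.toLinearMap ∘ₗ inj j 0
  have hιφ : ∀ j v, ι j ((G j).phi v) = F.phi (ι j v) := by
    intro j v
    change e.symm (inj j 0 _) = F.phi (e.symm (inj j 0 v))
    rw [LinearEquiv.symm_apply_eq, he, hD.commutes.phi, (hinj j).commutes.phi, ← he,
      LinearEquiv.apply_symm_apply]
  have hιinj : ∀ j, Function.Injective (ι j) := fun j => e.symm.injective.comp fun v w h => by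
    rw [← hid j 0 v, h, hid]
  refine isSemisimpleRing_phiEnd (W := fun j => LinearMap.range (ι j)) (fun j => ⟨isStable_range (hιφ j), fun h => ?_,
    fun U hU hUW => ?_⟩) ?_
  · apply (hG j).1
    rw [isZero_iff]
    refine ⟨fun v w => hιinj j ?_⟩
    rw [LinearMap.range_eq_bot.1 h]
    rfl
  · have h1 : IsStable (G j).phi (U.comap (ι j)) := by
      intro v hv
      rw [Submodule.mem_comap] at hv ⊢
      rw [hιφ]
      exact hU _ hv
    have h2 : (U.comap (ι j)).map (ι j) = U := Submodule.map_comap_eq_of_le hUW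
    rcases (hG j).eq_bot_or_eq_top hinf hc h1 with h3 | h3
    · left
      rw [← h2, h3, Submodule.map_bot]
    · right
      rw [← h2, h3, Submodule.map_top]
  · rw [eq_top_iff]
    intro v _
    have h1 : v = ∑ j, ι j (proj j 0 (f 0 v)) := by
      apply e.injective
      rw [map_sum, he]
      conv_lhs => rw [← hsum 0 (f 0 v)]
      exact Finset.sum_congr rfl fun j _ => (e.apply_symm_apply _).symm
    rw [h1]
    exact sum_mem fun j _ => Submodule.mem_iSup_of_mem j ⟨_, rfl⟩

/-- The zero divisor. -/
def _root_.TauSheaf.EffectiveDivisor.trivial (k E : Type*) [Field k] [Field E] [Algebra k E] :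
    EffectiveDivisor k E where
  eqn _ := 1
  eqn_mem _ := one_mem _
  eqn_ne_zero _ := one_ne_zero
  finite := by
    convert Set.finite_empty
    ext x
    simp [one_mem]

/-- The sheaf `S` has stalks `∑ e_j(F_i)`, the image of `F` under all idempotents at once, and `G j`
is the image under `e_j` alone. By orthogonality `S` is the direct sum of the `G j`, and `F` is
contained in `S` with the same generic fibre. -/
theorem isSemisimple_of_decomposition (F : AbelianTauSheaf K infty c) (hinf : infty.IsClosedPoint)
    (hc : c.point ≠ infty) {n : ℕ} {e : Fin n → phiEnd F.phi}
    (hsimple : ∀ j, IsSimpleStable F.phi (LinearMap.range (e j).1))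
    (hidem : ∀ j v, (e j).1 ((e j).1 v) = (e j).1 v)
    (horth : ∀ j j', j ≠ j' → ∀ v, (e j').1 ((e j).1 v) = 0) (hsum : ∀ v, ∑ j, (e j).1 v = v) :
    F.IsSemisimple := by
  have := isCurveFunctionField Fq Q L K
  have hfin := finite_functionField Fq Q L K
  have hS := F.isImageDatum F.phi F.phi_linearIndependent (fun j => (e j).1) (fun j => (e j).2) (by
    rw [eq_top_iff]
    intro v _
    rw [← hsum v]
    exact sum_mem fun j _ => Submodule.mem_iSup_of_mem j ⟨_, rfl⟩)
  let W : Fin n → Submodule K (F.sheaf 0).fiber := fun j => LinearMap.range (e j).1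
  have hW : ∀ j, IsStable F.phi (W j) := fun j => (hsimple j).stable
  let q : ∀ j, (F.sheaf 0).fiber →ₗ[K] W j := fun j => (e j).1.rangeRestrict
  have hG := fun j => F.isImageDatum (hW j).restrict
    (linearIndependent_of_injective ((hW j).restrict_bijective F.phi_bijective.1).1)
    (fun _ : Fin 1 => q j) (fun _ v => Subtype.ext ((e j).2 v)) (by
      rw [iSup_unique]
      exact LinearMap.range_rangeRestrict _)
  let S := hS.imageSheaf hinf hc
  let G := fun j => (hG j).imageSheaf hinf hc
  have hqe : ∀ j v, q j ((e j).1 v) = q j v := fun j v => Subtype.ext (hidem j v)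
  have hqw : ∀ j (w : W j), q j w = w := by
    rintro j ⟨_, v, rfl⟩
    exact Subtype.ext (hidem j v)
  have hq0 : ∀ j j', j ≠ j' → ∀ v, q j' ((e j).1 v) = 0 := fun j j' hj v =>
    Subtype.ext (horth j j' hj v)
  refine ⟨n, G, S, fun j => ?_, ⟨fun j i => (W j).subtype, fun j i => q j, fun j =>
    ⟨⟨fun _ _ => rfl, fun _ _ => rfl⟩, fun i P v hv => ?_⟩, fun j => ⟨⟨fun _ _ => rfl, fun i v => ?_⟩,
      fun i P v hv => ?_⟩, fun j i w => hqw j w, fun j j' hj i w => ?_, fun i v => hsum v⟩,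
      fun i => (F.psi i).toLinearMap, EffectiveDivisor.trivial Fq Q,
      ⟨⟨fun i v => F.psi_Pi i v, fun i v => F.psi_tau i v⟩, fun i P v hv => ?_⟩,
      fun i => (F.psi i).injective, {infty} ∪ CurvePoint.proj Fq Q ''
        {P : CurvePoint L K | F.selfDatum.stalk 0 P ≠ hS.stalk 0 P}, ?_, ?_, fun i P hP => ?_⟩
  -- Simplicity of `G j` comes from its generic fibre `W j`, whose stable subspaces are stable in
  -- `V`.
  · have hφ : ∀ v : W j, (G j).phi v = (hW j).restrict v := fun v => by
      have h1 := (G j).psi_Pi 0 ((hW j).restrict v)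
      exact h1.trans ((G j).psi_zero _)
    refine (G j).isSimple_of_forall_isStable (fun h => (hsimple j).ne_bot ?_) fun U hU => ?_
    · have h1 : Subsingleton (W j) := h
      exact (Submodule.subsingleton_iff_eq_bot).1 h1
    · let U : Submodule K (W j) := U
      have h1 : IsStable F.phi (U.map (W j).subtype) := by
        rintro _ ⟨v, hv, rfl⟩
        have h2 := hU v hv
        rw [hφ] at h2
        exact ⟨_, h2, rfl⟩
      rcases (hsimple j).eq_or_eq _ h1 (Submodule.map_subtype_le _ _) with h2 | h2
      · left
        apply Submodule.map_injective_of_injective (W j).injective_subtype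
        exact h2.trans (Submodule.map_bot _).symm
      · right
        apply Submodule.map_injective_of_injective (W j).injective_subtype
        exact h2.trans ((W j).map_subtype_top).symm
  · have h1 : (hG j).stalk i P ≤ (hS.stalk i P).comap ((W j).subtype.restrictScalars P.ring) :=
      (imageSub_le _).2 fun _ v hv => mem_imageSub (fun j => (e j).1 ∘ₗ (F.psi i).toLinearMap) hv j
    exact h1 hv
  · exact Subtype.ext ((e j).2 v)
  · have h1 : hS.stalk i P ≤ ((hG j).stalk i P).comap ((q j).restrictScalars P.ring) := by
      refine (imageSub_le _).2 fun j' v hv => ?_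
      change q j ((e j').1 (F.psi i v)) ∈ (hG j).stalk i P
      by_cases hj : j' = j
      · subst hj
        rw [hqe]
        exact mem_imageSub (fun _ : Fin 1 => q j' ∘ₗ (F.psi i).toLinearMap) hv 0
      · rw [hq0 j' j hj]
        exact zero_mem _
    exact h1 hv
  · obtain ⟨_, v, rfl⟩ := w
    exact hq0 j j' hj v
  -- `v` is the sum of the `e_j v`, so `F` lies in `S`, and the trivial divisor suffices.
  · have h1 : F.psi i v ∈ hS.stalk i P := by
      rw [← hsum (F.psi i v)]
      exact sum_mem fun j _ => mem_imageSub (fun j => (e j).1 ∘ₗ (F.psi i).toLinearMap) hv j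
    exact Submodule.smul_mem _ (⟨_, algebraMap_mem_ring (x := P.proj Fq Q) rfl (one_mem _)⟩ : P.ring) h1
  -- Two bundles with the same generic fibre agree outside a finite set. Index `0` is enough,
  -- because off `∞` the stalks do not depend on the index; this is why `∞` is put into the
  -- exceptional set.
  · obtain ⟨b, -, hb⟩ := (F.selfDatum.bundle 0).locallyFree (genericPoint L K)
    obtain ⟨b', -, hb'⟩ := (hS.bundle 0).locallyFree (genericPoint L K)
    refine (Set.finite_singleton _).union (Set.Finite.image _ ?_)
    exact finite_ne_of_eq_span (V := (F.sheaf 0).fiber) (fun P => F.selfDatum.stalk 0 P)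
      (fun P => hS.stalk 0 P) b.span_eq b'.span_eq hb hb'
  · rintro x (rfl | ⟨P, hP, rfl⟩)
    · exact hinf
    · refine CurvePoint.IsClosedPoint.proj fun h => hP ?_
      rw [F.selfDatum.stalk_eq_top 0 h, hS.stalk_eq_top 0 h]
  · rw [Set.mem_union, not_or] at hP
    have h1 : F.selfDatum.stalk i P = hS.stalk i P := by
      rw [F.selfDatum.stalk_eq_stalk_zero i hP.1, hS.stalk_eq_stalk_zero i hP.1]
      by_contra h
      exact hP.2 ⟨P, h, rfl⟩
    rw [map_psi_stalk] at h1
    have h2 := congrArg (fun N : Submodule P.ring (F.sheaf 0).fiber => (N : Set (F.sheaf 0).fiber)) h1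
    refine h2.trans ?_
    ext v
    change v ∈ hS.stalk i P ↔ algebraMap Q K 1 • v ∈ hS.stalk i P
    rw [map_one, one_smul]

/-- The finite field case of the main theorem. -/
theorem simple_semisimple_iff (F : AbelianTauSheaf K infty c) (hinf : infty.IsClosedPoint) :
    (IsDivisionAlgebra F.QEnd → F.IsSimple) ∧
      (c.point ≠ infty → (F.IsSimple ↔ IsDivisionAlgebra F.QEnd)) ∧
      (c.point ≠ infty → (F.IsSemisimple ↔ IsSemisimpleRing F.QEnd)) := by
  let e := F.qEndEquiv hinf
  have h1 : IsDivisionAlgebra F.QEnd → F.IsSimple := fun h =>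
    F.isSimple_of_isDivisionAlgebra (e.isDivisionAlgebra h)
  refine ⟨h1, fun hc => ⟨fun h => e.symm.isDivisionAlgebra (h.isDivisionAlgebra hinf hc), h1⟩,
    fun hc => ⟨fun h => ?_, fun h => ?_⟩⟩
  · have := h.isSemisimpleRing hinf hc
    exact e.symm.isSemisimpleRing
  · have := e.isSemisimpleRing
    obtain ⟨n, e, h1, h2, h3, h4⟩ := exists_decomposition (φ := F.phi)
      fun U hU => hU.exists_isCompl F.phi_bijective
    exact F.isSemisimple_of_decomposition hinf hc h1 h2 h3 h4

end AbelianTauSheaf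

end Simple

end

end TauSheaf

namespace TauSheaf

noncomputable section

/-! ### Coordinates on the projective line -/

section Coordinate

open Polynomial

/-- `E` is the rational function field `k(u)`. -/
structure IsCoord (k : Type*) {E : Type*} [Field k] [Field E] [Algebra k E] (u : E) : Prop where
  transcendental : Transcendental k u
  exists_div : ∀ z : E, ∃ p r : k[X], r ≠ 0 ∧ z = aeval u p / aeval u r

namespace IsCoord

variable {k E : Type*} [Field k] [Field E] [Algebra k E] {u : E}

theorem aeval_ne_zero (h : IsCoord k u) {p : k[X]} (hp : p ≠ 0) : aeval u p ≠ 0 := fun h0 =>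
  h.transcendental ⟨p, hp, h0⟩

theorem ne_zero (h : IsCoord k u) : u ≠ 0 := by
  simpa using h.aeval_ne_zero (X_ne_zero (R := k))

/-- The coordinate itself is separating, and in a rational function field every nonconstant element
is transcendental. -/
theorem isCurveFunctionField (h : IsCoord k u) : IsCurveFunctionField k E where
  exists_separating := by
    have h1 : Function.Surjective (algebraMap k⟮u⟯ E) := by
      intro z
      obtain ⟨p, r, hr, rfl⟩ := h.exists_div z
      have hmem : ∀ p : k[X], aeval u p ∈ k⟮u⟯ := fun p =>
        IntermediateField.algebra_adjoin_le_adjoin k {u} (aeval_mem_adjoin_singleton k u)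
      exact ⟨⟨_, div_mem (hmem p) (hmem r)⟩, rfl⟩
    refine ⟨u, h.transcendental, Module.Finite.of_surjective (Algebra.linearMap k⟮u⟯ E) h1,
      ⟨fun z => ?_⟩⟩
    obtain ⟨y, rfl⟩ := h1 z
    exact isSeparable_algebraMap y
  algebraic_mem z hz := by
    have hle : nonZeroDivisors k[X] ≤ (nonZeroDivisors E).comap (aeval (R := k) u) := by
      intro p hp
      exact mem_nonZeroDivisors_of_ne_zero (h.aeval_ne_zero (nonZeroDivisors.ne_zero hp))
    let f : RatFunc k →ₐ[k] E := RatFunc.liftAlgHom (aeval u) hle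
    obtain ⟨y, rfl⟩ : ∃ y, f y = z := by
      obtain ⟨p, r, hr, rfl⟩ := h.exists_div z
      exact ⟨algebraMap _ _ p / algebraMap _ _ r, RatFunc.liftAlgHom_apply_div _ _ _ _⟩
    rw [isAlgebraic_algHom_iff f f.toRingHom.injective] at hz
    by_contra hy
    refine RatFunc.transcendental_of_ne_C y (fun ⟨c, hc⟩ => hy ⟨c, ?_⟩) hz
    rw [hc, ← RatFunc.algebraMap_eq_C]
    exact (f.commutes c).symm

theorem inv (h : IsCoord k u) : IsCoord k u⁻¹ where
  transcendental h' := h.transcendental (by simpa using h'.inv)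
  exists_div z := by
    obtain ⟨p, r, hr, rfl⟩ := h.exists_div z
    have hu := h.ne_zero
    -- Reversing the coefficients rewrites a polynomial in `u` as one in `u⁻¹`, up to a power of
    -- `u`.
    have key : ∀ p : k[X], aeval u p = aeval u⁻¹ p.reverse * u ^ p.natDegree := by
      intro p
      let := invertibleOfNonzero hu
      have := eval₂_reverse_mul_pow (algebraMap k E) u p
      rw [invOf_eq_inv] at this
      exact this.symm
    refine ⟨p.reverse * X ^ r.natDegree, r.reverse * X ^ p.natDegree,
      mul_ne_zero (by simpa using hr) (pow_ne_zero _ X_ne_zero), ?_⟩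
    have h1 : aeval u⁻¹ r.reverse ≠ 0 := by
      intro h0
      apply h.aeval_ne_zero hr
      rw [key, h0, zero_mul]
    rw [key p, key r]
    simp only [map_mul, map_pow, aeval_X, inv_pow]
    generalize aeval u⁻¹ p.reverse = a at *
    generalize aeval u⁻¹ r.reverse = b at *
    field_simp

theorem exists_coprime_div (h : IsCoord k u) (z : E) :
    ∃ p r : k[X], IsCoprime p r ∧ r ≠ 0 ∧ z = aeval u p / aeval u r := by
  classical
  obtain ⟨p, r, hr, rfl⟩ := h.exists_div z
  have hd : EuclideanDomain.gcd p r ≠ 0 := fun h0 => hr (EuclideanDomain.gcd_eq_zero_iff.1 h0).2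
  obtain ⟨p', hp'⟩ := EuclideanDomain.gcd_dvd_left p r
  obtain ⟨r', hr'⟩ := EuclideanDomain.gcd_dvd_right p r
  have hab := EuclideanDomain.gcd_eq_gcd_ab p r
  generalize EuclideanDomain.gcd p r = d at *
  generalize EuclideanDomain.gcdA p r = a at *
  generalize EuclideanDomain.gcdB p r = b at *
  subst hp' hr'
  refine ⟨p', r', ⟨a, b, mul_left_cancel₀ hd (by linear_combination -hab)⟩,
    right_ne_zero_of_mul hr, ?_⟩
  rw [map_mul, map_mul, mul_div_mul_left _ _ (h.aeval_ne_zero hd)]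

theorem ne_zero_of_coeff {p : k[X]} (hp : p.coeff 0 ≠ 0) : p ≠ 0 := fun h0 => hp (by simp [h0])

/-- The zero of `u`. -/
def zeroPoint (h : IsCoord k u) : CurvePoint k E where
  ring :=
    { carrier := {z | ∃ p r : k[X], r.coeff 0 ≠ 0 ∧ z = aeval u p / aeval u r}
      zero_mem' := ⟨0, 1, by simp, by simp⟩
      one_mem' := ⟨1, 1, by simp, by simp⟩
      mul_mem' := by
        rintro _ _ ⟨p, r, hr, rfl⟩ ⟨p', r', hr', rfl⟩
        exact ⟨p * p', r * r', by rw [mul_coeff_zero]; exact mul_ne_zero hr hr',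
          by rw [map_mul, map_mul, div_mul_div_comm]⟩
      add_mem' := by
        rintro _ _ ⟨p, r, hr, rfl⟩ ⟨p', r', hr', rfl⟩
        refine ⟨p * r' + r * p', r * r', by rw [mul_coeff_zero]; exact mul_ne_zero hr hr', ?_⟩
        rw [div_add_div _ _ (h.aeval_ne_zero (ne_zero_of_coeff hr))
          (h.aeval_ne_zero (ne_zero_of_coeff hr'))]
        simp only [map_mul, map_add]
      neg_mem' := by
        rintro _ ⟨p, r, hr, rfl⟩
        exact ⟨-p, r, hr, by rw [map_neg, neg_div]⟩
      mem_or_inv_mem' := by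
        intro z
        obtain ⟨p, r, ⟨a, b, hab⟩, hr, rfl⟩ := h.exists_coprime_div z
        by_cases hr0 : r.coeff 0 = 0
        · right
          refine ⟨r, p, fun hp0 => ?_, by rw [inv_div]⟩
          have := congrArg (fun p => p.coeff 0) hab
          simp [mul_coeff_zero, hr0, hp0] at this
        · exact Or.inl ⟨p, r, hr0, rfl⟩ }
  const_mem a := ⟨C a, 1, by simp, by simp⟩

theorem coord_mem (h : IsCoord k u) : u ∈ h.zeroPoint.ring := ⟨X, 1, by simp, by simp⟩

theorem inv_notMem (h : IsCoord k u) : u⁻¹ ∉ h.zeroPoint.ring := by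
  rintro ⟨p, r, hr, hpr⟩
  have h1 : aeval u r = aeval u (X * p) := by
    have := h.ne_zero
    have := h.aeval_ne_zero (ne_zero_of_coeff hr)
    rw [map_mul, aeval_X]
    field_simp at hpr
    exact hpr
  have h2 := (transcendental_iff_injective.1 h.transcendental) h1
  apply hr
  rw [h2, mul_coeff_zero, coeff_X_zero, zero_mul]

theorem isClosedPoint (h : IsCoord k u) : h.zeroPoint.IsClosedPoint := fun h0 =>
  h.inv_notMem (h0 ▸ ValuationSubring.mem_top _)

/-- Every function which is regular at the zero of `u` is congruent to a constant modulo `u`. -/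
theorem exists_const (h : IsCoord k u) {z : E} (hz : z ∈ h.zeroPoint.ring) :
    ∃ (c : k) (y : E), y ∈ h.zeroPoint.ring ∧ z = algebraMap k E c + u * y := by
  obtain ⟨p, r, hr, rfl⟩ := hz
  have hr' := h.aeval_ne_zero (ne_zero_of_coeff hr)
  obtain ⟨s, hs⟩ : X ∣ p - C (p.coeff 0 / r.coeff 0) * r := by
    rw [X_dvd_iff]
    simp [hr]
  refine ⟨p.coeff 0 / r.coeff 0, aeval u s / aeval u r, ⟨s, r, hr, rfl⟩, ?_⟩
  have h1 := congrArg (aeval u) hs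
  simp only [map_mul, map_sub, aeval_X, aeval_C] at h1
  rw [mul_div_assoc', ← h1]
  field_simp
  ring

theorem nonunit_iff (h : IsCoord k u) (z : h.zeroPoint.ring) :
    ¬ IsUnit z ↔ ∃ y ∈ h.zeroPoint.ring, (z : E) = u * y := by
  constructor
  · intro hz
    obtain ⟨p, r, hr, hpr⟩ := z.2
    by_cases hp : p.coeff 0 = 0
    · obtain ⟨s, rfl⟩ := X_dvd_iff.2 hp
      refine ⟨aeval u s / aeval u r, ⟨s, r, hr, rfl⟩, ?_⟩
      rw [hpr, map_mul, aeval_X, mul_div_assoc]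
    · refine (hz (.of_mul_eq_one ⟨_, r, p, hp, rfl⟩ (Subtype.ext ?_))).elim
      change (z : E) * (aeval u r / aeval u p) = 1
      have h1 := h.aeval_ne_zero (ne_zero_of_coeff hr)
      have h2 := h.aeval_ne_zero (ne_zero_of_coeff hp)
      rw [hpr]
      field_simp
  · rintro ⟨y, hy, hzy⟩ hz
    obtain ⟨w, hw⟩ := hz.exists_right_inv
    have h1 : (z : E) * w = 1 := congrArg Subtype.val hw
    apply h.inv_notMem
    have h2 : u⁻¹ = y * w := by
      have := h.ne_zero
      rw [hzy] at h1
      field_simp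
      linear_combination -h1
    rw [h2]
    exact mul_mem hy w.2

theorem irreducible (h : IsCoord k u) : Irreducible (⟨u, h.coord_mem⟩ : h.zeroPoint.ring) := by
  have := h.isCurveFunctionField
  have := h.isClosedPoint.isDiscreteValuationRing
  rw [IsDiscreteValuationRing.irreducible_iff_uniformizer]
  ext z
  rw [IsLocalRing.mem_maximalIdeal, mem_nonunits_iff, h.nonunit_iff, Ideal.mem_span_singleton]
  constructor
  · rintro ⟨y, hy, hzy⟩
    exact ⟨⟨y, hy⟩, Subtype.ext hzy⟩
  · rintro ⟨y, hy⟩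
    exact ⟨y, y.2, congrArg Subtype.val hy⟩

theorem ord_coord (h : IsCoord k u) : h.zeroPoint.ord u = 1 :=
  CurvePoint.ord_irreducible h.irreducible

theorem isRational (h : IsCoord k u) : h.zeroPoint.IsRational := by
  intro z
  obtain ⟨z, rfl⟩ := IsLocalRing.residue_surjective z
  obtain ⟨c, y, hy, hzy⟩ := h.exists_const z.2
  refine ⟨c, ?_⟩
  change IsLocalRing.residue _ (algebraMap k h.zeroPoint.ring c) = _
  rw [← sub_eq_zero, ← map_sub, IsLocalRing.residue_eq_zero_iff, IsLocalRing.mem_maximalIdeal,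
    mem_nonunits_iff, h.nonunit_iff]
  refine ⟨-y, neg_mem hy, ?_⟩
  change algebraMap k E c - z = _
  rw [hzy]
  ring

/-- The point where `u` has a zero is unique. -/
theorem eq_zeroPoint (h : IsCoord k u) {P : CurvePoint k E} (h1 : u ∈ P.ring) (h2 : u⁻¹ ∉ P.ring) :
    P = h.zeroPoint := by
  have := h.isCurveFunctionField
  -- It suffices that every polynomial in `u` with nonzero constant term is invertible at `P`.
  -- Otherwise it and `u` lie in the maximal ideal, and so does its constant term.
  refine (CurvePoint.eq_of_le ?_ fun h0 => h2 (h0 ▸ ValuationSubring.mem_top _)).symm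
  have hmem : ∀ p : k[X], aeval u p ∈ P.ring := fun p =>
    P.adjoin_le h1 _ (aeval_mem_adjoin_singleton k u)
  rintro _ ⟨p, r, hr, rfl⟩
  rw [div_eq_mul_inv]
  refine mul_mem (hmem p) ?_
  by_contra h3
  have h4 : (⟨_, hmem r⟩ : P.ring) ∈ IsLocalRing.maximalIdeal P.ring := by
    rw [IsLocalRing.mem_maximalIdeal, mem_nonunits_iff]
    intro hu
    obtain ⟨w, hw⟩ := hu.exists_right_inv
    apply h3
    rw [← eq_inv_of_mul_eq_one_right (congrArg Subtype.val hw : aeval u r * (w : E) = 1)]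
    exact w.2
  have h5 : (⟨_, h1⟩ : P.ring) ∈ IsLocalRing.maximalIdeal P.ring := by
    rw [IsLocalRing.mem_maximalIdeal, mem_nonunits_iff]
    intro hu
    obtain ⟨w, hw⟩ := hu.exists_right_inv
    apply h2
    rw [← eq_inv_of_mul_eq_one_right (congrArg Subtype.val hw : u * (w : E) = 1)]
    exact w.2
  obtain ⟨s, hs⟩ := X_dvd_sub_C (p := r)
  have h6 : algebraMap k P.ring (r.coeff 0) ∈ IsLocalRing.maximalIdeal P.ring := by
    have h7 := sub_mem h4 (Ideal.mul_mem_right ⟨_, hmem s⟩ _ h5)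
    convert h7
    refine Subtype.ext ?_
    change algebraMap k E _ = aeval u r - u * aeval u s
    have := congrArg (aeval u) hs
    rw [map_sub, map_mul, aeval_X, aeval_C] at this
    linear_combination -this
  exact h6 ((IsUnit.mk0 _ hr).map (algebraMap k P.ring))

theorem deg_zeroPoint {k E : Type u} [Field k] [Field E] [Algebra k E] {u : E} (h : IsCoord k u) :
    h.zeroPoint.deg = 1 := by
  let e := LinearEquiv.ofBijective (Algebra.linearMap k (IsLocalRing.ResidueField h.zeroPoint.ring))
    ⟨(algebraMap k _).injective, h.isRational⟩
  exact e.finrank_eq.symm.trans (Module.finrank_self k)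

end IsCoord

end Coordinate

end

end TauSheaf

namespace TauSheaf

noncomputable section

/-! ### Base change of the projective line -/

section LineBaseChange

open Polynomial

section

variable (Fq Q L K : Type u) [Field Fq] [Field Q] [Field L] [Field K]
  [Algebra Fq Q] [Algebra Fq L] [Algebra Fq K] [Algebra Q K] [Algebra L K]
  [IsScalarTower Fq Q K] [IsScalarTower Fq L K]

theorem mulMap_comm (x : Q ⊗[Fq] L) :
    mulMap Fq L Q K (Algebra.TensorProduct.comm Fq Q L x) = mulMap Fq Q L K x := by
  have : (mulMap Fq L Q K).comp (Algebra.TensorProduct.comm Fq Q L).toAlgHom =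
      mulMap Fq Q L K := by
    ext x <;> simp [mulMap]
  exact DFunLike.congr_fun this x

theorem IsBaseChangeFunctionField.symm [IsBaseChangeFunctionField Fq Q L K] :
    IsBaseChangeFunctionField Fq L Q K where
  injective := by
    have h : ⇑(mulMap Fq L Q K) = mulMap Fq Q L K ∘ Algebra.TensorProduct.comm Fq L Q := by
      funext x
      exact (mulMap_comm Fq L Q K x).symm
    rw [h]
    exact IsBaseChangeFunctionField.injective.comp (AlgEquiv.injective _)
  exists_div z := by
    obtain ⟨a, b, hb, h⟩ := IsBaseChangeFunctionField.exists_div (Fq := Fq) (Q := Q) (L := L) z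
    exact ⟨Algebra.TensorProduct.comm Fq Q L a, Algebra.TensorProduct.comm Fq Q L b,
      by rwa [mulMap_comm], by rwa [mulMap_comm, mulMap_comm]⟩

/-- The other view of `K`: for `L = Fq(α)` it is the rational function field `Q(α)` over `Q`. The
place over `Q` where `α` has its pole is not trivial on `L` and is what controls endomorphisms in
the counterexample. -/
theorem IsCoord.baseChange_right [IsBaseChangeFunctionField Fq Q L K] {α : L}
    (h : IsCoord Fq α) : IsCoord Q (algebraMap L K α) where
  transcendental := by
    rw [transcendental_iff_injective]
    let f : Q ⊗[Fq] Fq[X] →ₐ[Q] Q ⊗[Fq] L :=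
      Algebra.TensorProduct.map (AlgHom.id Q Q) (aeval (R := Fq) α)
    let g : Q ⊗[Fq] L →ₐ[Q] K := Algebra.TensorProduct.lift (Algebra.ofId Q K)
      (IsScalarTower.toAlgHom Fq L K) fun _ _ => Commute.all _ _
    have hg : ∀ x, g x = mulMap Fq Q L K x := by
      intro x
      have : g.restrictScalars Fq = mulMap Fq Q L K := by
        ext x <;> simp [mulMap, g]
      exact DFunLike.congr_fun this x
    have hf : Function.Injective f :=
      Module.Flat.lTensor_preserves_injective_linearMap (M := Q) (aeval (R := Fq) α).toLinearMap
        (transcendental_iff_injective.1 h.transcendental)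
    have hfg : aeval (algebraMap L K α) = (g.comp f).comp (polyEquivTensor' Fq Q).toAlgHom := by
      refine Polynomial.algHom_ext ?_
      simp [f, g]
    rw [hfg]
    have hg' : Function.Injective g := by
      intro x y hxy
      rw [hg, hg] at hxy
      exact IsBaseChangeFunctionField.injective hxy
    exact (hg'.comp hf).comp (AlgEquiv.injective _)
  exists_div := by
    -- Denominators can be taken with coefficients in `Fq`, since only those from `L` have to be
    -- cleared.
    have hne : ∀ d : Fq[X], d ≠ 0 → aeval (algebraMap L K α) (d.map (algebraMap Fq Q)) ≠ 0 := by
      intro d hd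
      rw [aeval_map_algebraMap, aeval_algebraMap_apply, _root_.map_ne_zero]
      exact h.aeval_ne_zero hd
    have key : ∀ x : Q ⊗[Fq] L, ∃ (p : Q[X]) (d : Fq[X]), d ≠ 0 ∧ mulMap Fq Q L K x =
        aeval (algebraMap L K α) p / aeval (algebraMap L K α) (d.map (algebraMap Fq Q)) := by
      intro x
      induction x with
      | zero => exact ⟨0, 1, one_ne_zero, by simp⟩
      | tmul a b =>
        obtain ⟨p, r, hr, rfl⟩ := h.exists_div b
        refine ⟨C a * p.map (algebraMap Fq Q), r, hr, ?_⟩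
        simp only [mulMap, Algebra.TensorProduct.productMap_apply_tmul, map_mul, aeval_C,
          aeval_map_algebraMap, aeval_algebraMap_apply, IsScalarTower.coe_toAlgHom', map_div₀]
        rw [mul_div_assoc]
      | add x y hx hy =>
        obtain ⟨p, d, hd, hx⟩ := hx
        obtain ⟨p', d', hd', hy⟩ := hy
        refine ⟨p * d'.map (algebraMap Fq Q) + d.map (algebraMap Fq Q) * p', d * d',
          mul_ne_zero hd hd', ?_⟩
        rw [map_add, hx, hy, div_add_div _ _ (hne d hd) (hne d' hd')]
        simp only [Polynomial.map_mul, map_mul, map_add]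
    intro z
    obtain ⟨a, b, hb, rfl⟩ := IsBaseChangeFunctionField.exists_div (Fq := Fq) (Q := Q) (L := L) z
    obtain ⟨p, d, hd, hp⟩ := key a
    obtain ⟨p', d', hd', hp'⟩ := key b
    refine ⟨p * d'.map (algebraMap Fq Q), d.map (algebraMap Fq Q) * p', mul_ne_zero ?_ ?_, ?_⟩
    · rwa [Polynomial.map_ne_zero_iff (algebraMap Fq Q).injective]
    · rintro rfl
      apply hb
      rw [hp', map_zero, zero_div]
    · rw [hp, hp', div_div_div_eq, map_mul, map_mul]

theorem IsCoord.baseChange [IsBaseChangeFunctionField Fq Q L K] {t : Q}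
    (h : IsCoord Fq t) : IsCoord L (algebraMap Q K t) :=
  have := IsBaseChangeFunctionField.symm Fq Q L K
  h.baseChange_right Fq L Q K

/-- The base change of a function field to a rational function field. -/
theorem exists_isBaseChangeFunctionField (k Q : Type u) [Field k] [Field Q] [Algebra k Q] :
    ∃ (K : Type u) (_ : Field K) (_ : Algebra k K) (_ : Algebra Q K) (_ : Algebra (RatFunc k) K)
      (_ : IsScalarTower k Q K) (_ : IsScalarTower k (RatFunc k) K),
      IsBaseChangeFunctionField k Q (RatFunc k) K := by
  have hle : nonZeroDivisors k[X] ≤ (nonZeroDivisors (RatFunc Q)).comap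
      ((IsScalarTower.toAlgHom k Q[X] (RatFunc Q)).comp (Polynomial.mapAlg k Q)) := by
    intro p hp
    refine mem_nonZeroDivisors_of_ne_zero ?_
    change algebraMap Q[X] (RatFunc Q) (p.map (algebraMap k Q)) ≠ 0
    rw [_root_.map_ne_zero_iff _ (RatFunc.algebraMap_injective Q),
      Polynomial.map_ne_zero_iff (algebraMap k Q).injective]
    exact nonZeroDivisors.ne_zero hp
  -- `K` is taken to be `Q(X)`, with `k(X)` embedded by extension of coefficients.
  let f : RatFunc k →ₐ[k] RatFunc Q := RatFunc.liftAlgHom _ hle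
  have hf : ∀ p : k[X], f (algebraMap k[X] (RatFunc k) p) =
      algebraMap Q[X] (RatFunc Q) (p.map (algebraMap k Q)) := fun p => by
    have h := RatFunc.liftAlgHom_apply_div _ hle p 1
    rw [map_one, map_one, div_one, div_one] at h
    exact h
  let := f.toRingHom.toAlgebra
  have ht : IsScalarTower k (RatFunc k) (RatFunc Q) := .of_algebraMap_eq fun x => (f.commutes x).symm
  let g : Q ⊗[k] k[X] →ₐ[k] Q ⊗[k] RatFunc k :=
    Algebra.TensorProduct.map (AlgHom.id k Q) (IsScalarTower.toAlgHom k k[X] (RatFunc k))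
  have hg : ∀ p : Q[X], mulMap k Q (RatFunc k) (RatFunc Q) (g (polyEquivTensor k Q p)) =
      algebraMap Q[X] (RatFunc Q) p := by
    intro p
    induction p using Polynomial.induction_on' with
    | add p p' hp hp' => simp only [map_add, hp, hp']
    | monomial n a =>
      have h1 : f RatFunc.X = algebraMap Q[X] (RatFunc Q) X := by
        rw [← RatFunc.algebraMap_X, hf, map_X]
      have h2 : algebraMap (RatFunc k) (RatFunc Q) RatFunc.X = algebraMap Q[X] (RatFunc Q) X := h1
      rw [← C_mul_X_pow_eq_monomial]
      simp [g, mulMap, h2]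
  have hmap : ∀ p : k[X], polyEquivTensor k Q (p.map (algebraMap k Q)) = 1 ⊗ₜ p := by
    intro p
    have : (polyEquivTensor k Q).toAlgHom.comp (Polynomial.mapAlg k Q) =
        Algebra.TensorProduct.includeRight := by
      refine Polynomial.algHom_ext ?_
      have h1 : Polynomial.mapAlg k Q X = X := map_X (algebraMap k Q)
      simp [h1]
    exact DFunLike.congr_fun this p
  refine ⟨RatFunc Q, inferInstance, inferInstance, inferInstance, inferInstance, inferInstance, ht,
    ?_, ?_⟩
  · rw [injective_iff_map_eq_zero]
    have key : ∀ x : Q ⊗[k] RatFunc k, ∃ (d : k[X]) (y : Q[X]), d ≠ 0 ∧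
        (1 ⊗ₜ algebraMap k[X] (RatFunc k) d) * x = g (polyEquivTensor k Q y) := by
      intro x
      induction x with
      | zero => exact ⟨1, 0, one_ne_zero, by simp⟩
      | tmul a b =>
        induction b using RatFunc.induction_on with
        | f p r hr =>
          refine ⟨r, C a * p.map (algebraMap k Q), hr, ?_⟩
          have hr' : algebraMap k[X] (RatFunc k) r ≠ 0 := by
            rwa [_root_.map_ne_zero_iff _ (RatFunc.algebraMap_injective k)]
          rw [map_mul, hmap, Algebra.TensorProduct.tmul_mul_tmul, one_mul,
            mul_div_cancel₀ _ hr']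
          simp [g]
      | add x y hx hy =>
        obtain ⟨d, p, hd, hx⟩ := hx
        obtain ⟨d', p', hd', hy⟩ := hy
        refine ⟨d * d', d'.map (algebraMap k Q) * p + d.map (algebraMap k Q) * p', mul_ne_zero hd hd', ?_⟩
        have h1 : (1 : Q) ⊗ₜ[k] algebraMap k[X] (RatFunc k) (d * d') =
            (1 ⊗ₜ algebraMap k[X] (RatFunc k) d) * (1 ⊗ₜ algebraMap k[X] (RatFunc k) d') := by
          rw [Algebra.TensorProduct.tmul_mul_tmul, one_mul, map_mul]
        have h2 : ∀ d : k[X], g (1 ⊗ₜ d) = 1 ⊗ₜ algebraMap k[X] (RatFunc k) d := fun d => by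
          simp [g]
        rw [h1, map_add, map_mul (polyEquivTensor k Q), map_mul (polyEquivTensor k Q), hmap, hmap,
          map_add, map_mul g, map_mul g, h2, h2, ← hx, ← hy]
        ring
    intro x hx
    obtain ⟨d, y, hd, hy⟩ := key x
    have h1 : y = 0 := by
      apply RatFunc.algebraMap_injective Q
      rw [← hg, ← hy, map_mul, hx, mul_zero, map_zero]
    have h2 : algebraMap k[X] (RatFunc k) d ≠ 0 := by
      rwa [_root_.map_ne_zero_iff _ (RatFunc.algebraMap_injective k)]
    have h3 : ((1 : Q) ⊗ₜ[k] (algebraMap k[X] (RatFunc k) d)⁻¹) *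
        (1 ⊗ₜ algebraMap k[X] (RatFunc k) d) = 1 := by
      rw [Algebra.TensorProduct.tmul_mul_tmul, one_mul, inv_mul_cancel₀ h2]
      rfl
    rw [← one_mul x, ← h3, mul_assoc, hy, h1, map_zero, map_zero, mul_zero]
  · intro z
    induction z using RatFunc.induction_on with
    | f p r hr =>
      refine ⟨g (polyEquivTensor k Q p), g (polyEquivTensor k Q r), ?_, ?_⟩
      · rw [hg, _root_.map_ne_zero_iff _ (RatFunc.algebraMap_injective Q)]
        exact hr
      · rw [hg, hg]

end

section

variable {Fq Q L K : Type u} [Field Fq] [Field Q] [Field L] [Field K]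
  [Algebra Fq Q] [Algebra Fq L] [Algebra Fq K] [Algebra Q K] [Algebra L K]
  [IsScalarTower Fq Q K] [IsScalarTower Fq L K]

theorem IsCoord.eq_zeroPoint_iff {k E : Type*} [Field k] [Field E] [Algebra k E] {u : E}
    (h : IsCoord k u) {P : CurvePoint k E} : P = h.zeroPoint ↔ u ∈ P.ring ∧ u⁻¹ ∉ P.ring := by
  refine ⟨?_, fun h' => h.eq_zeroPoint h'.1 h'.2⟩
  rintro rfl
  exact ⟨h.coord_mem, h.inv_notMem⟩

theorem IsCoord.proj_eq_iff {t : Q} (h : IsCoord Fq t) (h' : IsCoord L (algebraMap Q K t))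
    {P : CurvePoint L K} : P.proj Fq Q = h.zeroPoint ↔ P = h'.zeroPoint := by
  rw [h.eq_zeroPoint_iff, h'.eq_zeroPoint_iff, ← map_inv₀]
  rfl

variable [Fintype Fq] [IsBaseChangeFunctionField Fq Q L K]

theorem IsCoord.sigmaPoint_eq_iff {t : Q} (h : IsCoord L (algebraMap Q K t))
    {P : CurvePoint L K} : sigmaPoint Fq Q L P = h.zeroPoint ↔ P = h.zeroPoint := by
  rw [h.eq_zeroPoint_iff, h.eq_zeroPoint_iff, ← map_inv₀]
  change sigma Fq Q L K _ ∈ P.ring ∧ sigma Fq Q L K _ ∉ P.ring ↔ _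
  rw [sigma_algebraMap_left, sigma_algebraMap_left]

/-- The zero of `t` is mapped to itself by `σ`, and the uniformizer `t` is fixed. -/
theorem IsCoord.ord_sigma_left {t : Q} (h : IsCoord L (algebraMap Q K t)) {z : K} (hz : z ≠ 0) :
    h.zeroPoint.ord (sigma Fq Q L K z) = h.zeroPoint.ord z := by
  have := h.isCurveFunctionField
  have hσ : ∀ z ∈ h.zeroPoint.ring, sigma Fq Q L K z ∈ h.zeroPoint.ring := by
    intro z hz
    rw [← (h.sigmaPoint_eq_iff (Fq := Fq)).2 rfl] at hz
    exact hz
  have h1 := h.isClosedPoint.eq_mul_ord (fun z => h.zeroPoint.ord (sigma Fq Q L K z))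
    (fun z z' hz hz' => by
      rw [map_mul, CurvePoint.ord_mul _ ((_root_.map_ne_zero _).2 hz) ((_root_.map_ne_zero _).2 hz')])
    (fun z hz0 hz hz' => CurvePoint.ord_eq_zero _ (hσ z hz) (by
      rw [← map_inv₀]
      exact hσ _ hz')) h.irreducible hz
  simp only at h1
  rw [h1, sigma_algebraMap_left, h.ord_coord, one_mul]

/-- Seen over `Q`, the map `σ` is `Q`-linear and raises the uniformizer to the power `q`. This
expansion of orders replaces the finite order of `σ` available over finite fields. -/
theorem IsCoord.ord_sigma_right {α : L} (h : IsCoord Q (algebraMap L K α)) {z : K} (hz : z ≠ 0) :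
    h.zeroPoint.ord (sigma Fq Q L K z) = Fintype.card Fq * h.zeroPoint.ord z := by
  have := h.isCurveFunctionField
  let σ : K →ₐ[Q] K := { sigma Fq Q L K with commutes' := sigma_algebraMap_left Fq Q L K }
  have hσα : σ (algebraMap L K α) = algebraMap L K α ^ Fintype.card Fq :=
    sigma_algebraMap_right Fq Q L K α
  have hσ : ∀ z ∈ h.zeroPoint.ring, sigma Fq Q L K z ∈ h.zeroPoint.ring := by
    rintro _ ⟨p, r, hr, rfl⟩
    refine ⟨expand Q (Fintype.card Fq) p, expand Q (Fintype.card Fq) r, ?_, ?_⟩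
    · rw [coeff_expand Fintype.card_pos]
      simpa using hr
    · change σ _ = _
      rw [map_div₀, expand_aeval, expand_aeval, ← hσα, aeval_algHom_apply σ, aeval_algHom_apply σ]
  have h1 := h.isClosedPoint.eq_mul_ord (fun z => h.zeroPoint.ord (sigma Fq Q L K z))
    (fun z z' hz hz' => by
      rw [map_mul, CurvePoint.ord_mul _ ((_root_.map_ne_zero _).2 hz) ((_root_.map_ne_zero _).2 hz')])
    (fun z hz0 hz hz' => CurvePoint.ord_eq_zero _ (hσ z hz) (by
      rw [← map_inv₀]
      exact hσ _ hz')) h.irreducible hz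
  simp only at h1
  rw [h1, sigma_algebraMap_right, CurvePoint.ord_pow _ h.ne_zero, h.ord_coord, mul_one]

end

end LineBaseChange

end

end TauSheaf

namespace TauSheaf

noncomputable section

/-! ### Scaled standard lattices -/

section ScaleLattice

open Module

/-- The residue field of a rational point. -/
def CurvePoint.IsRational.residueEquiv {k E : Type*} [Field k] [Field E] [Algebra k E]
    {x : CurvePoint k E} (hx : x.IsRational) : k ≃ₐ[k] IsLocalRing.ResidueField x.ring :=
  AlgEquiv.ofBijective (Algebra.ofId k (IsLocalRing.ResidueField x.ring))
    ⟨(algebraMap k _).injective, hx⟩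

/-- The characteristic given by a rational point. -/
def Characteristic.ofIsRational {k E : Type u} (L : Type u) [Field k] [Field E] [Field L]
    [Algebra k E] [Algebra k L] {x : CurvePoint k E} (hx : x.IsRational) :
    Characteristic k E L where
  point := x
  hom := (Algebra.ofId k L).comp (hx.residueEquiv.symm.toAlgHom.comp
    (IsScalarTower.toAlgHom k x.ring (IsLocalRing.ResidueField x.ring)))
  isLocalHom := ⟨fun a ha => by
    by_contra h
    have h1 : IsLocalRing.residue x.ring a = 0 := by
      rw [IsLocalRing.residue_eq_zero_iff]
      exact h
    apply ha.ne_zero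
    change Algebra.ofId k L (hx.residueEquiv.symm (IsLocalRing.residue x.ring a)) = 0
    rw [h1, map_zero, map_zero]⟩

theorem Characteristic.exists_ofIsRational_hom {k E L : Type u} [Field k] [Field E] [Field L]
    [Algebra k E] [Algebra k L] {x : CurvePoint k E} (hx : x.IsRational) (a : x.ring) :
    ∃ b : k, (ofIsRational L hx).hom a = algebraMap k L b ∧
      a - algebraMap k x.ring b ∈ IsLocalRing.maximalIdeal x.ring := by
  refine ⟨hx.residueEquiv.symm (IsLocalRing.residue x.ring a), rfl, ?_⟩
  rw [← IsLocalRing.residue_eq_zero_iff, map_sub, sub_eq_zero]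
  exact (hx.residueEquiv.apply_symm_apply _).symm

variable {L K : Type u} [Field L] [Field K] [Algebra L K]

/-- The lattice `z·O^n` in `K^n`. -/
def scaleLattice (P : CurvePoint L K) (n : ℕ) (z : K) : Submodule P.ring (Fin n → K) where
  carrier := {v | ∀ j, z⁻¹ * v j ∈ P.ring}
  zero_mem' j := by simp
  add_mem' {v w} hv hw j := by
    rw [Pi.add_apply, mul_add]
    exact add_mem (hv j) (hw j)
  smul_mem' a v hv j := by
    change z⁻¹ * ((a : K) * v j) ∈ P.ring
    rw [mul_left_comm]
    exact mul_mem a.2 (hv j)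

variable {P : CurvePoint L K} {n : ℕ} {z z' : K}

theorem mem_scaleLattice {v : Fin n → K} : v ∈ scaleLattice P n z ↔ ∀ j, z⁻¹ * v j ∈ P.ring :=
  Iff.rfl

theorem scaleLattice_mono (hz : z ≠ 0) (h : z'⁻¹ * z ∈ P.ring) :
    scaleLattice P n z ≤ scaleLattice P n z' := by
  intro v hv j
  have : z'⁻¹ * v j = z'⁻¹ * z * (z⁻¹ * v j) := by field_simp
  rw [this]
  exact mul_mem h (hv j)

/-- The basis `z·e_j`. -/
def scaleBasis (n : ℕ) (hz : z ≠ 0) : Basis (Fin n) K (Fin n → K) :=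
  (Pi.basisFun K (Fin n)).unitsSMul fun _ => Units.mk0 z hz

theorem scaleBasis_apply (hz : z ≠ 0) (j : Fin n) : scaleBasis n hz j = z • Pi.single j 1 := by
  rw [scaleBasis, Basis.unitsSMul_apply, Pi.basisFun_apply]
  rfl

theorem span_scaleBasis (hz : z ≠ 0) :
    Submodule.span P.ring (Set.range (scaleBasis n hz)) = scaleLattice P n z := by
  ext v
  rw [mem_span_basis_iff, mem_scaleLattice]
  refine forall_congr' fun j => ?_
  rw [scaleBasis, Basis.repr_unitsSMul, Pi.basisFun_repr]
  rfl

theorem relRank_scaleLattice [IsCurveFunctionField L K] (hz : z ≠ 0) (hz' : z' ≠ 0)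
    (h : z'⁻¹ * z ∈ P.ring) :
    relRank L P.ring (scaleLattice P n z' ⧸ (scaleLattice P n z).submoduleOf (scaleLattice P n z'))
      = ((P.deg * (n * P.ord (z'⁻¹ * z)).toNat : ℕ) : Cardinal) := by
  have h1 : (scaleBasis n hz').det (scaleBasis n hz) = (z'⁻¹ * z) ^ n := by
    have : ⇑(scaleBasis n hz) = fun j => (z'⁻¹ * z) • scaleBasis n hz' j := by
      funext j
      rw [scaleBasis_apply, scaleBasis_apply, smul_smul]
      congr 1
      field_simp
    rw [this, AlternatingMap.map_smul_univ]
    simp [Basis.det_self]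
  have h2 := CurvePoint.relRank_quotient_of_eq_span P (scaleBasis n hz') (scaleBasis n hz')
    (scaleBasis n hz) (span_scaleBasis hz).symm (span_scaleBasis hz').symm
    (scaleLattice_mono hz h)
  rw [h2.2, h1, Basis.det_self, CurvePoint.ord_eq_zero P (one_mem _) (by simp), sub_zero,
    CurvePoint.ord_pow _ (mul_ne_zero (inv_ne_zero hz') hz)]

/-- A cokernel which is supported at a rational point. -/
theorem cokerDim_of_forall_ne [IsCurveFunctionField L K] {N N' : ∀ P : CurvePoint L K,
    Submodule P.ring (Fin n → K)} (P : CurvePoint L K) (hP : P.deg = 1) (hz : z ≠ 0) (hz' : z' ≠ 0)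
    (h : P.ord (z'⁻¹ * z) = 1) (hN : N P = scaleLattice P n z) (hN' : N' P = scaleLattice P n z')
    (hne : ∀ P', P' ≠ P → N' P' ≤ N P') : cokerDim N N' = n := by
  have hPc : P.IsClosedPoint := fun h0 => by
    rw [CurvePoint.ord_of_not_isClosedPoint (fun h1 => h1 h0)] at h
    omega
  rw [cokerDim_eq_sum, Cardinal.sum_eq_of_forall_ne.{u, u} _ P fun P' hP' =>
    relRank_quotient_eq_zero_of_le (hne P' hP'), hN, hN', relRank_scaleLattice hz hz'
      (CurvePoint.mem_ring_of_ord_nonneg hPc (by omega)), hP, h]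
  simp

/-- A matrix with inverse over the local ring preserves the standard lattices. -/
theorem span_mulVec_scaleBasis (hz : z ≠ 0) {U U' : Matrix (Fin n) (Fin n) K}
    (hU : ∀ i j, U i j ∈ P.ring) (hU' : ∀ i j, U' i j ∈ P.ring) (h : U * U' = 1) :
    Submodule.span P.ring (Set.range fun j => U.mulVec (scaleBasis n hz j)) =
      scaleLattice P n z := by
  have hmem : ∀ {A : Matrix (Fin n) (Fin n) K}, (∀ i j, A i j ∈ P.ring) →
      ∀ v ∈ scaleLattice P n z, A.mulVec v ∈ scaleLattice P n z := by
    intro A hA v hv i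
    rw [Matrix.mulVec, dotProduct, Finset.mul_sum]
    refine sum_mem fun j _ => ?_
    rw [mul_left_comm]
    exact mul_mem (hA i j) (hv j)
  apply le_antisymm
  · rw [Submodule.span_le]
    rintro _ ⟨j, rfl⟩
    refine hmem hU _ ?_
    rw [← span_scaleBasis hz]
    exact Submodule.subset_span ⟨j, rfl⟩
  · intro v hv
    have h1 := hmem hU' v hv
    rw [← span_scaleBasis hz] at h1
    have h2 : v = U.mulVec (U'.mulVec v) := by
      rw [Matrix.mulVec_mulVec, h, Matrix.one_mulVec]
    rw [h2]
    have h3 := Submodule.mem_map_of_mem (f := U.mulVecLin.restrictScalars P.ring) h1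
    rw [Submodule.map_span, ← Set.range_comp] at h3
    exact h3


end ScaleLattice

end

end TauSheaf

namespace TauSheaf

noncomputable section

/-! ### Abelian `τ`-sheaves on the projective line -/

section LineSheaf

set_option linter.unusedSectionVars false

open Module

variable {Fq Q L : Type u} (K : Type u) [Field Fq] [Field Q] [Field L] [Field K]
  [Algebra Fq Q] [Algebra Fq L] [Algebra Fq K] [Algebra Q K] [Algebra L K]
  [IsScalarTower Fq Q K] [IsScalarTower Fq L K] [Fintype Fq] [IsBaseChangeFunctionField Fq Q L K]

variable (L) in
theorem IsCoord.coord_left {t : Q} (ht : IsCoord Fq t) : IsCoord L (algebraMap Q K t) := ht.baseChange Fq Q L K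

variable (L) in
theorem IsCoord.inv_left {t : Q} (ht : IsCoord Fq t) : IsCoord L (algebraMap Q K t⁻¹) := ht.inv.baseChange Fq Q L K

variable (L) in
theorem IsCoord.isCurveFunctionField_left {t : Q} (ht : IsCoord Fq t) : IsCurveFunctionField L K :=
  (ht.coord_left L K).isCurveFunctionField

variable {t : Q} (ht : IsCoord Fq t)

open Classical in
/-- A generator of the stalk at `P` of `O(i·∞)`, where `∞` is the pole of `t`. -/
def lineFactor (i : ℤ) (P : CurvePoint L K) : K :=
  if P = (ht.inv_left L K).zeroPoint then algebraMap Q K t ^ i else 1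

include ht

variable {K}

theorem lineFactor_ne_zero (i : ℤ) (P : CurvePoint L K) : lineFactor K ht i P ≠ 0 := by
  rw [lineFactor]
  split_ifs
  · exact zpow_ne_zero i (ht.coord_left L K).ne_zero
  · exact one_ne_zero

theorem lineFactor_infty (i : ℤ) :
    lineFactor K ht i (ht.inv_left L K).zeroPoint = algebraMap Q K t ^ i := if_pos rfl

theorem lineFactor_of_ne (i : ℤ) {P : CurvePoint L K} (hP : P ≠ (ht.inv_left L K).zeroPoint) :
    lineFactor K ht i P = 1 := if_neg hP

theorem lineFactor_sigmaPoint (i : ℤ) (P : CurvePoint L K) :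
    lineFactor K ht i (sigmaPoint Fq Q L P) = lineFactor K ht i P := by
  classical
  rw [lineFactor, lineFactor]
  exact if_congr (ht.inv_left L K).sigmaPoint_eq_iff rfl rfl

theorem sigma_lineFactor (i : ℤ) (P : CurvePoint L K) :
    sigma Fq Q L K (lineFactor K ht i P) = lineFactor K ht i P := by
  rw [lineFactor]
  split_ifs
  · rw [map_zpow₀, sigma_algebraMap_left]
  · rw [map_one]

theorem IsCoord.mem_of_ne_infty {P : CurvePoint L K} (hP : P ≠ (ht.inv_left L K).zeroPoint) :
    algebraMap Q K t ∈ P.ring := by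
  rw [Ne, IsCoord.eq_zeroPoint_iff, map_inv₀, inv_inv] at hP
  by_contra h
  exact hP ⟨(P.ring.mem_or_inv_mem _).resolve_left h, h⟩

theorem IsCoord.inv_mem_of_ne_zero {P : CurvePoint L K} (hP : P ≠ (ht.coord_left L K).zeroPoint) :
    (algebraMap Q K t)⁻¹ ∈ P.ring := by
  rw [Ne, IsCoord.eq_zeroPoint_iff] at hP
  by_contra h
  exact hP ⟨(P.ring.mem_or_inv_mem _).resolve_right h, h⟩

theorem IsCoord.zeroPoint_ne_infty : (ht.coord_left L K).zeroPoint ≠ (ht.inv_left L K).zeroPoint := by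
  intro h
  apply (ht.coord_left L K).inv_notMem
  rw [h, ← map_inv₀]
  exact (ht.inv_left L K).coord_mem

omit ht in
theorem IsCoord.infty_ne {k E : Type*} [Field k] [Field E] [Algebra k E] {u : E}
    (h : IsCoord k u) : h.zeroPoint ≠ h.inv.zeroPoint := by
  intro h0
  apply h.inv_notMem
  rw [h0]
  exact h.inv.coord_mem

/-- The bundle `O(i·∞)^n`. -/
abbrev lineBundle (n : ℕ) (i : ℤ) : VectorBundle L K :=
  have := ht.isCurveFunctionField_left L K
  VectorBundle.ofFamilies (L := L) (Fin n → K) (fun P => scaleLattice P n (lineFactor K ht i P))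
    (Fin n) fun P => ⟨scaleBasis n (lineFactor_ne_zero ht i P), Basis.span_eq _,
      (span_scaleBasis _).symm, by
        refine ((Set.finite_singleton (ht.inv_left L K).zeroPoint).union
          (finite_span_ne (L := L) (scaleBasis n one_ne_zero)
            (scaleBasis n (lineFactor_ne_zero ht i P)) (Basis.span_eq _) (Basis.span_eq _))).subset
            fun P' hP' => ?_
        by_contra h
        rw [Set.mem_union, not_or, Set.mem_singleton_iff] at h
        apply hP'
        rw [lineFactor_of_ne ht i h.1, ← span_scaleBasis one_ne_zero]
        exact not_not.1 h.2⟩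

omit ht in
/-- The semilinear map `t·U·σ`. -/
def linePhi (Fq : Type u) {Q L K : Type u} [Field Fq] [Field Q] [Field L] [Field K]
    [Algebra Fq Q] [Algebra Fq L] [Algebra Fq K] [Algebra Q K] [Algebra L K]
    [IsScalarTower Fq Q K] [IsScalarTower Fq L K] [Fintype Fq] [IsBaseChangeFunctionField Fq Q L K]
    (t : Q) {n : ℕ} (U : Matrix (Fin n) (Fin n) L) :
    (Fin n → K) →ₛₗ[sigma Fq Q L K] (Fin n → K) where
  toFun v := algebraMap Q K t • (U.map (algebraMap L K)).mulVec fun j => sigma Fq Q L K (v j)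
  map_add' v w := by
    rw [← smul_add, ← Matrix.mulVec_add]
    congr 2
    funext j
    exact map_add (sigma Fq Q L K) _ _
  map_smul' a v := by
    have h : (fun j => sigma Fq Q L K ((a • v) j)) =
        sigma Fq Q L K a • fun j => sigma Fq Q L K (v j) :=
      funext fun j => map_mul (sigma Fq Q L K) a (v j)
    rw [h, Matrix.mulVec_smul, smul_comm]

variable {n : ℕ} {U : Matrix (Fin n) (Fin n) L}

omit ht in
theorem linePhi_apply (v : Fin n → K) : linePhi Fq t U v =
    algebraMap Q K t • (U.map (algebraMap L K)).mulVec fun j => sigma Fq Q L K (v j) := rfl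

/-- `σ` need not be surjective here, so instead a left inverse `A` of the matrix of the vectors `v`
is chosen. Applying `σ` to its entries and undoing `t·U` gives a left inverse for the images. -/
theorem linearIndependent_linePhi {U' : Matrix (Fin n) (Fin n) L} (hU : U' * U = 1) (m : ℕ)
    (v : Fin m → Fin n → K) (hv : LinearIndependent K v) :
    LinearIndependent K fun j => linePhi Fq t U (v j) := by
  have hT := (ht.coord_left L K).ne_zero
  obtain ⟨f, hf⟩ := (Fintype.linearCombination K v).exists_leftInverse_of_injective
    (LinearMap.ker_eq_bot.2 (hv.fintypeLinearCombination_injective))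
  let A : Matrix (Fin m) (Fin n) K := f.toMatrix'
  have hA : ∀ j, A.mulVec (v j) = Pi.single j 1 := by
    intro j
    rw [← Matrix.toLin'_apply, Matrix.toLin'_toMatrix']
    have := LinearMap.congr_fun hf (Pi.single j 1)
    rwa [LinearMap.comp_apply, Fintype.linearCombination_apply_single, one_smul] at this
  have hσ : ∀ j, (A.map (sigma Fq Q L K)).mulVec (fun l => sigma Fq Q L K (v j l)) =
      Pi.single j 1 := by
    intro j
    funext i
    have h1 := congrArg (sigma Fq Q L K) (congrFun (hA j) i)
    rw [Matrix.mulVec, dotProduct, map_sum] at h1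
    simp only [map_mul] at h1
    refine h1.trans ?_
    rw [Pi.single_apply]
    split_ifs
    · exact map_one _
    · exact map_zero _
  refine LinearIndependent.of_comp ((algebraMap Q K t)⁻¹ • (A.map (sigma Fq Q L K) *
    U'.map (algebraMap L K)).mulVecLin) ?_
  have h2 : (((algebraMap Q K t)⁻¹ • (A.map (sigma Fq Q L K) *
    U'.map (algebraMap L K)).mulVecLin) ∘ fun j => linePhi Fq t U (v j)) = fun j => Pi.single j 1 := by
    funext j
    change (algebraMap Q K t)⁻¹ • (A.map (sigma Fq Q L K) * U'.map (algebraMap L K)).mulVec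
      (algebraMap Q K t • _) = _
    rw [Matrix.mulVec_smul, inv_smul_smul₀ hT, Matrix.mulVec_mulVec, Matrix.mul_assoc,
      ← Matrix.map_mul, hU, Matrix.map_one _ (map_zero _) (map_one _), Matrix.mul_one, hσ]
  rw [h2]
  exact Pi.linearIndependent_single_one (Fin m) K

/-- The stalk of the image of `τ`. -/
theorem span_linePhi_scaleLattice {U' : Matrix (Fin n) (Fin n) L} (hU : U * U' = 1)
    (P : CurvePoint L K) {z : K} (hz : z ≠ 0) :
    Submodule.span P.ring (linePhi Fq t U '' scaleLattice (sigmaPoint Fq Q L P) n z) =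
      scaleLattice P n (algebraMap Q K t * sigma Fq Q L K z) := by
  have hT := (ht.coord_left L K).ne_zero
  have hz' : algebraMap Q K t * sigma Fq Q L K z ≠ 0 := mul_ne_zero hT ((map_ne_zero _).2 hz)
  rw [← span_scaleBasis hz, span_image_sigma, ← Set.range_comp,
    ← span_mulVec_scaleBasis hz' (U := U.map (algebraMap L K)) (U' := U'.map (algebraMap L K))
      (fun i j => P.const_mem _) (fun i j => P.const_mem _)
      (by rw [← Matrix.map_mul, hU, Matrix.map_one _ (map_zero _) (map_one _)])]
  congr 2
  funext j
  rw [Function.comp_apply, linePhi_apply, scaleBasis_apply, scaleBasis_apply, ← Matrix.mulVec_smul]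
  congr 1
  funext l
  rw [Pi.smul_apply, Pi.smul_apply, Pi.smul_apply, Pi.single_apply]
  split_ifs <;> simp

theorem span_linePhi_stalk {U' : Matrix (Fin n) (Fin n) L} (hU : U * U' = 1) (i : ℤ)
    (P : CurvePoint L K) : Submodule.span P.ring (linePhi Fq t U ''
      scaleLattice (sigmaPoint Fq Q L P) n (lineFactor K ht i (sigmaPoint Fq Q L P))) =
      scaleLattice P n (algebraMap Q K t * lineFactor K ht i P) := by
  rw [span_linePhi_scaleLattice ht hU P (lineFactor_ne_zero ht i _), lineFactor_sigmaPoint,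
    sigma_lineFactor]

theorem fiberCast_lineBundle {i j : ℤ} (hij : i = j) (v : Fin n → K) :
    (fiberCast (lineBundle (L := L) ht n) hij
      (show (lineBundle (L := L) ht n i).fiber from v) : Fin n → K) = v := by
  subst hij
  rfl

theorem iterateMap_lineBundle (i : ℤ) (v : Fin n → K) :
    (iterateMap (lineBundle (L := L) ht n) (fun _ => (LinearMap.id : (Fin n → K) →ₗ[K] (Fin n → K)))
      i 1 (show (lineBundle (L := L) ht n i).fiber from v) : Fin n → K) = v :=
  (fiberCast_lineBundle ht _ _).trans (fiberCast_lineBundle ht _ _)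

theorem IsCoord.twistIdeal_infty (m : ℕ) :
    ∃ a : (ht.inv_left L K).zeroPoint.ring, (a : K) = (algebraMap Q K t)⁻¹ ^ m ∧
      twistIdeal m ht.inv.zeroPoint (ht.inv_left L K).zeroPoint = Ideal.span {a} := by
  have := ht.isCurveFunctionField
  refine ⟨_, ?_, twistIdeal_eq_span ht.inv.isClosedPoint ht.inv.irreducible
    ((ht.inv.proj_eq_iff (ht.inv_left L K)).2 rfl) m⟩
  rw [← map_inv₀]
  rfl

theorem IsCoord.twistIdeal_of_ne (m : ℕ) {P : CurvePoint L K} (hP : P ≠ (ht.inv_left L K).zeroPoint) :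
    twistIdeal m ht.inv.zeroPoint P = ⊤ :=
  (Ideal.eq_top_iff_one _).2 (Ideal.subset_span fun h =>
    (hP ((ht.inv.proj_eq_iff (ht.inv_left L K)).1 h)).elim)

theorem scaleLattice_lineFactor (i : ℤ) (P : CurvePoint L K) :
    scaleLattice P n (lineFactor K ht i P) =
      twistIdeal 1 ht.inv.zeroPoint P • scaleLattice P n (lineFactor K ht (i + 1) P) := by
  have hT := (ht.coord_left L K).ne_zero
  by_cases hP : P = (ht.inv_left L K).zeroPoint
  · subst hP
    obtain ⟨a, ha, h⟩ := ht.twistIdeal_infty (L := L) (K := K) 1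
    rw [h, lineFactor_infty, lineFactor_infty, Submodule.ideal_span_singleton_smul]
    rw [pow_one] at ha
    ext v
    constructor
    · intro hv
      refine ⟨algebraMap Q K t • v, fun j => ?_, ?_⟩
      · rw [Pi.smul_apply, smul_eq_mul, zpow_add_one₀ hT]
        convert hv j using 1
        field_simp
      · change (a : K) • algebraMap Q K t • v = v
        rw [ha, inv_smul_smul₀ hT]
    · rintro ⟨w, hw, rfl⟩ j
      change _ * ((a : K) * w j) ∈ _
      convert hw j using 1
      rw [ha, zpow_add_one₀ hT]
      field_simp
  · rw [ht.twistIdeal_of_ne 1 hP, Submodule.top_smul, lineFactor_of_ne ht i hP,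
      lineFactor_of_ne ht _ hP]

theorem inv_lineFactor_mul_mem (i : ℤ) (P : CurvePoint L K) :
    (lineFactor K ht (i + 1) P)⁻¹ * lineFactor K ht i P ∈ P.ring := by
  have hT := (ht.coord_left L K).ne_zero
  by_cases hP : P = (ht.inv_left L K).zeroPoint
  · subst hP
    rw [lineFactor_infty, lineFactor_infty, zpow_add_one₀ hT]
    convert (ht.inv_left L K).coord_mem using 1
    rw [map_inv₀]
    field_simp
  · rw [lineFactor_of_ne ht i hP, lineFactor_of_ne ht _ hP]
    simp

/-- `t` has a simple pole at `∞` and is regular elsewhere, so multiplication by `t` fits into the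
step from `O(i·∞)` to `O((i+1)·∞)`. -/
theorem inv_lineFactor_mul_coord_mem (i : ℤ) (P : CurvePoint L K) :
    (lineFactor K ht (i + 1) P)⁻¹ * (algebraMap Q K t * lineFactor K ht i P) ∈ P.ring := by
  have hT := (ht.coord_left L K).ne_zero
  by_cases hP : P = (ht.inv_left L K).zeroPoint
  · subst hP
    rw [lineFactor_infty, lineFactor_infty, zpow_add_one₀ hT]
    convert one_mem (ht.inv_left L K).zeroPoint.ring using 1
    field_simp
  · rw [lineFactor_of_ne ht i hP, lineFactor_of_ne ht _ hP]
    simpa using ht.mem_of_ne_infty hP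

/-- Outside of the zero of `t`, the map `t·U·σ` is surjective. -/
theorem scaleLattice_le_of_ne_zero (i : ℤ) {P : CurvePoint L K}
    (hP : P ≠ (ht.coord_left L K).zeroPoint) :
    scaleLattice P n (lineFactor K ht (i + 1) P) ≤
      scaleLattice P n (algebraMap Q K t * lineFactor K ht i P) := by
  have hT := (ht.coord_left L K).ne_zero
  refine scaleLattice_mono (lineFactor_ne_zero ht _ P) ?_
  by_cases hP' : P = (ht.inv_left L K).zeroPoint
  · subst hP'
    rw [lineFactor_infty, lineFactor_infty, zpow_add_one₀ hT]
    convert one_mem (ht.inv_left L K).zeroPoint.ring using 1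
    field_simp
  · rw [lineFactor_of_ne ht i hP', lineFactor_of_ne ht _ hP']
    simpa using ht.inv_mem_of_ne_zero hP

/-- The characteristic sends `a` to its value at the zero of `t`, and `a` minus this value is
divisible by `t`. So the graph ideal is contained in the ideal of `t`. -/
theorem IsCoord.graphIdeal_zeroPoint_le :
    ∀ z ∈ graphIdeal (Characteristic.ofIsRational L ht.isRational)
      (ht.coord_left L K).zeroPoint, (algebraMap Q K t)⁻¹ * (z : K) ∈
        (ht.coord_left L K).zeroPoint.ring := by
  have hT := (ht.coord_left L K).ne_zero
  have hproj := (ht.proj_eq_iff (ht.coord_left L K)).2 rfl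
  intro z hz
  rw [graphIdeal, if_pos (show (Characteristic.ofIsRational L ht.isRational).point.ring ≤ _ from
    (congrArg CurvePoint.ring hproj).ge)] at hz
  induction hz using Submodule.span_induction with
  | mem z hz =>
    obtain ⟨a, ha⟩ := hz
    obtain ⟨b, hb, hab⟩ := Characteristic.exists_ofIsRational_hom (L := L) ht.isRational a
    rw [IsLocalRing.mem_maximalIdeal, mem_nonunits_iff, ht.nonunit_iff] at hab
    obtain ⟨y, hy, hay⟩ := hab
    have h1 : (a : Q) = algebraMap Fq Q b + t * y := by
      rw [← hay]
      exact (add_sub_cancel _ _).symm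
    have h2 : (z : K) = algebraMap Q K t * algebraMap Q K y := by
      rw [ha, hb, h1, ← IsScalarTower.algebraMap_apply, map_add, ← IsScalarTower.algebraMap_apply,
        map_mul, add_sub_cancel_left]
    rw [h2, inv_mul_cancel_left₀ hT]
    exact algebraMap_mem_ring hproj hy
  | zero => simp
  | add z w _ _ hz hw =>
    change _ * ((z : K) + w) ∈ _
    rw [mul_add]
    exact add_mem hz hw
  | smul a z _ hz =>
    change _ * ((a : K) * z) ∈ _
    rw [mul_left_comm]
    exact mul_mem a.2 hz

/-- The abelian `τ`-sheaf with `F_i = O(i·∞)^n` and `τ_i = t·U·σ`. -/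
def lineSheaf (hn : n ≠ 0) {U U' : Matrix (Fin n) (Fin n) L} (hU : U * U' = 1) :
    AbelianTauSheaf K ht.inv.zeroPoint (Characteristic.ofIsRational L ht.isRational) where
  rank := n
  dim := n
  sheaf := lineBundle ht n
  Pi _ := (LinearMap.id : (Fin n → K) →ₗ[K] (Fin n → K))
  tau _ := linePhi Fq t U
  rank_sheaf _ := Module.finrank_fin_fun K
  Pi_mem i P v hv := scaleLattice_mono (lineFactor_ne_zero ht i P) (inv_lineFactor_mul_mem ht i P) hv
  tau_mem i P v hv := by
    have h1 : linePhi Fq t U v ∈ scaleLattice P n (algebraMap Q K t * lineFactor K ht i P) := by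
      rw [← span_linePhi_stalk ht hU]
      exact Submodule.subset_span ⟨v, hv, rfl⟩
    exact scaleLattice_mono (mul_ne_zero (ht.coord_left L K).ne_zero (lineFactor_ne_zero ht i P))
      (inv_lineFactor_mul_coord_mem ht i P) h1
  Pi_injective _ := Function.injective_id
  tau_injective _ m v hv := linearIndependent_linePhi ht (mul_eq_one_comm.1 hU) m v hv
  comm _ _ := rfl
  periodic := by
    -- Rank and dimension are both `n`, so `k = l = 1`.
    refine ⟨1, 1, one_pos, one_pos, rfl, fun i P => ?_⟩
    rw [stalkTwistNeg_eq]
    refine Eq.trans ?_ (congrArg (fun N : Submodule P.ring (Fin n → K) => (N : Set (Fin n → K)))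
      (scaleLattice_lineFactor ht i P))
    exact (Set.image_congr fun v _ => iterateMap_lineBundle ht i v).trans (Set.image_id' _)
  dim_coker_Pi i := by
    have := ht.isCurveFunctionField_left L K
    have hT := (ht.coord_left L K).ne_zero
    refine cokerDim_of_forall_ne (ht.inv_left L K).zeroPoint (ht.inv_left L K).deg_zeroPoint
      (lineFactor_ne_zero ht i (ht.inv_left L K).zeroPoint)
      (lineFactor_ne_zero ht (i + 1) (ht.inv_left L K).zeroPoint) ?_ ?_ rfl fun P hP => ?_
    · rw [lineFactor_infty, lineFactor_infty, zpow_add_one₀ hT]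
      convert (ht.inv_left L K).ord_coord using 2
      rw [map_inv₀]
      field_simp
    · exact (congrArg _ (Set.image_id' _)).trans (Submodule.span_eq _)
    · refine le_trans ?_ ((congrArg _ (Set.image_id' _)).trans (Submodule.span_eq
        (scaleLattice P n (lineFactor K ht i P)))).ge
      change scaleLattice P n (lineFactor K ht (i + 1) P) ≤ _
      rw [lineFactor_of_ne ht i hP, lineFactor_of_ne ht _ hP]
  dim_coker_tau i := by
    have := ht.isCurveFunctionField_left L K
    have hT := (ht.coord_left L K).ne_zero
    refine cokerDim_of_forall_ne (ht.coord_left L K).zeroPoint (ht.coord_left L K).deg_zeroPoint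
      (mul_ne_zero hT (lineFactor_ne_zero ht i (ht.coord_left L K).zeroPoint))
      (lineFactor_ne_zero ht (i + 1) (ht.coord_left L K).zeroPoint) ?_
      (span_linePhi_stalk ht hU i _) rfl fun P hP => ?_
    · rw [lineFactor_of_ne ht _ (ht.zeroPoint_ne_infty), lineFactor_of_ne ht _ (ht.zeroPoint_ne_infty),
        inv_one, one_mul, mul_one]
      exact (ht.coord_left L K).ord_coord
    · exact (scaleLattice_le_of_ne_zero ht i hP).trans (span_linePhi_stalk ht hU i P).ge
  annihilated i P a ha v hv := by
    have hT := (ht.coord_left L K).ne_zero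
    apply (span_linePhi_stalk ht hU i P).ge
    by_cases hP : P = (ht.coord_left L K).zeroPoint
    · subst hP
      -- The cokernel of `τ` at this point is killed by `t`, so the first power of the graph ideal
      -- is enough; this uses `n ≠ 0`.
      have h1 := ht.graphIdeal_zeroPoint_le a (Ideal.pow_le_self hn ha)
      have hv : v ∈ scaleLattice _ n (lineFactor K ht (i + 1) (ht.coord_left L K).zeroPoint) := hv
      intro j
      have h2 := hv j
      rw [lineFactor_of_ne ht _ (ht.zeroPoint_ne_infty)] at h2 ⊢
      change (algebraMap Q K t * 1)⁻¹ * ((a : K) * v j) ∈ _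
      rw [mul_one, ← mul_assoc]
      exact mul_mem h1 (by simpa using h2)
    · exact Submodule.smul_mem _ a (scaleLattice_le_of_ne_zero ht i hP hv)

end LineSheaf

end

end TauSheaf

namespace TauSheaf

noncomputable section

/-! ### Quotients of rank one on the projective line -/

section RankOne

set_option linter.unusedSectionVars false

open Module

section

variable {L K : Type u} [Field L] [Field K] [Algebra L K] {P : CurvePoint L K}

theorem exists_eq_scaleLattice {N : Submodule P.ring (Fin 1 → K)} {ι : Type*} [Fintype ι]
    (b : Basis ι K (Fin 1 → K)) (h : N = Submodule.span P.ring (Set.range b)) :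
    ∃ z : K, z ≠ 0 ∧ N = scaleLattice P 1 z := by
  have hcard : Fintype.card ι = 1 := by
    rw [← finrank_eq_card_basis b, finrank_fin_fun]
  let b' := b.reindex (Fintype.equivFinOfCardEq hcard)
  have hb' : b' 0 = b' 0 0 • Pi.single 0 1 := by
    funext j
    rw [Subsingleton.elim j 0]
    simp
  have hz : b' 0 0 ≠ 0 := fun h0 => b'.ne_zero 0 (by rw [hb', h0, zero_smul])
  refine ⟨b' 0 0, hz, ?_⟩
  have h1 : ⇑b' = scaleBasis 1 hz := by
    funext j
    rw [Subsingleton.elim j 0, scaleBasis_apply, ← hb']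
  rw [h, ← span_scaleBasis hz, ← h1, Basis.range_reindex]

theorem ord_eq_of_scaleLattice_eq [IsCurveFunctionField L K] {z z' : K} (hz : z ≠ 0) (hz' : z' ≠ 0)
    (h : scaleLattice P 1 z = scaleLattice P 1 z') : P.ord z = P.ord z' := by
  have key : ∀ {z z' : K}, z ≠ 0 → scaleLattice P 1 z ≤ scaleLattice P 1 z' → z'⁻¹ * z ∈ P.ring := by
    intro z z' hz h
    have h1 : (fun _ => z : Fin 1 → K) ∈ scaleLattice P 1 z := fun j => by
      rw [inv_mul_cancel₀ hz]
      exact one_mem _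
    exact h h1 0
  have h1 := CurvePoint.ord_eq_zero P (key hz h.le) (by
    rw [mul_inv, inv_inv, mul_comm]
    exact key hz' h.ge)
  rw [CurvePoint.ord_mul _ (inv_ne_zero hz') hz, CurvePoint.ord_inv] at h1
  omega

theorem span_singleton_smul_scaleLattice {n : ℕ} {a : P.ring} {z : K} (ha : (a : K) ≠ 0) :
    Ideal.span {a} • scaleLattice P n z = scaleLattice P n (a * z) := by
  rw [Submodule.ideal_span_singleton_smul]
  ext v
  constructor
  · rintro ⟨w, hw, rfl⟩ j
    change _ * ((a : K) * w j) ∈ _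
    convert hw j using 1
    field_simp
  · intro hv
    refine ⟨(a : K)⁻¹ • v, fun j => ?_, smul_inv_smul₀ ha v⟩
    convert hv j using 1
    rw [Pi.smul_apply, smul_eq_mul, mul_inv, ← mul_assoc, mul_comm z⁻¹]

end

variable {Fq Q L K : Type u} [Field Fq] [Field Q] [Field L] [Field K]
  [Algebra Fq Q] [Algebra Fq L] [Algebra Fq K] [Algebra Q K] [Algebra L K]
  [IsScalarTower Fq Q K] [IsScalarTower Fq L K] [Fintype Fq] [IsBaseChangeFunctionField Fq Q L K]
  {t : Q} (ht : IsCoord Fq t)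

/-- `t` has value zero at the characteristic point, so it is itself one of the generators, and it is
invertible at `P`. This covers closed points of `C_L` above the generic point of `C`, which may
exist for infinite `L`. -/
theorem graphIdeal_eq_top_of_ne {P : CurvePoint L K} (hP : P ≠ (ht.coord_left L K).zeroPoint) :
    graphIdeal (Characteristic.ofIsRational L ht.isRational) P = ⊤ := by
  rw [graphIdeal]
  split_ifs with h
  · have hT : algebraMap Q K t ∈ P.ring := h ht.coord_mem
    obtain ⟨b, hb, hab⟩ := Characteristic.exists_ofIsRational_hom (L := L) ht.isRational
      ⟨t, ht.coord_mem⟩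
    have h1 : algebraMap Fq ht.zeroPoint.ring b ∈ IsLocalRing.maximalIdeal ht.zeroPoint.ring := by
      have h2 : (⟨t, ht.coord_mem⟩ : ht.zeroPoint.ring) ∈
          IsLocalRing.maximalIdeal ht.zeroPoint.ring := by
        rw [IsLocalRing.mem_maximalIdeal]
        exact ht.irreducible.not_isUnit
      simpa using sub_mem h2 hab
    have hb0 : b = 0 := by
      by_contra hb0
      exact h1 ((IsUnit.mk0 _ hb0).map (algebraMap Fq ht.zeroPoint.ring))
    rw [hb0, map_zero] at hb
    refine Ideal.eq_top_of_isUnit_mem _ (x := ⟨_, hT⟩) (Ideal.subset_span ⟨⟨t, ht.coord_mem⟩, ?_⟩)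
      (.of_mul_eq_one ⟨_, ht.inv_mem_of_ne_zero hP⟩
        (Subtype.ext (mul_inv_cancel₀ (ht.coord_left L K).ne_zero)))
    change algebraMap Q K t = algebraMap Q K t - algebraMap L K
      ((Characteristic.ofIsRational L ht.isRational).hom (⟨t, ht.coord_mem⟩ : ht.zeroPoint.ring))
    exact (sub_eq_self.2 ((congrArg (algebraMap L K) hb).trans (map_zero _))).symm
  · rfl

/-- On the projective line, a quotient of rank one of the generic fibre comes from a quotient. -/
theorem exists_isQuotient_rank_one
    (G : AbelianTauSheaf K ht.inv.zeroPoint (Characteristic.ofIsRational L ht.isRational))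
    {U U' : Matrix (Fin 1) (Fin 1) L} (hU : U * U' = 1)
    {q : (G.sheaf 0).fiber →ₗ[K] (Fin 1 → K)} (hq : Function.Surjective q)
    (hqφ : ∀ v, q (G.phi v) = linePhi Fq t U (q v)) :
    ∃ G' : AbelianTauSheaf K ht.inv.zeroPoint (Characteristic.ofIsRational L ht.isRational),
      G'.IsQuotient G ∧ finrank K (G'.sheaf 0).fiber = 1 := by
  have := ht.isCurveFunctionField_left L K
  have := ht.isCurveFunctionField
  have hT := (ht.coord_left L K).ne_zero
  have h := G.isImageDatum (linePhi Fq t U)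
    (linearIndependent_linePhi ht (mul_eq_one_comm.1 hU)) (fun _ : Fin 1 => q)
    (fun _ => hqφ) (by rw [iSup_unique]; exact LinearMap.range_eq_top.2 hq)
  -- In rank one every stalk of the image is `z·O`, so all invariants can be read off from orders of
  -- the generators `z i P`.
  have h1 : ∀ i P, ∃ z : K, z ≠ 0 ∧ h.stalk i P = scaleLattice P 1 z := fun i P => by
    obtain ⟨b, hb, -⟩ := (h.bundle i).locallyFree P
    exact exists_eq_scaleLattice b hb
  choose z hz0 hz using h1
  have hσ0 : ∀ i P, algebraMap Q K t * sigma Fq Q L K (z i (sigmaPoint Fq Q L P)) ≠ 0 := fun i P =>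
    mul_ne_zero hT ((map_ne_zero _).2 (hz0 i _))
  have hτ : ∀ i P, h.tauStalk i P =
      scaleLattice P 1 (algebraMap Q K t * sigma Fq Q L K (z i (sigmaPoint Fq Q L P))) := by
    intro i P
    rw [IsImageDatum.tauStalk, hz, span_linePhi_scaleLattice ht hU P (hz0 i _)]
  obtain ⟨k, l, hk, hl, -, hF⟩ := G.periodic
  have hne : ∀ P : CurvePoint L K, P ≠ (ht.inv_left L K).zeroPoint →
      P.proj Fq Q ≠ ht.inv.zeroPoint := fun P hP h0 =>
    hP ((ht.inv.proj_eq_iff (ht.inv_left L K)).1 h0)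
  -- the orders at infinity
  have hinf : ∀ i, (ht.inv_left L K).zeroPoint.ord (z (i + 1) (ht.inv_left L K).zeroPoint) =
      (ht.inv_left L K).zeroPoint.ord (z i (ht.inv_left L K).zeroPoint) - 1 := by
    intro i
    -- `τ` is onto at `∞`, `σ` preserves orders there, and `t` has order `-1`; so each step lowers
    -- the order of the generator by one.
    have h2 := h.tauStalk_eq_of_graphIdeal i
      (graphIdeal_eq_top_of_ne ht (ht.zeroPoint_ne_infty (L := L) (K := K)).symm)
    rw [hτ, hz] at h2
    have h3 := ord_eq_of_scaleLattice_eq (hσ0 i _) (hz0 _ _) h2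
    have h4 : (ht.inv_left L K).zeroPoint.ord (algebraMap Q K t) = -1 := by
      have h5 : algebraMap Q K t = (algebraMap Q K t⁻¹)⁻¹ := by simp
      rw [h5, CurvePoint.ord_inv, (ht.inv_left L K).ord_coord]
    rw [CurvePoint.ord_mul _ hT ((map_ne_zero _).2 (hz0 i _)), h4,
      (ht.inv_left L K).ord_sigma_left (hz0 i _), (ht.inv_left L K).sigmaPoint_eq_iff.2 rfl] at h3
    omega
  have hinf' : ∀ i (m : ℕ), (ht.inv_left L K).zeroPoint.ord
      (z (i + m) (ht.inv_left L K).zeroPoint) =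
      (ht.inv_left L K).zeroPoint.ord (z i (ht.inv_left L K).zeroPoint) - m := by
    intro i m
    induction m with
    | zero => simp
    | succ m ih =>
      have h2 : i + ((m + 1 : ℕ) : ℤ) = i + m + 1 := by push_cast; ring
      rw [h2, hinf, ih]
      push_cast
      ring
  -- After `l` steps the order has dropped by `l`, while periodicity says by `k`; thus `l d = k r`
  -- holds with `d = r = 1`.
  have hkl : k = l := by
    have h2 := h.stalk_eq_smul hF 0 (ht.inv_left L K).zeroPoint
    obtain ⟨a, ha, haI⟩ := ht.twistIdeal_infty (L := L) (K := K) k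
    have ha0 : (a : K) ≠ 0 := by
      rw [ha]
      exact pow_ne_zero k (inv_ne_zero hT)
    rw [haI, hz, hz, span_singleton_smul_scaleLattice ha0] at h2
    have h3 := ord_eq_of_scaleLattice_eq (hz0 _ _) (mul_ne_zero ha0 (hz0 _ _)) h2
    rw [CurvePoint.ord_mul _ ha0 (hz0 _ _), hinf', ha, ← map_inv₀,
      CurvePoint.ord_pow _ (ht.inv_left L K).ne_zero, (ht.inv_left L K).ord_coord] at h3
    omega
  have hPi : ∀ i, cokerDim (h.stalk i) (h.stalk (i + 1)) = (1 : ℕ) := by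
    intro i
    refine cokerDim_of_forall_ne (ht.inv_left L K).zeroPoint (ht.inv_left L K).deg_zeroPoint
      (hz0 i _) (hz0 (i + 1) _) ?_ (hz i _) (hz (i + 1) _) fun P hP =>
        h.stalk_succ_le hF hl i (hne P hP)
    rw [CurvePoint.ord_mul _ (inv_ne_zero (hz0 _ _)) (hz0 _ _), CurvePoint.ord_inv, hinf]
    ring
  have htau : ∀ i, cokerDim (h.tauStalk i) (h.stalk (i + 1)) = (1 : ℕ) := by
    intro i
    refine cokerDim_of_forall_ne (ht.coord_left L K).zeroPoint (ht.coord_left L K).deg_zeroPoint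
      (hσ0 i _) (hz0 (i + 1) _) ?_ (hτ i _) (hz (i + 1) _) fun P hP =>
        (h.tauStalk_eq_of_graphIdeal i (graphIdeal_eq_top_of_ne ht hP)).ge
    -- At the zero of `t` the stalk does not change with `i`, so the cokernel of `τ` comes from the
    -- simple zero of `t` alone.
    have h2 : h.stalk (i + 1) (ht.coord_left L K).zeroPoint =
        h.stalk i (ht.coord_left L K).zeroPoint :=
      le_antisymm (h.stalk_succ_le hF hl i (hne _ ht.zeroPoint_ne_infty)) (h.stalk_le i _)
    rw [hz, hz] at h2
    have h3 := ord_eq_of_scaleLattice_eq (hz0 _ _) (hz0 _ _) h2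
    rw [CurvePoint.ord_mul _ (inv_ne_zero (hz0 _ _)) (hσ0 i _), CurvePoint.ord_inv, h3,
      CurvePoint.ord_mul _ hT ((map_ne_zero _).2 (hz0 i _)), (ht.coord_left L K).ord_coord,
      (ht.coord_left L K).ord_sigma_left (hz0 i _), (ht.coord_left L K).sigmaPoint_eq_iff.2 rfl]
    ring
  have hfin : finrank K (Fin 1 → K) = 1 := finrank_fin_fun K
  refine ⟨h.sheaf hk hl hF (by rw [hkl, hfin]) hPi htau,
    ⟨fun i => (q ∘ₗ (G.psi i).toLinearMap : (G.sheaf i).fiber →ₗ[K] (Fin 1 → K)),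
    ⟨⟨fun i v => h.Pi 0 i v, fun i v => h.tau 0 i v⟩, fun i P v hv =>
      mem_imageSub (fun _ : Fin 1 => q ∘ₗ (G.psi i).toLinearMap) hv 0⟩, fun i P => ?_⟩, hfin⟩
  have h1 : h.stalk i P = ((G.sheaf i).stalk P).map
      ((q ∘ₗ (G.psi i).toLinearMap).restrictScalars P.ring) := by
    rw [IsImageDatum.stalk, imageSub, iSup_unique]
  exact congrArg (fun N : Submodule P.ring (Fin 1 → K) => (N : Set (Fin 1 → K))) h1.symm

end RankOne

end

end TauSheaf

namespace TauSheaf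

noncomputable section

/-! ### An abelian `τ`-sheaf over the rational function field -/

section Counterexample

set_option linter.unusedSectionVars false

open Module

/-! ### Orders at the pole of `α` -/

section Order

variable {Fq Q L K : Type u} [Field Fq] [Field Q] [Field L] [Field K]
  [Algebra Fq Q] [Algebra Fq L] [Algebra Fq K] [Algebra Q K] [Algebra L K]
  [IsScalarTower Fq Q K] [IsScalarTower Fq L K] [Fintype Fq] [IsBaseChangeFunctionField Fq Q L K]
  {α : L}

/-- `x - y = x (1 - y/x)`, and `1 - y/x` is a unit because `y/x` vanishes at the point. -/
theorem IsCoord.ord_sub_of_lt {k E : Type*} [Field k] [Field E] [Algebra k E] {u : E}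
    (h : IsCoord k u) {x y : E} (hx : x ≠ 0) (hy : y ≠ 0)
    (hxy : h.zeroPoint.ord x < h.zeroPoint.ord y) :
    h.zeroPoint.ord (x - y) = h.zeroPoint.ord x := by
  have := h.isCurveFunctionField
  have hu := h.ne_zero
  have key : ∀ w : E, w ≠ 0 → 0 < h.zeroPoint.ord w → w * u⁻¹ ∈ h.zeroPoint.ring := by
    intro w hw hw'
    apply CurvePoint.mem_ring_of_ord_nonneg h.isClosedPoint
    rw [CurvePoint.ord_mul _ hw (inv_ne_zero hu), CurvePoint.ord_inv, h.ord_coord]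
    omega
  have h1 : 0 < h.zeroPoint.ord (y / x) := by
    rw [div_eq_mul_inv, CurvePoint.ord_mul _ hy (inv_ne_zero hx), CurvePoint.ord_inv]
    omega
  have h2 := key _ (div_ne_zero hy hx) h1
  have h3 : 1 - y / x ∈ h.zeroPoint.ring :=
    sub_mem (one_mem _) (CurvePoint.mem_ring_of_ord_nonneg h.isClosedPoint h1.le)
  have h4 : 1 - y / x ≠ 0 := by
    intro h0
    rw [← sub_eq_zero.1 h0, one_mul] at h2
    exact h.inv_notMem h2
  have h5 : h.zeroPoint.ord (1 - y / x) = 0 := by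
    by_contra h5
    have h6 := key _ h4 (lt_of_le_of_ne (CurvePoint.ord_nonneg h3) (Ne.symm h5))
    apply h.inv_notMem
    convert add_mem h6 h2 using 1
    ring
  have h6 : x - y = x * (1 - y / x) := by field_simp
  rw [h6, CurvePoint.ord_mul _ hx h4, h5, add_zero]

variable (h : IsCoord Q (algebraMap L K α⁻¹))

include h

theorem IsCoord.ord_inv_coord : h.zeroPoint.ord (algebraMap L K α) = -1 := by
  have := h.isCurveFunctionField
  have h1 : algebraMap L K α = (algebraMap L K α⁻¹)⁻¹ := by simp
  rw [h1, CurvePoint.ord_inv, h.ord_coord]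

theorem IsCoord.ne_zero_of_inv : algebraMap L K α ≠ 0 := by
  have h1 : algebraMap L K α = (algebraMap L K α⁻¹)⁻¹ := by simp
  rw [h1]
  exact inv_ne_zero h.ne_zero

variable (hq : 2 < Fintype.card Fq)

include hq

/-- A nonzero fixed element has order `v = q v`, hence `v = 0`. Subtracting its value at the point,
which lies in `Q`, leaves a fixed element of positive order, which must vanish. -/
theorem IsCoord.mem_range_of_sigma_eq {x : K} (hx : sigma Fq Q L K x = x) :
    ∃ a : Q, x = algebraMap Q K a := by
  have := h.isCurveFunctionField
  have h0 : ∀ x : K, x ≠ 0 → sigma Fq Q L K x = x → h.zeroPoint.ord x = 0 := by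
    intro x hx0 hx
    have h1 := h.ord_sigma_right (Fq := Fq) hx0
    rw [hx] at h1
    have h2 : ((Fintype.card Fq : ℤ) - 1) * h.zeroPoint.ord x = 0 := by linarith
    rcases mul_eq_zero.1 h2 with h3 | h3
    · omega
    · exact h3
  by_cases hx0 : x = 0
  · exact ⟨0, by rw [hx0, map_zero]⟩
  obtain ⟨a, y, hy, hxy⟩ := h.exists_const
    (CurvePoint.mem_ring_of_ord_nonneg h.isClosedPoint (h0 x hx0 hx).ge)
  refine ⟨a, ?_⟩
  by_contra hne
  have h1 : x - algebraMap Q K a ≠ 0 := sub_ne_zero.2 hne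
  have h2 := h0 _ h1 (by rw [map_sub, hx, sigma_algebraMap_left])
  have h3 : x - algebraMap Q K a = algebraMap L K α⁻¹ * y := by rw [hxy]; ring
  have hy0 : y ≠ 0 := by
    rintro rfl
    exact h1 (by rw [h3, mul_zero])
  rw [h3, CurvePoint.ord_mul _ h.ne_zero hy0, h.ord_coord] at h2
  have := CurvePoint.ord_nonneg hy
  omega

/-- With `v = ord x` the equation gives `v = q v - 1`, which has no integral solution for `q > 2`.
-/
theorem IsCoord.eq_zero_of_eq_mul_sigma {x : K} (hx : x = algebraMap L K α * sigma Fq Q L K x) :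
    x = 0 := by
  have := h.isCurveFunctionField
  by_contra hx0
  have h1 := congrArg h.zeroPoint.ord hx
  rw [CurvePoint.ord_mul _ h.ne_zero_of_inv ((map_ne_zero _).2 hx0), h.ord_inv_coord,
    h.ord_sigma_right hx0] at h1
  have hq' : (3 : ℤ) ≤ Fintype.card Fq := by exact_mod_cast hq
  rcases le_or_gt (h.zeroPoint.ord x) 0 with h2 | h2 <;> nlinarith

/-- For `v = ord x` the terms on the left have orders `q v` and `v - 1`, the right side has order
`-2` or is zero. Equal orders require `(q - 1) v = -1`. Otherwise the smaller one is `-2`: `q v =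
-2` is impossible, and `v = -1` contradicts `v - 1 < q v`. For `q = 2` the choice `v = -1` would
survive, which is where `q > 2` matters. -/
theorem IsCoord.eq_zero_of_sigma_sub_eq {a : Q} {x : K} (hx : sigma Fq Q L K x -
    algebraMap L K α * x = algebraMap L K α ^ 2 * algebraMap Q K a) : a = 0 ∧ x = 0 := by
  have := h.isCurveFunctionField
  have hα := h.ne_zero_of_inv
  have hq' : (3 : ℤ) ≤ Fintype.card Fq := by exact_mod_cast hq
  by_cases hx0 : x = 0
  · subst hx0
    rw [map_zero, mul_zero, sub_zero, eq_comm, mul_eq_zero, _root_.map_eq_zero] at hx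
    exact ⟨hx.resolve_left (pow_ne_zero 2 hα), rfl⟩
  exfalso
  have h1 := h.ord_sigma_right (Fq := Fq) hx0
  have h2 : h.zeroPoint.ord (algebraMap L K α * x) = -1 + h.zeroPoint.ord x := by
    rw [CurvePoint.ord_mul _ hα hx0, h.ord_inv_coord]
  have hσ0 : sigma Fq Q L K x ≠ 0 := (map_ne_zero _).2 hx0
  have hx0' := mul_ne_zero hα hx0
  have hval : sigma Fq Q L K x - algebraMap L K α * x ≠ 0 →
      h.zeroPoint.ord (sigma Fq Q L K x - algebraMap L K α * x) = -2 := by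
    intro hne
    have ha : algebraMap Q K a ≠ 0 := by
      rintro h0
      rw [hx, h0, mul_zero] at hne
      exact hne rfl
    rw [hx, CurvePoint.ord_mul _ (pow_ne_zero 2 hα) ha, CurvePoint.ord_pow _ hα, h.ord_inv_coord,
      CurvePoint.ord_eq_zero _ (h.zeroPoint.const_mem a)
        (by rw [← map_inv₀]; exact h.zeroPoint.const_mem _)]
    norm_num
  rcases lt_trichotomy (h.zeroPoint.ord (sigma Fq Q L K x))
    (h.zeroPoint.ord (algebraMap L K α * x)) with h3 | h3 | h3
  · have h4 := h.ord_sub_of_lt hσ0 hx0' h3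
    rw [hval (fun h0 => by rw [sub_eq_zero.1 h0] at h3; exact lt_irrefl _ h3), h1] at h4
    rcases le_or_gt 0 (h.zeroPoint.ord x) with h5 | h5 <;> nlinarith
  · rw [h1, h2] at h3
    rcases le_or_gt 0 (h.zeroPoint.ord x) with h5 | h5 <;> nlinarith
  · have h4 := h.ord_sub_of_lt hx0' hσ0 h3
    rw [← neg_sub, show ∀ z : K, -z = (-1) * z from fun z => by ring] at h4
    have hne : sigma Fq Q L K x - algebraMap L K α * x ≠ 0 :=
      fun h0 => by rw [sub_eq_zero.1 h0] at h3; exact lt_irrefl _ h3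
    rw [CurvePoint.ord_mul _ (by norm_num) hne, CurvePoint.ord_eq_zero _
      (neg_mem (one_mem _)) (by rw [inv_neg, inv_one]; exact neg_mem (one_mem _)), hval hne, h2] at h4
    rw [h1, h2] at h3
    nlinarith

end Order

/-! ### Sheaves with only scalar endomorphisms -/

section Scalar

variable {Fq Q L K : Type u} [Field Fq] [Field Q] [Field L] [Field K]
  [Algebra Fq Q] [Algebra Fq L] [Algebra Fq K] [Algebra Q K] [Algebra L K]
  [IsScalarTower Fq Q K] [IsScalarTower Fq L K] [Fintype Fq] [IsBaseChangeFunctionField Fq Q L K]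
  {infty : CurvePoint Fq Q} {c : Characteristic Fq Q L}

/-- All endomorphisms of the generic fibre are multiplications with elements of `Q`. -/
def AbelianTauSheaf.IsScalar (F : AbelianTauSheaf K infty c) : Prop :=
  ∀ f : (F.sheaf 0).fiber →ₗ[K] (F.sheaf 0).fiber, (∀ v, f (F.phi v) = F.phi (f v)) →
    ∃ a : Q, ∀ v, f v = algebraMap Q K a • v

namespace AbelianTauSheaf

variable {F : AbelianTauSheaf K infty c} (hF : F.IsScalar)

include hF

theorem IsScalar.qEnd_eq_bot [IsCurveFunctionField Fq Q] : F.QEnd = ⊥ := by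
  rw [eq_bot_iff]
  rintro f ⟨D, hf⟩
  obtain ⟨a, ha⟩ := hF (f 0) hf.commutes.phi
  rw [Algebra.mem_bot]
  refine ⟨a, funext fun i => LinearMap.ext fun v => (F.psi i).injective ?_⟩
  rw [hf.commutes.psi, ha]
  exact (F.psi i).map_smul (algebraMap Q K a) v

theorem IsScalar.nonempty_ringEquiv [IsCurveFunctionField Fq Q]
    [Nontrivial (F.sheaf 0).fiber] : Nonempty (Q ≃+* F.QEnd) := by
  have : Nontrivial F.GenericEnd := by
    obtain ⟨v, hv⟩ := exists_ne (0 : (F.sheaf 0).fiber)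
    exact ⟨1, 0, fun h => hv (LinearMap.congr_fun (congrFun h 0) v)⟩
  rw [hF.qEnd_eq_bot]
  exact ⟨(Algebra.botEquivOfInjective (algebraMap Q F.GenericEnd).injective).symm.toRingEquiv⟩

omit hF in
theorem _root_.RingEquiv.isDivisionAlgebra_of_field {E R : Type*} [Field E] [Ring R]
    (e : E ≃+* R) : IsDivisionAlgebra R :=
  e.isDivisionAlgebra ⟨inferInstance, fun _ hx => IsUnit.mk0 _ hx⟩

end AbelianTauSheaf

variable {t : Q} (ht : IsCoord Fq t)

/-- A sheaf of rank two with a one dimensional quotient of the generic fibre is not simple. -/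
theorem not_isSimple_of_finrank_eq_two
    {G : AbelianTauSheaf K ht.inv.zeroPoint (Characteristic.ofIsRational L ht.isRational)}
    (hG : finrank K (G.sheaf 0).fiber = 2)
    {U U' : Matrix (Fin 1) (Fin 1) L} (hU : U * U' = 1)
    {q : (G.sheaf 0).fiber →ₗ[K] (Fin 1 → K)} (hq : Function.Surjective q)
    (hqφ : ∀ v, q (G.phi v) = linePhi Fq t U (q v)) : ¬ G.IsSimple := by
  intro hs
  obtain ⟨G', h1, h2⟩ := exists_isQuotient_rank_one ht G hU hq hqφ
  rcases hs.2 G' h1 with h3 | h3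
  · have := G'.isZero_iff.1 h3
    rw [finrank_zero_of_subsingleton] at h2
    exact zero_ne_one h2
  · have h4 := AbelianTauSheaf.isomorphic_linearEquiv h3
    omega

/-- In a decomposition, the projections transported to `V` are scalars with sum the identity, so one
of them is a nonzero scalar. The corresponding summand then has the same generic fibre as `F`,
including the quotient of rank one, and cannot be simple. -/
theorem not_isSemisimple_of_isScalar
    {F : AbelianTauSheaf K ht.inv.zeroPoint (Characteristic.ofIsRational L ht.isRational)}
    (hF : F.IsScalar) (hG : finrank K (F.sheaf 0).fiber = 2)
    {U U' : Matrix (Fin 1) (Fin 1) L} (hU : U * U' = 1)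
    {q : (F.sheaf 0).fiber →ₗ[K] (Fin 1 → K)} (hq : Function.Surjective q)
    (hqφ : ∀ v, q (F.phi v) = linePhi Fq t U (q v)) : ¬ F.IsSemisimple := by
  rintro ⟨n, G, S, hGs, ⟨inj, proj, hinj, hproj, hid, hne, hsum⟩, f, hf⟩
  have hsurj := hf.surjective 0
  obtain ⟨D, hD, hfi, -⟩ := hf
  let e := LinearEquiv.ofBijective (f 0) ⟨hfi 0, hsurj⟩
  have heφ : ∀ v, e (F.phi v) = S.phi (e v) := hD.commutes.phi
  have heφ' : ∀ v, e.symm (S.phi v) = F.phi (e.symm v) := fun v => by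
    rw [LinearEquiv.symm_apply_eq, heφ, LinearEquiv.apply_symm_apply]
  have h1 : ∀ j, ∃ a : Q, ∀ v, e.symm (inj j 0 (proj j 0 (e v))) = algebraMap Q K a • v := fun j =>
    hF (e.symm.toLinearMap ∘ₗ inj j 0 ∘ₗ proj j 0 ∘ₗ e.toLinearMap) fun v => by
      change e.symm (inj j 0 (proj j 0 (e (F.phi v)))) = F.phi (e.symm _)
      rw [heφ, (hproj j).commutes.phi, (hinj j).commutes.phi, heφ']
      rfl
  choose a ha using h1
  obtain ⟨j, hj⟩ : ∃ j, a j ≠ 0 := by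
    by_contra! h
    have : Subsingleton (F.sheaf 0).fiber := by
      have h2 : ∀ v : (F.sheaf 0).fiber, v = 0 := fun v => by
        apply e.injective
        rw [map_zero, ← hsum 0 (e v)]
        refine Finset.sum_eq_zero fun j _ => ?_
        rw [← e.symm.map_eq_zero_iff, ha, h, map_zero, zero_smul]
      exact ⟨fun v w => (h2 v).trans (h2 w).symm⟩
    rw [finrank_zero_of_subsingleton] at hG
    omega
  -- A nonzero scalar is injective, so projecting to the `j`-th summand loses nothing.
  let ρ : (F.sheaf 0).fiber ≃ₗ[K] ((G j).sheaf 0).fiber :=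
    LinearEquiv.ofBijective (proj j 0 ∘ₗ e.toLinearMap) ⟨fun v w hvw => by
      have hvw : proj j 0 (e v) = proj j 0 (e w) := hvw
      have h2 := ha j v
      rw [hvw, ha] at h2
      exact (smul_right_injective _ ((_root_.map_ne_zero (algebraMap Q K)).2 hj) h2).symm,
      fun w => ⟨e.symm (inj j 0 w), by
        change proj j 0 (e (e.symm _)) = w
        rw [LinearEquiv.apply_symm_apply, hid]⟩⟩
  have hρφ : ∀ v, ρ (F.phi v) = (G j).phi (ρ v) := fun v => by
    change proj j 0 (e (F.phi v)) = (G j).phi (proj j 0 (e v))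
    rw [heφ, (hproj j).commutes.phi]
  refine not_isSimple_of_finrank_eq_two ht (ρ.finrank_eq.symm.trans hG) hU
    (q := q ∘ₗ ρ.symm.toLinearMap) (hq.comp ρ.symm.surjective) (fun v => ?_) (hGs j)
  obtain ⟨v, rfl⟩ := ρ.surjective v
  change q (ρ.symm ((G j).phi (ρ v))) = linePhi Fq t U (q (ρ.symm (ρ v)))
  rw [← hρφ, LinearEquiv.symm_apply_apply, LinearEquiv.symm_apply_apply, hqφ]

variable {n : ℕ} (hn : n ≠ 0) {U U' : Matrix (Fin n) (Fin n) L} (hU : U * U' = 1)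

theorem lineSheaf_phi (v : Fin n → K) :
    (lineSheaf (K := K) ht hn hU).phi v = linePhi Fq t U v :=
  ((lineSheaf (K := K) ht hn hU).psi_Pi 0 (linePhi Fq t U v)).trans
    ((lineSheaf (K := K) ht hn hU).psi_zero _)

end Scalar

/-! ### The explicit example of rank two -/

section Unipotent

variable {Fq Q L K : Type u} [Field Fq] [Field Q] [Field L] [Field K]
  [Algebra Fq Q] [Algebra Fq L] [Algebra Fq K] [Algebra Q K] [Algebra L K]
  [IsScalarTower Fq Q K] [IsScalarTower Fq L K] [Fintype Fq] [IsBaseChangeFunctionField Fq Q L K]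
  {t : Q} {α : L}

theorem unipotent_mul_inv {α : L} (h : α ≠ 0) :
    !![1, α ^ 2; 0, α] * !![1, -α; 0, α⁻¹] = (1 : Matrix (Fin 2) (Fin 2) L) := by
  rw [Matrix.mul_fin_two, Matrix.one_fin_two]
  congr 3 <;> field_simp <;> simp

/-- Endomorphisms of the generic fibre of the counterexample. -/
theorem exists_eq_smul_of_commutes (hq : 2 < Fintype.card Fq) (hα : IsCoord Fq α)
    (ht0 : t ≠ 0)
    {f : (Fin 2 → K) →ₗ[K] (Fin 2 → K)}
    (hf : ∀ v, f (linePhi Fq t !![1, α ^ 2; 0, α] v) = linePhi Fq t !![1, α ^ 2; 0, α] (f v)) :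
    ∃ a : Q, ∀ v, f v = algebraMap Q K a • v := by
  have h : IsCoord Q (algebraMap L K α⁻¹) := hα.inv.baseChange_right Fq Q L K
  have hT : algebraMap Q K t ≠ 0 := (_root_.map_ne_zero _).2 ht0
  have hα0 := h.ne_zero_of_inv
  obtain ⟨A, rfl⟩ := (Matrix.toLin' (R := K)).surjective f
  have h00 := congrFun (hf ![1, 0]) 0
  have h10 := congrFun (hf ![1, 0]) 1
  have h01 := congrFun (hf ![0, 1]) 0
  have h11 := congrFun (hf ![0, 1]) 1
  simp [linePhi_apply, Matrix.mulVec, dotProduct, Fin.sum_univ_two] at h00 h10 h01 h11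
  simp only [Algebra.smul_def] at h00 h10 h01 h11
  -- Commutation means `A U = U σ(A)`. The lower left entry satisfies `c = α σ(c)` and vanishes;
  -- then both diagonal entries are fixed by `σ`, and the upper right entry satisfies `σ(b) - α b =
  -- α² (a - d)`, which forces `a = d` and `b = 0`.
  have hc : A 1 0 = 0 := h.eq_zero_of_eq_mul_sigma hq (mul_left_cancel₀ hT (by linear_combination h10))
  rw [hc] at h00 h11
  obtain ⟨a, ha⟩ := h.mem_range_of_sigma_eq hq (x := A 0 0)
    (mul_left_cancel₀ hT (by
      rw [map_zero] at h00
      linear_combination -h00))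
  have hd : sigma Fq Q L K (A 1 1) = A 1 1 := mul_left_cancel₀ (mul_ne_zero hT hα0) (by
    linear_combination -h11)
  obtain ⟨d, hd'⟩ := h.mem_range_of_sigma_eq hq hd
  obtain ⟨had, hb⟩ := h.eq_zero_of_sigma_sub_eq hq (a := a - d) (x := A 0 1)
    (mul_left_cancel₀ hT (by
      rw [hd] at h01
      rw [map_sub, ← ha, ← hd']
      linear_combination -h01))
  refine ⟨a, fun v => ?_⟩
  rw [sub_eq_zero] at had
  funext i
  rw [Matrix.toLin'_apply, Matrix.mulVec, dotProduct, Fin.sum_univ_two, Pi.smul_apply, smul_eq_mul]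
  fin_cases i
  · change A 0 0 * v 0 + A 0 1 * v 1 = _ * v 0
    rw [hb, ha]
    ring
  · change A 1 0 * v 0 + A 1 1 * v 1 = _ * v 1
    rw [hc, hd', had]
    ring

theorem isCoord_ratFunc_X (k : Type*) [Field k] : IsCoord k (RatFunc.X : RatFunc k) where
  transcendental := RatFunc.transcendental_X
  exists_div z := by
    refine ⟨z.num, z.denom, z.denom_ne_zero, ?_⟩
    have h : ∀ p : Polynomial k, Polynomial.aeval (RatFunc.X : RatFunc k) p =
        algebraMap (Polynomial k) (RatFunc k) p := fun p => by
      rw [← RatFunc.algebraMap_X, Polynomial.aeval_algebraMap_apply, Polynomial.aeval_X_left_apply]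
    rw [h, h, RatFunc.num_div_denom]

/-- Over the rational function field, there is an abelian `τ`-sheaf whose only quasi-endomorphisms
are the scalars and which is not semisimple. -/
theorem exists_not_isSemisimple (hq : 2 < Fintype.card Fq) (ht : IsCoord Fq t)
    (hα : IsCoord Fq α) [IsCurveFunctionField Fq Q] :
    ∃ (infty : CurvePoint Fq Q) (c : Characteristic Fq Q L) (F : AbelianTauSheaf K infty c),
      infty.IsRational ∧ c.point ≠ infty ∧ F.rank = 2 ∧ F.dim = 2 ∧
        F.QEnd = ⊥ ∧ IsDivisionAlgebra F.QEnd ∧ IsSemisimpleRing F.QEnd ∧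
        ¬ F.IsSimple ∧ ¬ F.IsSemisimple := by
  let F := lineSheaf (K := K) ht two_ne_zero (unipotent_mul_inv hα.ne_zero)
  have hfin : finrank K (Fin 2 → K) = 2 := finrank_fin_fun K
  have hφ : ∀ v : Fin 2 → K, F.phi v = linePhi Fq t !![1, α ^ 2; 0, α] v :=
    lineSheaf_phi ht two_ne_zero (unipotent_mul_inv hα.ne_zero)
  have hF : F.IsScalar := by
    intro f hf
    refine exists_eq_smul_of_commutes (K := K) hq hα ht.ne_zero (f := f) fun v => ?_
    have h := hf v
    rw [hφ] at h
    exact h.trans (hφ _)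
  have hne : Nontrivial (F.sheaf 0).fiber := inferInstanceAs (Nontrivial (Fin 2 → K))
  obtain ⟨e⟩ := hF.nonempty_ringEquiv
  have hU : !![α] * !![α⁻¹] = (1 : Matrix (Fin 1) (Fin 1) L) := by
    ext i j
    rw [Subsingleton.elim i 0, Subsingleton.elim j 0]
    simp [Matrix.mul_apply, mul_inv_cancel₀ hα.ne_zero]
  -- The lower row of the matrix is `(0, α)`, so the second coordinate is a quotient on which `φ`
  -- acts as `t·α·σ`.
  let q : (Fin 2 → K) →ₗ[K] (Fin 1 → K) := LinearMap.funLeft K K fun _ => 1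
  have hqs : Function.Surjective q := fun w => ⟨fun _ => w 0, by
    funext j
    rw [Subsingleton.elim j 0]
    rfl⟩
  have hqφ : ∀ v : Fin 2 → K, q (F.phi v) = linePhi Fq t !![α] (q v) := by
    intro v
    rw [hφ]
    funext j
    change linePhi Fq t !![1, α ^ 2; 0, α] v 1 = linePhi Fq t !![α] (q v) j
    rw [Subsingleton.elim j 0]
    simp [linePhi_apply, Matrix.mulVec, dotProduct, q, LinearMap.funLeft_apply]
  exact ⟨_, _, F, ht.inv.isRational, ht.infty_ne, rfl, rfl, hF.qEnd_eq_bot,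
    e.isDivisionAlgebra_of_field, e.isSemisimpleRing,
    not_isSimple_of_finrank_eq_two ht hfin hU (q := q) hqs hqφ,
    not_isSemisimple_of_isScalar ht hF hfin hU (q := q) hqs hqφ⟩

end Unipotent

end Counterexample

end

end TauSheaf
namespace TauSheaf
noncomputable section

/-- The theorem on failure over infinite fields, for any copy of the rational function field as
function field of the projective line. -/
theorem exists_not_isSemisimple_of_isCoord (Fq Q : Type u) [Field Fq] [Fintype Fq] [Field Q]
    [Algebra Fq Q] (e : Q ≃ₐ[Fq] RatFunc Fq) {t : Q} (ht : IsCoord Fq t)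
    (hq : 2 < Fintype.card Fq) :
    ∃ (Q L K : Type u) (_ : Field Q) (_ : Field L) (_ : Field K)
      (_ : Algebra Fq Q) (_ : Algebra Fq L) (_ : Algebra Fq K) (_ : Algebra Q K) (_ : Algebra L K)
      (_ : IsScalarTower Fq Q K) (_ : IsScalarTower Fq L K)
      (_ : IsCurveFunctionField Fq Q) (_ : IsBaseChangeFunctionField Fq Q L K)
      (infty : CurvePoint Fq Q) (c : Characteristic Fq Q L)
      (F : AbelianTauSheaf K infty c),
      Nonempty (Q ≃ₐ[Fq] RatFunc Fq) ∧ Nonempty (L ≃ₐ[Fq] RatFunc Fq) ∧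
      infty.IsRational ∧ c.point ≠ infty ∧ F.rank = 2 ∧ F.dim = 2 ∧
      F.QEnd = ⊥ ∧ IsDivisionAlgebra F.QEnd ∧ IsSemisimpleRing F.QEnd ∧
      ¬ F.IsSimple ∧ ¬ F.IsSemisimple := by
  obtain ⟨K, iK, iFK, iQK, iLK, h1, h2, h3⟩ := exists_isBaseChangeFunctionField Fq Q
  have hc := ht.isCurveFunctionField
  obtain ⟨infty, c, F, h⟩ := exists_not_isSemisimple (K := K) hq ht (isCoord_ratFunc_X Fq)
  exact ⟨Q, RatFunc Fq, K, inferInstance, inferInstance, iK, inferInstance, inferInstance, iFK,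
    iQK, iLK, h1, h2, hc, h3, infty, c, F, ⟨e⟩, ⟨AlgEquiv.refl⟩, h⟩

end
end TauSheaf
theorem mainTheorem7 :
    -- the case of a finite base field `L`
    (∀ (Fq Q L K : Type u) [Field Fq] [Fintype Fq] [Field Q] [Field L] [Field K]
      [Algebra Fq Q] [Algebra Fq L] [Algebra Fq K] [Algebra Q K] [Algebra L K]
      [IsScalarTower Fq Q K] [IsScalarTower Fq L K]
      [TauSheaf.IsCurveFunctionField Fq Q] [TauSheaf.IsBaseChangeFunctionField Fq Q L K]
      [Finite L]
      (infty : TauSheaf.CurvePoint Fq Q) (_ : infty.IsRational)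
      (c : TauSheaf.Characteristic Fq Q L) (F : TauSheaf.AbelianTauSheaf K infty c),
      (TauSheaf.IsDivisionAlgebra F.QEnd → F.IsSimple) ∧
      (c.point ≠ infty → (F.IsSimple ↔ TauSheaf.IsDivisionAlgebra F.QEnd)) ∧
      (c.point ≠ infty → (F.IsSemisimple ↔ IsSemisimpleRing F.QEnd))) ∧
    -- failure over the rational function field `L = Fq(α)`, on the projective line
    (∀ (Fq : Type u) [Field Fq] [Fintype Fq], 2 < Fintype.card Fq →
      ∃ (Q L K : Type u) (_ : Field Q) (_ : Field L) (_ : Field K)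
        (_ : Algebra Fq Q) (_ : Algebra Fq L) (_ : Algebra Fq K) (_ : Algebra Q K) (_ : Algebra L K)
        (_ : IsScalarTower Fq Q K) (_ : IsScalarTower Fq L K)
        (_ : TauSheaf.IsCurveFunctionField Fq Q) (_ : TauSheaf.IsBaseChangeFunctionField Fq Q L K)
        (infty : TauSheaf.CurvePoint Fq Q) (c : TauSheaf.Characteristic Fq Q L)
        (F : TauSheaf.AbelianTauSheaf K infty c),
        Nonempty (Q ≃ₐ[Fq] RatFunc Fq) ∧ Nonempty (L ≃ₐ[Fq] RatFunc Fq) ∧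
        infty.IsRational ∧ c.point ≠ infty ∧ F.rank = 2 ∧ F.dim = 2 ∧
        F.QEnd = ⊥ ∧ TauSheaf.IsDivisionAlgebra F.QEnd ∧ IsSemisimpleRing F.QEnd ∧
        ¬ F.IsSimple ∧ ¬ F.IsSemisimple) := by
  refine ⟨?_, ?_⟩
  · intro Fq Q L K _ _ _ _ _ _ _ _ _ _ _ _ _ _ _ infty hinf c F
    exact F.simple_semisimple_iff hinf.isClosedPoint
  · intro Fq _ _ hq
    exact TauSheaf.exists_not_isSemisimple_of_isCoord Fq (RatFunc Fq) AlgEquiv.refl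
      (TauSheaf.isCoord_ratFunc_X Fq) hq
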